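/- Let $M$ be an $n$-dimensional complex analytic generalized Frobenius manifold (GFM): a manifold with a flat metric $\eta$, a commutative associative product on its tangent spaces with unit field $e$, $\nabla e\neq0$, satisfying $\langle a\cdot b,c\rangle=\langle a,b\cdot c\rangle$ and the total symmetry of $\nabla c$, where $c(a,b,w)=\langle a\cdot b,w\rangle$, and an Euler field $E$ with $\nabla^2E=0$, $\mathcal L_E(\cdot)=\cdot$, $\mathcal L_E\eta=(2-d)\eta$. Let $\mu=\frac{2-d}2-\nabla E$, let $v^1,\dots,v^n$ be flat coordinates and $c_{\alpha\beta}^\gamma$ the structure constants of the product in these coordinates, and let $D\subset M$ be an open set of semisimple points in this chart with canonical coordinates $u_1,\dots,u_n$, that is $\frac{\partial}{\partial u_i}\cdot\frac{\partial}{\partial u_j}=\delta_{ij}\frac{\partial}{\partial u_i}$, normalized by $E=\sum_iu_i\frac{\partial}{\partial u_i}$ and pairwise distinct on $D$. Put $h_i=\eta(\frac{\partial}{\partial u_i},\frac{\partial}{\partial u_i})$, choose holomorphic branches of $\sqrt{h_i}$, and put $J=\prod_i\sqrt{h_i}$, $\psi_{i\alpha}=\sqrt{h_i}\,\partial u_i/\partial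 v^\alpha$, $\Psi=(\psi_{i\alpha})$, $V=\Psi\mu\Psi^{-1}$, $H_i=\frac12\sum_{j\ne i}\frac{V_{ij}^2}{u_i-u_j}$. Let $\tau_I$ be an isomonodromic tau function, $d\log\tau_I=\sum_iH_i\,du_i$. A period is a function $p(v;\lambda)$, defined locally for $\lambda\ne u_i(v)$, that is flat for the metric $(\ ,\ )_\lambda$ with matrix $(g^{\alpha\beta}-\lambda\eta^{\alpha\beta})^{-1}$ ($g$ is the intersection form) and satisfies $(\mathcal U-\lambda)\partial_\lambda\nabla p=(\mu+\frac12)\nabla p$, where $\mathcal U$ is the multiplication by $E$ and $\nabla p$ is the $\eta$-gradient. For a basis of periods $p_1,\dots,p_n$ let $(G^{\alpha\beta})$ be the inverse of the matrix $G_{\alpha\beta}=(g^{\gamma\delta}-\lambda\eta^{\gamma\delta})\,\partial_\gamma p_\alpha\,\partial_\delta p_\beta$. Let $\theta_{\alpha,p}$ ($1\le\alpha\le n$, $p\ge0$) be the coefficients of the deformed flat coordinates $\theta_\alpha(v;z)=\sum_p\theta_{\alpha,p}z^p$ on $D$: $\theta_{\alpha,0}=\eta_{\alpha\beta}v^\beta$,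 $\partial_\alpha\partial_\beta\theta_{\gamma,p+1}=c_{\alpha\beta}^\varepsilon\partial_\varepsilon\theta_{\gamma,p}$, $\langle\nabla\theta_\alpha(v;-z),\nabla\theta_\beta(v;z)\rangle=\eta_{\alpha\beta}$, and $\xi=(\nabla\theta_1,\dots,\nabla\theta_n)z^\mu z^R$ satisfies $\partial_z\xi=(\mathcal U+\mu/z)\xi$, with constant $R=\sum_{k\ge1}R_k$, $[\mu,R_k]=kR_k$. Let $\Omega_{\alpha,p;\beta,q}$ be the coefficient of $z^pw^q$ in $\frac{\langle\nabla\theta_\alpha(z),\nabla\theta_\beta(w)\rangle-\eta_{\alpha\beta}}{z+w}$. The star product $*$ is the bilinear operation with $\theta_{\alpha,p}*\theta_{\beta,q}=\Omega_{\alpha,p;\beta,q}$ for which constants multiply to zero, extended to convergent series; the function $G^{\alpha\beta}\,\partial_\lambda p_\alpha*\partial_\lambda p_\beta$ is obtained by expanding the $\partial_\lambda p_\alpha$ in the $\theta_{\gamma,p}$ near $\lambda=\infty$ and by analytic continuation in $\lambda$. On the jet space of $M$, with coordinates $v^{\gamma,s}=\partial_x^sv^\gamma$, let $$K^{\gamma,s}=(s+1)\,\partial_x^s\Bigl(\frac1{E-\lambda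 e}\Bigr)^\gamma+\sum_{k=1}^sk\binom{s+1}{k+1}(\partial_x^{s-k}\partial^\gamma p_\alpha)\,G^{\alpha\beta}\,(\partial_\lambda\partial_x^kp_\beta).$$ The genus one part of the loop equation, for a holomorphic function $\mathcal F=\mathcal F(v,v_x,\dots,v^{(N)})$, is $$\sum_{s=0}^N\frac{\partial\mathcal F}{\partial v^{\gamma,s}}K^{\gamma,s}=\frac12\,G^{\alpha\beta}\,\frac{\partial p_\alpha}{\partial\lambda}*\frac{\partial p_\beta}{\partial\lambda}-\frac1{4\lambda^2}\operatorname{tr}\Bigl(\frac14-\mu^2\Bigr),$$ required for every basis of periods and identically in $\lambda$. Theorem. The function $G^{\alpha\beta}\,\partial_\lambda p_\alpha*\partial_\lambda p_\beta$ exists, independently of the basis of periods, and is holomorphic in $\lambda$ for $\lambda\ne0,u_1(v),\dots,u_n(v)$. On every open set of first order jets over $D$ on which $u_{i,x}=v_x^\alpha\,\partial u_i/\partial v^\alpha\ne0$ for all $i$, for any holomorphic branches of the logarithms and of $J^{1/24}$, the function $$\mathcal F_1=\log\frac{\tau_I}{J^{1/24}}+\frac1{24}\sum_{i=1}^n\log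 u_{i,x}$$ solves the genus one part of the loop equation. It is the solution up to an additive constant: if $N\ge1$ and $\mathcal F(v,v_x,\dots,v^{(N)})$ is a solution on a connected open set of jets of order $N$ lying over that set of first order jets, then $\mathcal F-\mathcal F_1$ is constant. -/

import Mathlib

open Filter Topology
open scoped BigOperators

noncomputable section

namespace GFM

/-- Coordinate space `ℂⁿ`; its points are the flat coordinates `(v¹, …, vⁿ)`. -/
abbrev Vec (n : ℕ) := Fin n → ℂ

/-- The partial derivative `∂f/∂v^α`. -/
def pd {n : ℕ} (α : Fin n) (f : Vec n → ℂ) (v : Vec n) : ℂ :=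
  fderiv ℂ f v (Pi.single α 1)

/-! ### Generalized Frobenius manifolds, in a chart of flat coordinates -/

/-- An `n`-dimensional (complex analytic) generalized Frobenius manifold with non-flat unity, in a
connected chart of flat coordinates. The flat metric is the constant matrix `η`, its Levi-Civita
connection is the coordinate derivative, and `c α β γ v` is the structure constant
`c_{αβ}^γ` at `v`, that is `∂_α · ∂_β = c_{αβ}^γ ∂_γ`. The condition `∇²E = 0` says that the
Euler vector field is affine in flat coordinates: `E(v) = gradE v + E₀`. -/
structure GenFrobeniusManifold (n : ℕ) where
  domain : Set (Vec n)
  isOpen_domain : IsOpen domain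
  isConnected_domain : IsConnected domain
  η : Matrix (Fin n) (Fin n) ℂ
  η_symm : η.IsSymm
  η_det : η.det ≠ 0
  c : Fin n → Fin n → Fin n → Vec n → ℂ
  c_analytic : ∀ α β γ, AnalyticOnNhd ℂ (c α β γ) domain
  /-- The components `e^α` of the unit vector field. -/
  e : Fin n → Vec n → ℂ
  e_analytic : ∀ α, AnalyticOnNhd ℂ (e α) domain
  /-- The constant matrix `(∇E)^α_β = ∂_β E^α`. -/
  gradE : Matrix (Fin n) (Fin n) ℂ
  E₀ : Vec n
  /-- The charge `d`. -/
  d : ℂ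
  mul_comm' : ∀ v ∈ domain, ∀ α β γ, c α β γ v = c β α γ v
  mul_assoc' : ∀ v ∈ domain, ∀ α β γ δ,
    ∑ ε, c α β ε v * c ε γ δ v = ∑ ε, c β γ ε v * c α ε δ v
  one_mul' : ∀ v ∈ domain, ∀ β γ,
    ∑ α, e α v * c α β γ v = if β = γ then 1 else 0
  /-- `⟨a · b, c⟩ = ⟨a, b · c⟩`. -/
  frobenius : ∀ v ∈ domain, ∀ α β γ,
    ∑ ε, c α β ε v * η ε γ = ∑ ε, η α ε * c β γ ε v
  /-- The tensor `(∇_x c)(y, z, w)` with `c(y, z, w) = ⟨y · z, w⟩` is totally symmetric. -/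
  nabla_c_symm : ∀ v ∈ domain, ∀ α β γ δ,
    pd δ (fun w => ∑ ε, c α β ε w * η ε γ) v = pd α (fun w => ∑ ε, c δ β ε w * η ε γ) v
  /-- `[E, a · b] - [E, a] · b - a · [E, b] = a · b`. -/
  euler_mul : ∀ v ∈ domain, ∀ α β γ,
    ∑ ε, (gradE.mulVec v + E₀) ε * pd ε (c α β γ) v - ∑ ε, c α β ε v * gradE γ ε
      + ∑ ε, gradE ε α * c ε β γ v + ∑ ε, gradE ε β * c α ε γ v = c α β γ v
  /-- `E⟨a, b⟩ - ⟨[E, a], b⟩ - ⟨a, [E, b]⟩ = (2 - d)⟨a, b⟩`. -/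
  euler_metric : gradE.transpose * η + η * gradE = (2 - d) • η
  /-- The unit vector field is not flat: `∇e ≠ 0`. -/
  e_nonflat : ∃ v ∈ domain, ∃ α γ, pd α (e γ) v ≠ 0

namespace GenFrobeniusManifold

variable {n : ℕ} (M : GenFrobeniusManifold n)

/-- The Euler vector field. -/
def E (v : Vec n) : Vec n := M.gradE.mulVec v + M.E₀

/-- The grading operator `μ = (2-d)/2 - ∇E`. -/
def μ : Matrix (Fin n) (Fin n) ℂ := ((2 - M.d) / 2) • (1 : Matrix (Fin n) (Fin n) ℂ) - M.gradE

/-- The matrix of multiplication by `E`: `𝒰^γ_β = E^ε c_{εβ}^γ` (row `γ`, column `β`). -/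
def calU (v : Vec n) : Matrix (Fin n) (Fin n) ℂ :=
  Matrix.of fun γ β => ∑ ε, M.E v ε * M.c ε β γ v

/-- The gradient with respect to `η`: `∂^α f = η^{αβ} ∂_β f`. -/
def grad (f : Vec n → ℂ) (α : Fin n) (v : Vec n) : ℂ := ∑ β, M.η⁻¹ α β * pd β f v

/-- The components of the vector field `1/(E - λe)`, the inverse of `E - λe` in the tangent
algebra. -/
def invEulerSub (lam : ℂ) (γ : Fin n) (v : Vec n) : ℂ :=
  ((M.calU v - lam • (1 : Matrix (Fin n) (Fin n) ℂ))⁻¹.mulVec (fun α => M.e α v)) γ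

/-- The intersection form `g^{αβ} = η^{αγ} 𝒰^β_γ`. -/
def g (v : Vec n) : Matrix (Fin n) (Fin n) ℂ :=
  Matrix.of fun α β => ∑ γ, M.η⁻¹ α γ * M.calU v β γ

/-- The pencil `g^{αβ} - λ η^{αβ}` of contravariant metrics. -/
def pencil (lam : ℂ) (v : Vec n) : Matrix (Fin n) (Fin n) ℂ := M.g v - lam • M.η⁻¹

/-- The (covariant) metric `( , )_λ` with matrix `(g^{αβ} - λ η^{αβ})⁻¹`. -/
def pencilMetric (lam : ℂ) (v : Vec n) : Matrix (Fin n) (Fin n) ℂ := (M.pencil lam v)⁻¹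

/-- The Christoffel symbols `Γ^γ_{αβ}` of the Levi-Civita connection of `( , )_λ`. -/
def christoffel (lam : ℂ) (γ α β : Fin n) (v : Vec n) : ℂ :=
  (1 / 2) * ∑ δ, M.pencil lam v γ δ *
    (pd α (fun w => M.pencilMetric lam w δ β) v + pd β (fun w => M.pencilMetric lam w δ α) v
      - pd δ (fun w => M.pencilMetric lam w α β) v)

/-- A (local branch of a) period of `M` on an open set `W` of pairs `(v, λ)`: for each `λ` a flat
function `p(·; λ)` of the metric `( , )_λ`, that is `∇(λ) dp = 0`, depending on `λ` through
the Gauss–Manin equation `(𝒰 - λ) ∂_λ ∇p = (μ + ½) ∇p`. -/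
structure IsPeriod (W : Set (Vec n × ℂ)) (p : Vec n → ℂ → ℂ) : Prop where
  analytic : AnalyticOnNhd ℂ (fun x : Vec n × ℂ => p x.1 x.2) W
  flat : ∀ v lam, (v, lam) ∈ W → ∀ α β,
    pd α (pd β fun w => p w lam) v = ∑ γ, M.christoffel lam γ α β v * pd γ (fun w => p w lam) v
  gaussManin : ∀ v lam, (v, lam) ∈ W → ∀ α,
    ∑ β, (M.calU v - lam • (1 : Matrix (Fin n) (Fin n) ℂ)) α β *
        deriv (fun l => M.grad (fun w => p w l) β v) lam
      = ∑ β, (M.μ + (1 / 2 : ℂ) • (1 : Matrix (Fin n) (Fin n) ℂ)) α β *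
        M.grad (fun w => p w lam) β v

end GenFrobeniusManifold

/-! ### Canonical coordinates and the isomonodromic tau function -/

/-- The Jacobi matrix `∂u_i/∂v^α` (row `i`, column `α`). -/
def jac {n : ℕ} (u : Fin n → Vec n → ℂ) (v : Vec n) : Matrix (Fin n) (Fin n) ℂ :=
  Matrix.of fun i α => pd α (u i) v

/-- The inverse Jacobi matrix: its entry `(α, i)` is `∂v^α/∂u_i`, the `α`-th flat component
of the coordinate vector field `∂/∂u_i`. -/
def invJac {n : ℕ} (u : Fin n → Vec n → ℂ) (v : Vec n) : Matrix (Fin n) (Fin n) ℂ := (jac u v)⁻¹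

/-- `h_i = η(∂/∂u_i, ∂/∂u_i)`. -/
def lameSq {n : ℕ} (η : Matrix (Fin n) (Fin n) ℂ) (u : Fin n → Vec n → ℂ) (i : Fin n)
    (v : Vec n) : ℂ :=
  ∑ α, ∑ β, η α β * invJac u v α i * invJac u v β i

/-- An open set `D` of semisimple points of `M` with canonical coordinates `u_1, …, u_n`
normalized by `E = ∑ u_i ∂/∂u_i` and pairwise distinct (they are the eigenvalues of the
multiplication by `E`), and with branches `sqrtH i` of the functions `√h_i`. -/
structure CanonicalChart {n : ℕ} (M : GenFrobeniusManifold n) where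
  D : Set (Vec n)
  isOpen_D : IsOpen D
  D_subset : D ⊆ M.domain
  u : Fin n → Vec n → ℂ
  u_analytic : ∀ i, AnalyticOnNhd ℂ (u i) D
  jac_det : ∀ v ∈ D, (jac u v).det ≠ 0
  /-- `∂/∂u_i · ∂/∂u_j = δ_{ij} ∂/∂u_i`. -/
  mul_canonical : ∀ v ∈ D, ∀ i j γ,
    ∑ α, ∑ β, invJac u v α i * invJac u v β j * M.c α β γ v = if i = j then invJac u v γ i else 0
  /-- `E = ∑ u_i ∂/∂u_i`. -/
  euler_canonical : ∀ v ∈ D, ∀ γ, M.E v γ = ∑ i, u i v * invJac u v γ i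
  u_distinct : ∀ v ∈ D, ∀ i j, i ≠ j → u i v ≠ u j v
  sqrtH : Fin n → Vec n → ℂ
  sqrtH_analytic : ∀ i, AnalyticOnNhd ℂ (sqrtH i) D
  sqrtH_sq : ∀ v ∈ D, ∀ i, sqrtH i v ^ 2 = lameSq M.η u i v

namespace CanonicalChart

variable {n : ℕ} {M : GenFrobeniusManifold n} (X : CanonicalChart M)

/-- The matrix `Ψ = (ψ_{iα})` with `(∂/∂v¹, …, ∂/∂vⁿ) = (f_1, …, f_n) Ψ`,
`f_i = (√h_i)⁻¹ ∂/∂u_i`; equivalently `∂u_i/∂v^α = ψ_{iα}/√h_i`. -/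
def Ψ (v : Vec n) : Matrix (Fin n) (Fin n) ℂ :=
  Matrix.of fun i α => X.sqrtH i v * jac X.u v i α

/-- `V = Ψ μ Ψ⁻¹`. -/
def V (v : Vec n) : Matrix (Fin n) (Fin n) ℂ := X.Ψ v * M.μ * (X.Ψ v)⁻¹

/-- The Hamiltonians `H_i = ½ ∑_{j ≠ i} V_{ij}² / (u_i - u_j)`. -/
def H (i : Fin n) (v : Vec n) : ℂ :=
  (1 / 2) * ∑ j ∈ Finset.univ.erase i, X.V v i j ^ 2 / (X.u i v - X.u j v)

/-- `τ` is an isomonodromic tau function on `D`: `d log τ = ∑ H_i du_i`. -/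
structure IsTau (τ : Vec n → ℂ) : Prop where
  analytic : AnalyticOnNhd ℂ τ X.D
  ne_zero : ∀ v ∈ X.D, τ v ≠ 0
  dlog : ∀ v ∈ X.D, ∀ α, pd α τ v / τ v = ∑ i, X.H i v * pd α (X.u i) v

/-- `J = ∏ √h_i`. -/
def J (v : Vec n) : ℂ := ∏ i, X.sqrtH i v

/-- A basis of periods `p_1, …, p_n` on an open set `W` of pairs `(v, λ)` with `v ∈ D` off the
discriminant `Σ_λ` (that is, `λ ≠ u_i(v)` for all `i`). -/
structure IsPeriodBasis (W : Set (Vec n × ℂ)) (p : Fin n → Vec n → ℂ → ℂ) : Prop where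
  isOpen : IsOpen W
  subset : ∀ v lam, (v, lam) ∈ W → v ∈ X.D ∧ (M.pencil lam v).det ≠ 0
  period : ∀ α, M.IsPeriod W (p α)
  independent : ∀ v lam, (v, lam) ∈ W →
    (Matrix.of fun α β : Fin n => pd β (fun w => p α w lam) v).det ≠ 0

end CanonicalChart

/-- The Gram matrix `(G^{αβ})` of a basis of periods: the inverse of the matrix
`G_{αβ} = (g^{γδ} - λ η^{γδ}) ∂_γ p_α ∂_δ p_β` of their inner products. -/
def gram {n : ℕ} (M : GenFrobeniusManifold n) (p : Fin n → Vec n → ℂ → ℂ) (v : Vec n) (lam : ℂ) :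
    Matrix (Fin n) (Fin n) ℂ :=
  (Matrix.of fun α β : Fin n => ∑ γ, ∑ δ,
    M.pencil lam v γ δ * pd γ (fun w => p α w lam) v * pd δ (fun w => p β w lam) v)⁻¹

/-! ### Deformed flat coordinates, two-point functions, star product -/

/-- The matrix with entries `η^{αβ} ∂_β θ_γ` (row `α`, column `γ`): its columns are the
gradients of the functions `θ_1, …, θ_n`. -/
def gradMatrix {n : ℕ} (M : GenFrobeniusManifold n) (θ : Fin n → Vec n → ℂ) (v : Vec n) :
    Matrix (Fin n) (Fin n) ℂ :=
  Matrix.of fun α γ => M.grad (θ γ) α v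

/-- A calibration on `D`: coefficients `θ_{α,p}` of the deformed flat coordinates
`θ_α(v; z) = ∑_p θ_{α,p}(v) z^p`, together with the monodromy data `R = R_1 + R_2 + ⋯`
at `z = 0` (the matrix `R 0` plays no role). The last condition says that
`ξ = (∇θ_1(v;z), …, ∇θ_n(v;z)) z^μ z^R` satisfies `∂_z ξ = (𝒰 + μ/z) ξ`. -/
structure Calibration {n : ℕ} {M : GenFrobeniusManifold n} (X : CanonicalChart M) where
  θ : Fin n → ℕ → Vec n → ℂ
  R : ℕ → Matrix (Fin n) (Fin n) ℂ
  θ_analytic : ∀ α p, AnalyticOnNhd ℂ (θ α p) X.D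
  θ_zero : ∀ α, ∀ v ∈ X.D, θ α 0 v = ∑ β, M.η α β * v β
  /-- `∂_α ∂_β θ_{γ,p+1} = c_{αβ}^ε ∂_ε θ_{γ,p}`. -/
  θ_rec : ∀ v ∈ X.D, ∀ α β γ p,
    pd α (pd β (θ γ (p + 1))) v = ∑ ε, M.c α β ε v * pd ε (θ γ p) v
  /-- `⟨∇θ_α(v; -z), ∇θ_β(v; z)⟩ = η_{αβ}`. -/
  θ_orth : ∀ v ∈ X.D, ∀ m : ℕ, 1 ≤ m →
    ∑ k ∈ Finset.range (m + 1), (-1 : ℂ) ^ k •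
      ((gradMatrix M (fun γ => θ γ k) v).transpose * M.η *
        gradMatrix M (fun γ => θ γ (m - k)) v) = 0
  μ_R : ∀ k : ℕ, 1 ≤ k → M.μ * R k - R k * M.μ = (k : ℂ) • R k
  θ_homogeneous : ∀ v ∈ X.D, ∀ p : ℕ,
    ((p + 1 : ℕ) : ℂ) • gradMatrix M (fun γ => θ γ (p + 1)) v
        + gradMatrix M (fun γ => θ γ (p + 1)) v * M.μ
        + ∑ k ∈ Finset.Icc 1 (p + 1), gradMatrix M (fun γ => θ γ (p + 1 - k)) v * R k
      = M.calU v * gradMatrix M (fun γ => θ γ p) v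
        + M.μ * gradMatrix M (fun γ => θ γ (p + 1)) v

namespace Calibration

variable {n : ℕ} {M : GenFrobeniusManifold n} {X : CanonicalChart M} (Θ : Calibration X)

/-- The coefficient `⟨∇θ_{α,p}, ∇θ_{β,q}⟩ - η_{αβ} δ_{p0} δ_{q0}` of `z^p w^q` in
`⟨∇θ_α(z), ∇θ_β(w)⟩ - η_{αβ}`. -/
def pairing (α : Fin n) (p : ℕ) (β : Fin n) (q : ℕ) (v : Vec n) : ℂ :=
  (∑ γ, ∑ δ, M.η γ δ * M.grad (Θ.θ α p) γ v * M.grad (Θ.θ β q) δ v)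
    - if p = 0 ∧ q = 0 then M.η α β else 0

/-- The two-point functions `Ω_{α,p;β,q}`, the coefficients of `z^p w^q` in
`(⟨∇θ_α(z), ∇θ_β(w)⟩ - η_{αβ}) / (z + w)`. -/
def Ω (α : Fin n) (p : ℕ) (β : Fin n) (q : ℕ) (v : Vec n) : ℂ :=
  ∑ k ∈ Finset.range (q + 1), (-1 : ℂ) ^ k * Θ.pairing α (p + 1 + k) β (q - k) v

/-- `f = ∑ a_{γ,p} θ_{γ,p}` up to an additive constant in a neighbourhood of `v`, where the
coefficients satisfy `|a_{γ,p}| ≤ C p! / r^p` with `r > 2 max_i |u_i(v)|` (since `θ_{γ,p}`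
is, up to subexponential factors, of size at most `max_i |u_i|^p / p!`, this makes all the series
here and in the star product absolutely convergent and determines the coefficients). -/
def IsExpansion (a : Fin n → ℕ → ℂ) (f : Vec n → ℂ) (v : Vec n) : Prop :=
  (∃ C r : ℝ, (∀ i, 2 * ‖X.u i v‖ < r) ∧ ∀ γ p, ‖a γ p‖ ≤ C * (p.factorial : ℝ) / r ^ p) ∧
  ∀ᶠ w in 𝓝 v, ∀ β,
    HasSum (fun x : Fin n × ℕ => a x.1 x.2 * pd β (Θ.θ x.1 x.2) w) (pd β f w)

/-- `s` is the value at `v` of the star product `f * g`: the bilinear product with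
`θ_{α,p} * θ_{β,q} = Ω_{α,p;β,q}` for which constants multiply to zero, extended to
convergent series. -/
def IsStar (f g : Vec n → ℂ) (v : Vec n) (s : ℂ) : Prop :=
  ∃ a b : Fin n → ℕ → ℂ, Θ.IsExpansion a f v ∧ Θ.IsExpansion b g v ∧
    HasSum (fun x : (Fin n × ℕ) × (Fin n × ℕ) =>
      a x.1.1 x.1.2 * b x.2.1 x.2.2 * Θ.Ω x.1.1 x.1.2 x.2.1 x.2.2 v) s

/-- `S(v, λ)` is the function `G^{αβ} ∂_λ p_α * ∂_λ p_β`: near `λ = ∞` it is given by the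
expansions of the periods in the functions `θ_{γ,p}`, for every basis of periods; for the
other values of `λ` it is given by analytic continuation in `λ`. -/
structure IsStarSum (S : Vec n → ℂ → ℂ) : Prop where
  analytic : ∀ v ∈ X.D, AnalyticOnNhd ℂ (S v) {lam | lam ≠ 0 ∧ ∀ i, lam ≠ X.u i v}
  near_infinity : ∀ (W : Set (Vec n × ℂ)) (p : Fin n → Vec n → ℂ → ℂ), X.IsPeriodBasis W p →
    ∀ v lam, (v, lam) ∈ W → (∀ i, 2 * ‖X.u i v‖ < ‖lam‖) →
    ∃ s : Fin n → Fin n → ℂ,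
      (∀ α β, Θ.IsStar (fun w => deriv (p α w) lam) (fun w => deriv (p β w) lam) v (s α β)) ∧
      S v lam = ∑ α, ∑ β, gram M p v lam α β * s α β

end Calibration

/-! ### Jets and the genus one loop equation -/

/-- Jets `(v, v_x, …, v^{(N)})` of order `N`: `j s γ` is the jet coordinate `v^{γ,s}`. -/
abbrev Jet (N n : ℕ) := Fin (N + 1) → Vec n

/-- The total derivative `∂_x^m g(v)` (`m ≤ N`) of a function `g` on `M`, as a function of
the jet: the `m`-th derivative at `x = 0` of `g` along the curve
`x ↦ ∑_s v^{(s)} x^s / s!` with the given jet. -/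
def totalDeriv {N n : ℕ} (m : ℕ) (g : Vec n → ℂ) (j : Jet N n) : ℂ :=
  iteratedDeriv m (fun x : ℂ =>
    g (∑ s : Fin (N + 1), (x ^ (s : ℕ) / ((s : ℕ).factorial : ℂ)) • j s)) 0

/-- The partial derivative `∂F/∂v^{γ,s}` of a function on jets. -/
def jetPd {N n : ℕ} (s : Fin (N + 1)) (γ : Fin n) (F : Jet N n → ℂ) (j : Jet N n) : ℂ :=
  fderiv ℂ F j (Pi.single s (Pi.single γ 1))

/-- `K^{γ,s} = (s+1) ∂_x^s (1/(E-λe))^γ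
  + ∑_{k=1}^s k C(s+1,k+1) (∂_x^{s-k} ∂^γ p_α) G^{αβ} (∂_λ ∂_x^k p_β)`. -/
def K {N n : ℕ} (M : GenFrobeniusManifold n) (p : Fin n → Vec n → ℂ → ℂ) (γ : Fin n) (s : ℕ)
    (j : Jet N n) (lam : ℂ) : ℂ :=
  ((s : ℂ) + 1) * totalDeriv s (M.invEulerSub lam γ) j
    + ∑ k ∈ Finset.Icc 1 s, (k : ℂ) * ((s + 1).choose (k + 1) : ℂ) *
      ∑ α, ∑ β, totalDeriv (s - k) (M.grad (fun w => p α w lam) γ) j * gram M p (j 0) lam α β *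
        deriv (fun l => totalDeriv k (fun w => p β w l) j) lam

/-- `F` is a holomorphic solution, on the open set `U` of jets of order `N`, of the genus one part
of the loop equation,
`∑_s ∂F/∂v^{γ,s} K^{γ,s} = ½ G^{αβ} ∂_λ p_α * ∂_λ p_β - (4λ²)⁻¹ tr(¼ - μ²)`,
where `S` stands for `G^{αβ} ∂_λ p_α * ∂_λ p_β`. -/
structure SolvesGenusOne {N n : ℕ} {M : GenFrobeniusManifold n} (X : CanonicalChart M)
    (S : Vec n → ℂ → ℂ) (U : Set (Jet N n)) (F : Jet N n → ℂ) : Prop where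
  analytic : AnalyticOnNhd ℂ F U
  equation : ∀ (W : Set (Vec n × ℂ)) (p : Fin n → Vec n → ℂ → ℂ), X.IsPeriodBasis W p →
    ∀ j ∈ U, ∀ lam : ℂ, (j 0, lam) ∈ W → lam ≠ 0 →
    ∑ s : Fin (N + 1), ∑ γ, jetPd s γ F j * K M p γ s j lam
      = (1 / 2) * S (j 0) lam
        - 1 / (4 * lam ^ 2) *
          ((1 / 4 : ℂ) • (1 : Matrix (Fin n) (Fin n) ℂ) - M.μ * M.μ).trace

/-- `u_{i,x} = v^α_x ∂u_i/∂v^α`, as a function of the first order jet. -/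
def canonicalX {n : ℕ} {M : GenFrobeniusManifold n} (X : CanonicalChart M) (i : Fin n)
    (j : Jet 1 n) : ℂ :=
  ∑ α, j 1 α * pd α (X.u i) (j 0)

/-- The projection of jets of order `N ≥ 1` to jets of order one. -/
def truncOne {N n : ℕ} (hN : 1 ≤ N) (j : Jet N n) : Jet 1 n :=
  fun k => j (Fin.castLE (Nat.succ_le_succ hN) k)

end GFM

end

open GFM

/-! Notation: `C_a` is multiplication by `a`, `L = (𝒰 - λ)⁻¹`, `μ₊ = μ + ½`, `μ₋ = ½ - μ`, and `Φ`
is the matrix whose columns are the `η`-gradients of a basis of periods. Elimination of the periods.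
Because `η(L(a·b), c)` is totally symmetric and `∂_α 𝒰 = C_α μ₊ + μ₋ C_α`, flatness and the
Gauss–Manin equation become the linear system `∂_α Φ = -L C_α μ₊ Φ`, `∂_λ Φ = L μ₊ Φ`, while the
Gram matrix satisfies `Φ G Φᵀ = L η⁻¹` (`christoffel_eq`, `periodMat_gram`). Every jet of a gradient
is therefore a matrix built from the structure constants, times `Φ`, and the functions `K^{γ,s}` do
not depend on the periods (`IsPeriodBasis.K_eq`). The system is integrable
(`gaussManin_integrable`), so that bases of periods exist near every point off the discriminant
(`exists_isPeriodBasis`); without this the loop equation could be vacuous and uniqueness would fail.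
The star product. For `|λ| > 2 max |u_i|` one has `Φ = ∑ Θ_p A_p` up to a constant right factor,
where `Θ_p` has the gradients of `θ_{α,p}` as columns and `λ A_{p+1} = (p + μ₊) A_p + ∑ R_k
A_{p+k}`. The relation `(z + w) Ω(z, w) = ⟨∇θ(z), ∇θ(w)⟩ - η` and the Euler identity for `Ω` combine
into one formula for `∑ a_pᵀ Ω_{p,q} a_q` with the factor `2ν - 1`, where `p + μ + ν` is the
coefficient in the recursion (`BoundedAt.star_self`). For `ν = ½` the factor is zero and the formula
says that the Gram matrix of the series is a constant; for `ν = 3/2`, the case of the shifted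
sequence, it gives the star product. All corrections due to the `R_k` have positive degree for `ad
μ`, hence trace zero, and the result is `G^{αβ} ∂_λ p_α * ∂_λ p_β = -½ tr(L μ₊ L μ₋) + (2λ²)⁻¹ tr(¼
- μ²)` (`BoundedAt.trace_star`). This is rational in `λ`, and its last term is the one that the loop
equation subtracts. Existence. In the orthonormal frame of normalized idempotents `L` is the
diagonal matrix with entries `d_i = (u_i - λ)⁻¹` and `μ` becomes the skew matrix `V`. Then `-¼ tr(L
μ₊ L μ₋) = ∑ H_i d_i - (1/16) ∑ d_i²` (`trace_res`). Along the vector `(K^{γ,s})` the logarithm of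
`τ_I` changes by `∑ H_i d_i`, and `log u_{i,x}` by `-(3/2) d_i²` plus the change of `log √h_i`
(`fderiv_u_curveK`). The latter cancels against `log J`, and `(1/24)(3/2) = 1/16`. Uniqueness. At `λ
= u_i` the function `K^{γ,s}` has a pole of order `s + 1` whose leading coefficient is `u_{i,x}^s
∂v^γ/∂u_i` times a number `± ((s+1)! - ∑ k C(s+1,k+1) (½)_k (½)_{s-k})`. This number is not zero, by
the Vandermonde convolution of rising factorials (`factorial_sub_sum_pos`). Hence the `K^{γ,s}` are
linearly independent functions of `λ`, and the difference of two solutions has zero differential. -/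

noncomputable section

namespace GFM

/-! ### Entrywise calculus of matrix-valued functions -/

section MatrixCalculus

variable {E : Type*} [NormedAddCommGroup E] [NormedSpace ℂ E]
variable {E' : Type*} [NormedAddCommGroup E'] [NormedSpace ℂ E']
variable {k l m n : Type*}

/-- All entries of a matrix-valued function are analytic at a point. -/
def MatAnalyticAt (F : E → Matrix m n ℂ) (z : E) : Prop :=
  ∀ i j, AnalyticAt ℂ (fun w => F w i j) z

/-- The entrywise directional derivative of a matrix-valued function. -/
def matDeriv (a : E) (F : E → Matrix m n ℂ) (z : E) : Matrix m n ℂ :=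
  Matrix.of fun i j => fderiv ℂ (fun w => F w i j) z a

theorem matDeriv_apply (a : E) (F : E → Matrix m n ℂ) (z : E) (i : m) (j : n) :
    matDeriv a F z i j = fderiv ℂ (fun w => F w i j) z a := rfl

theorem matAnalyticAt_const (A : Matrix m n ℂ) (z : E) : MatAnalyticAt (fun _ => A) z :=
  fun _ _ => analyticAt_const

theorem MatAnalyticAt.add {F G : E → Matrix m n ℂ} {z : E} (hF : MatAnalyticAt F z)
    (hG : MatAnalyticAt G z) : MatAnalyticAt (fun w => F w + G w) z :=
  fun i j => (hF i j).add (hG i j)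

theorem MatAnalyticAt.sub {F G : E → Matrix m n ℂ} {z : E} (hF : MatAnalyticAt F z)
    (hG : MatAnalyticAt G z) : MatAnalyticAt (fun w => F w - G w) z :=
  fun i j => (hF i j).sub (hG i j)

theorem MatAnalyticAt.neg {F : E → Matrix m n ℂ} {z : E} (hF : MatAnalyticAt F z) :
    MatAnalyticAt (fun w => -F w) z :=
  fun i j => (hF i j).neg

theorem MatAnalyticAt.smul {f : E → ℂ} {F : E → Matrix m n ℂ} {z : E} (hf : AnalyticAt ℂ f z)
    (hF : MatAnalyticAt F z) : MatAnalyticAt (fun w => f w • F w) z :=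
  fun i j => hf.mul (hF i j)

theorem MatAnalyticAt.transpose {F : E → Matrix m n ℂ} {z : E} (hF : MatAnalyticAt F z) :
    MatAnalyticAt (fun w => (F w).transpose) z :=
  fun i j => hF j i

theorem MatAnalyticAt.mul [Fintype m] {F : E → Matrix l m ℂ} {G : E → Matrix m n ℂ} {z : E}
    (hF : MatAnalyticAt F z) (hG : MatAnalyticAt G z) : MatAnalyticAt (fun w => F w * G w) z := by
  intro i j
  simp only [Matrix.mul_apply]
  exact Finset.analyticAt_fun_sum _ fun x _ => (hF i x).mul (hG x j)

theorem MatAnalyticAt.sum {ι : Type*} (s : Finset ι) {F : ι → E → Matrix m n ℂ} {z : E}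
    (hF : ∀ x ∈ s, MatAnalyticAt (F x) z) : MatAnalyticAt (fun w => ∑ x ∈ s, F x w) z := by
  intro i j
  simp only [Matrix.sum_apply]
  exact Finset.analyticAt_fun_sum _ fun x hx => hF x hx i j

theorem MatAnalyticAt.comp {F : E' → Matrix m n ℂ} {f : E → E'} {z : E}
    (hF : MatAnalyticAt F (f z)) (hf : AnalyticAt ℂ f z) :
    MatAnalyticAt (fun w => F (f w)) z :=
  fun i j => (hF i j).fun_comp hf

theorem MatAnalyticAt.congr {F G : E → Matrix m n ℂ} {z : E} (hF : MatAnalyticAt F z)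
    (h : F =ᶠ[𝓝 z] G) : MatAnalyticAt G z :=
  fun i j => (hF i j).congr (h.mono fun w hw => by simp only [hw])

theorem MatAnalyticAt.det [Fintype n] [DecidableEq n] {F : E → Matrix n n ℂ} {z : E}
    (hF : MatAnalyticAt F z) : AnalyticAt ℂ (fun w => (F w).det) z := by
  simp only [Matrix.det_apply]
  refine Finset.analyticAt_fun_sum _ fun σ _ => ?_
  have h : AnalyticAt ℂ (fun w => ∏ i, F w (σ i) i) z :=
    Finset.analyticAt_fun_prod _ fun i _ => hF (σ i) i
  rcases Int.units_eq_one_or (Equiv.Perm.sign σ) with hs | hs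
  · simpa [hs] using h
  · have := h.fun_neg
    simpa [hs] using this

/-- Cramer's rule: the entries of the adjugate are determinants of matrices in which one row has
been replaced by a constant one. -/
theorem MatAnalyticAt.inv [Fintype n] [DecidableEq n] {F : E → Matrix n n ℂ} {z : E}
    (hF : MatAnalyticAt F z) (hz : (F z).det ≠ 0) : MatAnalyticAt (fun w => (F w)⁻¹) z := by
  intro i j
  simp only [Matrix.inv_def, Ring.inverse_eq_inv', Matrix.smul_apply, smul_eq_mul,
    Matrix.adjugate_apply]
  refine (hF.det.inv hz).mul ?_
  refine MatAnalyticAt.det fun a b => ?_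
  by_cases h : a = j
  · subst h; simpa using analyticAt_const
  · simpa [Matrix.updateRow_ne h] using hF a b

theorem matDeriv_const (a : E) (A : Matrix m n ℂ) (z : E) : matDeriv a (fun _ => A) z = 0 := by
  ext i j; simp [matDeriv]

theorem matDeriv_congr (a : E) {F G : E → Matrix m n ℂ} {z : E} (h : F =ᶠ[𝓝 z] G) :
    matDeriv a F z = matDeriv a G z := by
  ext i j
  have : (fun w => F w i j) =ᶠ[𝓝 z] fun w => G w i j := h.mono fun w hw => by simp only [hw]
  simp only [matDeriv, Matrix.of_apply, this.fderiv_eq]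

theorem matDeriv_sub (a : E) {F G : E → Matrix m n ℂ} {z : E} (hF : MatAnalyticAt F z)
    (hG : MatAnalyticAt G z) :
    matDeriv a (fun w => F w - G w) z = matDeriv a F z - matDeriv a G z := by
  ext i j
  have := fderiv_fun_sub (hF i j).differentiableAt (hG i j).differentiableAt
  simp [matDeriv, this]

theorem matDeriv_neg (a : E) {F : E → Matrix m n ℂ} {z : E} :
    matDeriv a (fun w => -F w) z = -matDeriv a F z := by
  ext i j
  simp [matDeriv, fderiv_fun_neg]

theorem matDeriv_smul (a : E) {f : E → ℂ} {F : E → Matrix m n ℂ} {z : E} (hf : AnalyticAt ℂ f z)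
    (hF : MatAnalyticAt F z) :
    matDeriv a (fun w => f w • F w) z = fderiv ℂ f z a • F z + f z • matDeriv a F z := by
  ext i j
  have := fderiv_fun_mul hf.differentiableAt (hF i j).differentiableAt
  simp [matDeriv, this]
  ring

theorem matDeriv_transpose (a : E) (F : E → Matrix m n ℂ) (z : E) :
    matDeriv a (fun w => (F w).transpose) z = (matDeriv a F z).transpose := rfl

theorem matDeriv_sum {ι : Type*} (s : Finset ι) (a : E) {F : ι → E → Matrix m n ℂ} {z : E}
    (hF : ∀ x ∈ s, MatAnalyticAt (F x) z) :
    matDeriv a (fun w => ∑ x ∈ s, F x w) z = ∑ x ∈ s, matDeriv a (F x) z := by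
  ext i j
  simp only [matDeriv, Matrix.sum_apply, Matrix.of_apply]
  rw [fderiv_fun_sum fun x hx => (hF x hx i j).differentiableAt]
  simp

theorem matDeriv_mul [Fintype m] (a : E) {F : E → Matrix l m ℂ} {G : E → Matrix m n ℂ} {z : E}
    (hF : MatAnalyticAt F z) (hG : MatAnalyticAt G z) :
    matDeriv a (fun w => F w * G w) z = matDeriv a F z * G z + F z * matDeriv a G z := by
  ext i j
  simp only [matDeriv, Matrix.mul_apply, Matrix.of_apply, Matrix.add_apply]
  rw [fderiv_fun_sum fun x _ =>
    (hF i x).differentiableAt.fun_mul (hG x j).differentiableAt]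
  simp only [sum_apply, ← Finset.sum_add_distrib]
  refine Finset.sum_congr rfl fun x _ => ?_
  rw [fderiv_fun_mul (hF i x).differentiableAt (hG x j).differentiableAt]
  simp
  ring

theorem matDeriv_const_mul [Fintype m] (a : E) (A : Matrix l m ℂ) {G : E → Matrix m n ℂ} {z : E}
    (hG : MatAnalyticAt G z) :
    matDeriv a (fun w => A * G w) z = A * matDeriv a G z := by
  rw [matDeriv_mul a (matAnalyticAt_const A z) hG, matDeriv_const]; simp

theorem matDeriv_mul_const [Fintype m] (a : E) {F : E → Matrix l m ℂ} (A : Matrix m n ℂ) {z : E}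
    (hF : MatAnalyticAt F z) :
    matDeriv a (fun w => F w * A) z = matDeriv a F z * A := by
  rw [matDeriv_mul a hF (matAnalyticAt_const A z), matDeriv_const]; simp

theorem MatAnalyticAt.eventually_det_ne_zero [Fintype n] [DecidableEq n] {F : E → Matrix n n ℂ}
    {z : E} (hF : MatAnalyticAt F z) (hz : (F z).det ≠ 0) : ∀ᶠ w in 𝓝 z, (F w).det ≠ 0 :=
  hF.det.continuousAt.eventually_ne hz

theorem matDeriv_inv [Fintype n] [DecidableEq n] (a : E) {F : E → Matrix n n ℂ} {z : E}
    (hF : MatAnalyticAt F z) (hz : (F z).det ≠ 0) :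
    matDeriv a (fun w => (F w)⁻¹) z = -((F z)⁻¹ * matDeriv a F z * (F z)⁻¹) := by
  have h1 : (fun w => F w * (F w)⁻¹) =ᶠ[𝓝 z] fun _ => (1 : Matrix n n ℂ) :=
    (hF.eventually_det_ne_zero hz).mono fun w hw => Matrix.mul_nonsing_inv _ (Ne.isUnit hw)
  have h2 := matDeriv_congr a h1
  rw [matDeriv_mul a hF (hF.inv hz), matDeriv_const] at h2
  have h3 : (F z)⁻¹ * (F z) = 1 := Matrix.nonsing_inv_mul _ (Ne.isUnit hz)
  calc matDeriv a (fun w => (F w)⁻¹) z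
      = ((F z)⁻¹ * F z) * matDeriv a (fun w => (F w)⁻¹) z := by rw [h3, one_mul]
    _ = (F z)⁻¹ * (matDeriv a F z * (F z)⁻¹ + F z * matDeriv a (fun w => (F w)⁻¹) z)
        - (F z)⁻¹ * matDeriv a F z * (F z)⁻¹ := by noncomm_ring
    _ = _ := by rw [h2]; simp

theorem MatAnalyticAt.matDeriv {F : E → Matrix m n ℂ} {z : E} (hF : MatAnalyticAt F z) (a : E) :
    MatAnalyticAt (matDeriv a F) z := fun i j =>
  ((ContinuousLinearMap.apply ℂ ℂ a).analyticAt _).fun_comp (hF i j).fderiv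

theorem analyticAt_fderiv_apply {f : E → ℂ} {z : E} (hf : AnalyticAt ℂ f z) (a : E) :
    AnalyticAt ℂ (fun w => fderiv ℂ f w a) z :=
  ((ContinuousLinearMap.apply ℂ ℂ a).analyticAt _).fun_comp hf.fderiv

end MatrixCalculus

theorem pd_eq_fderiv {n : ℕ} (α : Fin n) (f : Vec n → ℂ) (v : Vec n) :
    pd α f v = fderiv ℂ f v (Pi.single α 1) := rfl

theorem fderiv_eq_sum_pd {n : ℕ} (f : Vec n → ℂ) (v a : Vec n) :
    fderiv ℂ f v a = ∑ α, a α * pd α f v := by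
  conv_lhs => rw [pi_eq_sum_univ' a]
  simp [map_sum, pd]

/-! ### Structure constants, the Euler field and the grading operator -/

namespace GenFrobeniusManifold

variable {n : ℕ} (M : GenFrobeniusManifold n)

/-- The matrix of multiplication by `∂_α`. -/
def mulBy (α : Fin n) (v : Vec n) : Matrix (Fin n) (Fin n) ℂ := Matrix.of fun γ β => M.c α β γ v

/-- The coordinate derivative of matrix-valued functions on the chart. -/
abbrev mpd {n : ℕ} {l m : Type*} (α : Fin n) (F : Vec n → Matrix l m ℂ) (v : Vec n) :
    Matrix l m ℂ := matDeriv (Pi.single α 1) F v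

variable {M} {v : Vec n}

theorem mulBy_analytic (hv : v ∈ M.domain) (α : Fin n) : MatAnalyticAt (M.mulBy α) v :=
  fun _ _ => M.c_analytic _ _ _ v hv

theorem E_analytic (α : Fin n) (v : Vec n) : AnalyticAt ℂ (fun w => M.E w α) v := by
  have : (fun w => M.E w α) = fun w : Vec n => (∑ β, M.gradE α β * w β) + M.E₀ α := by
    funext w; simp [E, Matrix.mulVec, dotProduct]
  rw [this]
  refine AnalyticAt.add (Finset.analyticAt_fun_sum _ fun β _ => analyticAt_const.mul ?_)
    analyticAt_const
  exact (ContinuousLinearMap.proj (R := ℂ) (φ := fun _ : Fin n => ℂ) β).analyticAt v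

theorem pd_E (α γ : Fin n) (v : Vec n) : pd α (fun w => M.E w γ) v = M.gradE γ α := by
  have : (fun w => M.E w γ) = fun w : Vec n => (∑ β, M.gradE γ β * w β) + M.E₀ γ := by
    funext w; simp [E, Matrix.mulVec, dotProduct]
  have h : HasFDerivAt (fun w => M.E w γ) (∑ β, M.gradE γ β •
      ContinuousLinearMap.proj (R := ℂ) (φ := fun _ : Fin n => ℂ) β) v := by
    rw [this]
    refine HasFDerivAt.add_const _ (HasFDerivAt.fun_sum fun β _ => ?_)
    exact ((ContinuousLinearMap.proj (R := ℂ) (φ := fun _ : Fin n => ℂ) β).hasFDerivAt).const_mul _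
  rw [pd, h.fderiv]
  simp [Pi.single_apply]

theorem calU_eq (v : Vec n) : M.calU v = ∑ ε, M.E v ε • M.mulBy ε v := by
  ext γ β; simp [calU, mulBy, Matrix.sum_apply]

theorem calU_analytic (hv : v ∈ M.domain) : MatAnalyticAt M.calU v := by
  have : M.calU = fun v => ∑ ε, M.E v ε • M.mulBy ε v := funext calU_eq
  rw [this]
  exact MatAnalyticAt.sum _ fun ε _ => MatAnalyticAt.smul (E_analytic ε v) (mulBy_analytic hv ε)

/-- By associativity `C_α C_β` is multiplication by the product `∂_α · ∂_β`, which is symmetric. -/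
theorem mulBy_comm (hv : v ∈ M.domain) (α β : Fin n) :
    M.mulBy α v * M.mulBy β v = M.mulBy β v * M.mulBy α v := by
  have key : ∀ α β γ δ, (M.mulBy α v * M.mulBy β v) γ δ = ∑ ε, M.c α β ε v * M.c ε δ γ v := by
    intro α β γ δ
    rw [M.mul_assoc' v hv, Matrix.mul_apply]
    exact Finset.sum_congr rfl fun ε _ => by simp [mulBy, mul_comm]
  ext γ δ
  rw [key, key]
  exact Finset.sum_congr rfl fun ε _ => by rw [M.mul_comm' v hv α β]

theorem η_mulBy (hv : v ∈ M.domain) (α : Fin n) :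
    M.η * M.mulBy α v = (M.mulBy α v).transpose * M.η := by
  ext γ β
  simp only [Matrix.mul_apply, mulBy, Matrix.of_apply, Matrix.transpose_apply]
  rw [← M.frobenius v hv]
  exact Finset.sum_congr rfl fun ε _ => by rw [M.mul_comm' v hv]

/-- The conformal condition on `η` says that `∇E` is `(2-d)/2` plus a skew-adjoint operator, so `μ`
is skew-adjoint. -/
theorem η_μ : M.η * M.μ = -(M.μ.transpose * M.η) := by
  have h := M.euler_metric
  have h1 : M.μ.transpose = ((2 - M.d) / 2) • (1 : Matrix (Fin n) (Fin n) ℂ)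
      - M.gradE.transpose := by simp [μ]
  rw [h1, μ, mul_sub, sub_mul, Matrix.mul_smul, Matrix.smul_mul, mul_one, one_mul]
  have h2 : M.gradE.transpose * M.η = (2 - M.d) • M.η - M.η * M.gradE := by
    rw [← h]; abel
  rw [h2]
  module

theorem η_mul_inv : M.η * M.η⁻¹ = 1 := Matrix.mul_nonsing_inv _ (Ne.isUnit M.η_det)
theorem η_inv_mul : M.η⁻¹ * M.η = 1 := Matrix.nonsing_inv_mul _ (Ne.isUnit M.η_det)

theorem η_inv_symm : (M.η⁻¹).transpose = M.η⁻¹ := by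
  rw [Matrix.transpose_nonsing_inv, M.η_symm.eq]

/-- The symmetry of `∇c` with one index raised; `η` is constant and passes through the derivative.
-/
theorem mpd_mulBy_symm (hv : v ∈ M.domain) (α β : Fin n) :
    mpd α (M.mulBy β) v = mpd β (M.mulBy α) v := by
  have key : ∀ α β, M.η * mpd α (M.mulBy β) v = Matrix.of fun γ δ =>
      pd α (fun w => ∑ ε, M.c β δ ε w * M.η ε γ) v := by
    intro α β
    rw [mpd, ← matDeriv_const_mul _ _ (mulBy_analytic hv β)]
    ext γ δ
    simp only [matDeriv, Matrix.of_apply, pd]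
    congr 3
    funext w
    simp only [Matrix.mul_apply, mulBy, Matrix.of_apply]
    refine Finset.sum_congr rfl fun ε _ => ?_
    rw [← M.η_symm.apply γ ε, mul_comm]
  have h : M.η * mpd α (M.mulBy β) v = M.η * mpd β (M.mulBy α) v := by
    rw [key, key]
    ext γ δ
    exact M.nabla_c_symm v hv β δ γ α
  calc _ = M.η⁻¹ * (M.η * mpd α (M.mulBy β) v) := by rw [← mul_assoc, η_inv_mul, one_mul]
    _ = _ := by rw [h, ← mul_assoc, η_inv_mul, one_mul]

/-- Differentiating `𝒰 = E^ε C_ε` gives a term with `∇E` and the term `E^ε ∂_ε C_α`, by the symmetry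
of `∇c`. The homogeneity of the product evaluates the second one, and the scalar part of `μ` drops
out of the commutator. -/
theorem mpd_calU (hv : v ∈ M.domain) (α : Fin n) :
    mpd α M.calU v = M.mulBy α v + M.mulBy α v * M.μ - M.μ * M.mulBy α v := by
  have h0 : M.calU = fun v => ∑ ε, M.E v ε • M.mulBy ε v := funext calU_eq
  have h1 : mpd α M.calU v = ∑ ε, (M.gradE ε α • M.mulBy ε v + M.E v ε • mpd ε (M.mulBy α) v) := by
    rw [mpd, h0, matDeriv_sum _ _ fun ε _ => MatAnalyticAt.smul (E_analytic ε v) (mulBy_analytic hv ε)]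
    refine Finset.sum_congr rfl fun ε _ => ?_
    rw [matDeriv_smul _ (E_analytic ε v) (mulBy_analytic hv ε), ← pd_eq_fderiv, pd_E]
    rw [← mpd, mpd_mulBy_symm hv]
  rw [h1]
  ext γ β
  have h2 := M.euler_mul v hv α β γ
  simp only [μ, Matrix.sum_apply, Matrix.add_apply, Matrix.sub_apply, Matrix.smul_apply,
    smul_eq_mul, mul_sub, sub_mul, Matrix.mul_smul, Matrix.smul_mul, mul_one, one_mul,
    Finset.sum_add_distrib]
  simp only [Matrix.mul_apply, mulBy, Matrix.of_apply]
  have h3 : ∀ ε, mpd ε (Matrix.of fun γ β => M.c α β γ · : Vec n → Matrix (Fin n) (Fin n) ℂ) v γ β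
      = pd ε (M.c α β γ) v := fun _ => rfl
  have h4 : ∀ ε, mpd ε (M.mulBy α) v γ β = pd ε (M.c α β γ) v := fun _ => rfl
  simp only [h4]
  have h5 : ∑ ε, M.gradE γ ε * M.c α β ε v = ∑ ε, M.c α β ε v * M.gradE γ ε :=
    Finset.sum_congr rfl fun _ _ => mul_comm _ _
  have h6 : ∑ ε, M.c α ε γ v * M.gradE ε β = ∑ ε, M.gradE ε β * M.c α ε γ v :=
    Finset.sum_congr rfl fun _ _ => mul_comm _ _
  rw [h5, h6]
  have h7 : ∀ ε, M.E v ε = (M.gradE.mulVec v + M.E₀) ε := fun _ => rfl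
  simp only [h7]
  linear_combination h2

theorem calU_mulBy_comm (hv : v ∈ M.domain) (α : Fin n) :
    M.calU v * M.mulBy α v = M.mulBy α v * M.calU v := by
  rw [calU_eq, Finset.sum_mul, Finset.mul_sum]
  exact Finset.sum_congr rfl fun ε _ => by
    rw [Matrix.smul_mul, Matrix.mul_smul, mulBy_comm hv]

theorem η_calU (hv : v ∈ M.domain) : M.η * M.calU v = (M.calU v).transpose * M.η := by
  rw [calU_eq, Finset.mul_sum, Matrix.transpose_sum, Finset.sum_mul]
  exact Finset.sum_congr rfl fun ε _ => by
    rw [Matrix.transpose_smul, Matrix.smul_mul, Matrix.mul_smul, η_mulBy hv]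

end GenFrobeniusManifold

/-! ### The resolvent of `𝒰` and the Christoffel symbols of the pencil of metrics -/

namespace GenFrobeniusManifold

variable {n : ℕ} (M : GenFrobeniusManifold n)

/-- The matrix `μ + ½`. -/
def muPlus : Matrix (Fin n) (Fin n) ℂ := M.μ + (1 / 2 : ℂ) • (1 : Matrix (Fin n) (Fin n) ℂ)

/-- The matrix `½ - μ`. -/
def muMinus : Matrix (Fin n) (Fin n) ℂ := (1 / 2 : ℂ) • (1 : Matrix (Fin n) (Fin n) ℂ) - M.μ

/-- The matrix `𝒰 - λ`. -/
def eulerSub (lam : ℂ) (v : Vec n) : Matrix (Fin n) (Fin n) ℂ :=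
  M.calU v - lam • (1 : Matrix (Fin n) (Fin n) ℂ)

/-- The resolvent `(𝒰 - λ)⁻¹`. -/
def res (lam : ℂ) (v : Vec n) : Matrix (Fin n) (Fin n) ℂ := (M.eulerSub lam v)⁻¹

variable {M} {v : Vec n} {lam : ℂ}

theorem η_muMinus : M.η * M.muMinus = M.muPlus.transpose * M.η := by
  simp [muPlus, muMinus, mul_sub, add_mul, η_μ]
  abel

theorem muMinus_eq : M.muMinus = 1 - M.muPlus := by
  ext i j
  simp only [muMinus, muPlus, Matrix.sub_apply, Matrix.add_apply, Matrix.smul_apply, smul_eq_mul]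
  ring

/-- The term `C_α` is divided equally between the two sides. In this form the derivative is
self-adjoint, since `μ + ½` and `½ - μ` are adjoint to each other; the Christoffel symbols and the
integrability condition both rest on it. -/
theorem mpd_calU' (hv : v ∈ M.domain) (α : Fin n) :
    mpd α M.calU v = M.mulBy α v * M.muPlus + M.muMinus * M.mulBy α v := by
  rw [mpd_calU hv, muPlus, muMinus, mul_add, sub_mul, Matrix.mul_smul, Matrix.smul_mul, mul_one,
    one_mul]
  module

theorem η_eulerSub (hv : v ∈ M.domain) :
    M.η * M.eulerSub lam v = (M.eulerSub lam v).transpose * M.η := by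
  simp [eulerSub, mul_sub, sub_mul, η_calU hv]

theorem eulerSub_mulBy_comm (hv : v ∈ M.domain) (α : Fin n) :
    M.eulerSub lam v * M.mulBy α v = M.mulBy α v * M.eulerSub lam v := by
  simp [eulerSub, mul_sub, sub_mul, calU_mulBy_comm hv]

theorem res_mul (h : (M.eulerSub lam v).det ≠ 0) : M.res lam v * M.eulerSub lam v = 1 :=
  Matrix.nonsing_inv_mul _ (Ne.isUnit h)

theorem mul_res (h : (M.eulerSub lam v).det ≠ 0) : M.eulerSub lam v * M.res lam v = 1 :=
  Matrix.mul_nonsing_inv _ (Ne.isUnit h)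

theorem res_mulBy_comm (hv : v ∈ M.domain) (h : (M.eulerSub lam v).det ≠ 0) (α : Fin n) :
    M.res lam v * M.mulBy α v = M.mulBy α v * M.res lam v := by
  calc M.res lam v * M.mulBy α v
      = M.res lam v * M.mulBy α v * (M.eulerSub lam v * M.res lam v) := by rw [mul_res h, mul_one]
    _ = M.res lam v * (M.mulBy α v * M.eulerSub lam v) * M.res lam v := by noncomm_ring
    _ = (M.res lam v * M.eulerSub lam v) * M.mulBy α v * M.res lam v := by
        rw [← eulerSub_mulBy_comm hv]; noncomm_ring
    _ = _ := by rw [res_mul h, one_mul]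

theorem η_res (hv : v ∈ M.domain) : M.η * M.res lam v = (M.res lam v).transpose * M.η := by
  have h1 : M.η * M.eulerSub lam v * M.η⁻¹ = (M.eulerSub lam v).transpose := by
    rw [η_eulerSub hv, mul_assoc, η_mul_inv, mul_one]
  have h2 : (M.res lam v).transpose = M.η * M.res lam v * M.η⁻¹ := by
    rw [res, Matrix.transpose_nonsing_inv, ← h1, Matrix.mul_inv_rev, Matrix.mul_inv_rev,
      Matrix.nonsing_inv_nonsing_inv _ (Ne.isUnit M.η_det), mul_assoc]
  rw [h2, mul_assoc (M.η * _), η_inv_mul, mul_one]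

theorem pencil_eq (hv : v ∈ M.domain) : M.pencil lam v = M.eulerSub lam v * M.η⁻¹ := by
  have h : M.g v = M.η⁻¹ * (M.calU v).transpose := by
    ext α β; simp [g, Matrix.mul_apply]
  have h2 : M.η⁻¹ * (M.calU v).transpose = M.calU v * M.η⁻¹ := by
    calc M.η⁻¹ * (M.calU v).transpose = M.η⁻¹ * ((M.calU v).transpose * M.η) * M.η⁻¹ := by
          rw [mul_assoc, mul_assoc, η_mul_inv, mul_one]
      _ = _ := by rw [← η_calU hv, ← mul_assoc, η_inv_mul, one_mul]
  rw [pencil, h, h2, eulerSub, sub_mul, Matrix.smul_mul, one_mul]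

theorem det_eulerSub_ne_zero_iff (hv : v ∈ M.domain) :
    (M.pencil lam v).det ≠ 0 ↔ (M.eulerSub lam v).det ≠ 0 := by
  rw [pencil_eq hv, Matrix.det_mul]
  simp [M.η_det]

theorem pencilMetric_eq (hv : v ∈ M.domain) : M.pencilMetric lam v = M.η * M.res lam v := by
  rw [pencilMetric, pencil_eq hv, Matrix.mul_inv_rev,
    Matrix.nonsing_inv_nonsing_inv _ (Ne.isUnit M.η_det), res]

theorem eulerSub_analytic (hv : v ∈ M.domain) : MatAnalyticAt (M.eulerSub lam) v :=
  (calU_analytic hv).sub (matAnalyticAt_const _ _)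

theorem res_analytic (hv : v ∈ M.domain) (h : (M.eulerSub lam v).det ≠ 0) :
    MatAnalyticAt (M.res lam) v :=
  (eulerSub_analytic hv).inv h

theorem eulerSub_analytic₂ (hv : v ∈ M.domain) :
    MatAnalyticAt (fun z : Vec n × ℂ => M.eulerSub z.2 z.1) (v, lam) := by
  refine MatAnalyticAt.sub (MatAnalyticAt.comp (f := Prod.fst) (calU_analytic hv) analyticAt_fst) ?_
  exact MatAnalyticAt.smul analyticAt_snd (matAnalyticAt_const _ _)

theorem res_analytic₂ (hv : v ∈ M.domain) (h : (M.eulerSub lam v).det ≠ 0) :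
    MatAnalyticAt (fun z : Vec n × ℂ => M.res z.2 z.1) (v, lam) :=
  MatAnalyticAt.inv (eulerSub_analytic₂ hv) h

theorem mpd_res (hv : v ∈ M.domain) (h : (M.eulerSub lam v).det ≠ 0) (α : Fin n) :
    mpd α (M.res lam) v = -(M.res lam v *
      (M.mulBy α v * M.muPlus + M.muMinus * M.mulBy α v) * M.res lam v) := by
  have := matDeriv_inv (Pi.single α 1) (eulerSub_analytic (lam := lam) hv) h
  rw [show matDeriv (Pi.single α 1) (M.eulerSub lam) v = mpd α M.calU v by
    rw [mpd]
    change matDeriv _ (fun w => M.calU w - lam • (1 : Matrix (Fin n) (Fin n) ℂ)) v = _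
    rw [matDeriv_sub _ (calU_analytic hv) (matAnalyticAt_const _ _), matDeriv_const, sub_zero],
    mpd_calU' hv] at this
  exact this

/-- The resolvent commutes with all multiplications and is self-adjoint, so the trilinear form
`η(L(a·b), c)` is totally symmetric. -/
theorem η_res_mulBy_symm (hv : v ∈ M.domain) (h : (M.eulerSub lam v).det ≠ 0) (α δ β : Fin n) :
    (M.η * M.res lam v * M.mulBy α v) δ β = (M.η * M.res lam v * M.mulBy δ v) α β := by
  have hs : ∀ α, (M.η * M.res lam v * M.mulBy α v).transpose = M.η * M.res lam v * M.mulBy α v := by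
    intro α
    rw [Matrix.transpose_mul, Matrix.transpose_mul, M.η_symm.eq, ← η_res hv, ← mul_assoc,
      ← η_mulBy hv, mul_assoc, ← res_mulBy_comm hv h, mul_assoc]
  rw [← hs α, ← hs δ, Matrix.transpose_apply, Matrix.transpose_apply, Matrix.mul_apply,
    Matrix.mul_apply]
  exact Finset.sum_congr rfl fun y _ => by
    simp only [mulBy, Matrix.of_apply]; rw [M.mul_comm' v hv]

theorem mpd_pencilMetric (hv : v ∈ M.domain) (h : (M.eulerSub lam v).det ≠ 0) (α : Fin n) :
    mpd α (M.pencilMetric lam) v =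
      -(M.η * M.res lam v * M.mulBy α v * (M.muPlus * M.res lam v)
        + (M.η * M.res lam v * M.mulBy α v * (M.muPlus * M.res lam v)).transpose) := by
  have h0 : M.pencilMetric lam =ᶠ[𝓝 v] fun w => M.η * M.res lam w :=
    (M.isOpen_domain.eventually_mem hv).mono fun w hw => pencilMetric_eq hw
  rw [mpd, matDeriv_congr _ h0, matDeriv_const_mul _ _ (res_analytic hv h), ← mpd,
    mpd_res hv h]
  have h1 : (M.η * M.res lam v * M.mulBy α v * (M.muPlus * M.res lam v)).transpose
      = M.η * M.res lam v * M.muMinus * M.mulBy α v * M.res lam v := by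
    simp only [Matrix.transpose_mul, M.η_symm.eq]
    rw [← η_res hv]
    calc _ = (M.res lam v).transpose * M.muPlus.transpose * ((M.mulBy α v).transpose * M.η) *
          M.res lam v := by noncomm_ring
      _ = (M.res lam v).transpose * (M.muPlus.transpose * M.η) * M.mulBy α v *
          M.res lam v := by rw [← η_mulBy hv]; noncomm_ring
      _ = ((M.res lam v).transpose * M.η) * M.muMinus * M.mulBy α v *
          M.res lam v := by rw [← η_muMinus]; noncomm_ring
      _ = _ := by rw [← η_res hv]
  rw [h1]
  noncomm_ring

/-- With `N_α = η L C_α μ₊ L` the derivative of the metric is `-(N_α + N_αᵀ)`, and `N_α(δ, β) =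
N_δ(α, β)`. In the Koszul formula four of the six terms cancel in pairs and the other two are equal;
raising the index cancels the last resolvent. -/
theorem christoffel_eq (hv : v ∈ M.domain) (h : (M.eulerSub lam v).det ≠ 0) (γ α β : Fin n) :
    M.christoffel lam γ α β v =
      -(M.η * M.res lam v * M.mulBy α v * M.muPlus * M.η⁻¹) β γ := by
  set N : Fin n → Matrix (Fin n) (Fin n) ℂ := fun α =>
    M.η * M.res lam v * M.mulBy α v * (M.muPlus * M.res lam v) with hN
  have hsym : ∀ α δ β, N α δ β = N δ α β := by
    intro α δ β
    simp only [hN, Matrix.mul_apply (N := M.muPlus * M.res lam v)]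
    exact Finset.sum_congr rfl fun x _ => by rw [η_res_mulBy_symm hv h]
  have hd : ∀ α β γ, pd α (fun w => M.pencilMetric lam w β γ) v = -(N α β γ + N α γ β) := by
    intro α β γ
    have := congrFun (congrFun (mpd_pencilMetric hv h α) β) γ
    rw [Matrix.neg_apply, Matrix.add_apply, Matrix.transpose_apply] at this
    exact this
  have hNP : ∀ α, N α * M.pencil lam v = M.η * M.res lam v * M.mulBy α v * M.muPlus * M.η⁻¹ := by
    intro α
    rw [pencil_eq hv]
    calc _ = M.η * M.res lam v * M.mulBy α v * M.muPlus * (M.res lam v * M.eulerSub lam v)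
          * M.η⁻¹ := by simp only [hN]; noncomm_ring
      _ = _ := by rw [res_mul h, mul_one]
  have hPs : (M.pencil lam v).transpose = M.pencil lam v := by
    rw [pencil_eq hv, Matrix.transpose_mul, η_inv_symm]
    calc _ = M.η⁻¹ * ((M.eulerSub lam v).transpose * M.η) * M.η⁻¹ := by
          rw [mul_assoc, mul_assoc, η_mul_inv, mul_one]
      _ = _ := by rw [← η_eulerSub hv, ← mul_assoc, η_inv_mul, one_mul]
  rw [← hNP, christoffel, Matrix.mul_apply, Finset.mul_sum, ← Finset.sum_neg_distrib]
  refine Finset.sum_congr rfl fun δ _ => ?_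
  rw [hd, hd, hd, ← hPs, Matrix.transpose_apply, hPs, hsym δ α β, hsym δ β α, hsym β α δ]
  ring

end GenFrobeniusManifold

/-! ### Slices of functions of two variables -/

section Slices

variable {E F : Type*} [NormedAddCommGroup E] [NormedSpace ℂ E] [NormedAddCommGroup F]
  [NormedSpace ℂ F] {f : E × F → ℂ} {x : E} {y : F}

theorem fderiv_slice_left (hf : DifferentiableAt ℂ f (x, y)) (a : E) :
    fderiv ℂ (fun w => f (w, y)) x a = fderiv ℂ f (x, y) (a, 0) := by
  have h : HasFDerivAt (fun w : E => (w, y)) (ContinuousLinearMap.inl ℂ E F) x :=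
    hasFDerivAt_prodMk_left x y
  have h2 := hf.hasFDerivAt.comp x h
  have h3 : fderiv ℂ (fun w => f (w, y)) x = _ := h2.fderiv
  rw [h3]; simp

theorem fderiv_slice_right (hf : DifferentiableAt ℂ f (x, y)) (a : F) :
    fderiv ℂ (fun w => f (x, w)) y a = fderiv ℂ f (x, y) (0, a) := by
  have h : HasFDerivAt (fun w : F => (x, w)) (ContinuousLinearMap.inr ℂ E F) y :=
    hasFDerivAt_prodMk_right x y
  have h2 := hf.hasFDerivAt.comp y h
  have h3 : fderiv ℂ (fun w => f (x, w)) y = _ := h2.fderiv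
  rw [h3]; simp

theorem deriv_slice_right {f : E × ℂ → ℂ} {y : ℂ} (hf : DifferentiableAt ℂ f (x, y)) :
    deriv (fun w => f (x, w)) y = fderiv ℂ f (x, y) (0, 1) := by
  rw [← fderiv_slice_right hf, fderiv_apply_one_eq_deriv]

theorem analyticAt_slice_left (hf : AnalyticAt ℂ f (x, y)) :
    AnalyticAt ℂ (fun w => f (w, y)) x :=
  AnalyticAt.fun_comp (f := fun w => (w, y)) hf (analyticAt_id.prod analyticAt_const)

theorem analyticAt_slice_right (hf : AnalyticAt ℂ f (x, y)) :
    AnalyticAt ℂ (fun w => f (x, w)) y :=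
  AnalyticAt.fun_comp (f := fun w => (x, w)) hf (analyticAt_const.prod analyticAt_id)

end Slices

/-! ### The Gauss–Manin system for the gradients of the periods -/

namespace GenFrobeniusManifold

variable {n : ℕ} (M : GenFrobeniusManifold n)

/-- The matrix whose columns are the gradients of the functions `p_1, …, p_n`, as a function
of `(v, λ)`. -/
def periodMat (p : Fin n → Vec n → ℂ → ℂ) (z : Vec n × ℂ) : Matrix (Fin n) (Fin n) ℂ :=
  Matrix.of fun γ α => M.grad (fun w => p α w z.2) γ z.1

variable {M} {p : Fin n → Vec n → ℂ → ℂ} {W : Set (Vec n × ℂ)} {z : Vec n × ℂ}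

/-- The gradient is defined by slices at fixed `λ`; as a partial derivative of a function of both
variables it is jointly analytic. -/
theorem periodMat_eventuallyEq (hp : ∀ α, AnalyticAt ℂ (fun x : Vec n × ℂ => p α x.1 x.2) z) :
    M.periodMat p =ᶠ[𝓝 z] fun y => M.η⁻¹ * Matrix.of fun β α =>
      fderiv ℂ (fun x : Vec n × ℂ => p α x.1 x.2) y (Pi.single β 1, 0) := by
  have : ∀ᶠ y in 𝓝 z, ∀ α, AnalyticAt ℂ (fun x : Vec n × ℂ => p α x.1 x.2) y :=
    eventually_all.2 fun α => (hp α).eventually_analyticAt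
  refine this.mono fun y hy => ?_
  ext γ α
  simp only [periodMat, grad, Matrix.of_apply, Matrix.mul_apply]
  refine Finset.sum_congr rfl fun β _ => ?_
  rw [pd, ← fderiv_slice_left (f := fun x : Vec n × ℂ => p α x.1 x.2) (x := y.1) (y := y.2)
    (hy α).differentiableAt]

theorem periodMat_analyticAt (hp : ∀ α, AnalyticAt ℂ (fun x : Vec n × ℂ => p α x.1 x.2) z) :
    MatAnalyticAt (M.periodMat p) z := by
  refine MatAnalyticAt.congr ?_ (periodMat_eventuallyEq hp).symm
  exact (matAnalyticAt_const _ _).mul fun i j => analyticAt_fderiv_apply (hp j) _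

theorem matDeriv_periodMat_right (hper : ∀ α, M.IsPeriod W (p α)) (hz : z ∈ W)
    (h : (M.eulerSub z.2 z.1).det ≠ 0) :
    matDeriv (0, 1) (M.periodMat p) z = M.res z.2 z.1 * M.muPlus * M.periodMat p z := by
  have han := periodMat_analyticAt (M := M) fun α => (hper α).analytic z hz
  have h1 : M.eulerSub z.2 z.1 * matDeriv (0, 1) (M.periodMat p) z
      = M.muPlus * M.periodMat p z := by
    ext γ α
    have := (hper α).gaussManin z.1 z.2 hz γ
    rw [Matrix.mul_apply, Matrix.mul_apply]
    refine (Finset.sum_congr rfl fun β _ => ?_).trans this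
    rw [matDeriv_apply, ← deriv_slice_right (x := z.1) (y := z.2)
      (han β α).differentiableAt]
    rfl
  calc _ = M.res z.2 z.1 * M.eulerSub z.2 z.1 * matDeriv (0, 1) (M.periodMat p) z := by
        rw [res_mul h, one_mul]
    _ = _ := by rw [mul_assoc, h1, mul_assoc]

theorem matDeriv_periodMat_left (hper : ∀ α, M.IsPeriod W (p α)) (hz : z ∈ W)
    (hv : z.1 ∈ M.domain) (h : (M.eulerSub z.2 z.1).det ≠ 0) (α : Fin n) :
    matDeriv (Pi.single α 1, 0) (M.periodMat p) z =
      -(M.res z.2 z.1 * M.mulBy α z.1 * M.muPlus * M.periodMat p z) := by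
  have hP : ∀ δ, AnalyticAt ℂ (fun w => p δ w z.2) z.1 := fun δ =>
    analyticAt_slice_left (f := fun x : Vec n × ℂ => p δ x.1 x.2) ((hper δ).analytic z hz)
  have han := periodMat_analyticAt (M := M) fun α => (hper α).analytic z hz
  set Q : Vec n → Matrix (Fin n) (Fin n) ℂ := fun w => Matrix.of fun β δ =>
    pd β (fun w => p δ w z.2) w with hQ
  have hQan : MatAnalyticAt Q z.1 := fun β δ => analyticAt_fderiv_apply (hP δ) _
  have hPQ : ∀ w, M.periodMat p (w, z.2) = M.η⁻¹ * Q w := fun w => by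
    ext γ δ; simp [periodMat, grad, Matrix.mul_apply, hQ]
  have h1 : matDeriv (Pi.single α 1, 0) (M.periodMat p) z = M.η⁻¹ * mpd α Q z.1 := by
    rw [← matDeriv_const_mul _ _ hQan]
    ext γ δ
    rw [matDeriv_apply, matDeriv_apply,
      ← fderiv_slice_left (x := z.1) (y := z.2) (han γ δ).differentiableAt]
    simp only [hPQ]
  have h2 : mpd α Q z.1 = -(M.η * M.res z.2 z.1 * M.mulBy α z.1 * M.muPlus * M.η⁻¹ * Q z.1) := by
    ext β δ
    have := (hper δ).flat z.1 z.2 hz α β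
    rw [Matrix.neg_apply, Matrix.mul_apply (N := Q z.1), ← Finset.sum_neg_distrib]
    refine this.trans (Finset.sum_congr rfl fun γ _ => ?_)
    rw [christoffel_eq hv h, neg_mul]
    rfl
  have h3 : M.periodMat p z = M.η⁻¹ * Q z.1 := hPQ z.1
  rw [h1, h2, h3]
  calc _ = -((M.η⁻¹ * M.η) * M.res z.2 z.1 * M.mulBy α z.1 * M.muPlus * (M.η⁻¹ * Q z.1)) := by
        noncomm_ring
    _ = _ := by rw [η_inv_mul, one_mul]

/-- The Gram matrix is `(Q P Qᵀ)⁻¹`, where `Q` holds the differentials of the periods and `P` is the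
pencil, so the invertible factors `Q` cancel. This is what makes every contraction with `G^{αβ}`
independent of the basis. -/
theorem periodMat_gram (hv : z.1 ∈ M.domain)
    (hind : (Matrix.of fun α β : Fin n => pd β (fun w => p α w z.2) z.1).det ≠ 0) :
    M.periodMat p z * gram M p z.1 z.2 * (M.periodMat p z).transpose
      = M.res z.2 z.1 * M.η⁻¹ := by
  set Q := (Matrix.of fun α β : Fin n => pd β (fun w => p α w z.2) z.1) with hQ
  have h1 : M.periodMat p z = M.η⁻¹ * Q.transpose := by
    ext γ δ; simp [periodMat, grad, Matrix.mul_apply, hQ]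
  have h2 : gram M p z.1 z.2 = (Q * M.pencil z.2 z.1 * Q.transpose)⁻¹ := by
    rw [gram]
    congr 1
    ext α β
    simp only [Matrix.of_apply, Matrix.mul_apply, Finset.sum_mul, Matrix.transpose_apply, hQ]
    rw [Finset.sum_comm]
    exact Finset.sum_congr rfl fun _ _ => Finset.sum_congr rfl fun _ _ => by ring
  have hu : IsUnit Q.det := Ne.isUnit hind
  have hu' : IsUnit Q.transpose.det := by rwa [Matrix.det_transpose]
  have e1 : Q⁻¹ * Q = 1 := Matrix.nonsing_inv_mul _ hu
  have e2 : Q.transpose * Q.transpose⁻¹ = 1 := Matrix.mul_nonsing_inv _ hu'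
  rw [h1, h2, Matrix.mul_inv_rev, Matrix.mul_inv_rev, Matrix.transpose_mul, η_inv_symm,
    Matrix.transpose_transpose, ← pencilMetric, pencilMetric_eq hv]
  calc _ = M.η⁻¹ * (Q.transpose * Q.transpose⁻¹) * (M.η * M.res z.2 z.1) * (Q⁻¹ * Q) * M.η⁻¹ := by
        noncomm_ring
    _ = M.η⁻¹ * M.η * M.res z.2 z.1 * M.η⁻¹ := by rw [e1, e2]; noncomm_ring
    _ = _ := by rw [η_inv_mul, one_mul]

end GenFrobeniusManifold

/-! ### Canonical coordinates and the orthonormal frame of normalized idempotents -/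

namespace CanonicalChart

open GenFrobeniusManifold

variable {n : ℕ} {M : GenFrobeniusManifold n} (X : CanonicalChart M) {v : Vec n} {lam : ℂ}

theorem mem_domain (hv : v ∈ X.D) : v ∈ M.domain := X.D_subset hv

theorem jac_mul_invJac (hv : v ∈ X.D) : jac X.u v * invJac X.u v = 1 :=
  Matrix.mul_nonsing_inv _ (Ne.isUnit (X.jac_det v hv))

theorem invJac_mul_jac (hv : v ∈ X.D) : invJac X.u v * jac X.u v = 1 :=
  Matrix.nonsing_inv_mul _ (Ne.isUnit (X.jac_det v hv))

theorem jac_analytic (hv : v ∈ X.D) : MatAnalyticAt (jac X.u) v :=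
  fun i _ => analyticAt_fderiv_apply (X.u_analytic i v hv) _

theorem invJac_analytic (hv : v ∈ X.D) : MatAnalyticAt (invJac X.u) v :=
  (X.jac_analytic hv).inv (X.jac_det v hv)

/-- The fields `∂/∂u_i` are common eigenvectors of all multiplications, and `∂_α = ∑ (∂u_i/∂v^α)
∂/∂u_i`. -/
theorem mulBy_mul_invJac (hv : v ∈ X.D) (α : Fin n) :
    M.mulBy α v * invJac X.u v = invJac X.u v * Matrix.diagonal fun i => jac X.u v i α := by
  ext γ j
  have h1 : ∀ i, ∑ ε, invJac X.u v ε i * (M.mulBy ε v * invJac X.u v) γ j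
      = if i = j then invJac X.u v γ i else 0 := by
    intro i
    rw [← X.mul_canonical v hv i j γ]
    refine Finset.sum_congr rfl fun ε _ => ?_
    rw [Matrix.mul_apply, Finset.mul_sum]
    exact Finset.sum_congr rfl fun β _ => by simp [mulBy]; ring
  have h2 : ∑ i, jac X.u v i α * ∑ ε, invJac X.u v ε i * (M.mulBy ε v * invJac X.u v) γ j
      = (M.mulBy α v * invJac X.u v) γ j := by
    simp only [Finset.mul_sum]
    rw [Finset.sum_comm]
    have h3 : ∀ ε, ∑ i, jac X.u v i α * (invJac X.u v ε i * (M.mulBy ε v * invJac X.u v) γ j)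
        = (invJac X.u v * jac X.u v) ε α * (M.mulBy ε v * invJac X.u v) γ j := by
      intro ε
      rw [Matrix.mul_apply (M := invJac X.u v) (N := jac X.u v), Finset.sum_mul]
      exact Finset.sum_congr rfl fun _ _ => by ring
    simp [h3, X.invJac_mul_jac hv, Matrix.one_apply]
  rw [← h2]
  simp only [h1, Matrix.mul_diagonal]
  simp [mul_comm]

theorem mulBy_eq (hv : v ∈ X.D) (α : Fin n) :
    M.mulBy α v = invJac X.u v * (Matrix.diagonal fun i => jac X.u v i α) * jac X.u v := by
  rw [← X.mulBy_mul_invJac hv, mul_assoc, X.invJac_mul_jac hv, mul_one]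

theorem sum_smul_mulBy (hv : v ∈ X.D) (a : Vec n) :
    ∑ ε, a ε • M.mulBy ε v
      = invJac X.u v * (Matrix.diagonal ((jac X.u v).mulVec a)) * jac X.u v := by
  have : Matrix.diagonal ((jac X.u v).mulVec a)
      = ∑ ε, a ε • Matrix.diagonal fun i => jac X.u v i ε := by
    ext i j
    by_cases h : i = j
    · subst h; simp [Matrix.sum_apply, Matrix.mulVec, dotProduct, mul_comm]
    · simp [Matrix.sum_apply, h]
  rw [this, Finset.mul_sum, Finset.sum_mul]
  exact Finset.sum_congr rfl fun ε _ => by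
    rw [X.mulBy_eq hv, Matrix.mul_smul, Matrix.smul_mul]

theorem calU_eq (hv : v ∈ X.D) :
    M.calU v = invJac X.u v * (Matrix.diagonal fun i => X.u i v) * jac X.u v := by
  have hE : M.E v = (invJac X.u v).mulVec fun i => X.u i v := by
    ext γ; rw [X.euler_canonical v hv]; simp [Matrix.mulVec, dotProduct, mul_comm]
  rw [GenFrobeniusManifold.calU_eq, X.sum_smul_mulBy hv, hE, Matrix.mulVec_mulVec,
    X.jac_mul_invJac hv, Matrix.one_mulVec]

/-- The unit acts as the identity, and in the frame `∂/∂u_i` multiplication by `e` is diagonal with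
entries `du_i(e)`; hence all of them are `1`. -/
theorem e_eq (hv : v ∈ X.D) (γ : Fin n) : M.e γ v = ∑ i, invJac X.u v γ i := by
  have h1 : ∑ ε, M.e ε v • M.mulBy ε v = 1 := by
    ext γ β
    rw [Matrix.sum_apply, Matrix.one_apply]
    have := M.one_mul' v (X.mem_domain hv) β γ
    simp only [eq_comm (a := γ)]
    rw [← this]; rfl
  rw [X.sum_smul_mulBy hv (fun ε => M.e ε v)] at h1
  have h2 : Matrix.diagonal ((jac X.u v).mulVec fun ε => M.e ε v) = 1 := by
    calc _ = (jac X.u v * invJac X.u v) * Matrix.diagonal ((jac X.u v).mulVec fun ε => M.e ε v)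
          * (jac X.u v * invJac X.u v) := by rw [X.jac_mul_invJac hv, one_mul, mul_one]
      _ = jac X.u v * (invJac X.u v * Matrix.diagonal ((jac X.u v).mulVec fun ε => M.e ε v)
          * jac X.u v) * invJac X.u v := by noncomm_ring
      _ = 1 := by rw [h1, mul_one, X.jac_mul_invJac hv]
  have h3 : ((jac X.u v).mulVec fun ε => M.e ε v) = fun _ => 1 := by
    funext i
    have := congrFun (congrFun h2 i) i
    simpa using this
  have h4 : (fun ε => M.e ε v) = (invJac X.u v).mulVec fun _ => 1 := by
    rw [← h3, Matrix.mulVec_mulVec, X.invJac_mul_jac hv, Matrix.one_mulVec]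
  have := congrFun h4 γ
  simpa [Matrix.mulVec, dotProduct] using this

/-- In canonical coordinates the flat metric is diagonal. -/
theorem invJac_η_invJac (hv : v ∈ X.D) :
    (invJac X.u v).transpose * M.η * invJac X.u v
      = Matrix.diagonal fun i => lameSq M.η X.u i v := by
  set I := invJac X.u v
  set Q := I.transpose * M.η * I with hQ
  -- Self-adjointness of `C_α`, written in the basis of its eigenvectors.
  have hcomm : ∀ α, (Matrix.diagonal fun i => jac X.u v i α) * Q
      = Q * Matrix.diagonal fun i => jac X.u v i α := by
    intro α
    have h1 := X.mulBy_mul_invJac hv α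
    have h2 := congrArg Matrix.transpose h1
    rw [Matrix.transpose_mul, Matrix.transpose_mul, Matrix.diagonal_transpose] at h2
    calc _ = (Matrix.diagonal fun i => jac X.u v i α) * I.transpose * M.η * I := by
          rw [hQ]; noncomm_ring
      _ = I.transpose * ((M.mulBy α v).transpose * M.η) * I := by rw [← h2]; noncomm_ring
      _ = I.transpose * M.η * (M.mulBy α v * I) := by
          rw [← η_mulBy (X.mem_domain hv)]; noncomm_ring
      _ = _ := by rw [h1, hQ]; noncomm_ring
  ext i j
  by_cases hij : i = j
  · subst hij
    simp only [Matrix.diagonal_apply_eq, lameSq, hQ, Matrix.mul_apply, Matrix.transpose_apply,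
      Finset.sum_mul]
    rw [Finset.sum_comm]
    exact Finset.sum_congr rfl fun _ _ => Finset.sum_congr rfl fun _ _ => by ring
  · rw [Matrix.diagonal_apply_ne _ hij]
    have h1 : ∀ α, (jac X.u v i α - jac X.u v j α) * Q i j = 0 := by
      intro α
      have := congrFun (congrFun (hcomm α) i) j
      rw [Matrix.diagonal_mul, Matrix.mul_diagonal] at this
      linear_combination this
    -- The functionals `du_i` and `du_j` take the values `1` and `0` on `∂/∂u_i`, so some
    -- multiplication separates the two eigenlines and the entry `Q i j` has to vanish.
    have h2 : ∑ α, (jac X.u v i α - jac X.u v j α) * I α i = 1 := by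
      have e1 := congrFun (congrFun (X.jac_mul_invJac hv) i) i
      have e2 := congrFun (congrFun (X.jac_mul_invJac hv) j) i
      rw [Matrix.mul_apply] at e1 e2
      rw [Matrix.one_apply_eq] at e1
      rw [Matrix.one_apply_ne (Ne.symm hij)] at e2
      simp only [sub_mul, Finset.sum_sub_distrib]
      rw [e1, e2, sub_zero]
    calc Q i j = (∑ α, (jac X.u v i α - jac X.u v j α) * I α i) * Q i j := by rw [h2, one_mul]
      _ = ∑ α, I α i * ((jac X.u v i α - jac X.u v j α) * Q i j) := by
          rw [Finset.sum_mul]; exact Finset.sum_congr rfl fun _ _ => by ring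
      _ = 0 := by simp [h1]

theorem det_invJac_ne_zero (hv : v ∈ X.D) : (invJac X.u v).det ≠ 0 := by
  have h := congrArg Matrix.det (X.jac_mul_invJac hv)
  rw [Matrix.det_mul, Matrix.det_one] at h
  exact right_ne_zero_of_mul_eq_one h

/-- The product of the `h_i` is the determinant of the nondegenerate metric in the coordinates
`u_i`. -/
theorem sqrtH_ne_zero (hv : v ∈ X.D) (i : Fin n) : X.sqrtH i v ≠ 0 := by
  have h := congrArg Matrix.det (X.invJac_η_invJac hv)
  rw [Matrix.det_mul, Matrix.det_mul, Matrix.det_transpose, Matrix.det_diagonal] at h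
  have h2 : ∏ i, lameSq M.η X.u i v ≠ 0 := by
    rw [← h]
    exact mul_ne_zero (mul_ne_zero (X.det_invJac_ne_zero hv) M.η_det) (X.det_invJac_ne_zero hv)
  have h3 := (Finset.prod_ne_zero_iff.1 h2) i (Finset.mem_univ i)
  rw [← X.sqrtH_sq v hv] at h3
  exact fun h0 => h3 (by rw [h0]; ring)

theorem Ψ_eq (v : Vec n) : X.Ψ v = (Matrix.diagonal fun i => X.sqrtH i v) * jac X.u v := by
  ext i α; simp [Ψ, Matrix.diagonal_mul]

theorem Ψ_det (hv : v ∈ X.D) : (X.Ψ v).det ≠ 0 := by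
  rw [X.Ψ_eq, Matrix.det_mul, Matrix.det_diagonal]
  exact mul_ne_zero (Finset.prod_ne_zero_iff.2 fun i _ => X.sqrtH_ne_zero hv i) (X.jac_det v hv)

theorem Ψ_mul_inv (hv : v ∈ X.D) : X.Ψ v * (X.Ψ v)⁻¹ = 1 :=
  Matrix.mul_nonsing_inv _ (Ne.isUnit (X.Ψ_det hv))

theorem Ψ_inv_mul (hv : v ∈ X.D) : (X.Ψ v)⁻¹ * X.Ψ v = 1 :=
  Matrix.nonsing_inv_mul _ (Ne.isUnit (X.Ψ_det hv))

theorem Ψ_analytic (hv : v ∈ X.D) : MatAnalyticAt X.Ψ v :=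
  fun i α => (X.sqrtH_analytic i v hv).mul (X.jac_analytic hv i α)

theorem Ψ_transpose_mul (hv : v ∈ X.D) : (X.Ψ v).transpose * X.Ψ v = M.η := by
  have h := X.invJac_η_invJac hv
  have h1 : (Matrix.diagonal fun i => X.sqrtH i v) * (Matrix.diagonal fun i => X.sqrtH i v)
      = Matrix.diagonal fun i => lameSq M.η X.u i v := by
    rw [Matrix.diagonal_mul_diagonal]
    congr 1; funext i; rw [← X.sqrtH_sq v hv, sq]
  have h2 : (jac X.u v).transpose * (invJac X.u v).transpose = 1 := by
    rw [← Matrix.transpose_mul, X.invJac_mul_jac hv, Matrix.transpose_one]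
  rw [X.Ψ_eq, Matrix.transpose_mul, Matrix.diagonal_transpose]
  calc _ = (jac X.u v).transpose * ((Matrix.diagonal fun i => X.sqrtH i v) *
        (Matrix.diagonal fun i => X.sqrtH i v)) * jac X.u v := by noncomm_ring
    _ = ((jac X.u v).transpose * (invJac X.u v).transpose) * M.η *
        (invJac X.u v * jac X.u v) := by rw [h1, ← h]; noncomm_ring
    _ = _ := by rw [h2, X.invJac_mul_jac hv, one_mul, mul_one]

theorem Ψ_inv_eq (hv : v ∈ X.D) : (X.Ψ v)⁻¹ = M.η⁻¹ * (X.Ψ v).transpose := by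
  refine Matrix.inv_eq_left_inv ?_
  rw [mul_assoc, X.Ψ_transpose_mul hv, η_inv_mul]

theorem Ψ_mul_η_inv (hv : v ∈ X.D) : X.Ψ v * M.η⁻¹ * (X.Ψ v).transpose = 1 := by
  rw [mul_assoc, ← X.Ψ_inv_eq hv, X.Ψ_mul_inv hv]

theorem Ψ_inv_transpose (hv : v ∈ X.D) : (X.Ψ v)⁻¹.transpose = X.Ψ v * M.η⁻¹ := by
  rw [X.Ψ_inv_eq hv, Matrix.transpose_mul, Matrix.transpose_transpose, η_inv_symm]

theorem Ψ_inv_apply (hv : v ∈ X.D) (γ i : Fin n) :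
    (X.Ψ v)⁻¹ γ i = invJac X.u v γ i / X.sqrtH i v := by
  have h : (X.Ψ v)⁻¹ = invJac X.u v * Matrix.diagonal fun i => (X.sqrtH i v)⁻¹ := by
    refine Matrix.inv_eq_left_inv ?_
    rw [X.Ψ_eq]
    have : (Matrix.diagonal fun i => (X.sqrtH i v)⁻¹) * (Matrix.diagonal fun i => X.sqrtH i v)
        = 1 := by
      rw [Matrix.diagonal_mul_diagonal, ← Matrix.diagonal_one]
      congr 1; funext i; exact inv_mul_cancel₀ (X.sqrtH_ne_zero hv i)
    calc _ = invJac X.u v * ((Matrix.diagonal fun i => (X.sqrtH i v)⁻¹) *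
          (Matrix.diagonal fun i => X.sqrtH i v)) * jac X.u v := by noncomm_ring
      _ = 1 := by rw [this, mul_one, X.invJac_mul_jac hv]
  rw [h, Matrix.mul_diagonal, div_eq_mul_inv]

/-- The frame `Ψ` differs from the Jacobian by a diagonal factor, which commutes with diagonal
matrices. -/
theorem Ψ_conj_diagonal (hv : v ∈ X.D) (d : Fin n → ℂ) :
    (X.Ψ v)⁻¹ * Matrix.diagonal d * X.Ψ v = invJac X.u v * Matrix.diagonal d * jac X.u v := by
  have h : (X.Ψ v)⁻¹ * (Matrix.diagonal fun i => X.sqrtH i v) = invJac X.u v := by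
    ext γ i
    rw [Matrix.mul_diagonal, X.Ψ_inv_apply hv, div_mul_cancel₀ _ (X.sqrtH_ne_zero hv i)]
  rw [X.Ψ_eq, ← h, X.Ψ_eq]
  have hc : (Matrix.diagonal d) * (Matrix.diagonal fun i => X.sqrtH i v)
      = (Matrix.diagonal fun i => X.sqrtH i v) * (Matrix.diagonal d) := by
    rw [Matrix.diagonal_mul_diagonal, Matrix.diagonal_mul_diagonal]
    congr 1; funext i; exact mul_comm _ _
  set A := (Matrix.diagonal (fun i => X.sqrtH i v) * jac X.u v)⁻¹
  calc _ = A * (Matrix.diagonal d * (Matrix.diagonal fun i => X.sqrtH i v)) * jac X.u v := by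
        noncomm_ring
    _ = _ := by rw [hc]; noncomm_ring

theorem calU_eq_Ψ (hv : v ∈ X.D) :
    M.calU v = (X.Ψ v)⁻¹ * (Matrix.diagonal fun i => X.u i v) * X.Ψ v := by
  rw [X.Ψ_conj_diagonal hv, X.calU_eq hv]

theorem eulerSub_eq_Ψ (hv : v ∈ X.D) :
    M.eulerSub lam v = (X.Ψ v)⁻¹ * (Matrix.diagonal fun i => X.u i v - lam) * X.Ψ v := by
  have : (Matrix.diagonal fun i => X.u i v - lam)
      = (Matrix.diagonal fun i => X.u i v) - lam • (1 : Matrix (Fin n) (Fin n) ℂ) := by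
    rw [Matrix.smul_one_eq_diagonal, Matrix.diagonal_sub]
  rw [this, mul_sub, sub_mul, ← X.calU_eq_Ψ hv, Matrix.mul_smul, Matrix.smul_mul, mul_one,
    X.Ψ_inv_mul hv, eulerSub]

theorem det_eulerSub (hv : v ∈ X.D) : (M.eulerSub lam v).det = ∏ i, (X.u i v - lam) := by
  have h := congrArg Matrix.det (X.Ψ_inv_mul hv)
  rw [Matrix.det_mul, Matrix.det_one] at h
  rw [X.eulerSub_eq_Ψ hv, Matrix.det_mul, Matrix.det_mul, Matrix.det_diagonal]
  linear_combination (∏ i, (X.u i v - lam)) * h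

theorem det_eulerSub_ne_zero_iff (hv : v ∈ X.D) :
    (M.eulerSub lam v).det ≠ 0 ↔ ∀ i, lam ≠ X.u i v := by
  rw [X.det_eulerSub hv, Finset.prod_ne_zero_iff]
  simp only [Finset.mem_univ, true_imp_iff, sub_ne_zero]
  exact forall_congr' fun i => ne_comm

theorem res_eq_Ψ (hv : v ∈ X.D) (h : ∀ i, lam ≠ X.u i v) :
    M.res lam v = (X.Ψ v)⁻¹ * (Matrix.diagonal fun i => (X.u i v - lam)⁻¹) * X.Ψ v := by
  rw [res]
  refine Matrix.inv_eq_left_inv ?_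
  rw [X.eulerSub_eq_Ψ hv]
  have : (Matrix.diagonal fun i => (X.u i v - lam)⁻¹) * (Matrix.diagonal fun i => X.u i v - lam)
      = 1 := by
    rw [Matrix.diagonal_mul_diagonal, ← Matrix.diagonal_one]
    congr 1; funext i; exact inv_mul_cancel₀ (sub_ne_zero.2 (h i).symm)
  calc _ = (X.Ψ v)⁻¹ * (Matrix.diagonal fun i => (X.u i v - lam)⁻¹) * (X.Ψ v * (X.Ψ v)⁻¹)
        * (Matrix.diagonal fun i => X.u i v - lam) * X.Ψ v := by noncomm_ring
    _ = (X.Ψ v)⁻¹ * ((Matrix.diagonal fun i => (X.u i v - lam)⁻¹)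
        * (Matrix.diagonal fun i => X.u i v - lam)) * X.Ψ v := by
        rw [X.Ψ_mul_inv hv]; noncomm_ring
    _ = 1 := by rw [this, mul_one, X.Ψ_inv_mul hv]

theorem res_eq (hv : v ∈ X.D) (h : ∀ i, lam ≠ X.u i v) :
    M.res lam v = invJac X.u v * (Matrix.diagonal fun i => (X.u i v - lam)⁻¹) * jac X.u v := by
  rw [X.res_eq_Ψ hv h, X.Ψ_conj_diagonal hv]

/-- The rows of `Ψ` define an orthonormal frame, in which a skew-adjoint operator has a skew matrix.
-/
theorem V_transpose (hv : v ∈ X.D) : (X.V v).transpose = -X.V v := by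
  have h1 : M.η⁻¹ * M.μ.transpose = -(M.μ * M.η⁻¹) := by
    have h := η_μ (M := M)
    calc M.η⁻¹ * M.μ.transpose = M.η⁻¹ * (M.μ.transpose * M.η) * M.η⁻¹ := by
          rw [mul_assoc, mul_assoc, η_mul_inv, mul_one]
      _ = M.η⁻¹ * -(M.η * M.μ) * M.η⁻¹ := by rw [h, neg_neg]
      _ = -((M.η⁻¹ * M.η) * M.μ * M.η⁻¹) := by noncomm_ring
      _ = _ := by rw [η_inv_mul, one_mul]
  rw [V, Matrix.transpose_mul, Matrix.transpose_mul, X.Ψ_inv_transpose hv, X.Ψ_inv_eq hv]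
  calc _ = X.Ψ v * (M.η⁻¹ * M.μ.transpose) * (X.Ψ v).transpose := by noncomm_ring
    _ = _ := by rw [h1]; noncomm_ring

theorem V_symm (hv : v ∈ X.D) (i j : Fin n) : X.V v j i = -X.V v i j := by
  have := congrFun (congrFun (X.V_transpose hv) i) j
  simpa using this

theorem V_diag (hv : v ∈ X.D) (i : Fin n) : X.V v i i = 0 := by
  have := X.V_symm hv i i
  exact self_eq_neg.1 this

theorem invEulerSub_eq (hv : v ∈ X.D) (h : ∀ i, lam ≠ X.u i v) (γ : Fin n) :
    M.invEulerSub lam γ v = ∑ i, invJac X.u v γ i * (X.u i v - lam)⁻¹ := by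
  have he : (fun α => M.e α v) = (invJac X.u v).mulVec fun _ => 1 := by
    funext γ; rw [X.e_eq hv]; simp [Matrix.mulVec, dotProduct]
  have h1 : M.invEulerSub lam γ v = (M.res lam v).mulVec (fun α => M.e α v) γ := rfl
  rw [h1, X.res_eq hv h, he, Matrix.mulVec_mulVec, mul_assoc, X.jac_mul_invJac hv, mul_one]
  simp [Matrix.mulVec, dotProduct, Matrix.mul_diagonal]

end CanonicalChart

section MatrixCalculus

variable {E E' : Type*} [NormedAddCommGroup E] [NormedSpace ℂ E] [NormedAddCommGroup E']
  [NormedSpace ℂ E'] {m n : Type*}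

theorem matDeriv_comp {F : E' → Matrix m n ℂ} {f : E → E'} {z : E}
    (hF : MatAnalyticAt F (f z)) (hf : DifferentiableAt ℂ f z) (a : E) :
    matDeriv a (fun w => F (f w)) z = matDeriv (fderiv ℂ f z a) F (f z) := by
  ext i j
  have h := fderiv_comp z (hF i j).differentiableAt hf
  have h' : fderiv ℂ (fun w => F (f w) i j) z = _ := h
  rw [matDeriv_apply, matDeriv_apply, h']
  rfl

theorem matDeriv_smul_dir (c : ℂ) (a : E) (F : E → Matrix m n ℂ) (z : E) :
    matDeriv (c • a) F z = c • matDeriv a F z := by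
  ext i j; simp [matDeriv]

theorem matDeriv_sum_dir {ι : Type*} (s : Finset ι) (a : ι → E) (F : E → Matrix m n ℂ) (z : E) :
    matDeriv (∑ x ∈ s, a x) F z = ∑ x ∈ s, matDeriv (a x) F z := by
  ext i j; simp [matDeriv, Matrix.sum_apply, map_sum]

end MatrixCalculus

/-! ### The curve with a given jet -/

section Curve

variable {N n : ℕ} (j : Jet N n)

/-- The polynomial curve with jet `j` at `0`. -/
def jetCurve (x : ℂ) : Vec n := ∑ s : Fin (N + 1), (x ^ (s : ℕ) / ((s : ℕ).factorial : ℂ)) • j s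

/-- The velocity of the curve with jet `j`. -/
def jetVel (x : ℂ) : Vec n := deriv (jetCurve j) x

theorem jetCurve_analytic (x : ℂ) : AnalyticAt ℂ (jetCurve j) x := by
  refine Finset.analyticAt_fun_sum _ fun s _ => AnalyticAt.fun_smul ?_ analyticAt_const
  exact (analyticAt_id.pow _).div_const

theorem jetVel_analytic (x : ℂ) : AnalyticAt ℂ (jetVel j) x := (jetCurve_analytic j x).deriv

theorem jetCurve_zero : jetCurve j 0 = j 0 := by
  rw [jetCurve, Finset.sum_eq_single 0]
  · simp
  · intro s _ hs
    have : (s : ℕ) ≠ 0 := fun h => hs (Fin.ext h)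
    simp [this]
  · simp

theorem jetVel_zero (hN : 1 ≤ N) : jetVel j 0 = j ⟨1, by omega⟩ := by
  have h : HasDerivAt (jetCurve j) (∑ s : Fin (N + 1),
      (((s : ℕ) * (0 : ℂ) ^ ((s : ℕ) - 1)) / ((s : ℕ).factorial : ℂ)) • j s) 0 := by
    refine HasDerivAt.fun_sum fun s _ => ?_
    exact ((hasDerivAt_pow (s : ℕ) (0 : ℂ)).div_const _).smul_const (j s)
  rw [jetVel, h.deriv, Finset.sum_eq_single ⟨1, by omega⟩]
  · simp
  · intro s _ hs
    have h1 : (s : ℕ) ≠ 1 := fun h => hs (Fin.ext h)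
    rcases Nat.eq_zero_or_pos (s : ℕ) with h0 | h0
    · simp [h0]
    · have : (s : ℕ) - 1 ≠ 0 := by omega
      simp [this]
  · simp

theorem totalDeriv_eq (m : ℕ) (g : Vec n → ℂ) :
    totalDeriv m g j = iteratedDeriv m (fun x => g (jetCurve j x)) 0 := rfl

/-- The map `(x, λ) ↦ (v(x), λ)`. -/
def jetLift (y : ℂ × ℂ) : Vec n × ℂ := (jetCurve j y.1, y.2)

theorem jetLift_analytic (y : ℂ × ℂ) : AnalyticAt ℂ (jetLift j) y :=
  ((jetCurve_analytic j y.1).fun_comp analyticAt_fst).prod analyticAt_snd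

theorem fderiv_jetLift (y a : ℂ × ℂ) :
    fderiv ℂ (jetLift j) y a = (a.1 • jetVel j y.1, a.2) := by
  have h1 : HasDerivAt (jetCurve j) (jetVel j y.1) y.1 :=
    (jetCurve_analytic j y.1).differentiableAt.hasDerivAt
  have h2 : HasFDerivAt (fun y : ℂ × ℂ => jetCurve j y.1) _ y :=
    h1.hasFDerivAt.comp y (hasFDerivAt_fst (𝕜 := ℂ) (E := ℂ) (F := ℂ) (p := y))
  have h3 : HasFDerivAt (jetLift j) _ y :=
    h2.prodMk (hasFDerivAt_snd (𝕜 := ℂ) (E := ℂ) (F := ℂ) (p := y))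
  rw [h3.fderiv]
  simp

end Curve

/-! ### Jets of the periods along a curve, and elimination of the periods from `K^{γ,s}` -/

namespace CanonicalChart

open GenFrobeniusManifold

variable {n N : ℕ} {M : GenFrobeniusManifold n} (X : CanonicalChart M) (j : Jet N n)

/-- The pairs `(x, λ)` with `v(x) ∈ D` and `λ ≠ u_i(v(x))`. -/
def regularSet : Set (ℂ × ℂ) := {y | jetCurve j y.1 ∈ X.D ∧ ∀ i, y.2 ≠ X.u i (jetCurve j y.1)}

variable (M)

/-- Multiplication by the velocity of the curve. -/
def velMul (x : ℂ) : Matrix (Fin n) (Fin n) ℂ := ∑ α, jetVel j x α • M.mulBy α (jetCurve j x)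

/-- The resolvent along the curve. -/
def curveRes (y : ℂ × ℂ) : Matrix (Fin n) (Fin n) ℂ := M.res y.2 (jetCurve j y.1)

/-- The connection matrix along the curve: `∂_x∇p = -(𝒰 - λ)⁻¹ v_x (μ + ½) ∇p`. -/
def curveConn (y : ℂ × ℂ) : Matrix (Fin n) (Fin n) ℂ :=
  -(curveRes M j y * velMul M j y.1 * M.muPlus)

/-- The matrices with `∂_x^m ∇p = Q_m ∇p`. -/
def gradJet : ℕ → ℂ × ℂ → Matrix (Fin n) (Fin n) ℂ
  | 0 => fun _ => 1
  | m + 1 => fun y => matDeriv (1, 0) (gradJet m) y + gradJet m y * curveConn M j y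

/-- The row vectors with `∂_x^{k+1} p = ℓ_k ∇p`. -/
def rowJet : ℕ → ℂ × ℂ → Matrix Unit (Fin n) ℂ
  | 0 => fun y => Matrix.of fun _ γ => ∑ δ, jetVel j y.1 δ * M.η δ γ
  | k + 1 => fun y => matDeriv (1, 0) (rowJet k) y + rowJet k y * curveConn M j y

/-- The row vectors with `∂_λ ∂_x^{k+1} p = ℓ ∇p`. -/
def rowJetDeriv (k : ℕ) (y : ℂ × ℂ) : Matrix Unit (Fin n) ℂ :=
  matDeriv (0, 1) (rowJet M j k) y + rowJet M j k y * (curveRes M j y * M.muPlus)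

variable {M}

theorem eventually_mem_regularSet {y : ℂ × ℂ} (hy : y ∈ X.regularSet j) :
    ∀ᶠ z in 𝓝 y, z ∈ X.regularSet j := by
  have hc : ContinuousAt (fun z : ℂ × ℂ => jetCurve j z.1) y :=
    ((jetCurve_analytic j y.1).fun_comp analyticAt_fst).continuousAt
  have h1 : ∀ᶠ z in 𝓝 y, jetCurve j z.1 ∈ X.D := hc.eventually (X.isOpen_D.eventually_mem hy.1)
  have h2 : ∀ᶠ z in 𝓝 y, ∀ i, z.2 ≠ X.u i (jetCurve j z.1) := by
    refine eventually_all.2 fun i => ?_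
    have hu : ContinuousAt (fun z : ℂ × ℂ => X.u i (jetCurve j z.1)) y :=
      ContinuousAt.comp (f := fun z : ℂ × ℂ => jetCurve j z.1)
        (X.u_analytic i _ hy.1).continuousAt hc
    exact (ContinuousAt.ne_iff_eventually_ne continuousAt_snd hu).1 (hy.2 i)
  exact h1.and h2

theorem velMul_analytic {x : ℂ} (hx : jetCurve j x ∈ X.D) : MatAnalyticAt (velMul M j) x := by
  refine MatAnalyticAt.sum _ fun α _ => MatAnalyticAt.smul ?_ ?_
  · exact ((ContinuousLinearMap.proj (R := ℂ) (φ := fun _ : Fin n => ℂ) α).analyticAt _).fun_comp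
      (jetVel_analytic j x)
  · exact (mulBy_analytic (X.D_subset hx) α).comp (jetCurve_analytic j x)

variable {j} {y : ℂ × ℂ}

theorem det_eulerSub_ne_zero_of_mem (hy : y ∈ X.regularSet j) :
    (M.eulerSub y.2 (jetCurve j y.1)).det ≠ 0 :=
  (X.det_eulerSub_ne_zero_iff hy.1).2 hy.2

theorem curveRes_analytic (hy : y ∈ X.regularSet j) : MatAnalyticAt (curveRes M j) y := by
  have h := res_analytic₂ (M := M) (v := jetCurve j y.1) (lam := y.2) (X.D_subset hy.1)
    (X.det_eulerSub_ne_zero_of_mem hy)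
  exact MatAnalyticAt.comp (f := jetLift j) h (jetLift_analytic j y)

theorem curveConn_analytic (hy : y ∈ X.regularSet j) : MatAnalyticAt (curveConn M j) y :=
  (((X.curveRes_analytic hy).mul (MatAnalyticAt.comp (f := Prod.fst) (X.velMul_analytic j hy.1) analyticAt_fst)).mul
    (matAnalyticAt_const _ _)).neg

theorem gradJet_analytic (m : ℕ) (hy : y ∈ X.regularSet j) : MatAnalyticAt (gradJet M j m) y := by
  induction m with
  | zero => exact matAnalyticAt_const _ _
  | succ m ih => exact (ih.matDeriv _).add (ih.mul (X.curveConn_analytic hy))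

theorem rowJet_analytic (k : ℕ) (hy : y ∈ X.regularSet j) : MatAnalyticAt (rowJet M j k) y := by
  induction k with
  | zero =>
    intro _ γ
    change AnalyticAt ℂ (fun w : ℂ × ℂ => ∑ δ, jetVel j w.1 δ * M.η δ γ) y
    refine Finset.analyticAt_fun_sum _ fun δ _ => AnalyticAt.mul ?_ analyticAt_const
    have h : AnalyticAt ℂ (fun z : ℂ × ℂ => jetVel j z.1) y :=
      (jetVel_analytic j y.1).fun_comp analyticAt_fst
    exact ((ContinuousLinearMap.proj (R := ℂ) (φ := fun _ : Fin n => ℂ) δ).analyticAt _).fun_comp h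
  | succ k ih => exact (ih.matDeriv _).add (ih.mul (X.curveConn_analytic hy))

theorem rowJetDeriv_analytic (k : ℕ) (hy : y ∈ X.regularSet j) :
    MatAnalyticAt (rowJetDeriv M j k) y :=
  ((X.rowJet_analytic k hy).matDeriv _).add ((X.rowJet_analytic k hy).mul
    ((X.curveRes_analytic hy).mul (matAnalyticAt_const _ _)))

section Periods

variable {X} {W : Set (Vec n × ℂ)} {p : Fin n → Vec n → ℂ → ℂ} (hp : X.IsPeriodBasis W p)
include hp

theorem IsPeriodBasis.mem_D {z : Vec n × ℂ} (hz : z ∈ W) : z.1 ∈ X.D := (hp.subset z.1 z.2 hz).1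

theorem IsPeriodBasis.det_ne_zero {z : Vec n × ℂ} (hz : z ∈ W) :
    (M.eulerSub z.2 z.1).det ≠ 0 :=
  (GenFrobeniusManifold.det_eulerSub_ne_zero_iff (X.D_subset (hp.mem_D hz))).1
    (hp.subset z.1 z.2 hz).2

theorem IsPeriodBasis.ne_u {z : Vec n × ℂ} (hz : z ∈ W) (i : Fin n) : z.2 ≠ X.u i z.1 :=
  (X.det_eulerSub_ne_zero_iff (hp.mem_D hz)).1 (hp.det_ne_zero hz) i

theorem IsPeriodBasis.mem_regularSet (hy : jetLift j y ∈ W) : y ∈ X.regularSet j :=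
  ⟨hp.mem_D hy, fun i => hp.ne_u hy i⟩

theorem IsPeriodBasis.eventually_mem (hy : jetLift j y ∈ W) : ∀ᶠ z in 𝓝 y, jetLift j z ∈ W :=
  (jetLift_analytic j y).continuousAt.eventually (hp.isOpen.eventually_mem hy)

theorem IsPeriodBasis.periodMat_analyticAt {z : Vec n × ℂ} (hz : z ∈ W) :
    MatAnalyticAt (M.periodMat p) z :=
  GenFrobeniusManifold.periodMat_analyticAt fun α => (hp.period α).analytic z hz

theorem IsPeriodBasis.curve_analytic (hy : jetLift j y ∈ W) :
    MatAnalyticAt (fun z => M.periodMat p (jetLift j z)) y :=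
  (hp.periodMat_analyticAt hy).comp (jetLift_analytic j y)

theorem IsPeriodBasis.matDeriv_curve_left (hy : jetLift j y ∈ W) :
    matDeriv (1, 0) (fun z => M.periodMat p (jetLift j z)) y
      = curveConn M j y * M.periodMat p (jetLift j y) := by
  rw [matDeriv_comp (hp.periodMat_analyticAt hy) (jetLift_analytic j y).differentiableAt,
    fderiv_jetLift]
  have h1 : (((1 : ℂ) • jetVel j y.1, (0 : ℂ)) : Vec n × ℂ)
      = ∑ α, jetVel j y.1 α • ((Pi.single α 1, 0) : Vec n × ℂ) := by
    rw [one_smul]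
    refine Prod.ext ?_ ?_
    · rw [Prod.fst_sum]
      conv_lhs => rw [pi_eq_sum_univ' (jetVel j y.1)]
      rfl
    · rw [Prod.snd_sum]; simp
  rw [h1, matDeriv_sum_dir]
  simp only [matDeriv_smul_dir]
  have h2 : ∀ α, matDeriv (Pi.single α 1, 0) (M.periodMat p) (jetLift j y)
      = -(curveRes M j y * M.mulBy α (jetCurve j y.1) * M.muPlus
          * M.periodMat p (jetLift j y)) := fun α =>
    matDeriv_periodMat_left (z := jetLift j y) hp.period hy (X.D_subset (hp.mem_D hy))
      (hp.det_ne_zero hy) α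
  simp only [h2, curveConn, velMul, Finset.mul_sum, Finset.sum_mul, smul_neg,
    Finset.sum_neg_distrib, neg_mul, Matrix.mul_smul, Matrix.smul_mul]

theorem IsPeriodBasis.matDeriv_curve_right (hy : jetLift j y ∈ W) :
    matDeriv (0, 1) (fun z => M.periodMat p (jetLift j z)) y
      = curveRes M j y * M.muPlus * M.periodMat p (jetLift j y) := by
  rw [matDeriv_comp (hp.periodMat_analyticAt hy) (jetLift_analytic j y).differentiableAt,
    fderiv_jetLift, zero_smul]
  exact matDeriv_periodMat_right (z := jetLift j y) hp.period hy (hp.det_ne_zero hy)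

theorem IsPeriodBasis.iteratedDeriv_grad (m : ℕ) (γ α : Fin n) {x l : ℂ}
    (hy : jetLift j (x, l) ∈ W) :
    iteratedDeriv m (fun x => M.grad (fun w => p α w l) γ (jetCurve j x)) x
      = (gradJet M j m (x, l) * M.periodMat p (jetLift j (x, l))) γ α := by
  induction m generalizing x with
  | zero => simp [gradJet, periodMat, jetLift]
  | succ m ih =>
    have h1 : ∀ᶠ x' in 𝓝 x, jetLift j (x', l) ∈ W :=
      (Continuous.prodMk_left l).continuousAt.eventually (hp.eventually_mem hy)
    have h2 := h1.mono fun x' hx' => ih hx'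
    have han := (X.gradJet_analytic m (hp.mem_regularSet hy)).mul (hp.curve_analytic hy)
    rw [iteratedDeriv_succ, Filter.EventuallyEq.deriv_eq h2, ← fderiv_apply_one_eq_deriv,
      fderiv_slice_left (f := fun z => (gradJet M j m z * M.periodMat p (jetLift j z)) γ α)
        (han γ α).differentiableAt, ← matDeriv_apply (F := fun z =>
          gradJet M j m z * M.periodMat p (jetLift j z)),
      matDeriv_mul _ (X.gradJet_analytic m (hp.mem_regularSet hy)) (hp.curve_analytic hy),
      hp.matDeriv_curve_left hy, ← mul_assoc, ← add_mul]
    rfl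

theorem IsPeriodBasis.iteratedDeriv_period (k : ℕ) (β : Fin n) {x l : ℂ}
    (hy : jetLift j (x, l) ∈ W) :
    iteratedDeriv (k + 1) (fun x => p β (jetCurve j x) l) x
      = (rowJet M j k (x, l) * M.periodMat p (jetLift j (x, l))) () β := by
  induction k generalizing x with
  | zero =>
    have hP : AnalyticAt ℂ (fun w => p β w l) (jetCurve j x) :=
      analyticAt_slice_left (f := fun z : Vec n × ℂ => p β z.1 z.2) ((hp.period β).analytic _ hy)
    have h1 : HasDerivAt (fun x => p β (jetCurve j x) l)
        (fderiv ℂ (fun w => p β w l) (jetCurve j x) (jetVel j x)) x :=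
      hP.differentiableAt.hasFDerivAt.comp_hasDerivAt x
        (jetCurve_analytic j x).differentiableAt.hasDerivAt
    rw [zero_add, iteratedDeriv_one, h1.deriv, fderiv_eq_sum_pd]
    have e1 : rowJet M j 0 (x, l) = (Matrix.of fun (_ : Unit) δ => jetVel j x δ) * M.η := by
      ext; simp [rowJet, Matrix.mul_apply]
    have e2 : M.periodMat p (jetLift j (x, l))
        = M.η⁻¹ * Matrix.of fun δ β => pd δ (fun w => p β w l) (jetCurve j x) := by
      ext; simp [periodMat, grad, Matrix.mul_apply, jetLift]
    rw [e1, e2, Matrix.mul_assoc, ← Matrix.mul_assoc M.η, η_mul_inv, Matrix.one_mul,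
      Matrix.mul_apply]
    rfl
  | succ k ih =>
    have h1 : ∀ᶠ x' in 𝓝 x, jetLift j (x', l) ∈ W :=
      (Continuous.prodMk_left l).continuousAt.eventually (hp.eventually_mem hy)
    have h2 := h1.mono fun x' hx' => ih hx'
    have han := (X.rowJet_analytic k (hp.mem_regularSet hy)).mul (hp.curve_analytic hy)
    rw [iteratedDeriv_succ, Filter.EventuallyEq.deriv_eq h2, ← fderiv_apply_one_eq_deriv,
      fderiv_slice_left (f := fun z => (rowJet M j k z * M.periodMat p (jetLift j z)) () β)
        (han () β).differentiableAt, ← matDeriv_apply (F := fun z =>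
          rowJet M j k z * M.periodMat p (jetLift j z)),
      matDeriv_mul _ (X.rowJet_analytic k (hp.mem_regularSet hy)) (hp.curve_analytic hy),
      hp.matDeriv_curve_left hy, ← Matrix.mul_assoc, ← Matrix.add_mul]
    rfl

theorem IsPeriodBasis.deriv_iteratedDeriv_period (k : ℕ) (β : Fin n) {x l : ℂ}
    (hy : jetLift j (x, l) ∈ W) :
    deriv (fun l => iteratedDeriv (k + 1) (fun x => p β (jetCurve j x) l) x) l
      = (rowJetDeriv M j k (x, l) * M.periodMat p (jetLift j (x, l))) () β := by
  have h1 : ∀ᶠ l' in 𝓝 l, jetLift j (x, l') ∈ W :=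
    (Continuous.prodMk_right x).continuousAt.eventually (hp.eventually_mem hy)
  have h2 := h1.mono fun l' hl' => hp.iteratedDeriv_period k β hl'
  have han := (X.rowJet_analytic k (hp.mem_regularSet hy)).mul (hp.curve_analytic hy)
  rw [Filter.EventuallyEq.deriv_eq h2,
    deriv_slice_right (f := fun z => (rowJet M j k z * M.periodMat p (jetLift j z)) () β)
      (han () β).differentiableAt, ← matDeriv_apply (F := fun z =>
        rowJet M j k z * M.periodMat p (jetLift j z)),
    matDeriv_mul _ (X.rowJet_analytic k (hp.mem_regularSet hy)) (hp.curve_analytic hy),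
    hp.matDeriv_curve_right hy, ← Matrix.mul_assoc, ← Matrix.add_mul]
  rfl

end Periods

variable (j)

/-- The functions `K^{γ,s}` in terms of the structure constants only. -/
def curveK (γ : Fin n) (s : ℕ) (lam : ℂ) : ℂ :=
  ((s : ℂ) + 1) * iteratedDeriv s (fun x => ∑ i, invJac X.u (jetCurve j x) γ i
      * (X.u i (jetCurve j x) - lam)⁻¹) 0
    + ∑ k ∈ Finset.Icc 1 s, (k : ℂ) * ((s + 1).choose (k + 1) : ℂ) *
      (gradJet M j (s - k) (0, lam) * (curveRes M j (0, lam) * M.η⁻¹)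
        * (rowJetDeriv M j (k - 1) (0, lam)).transpose) γ ()

variable {X} {j}

/-- Along the curve all jets involved are known matrices times `Φ`, so the periods enter only
through `Φ G Φᵀ = L η⁻¹`. -/
theorem IsPeriodBasis.K_eq {W : Set (Vec n × ℂ)} {p : Fin n → Vec n → ℂ → ℂ}
    (hp : X.IsPeriodBasis W p) {lam : ℂ} (hW : (j 0, lam) ∈ W) (γ : Fin n) (s : ℕ) :
    K M p γ s j lam = X.curveK j γ s lam := by
  have hy : jetLift j (0, lam) ∈ W := by rwa [jetLift, jetCurve_zero]
  rw [K, curveK]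
  congr 1
  · congr 1
    rw [totalDeriv_eq]
    refine Filter.EventuallyEq.iteratedDeriv_eq s ?_
    have h1 : ∀ᶠ x' in 𝓝 (0 : ℂ), jetLift j (x', lam) ∈ W :=
      (Continuous.prodMk_left lam).continuousAt.eventually (hp.eventually_mem hy)
    exact h1.mono fun x hx => X.invEulerSub_eq (hp.mem_D hx) (fun i => hp.ne_u hx i) γ
  · refine Finset.sum_congr rfl fun k hk => ?_
    congr 1
    -- As `k ≥ 1`, only derivatives of `p_β` of positive order in `x` occur. These are linear in
    -- `∇p_β`, unlike `p_β` itself.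
    obtain ⟨k, rfl⟩ : ∃ k', k = k' + 1 := ⟨k - 1, by have := Finset.mem_Icc.1 hk; omega⟩
    rw [Nat.add_sub_cancel]
    have hg := periodMat_gram (M := M) (p := p) (z := jetLift j (0, lam))
      (X.D_subset (hp.mem_D hy)) (hp.independent _ _ hy)
    have hg' : gram M p (jetLift j (0, lam)).1 (jetLift j (0, lam)).2 = gram M p (j 0) lam := by
      simp [jetLift, jetCurve_zero]
    have hr : M.res (jetLift j (0, lam)).2 (jetLift j (0, lam)).1 = curveRes M j (0, lam) := rfl
    rw [hg', hr] at hg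
    rw [← hg]
    set Φ := M.periodMat p (jetLift j (0, lam))
    have h3 : gradJet M j (s - (k + 1)) (0, lam) * (Φ * gram M p (j 0) lam * Φ.transpose)
        * (rowJetDeriv M j k (0, lam)).transpose
        = (gradJet M j (s - (k + 1)) (0, lam) * Φ) * gram M p (j 0) lam
          * (rowJetDeriv M j k (0, lam) * Φ).transpose := by
      rw [Matrix.transpose_mul]; simp only [Matrix.mul_assoc]
    rw [h3, Matrix.mul_apply, Finset.sum_comm]
    refine Finset.sum_congr rfl fun β _ => ?_
    rw [Matrix.mul_apply, Finset.sum_mul]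
    refine Finset.sum_congr rfl fun α _ => ?_
    rw [Matrix.transpose_apply]
    congr 1
    · congr 1
      exact hp.iteratedDeriv_grad _ γ α hy
    · exact hp.deriv_iteratedDeriv_period k β hy

end CanonicalChart

/-! ### Contraction of the loop operator with the differentials of `u_i`, `√h_i` and `u_{i,x}` -/

namespace CanonicalChart

open GenFrobeniusManifold

variable {n N : ℕ} {M : GenFrobeniusManifold n} (X : CanonicalChart M) {v : Vec n} {lam : ℂ}

/-- The diagonal entries `1/(u_i - λ)` of the resolvent. -/
def poleFn (v : Vec n) (lam : ℂ) (i : Fin n) : ℂ := (X.u i v - lam)⁻¹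

/-- The vector field `1/(E - λe) = ∑ (u_i - λ)⁻¹ ∂/∂u_i`. -/
def poleVec (v : Vec n) (lam : ℂ) : Vec n := (invJac X.u v).mulVec (X.poleFn v lam)

theorem jac_mulVec (v a : Vec n) : (jac X.u v).mulVec a = fun i => fderiv ℂ (X.u i) v a := by
  funext i
  rw [fderiv_eq_sum_pd]
  simp [Matrix.mulVec, dotProduct, jac, mul_comm]

theorem fderiv_u_poleVec (hv : v ∈ X.D) (i : Fin n) :
    fderiv ℂ (X.u i) v (X.poleVec v lam) = X.poleFn v lam i := by
  have := congrFun (X.jac_mulVec v (X.poleVec v lam)) i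
  rw [← this, poleVec, Matrix.mulVec_mulVec, X.jac_mul_invJac hv, Matrix.one_mulVec]

/-- The rotation matrix `∂_a Ψ · Ψ⁻¹`. -/
def rot (v a : Vec n) : Matrix (Fin n) (Fin n) ℂ := matDeriv a X.Ψ v * (X.Ψ v)⁻¹

theorem matDeriv_Ψ (hv : v ∈ X.D) (a : Vec n) : matDeriv a X.Ψ v = X.rot v a * X.Ψ v := by
  rw [rot, mul_assoc, X.Ψ_inv_mul hv, mul_one]

theorem matDeriv_calU (hv : v ∈ M.domain) (a : Vec n) :
    matDeriv a M.calU v = ∑ α, a α • M.mulBy α v + (∑ α, a α • M.mulBy α v) * M.μ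
      - M.μ * ∑ α, a α • M.mulBy α v := by
  have h : a = ∑ α, a α • (Pi.single α 1 : Vec n) := pi_eq_sum_univ' a
  conv_lhs => rw [h]
  rw [matDeriv_sum_dir]
  simp only [matDeriv_smul_dir]
  have h2 : ∀ α, matDeriv (Pi.single α 1) M.calU v = _ := fun α => mpd_calU hv α
  simp only [h2, smul_add, smul_sub, Finset.sum_add_distrib, Finset.sum_sub_distrib,
    Finset.sum_mul, Finset.mul_sum, Matrix.smul_mul, Matrix.mul_smul]

/-- The derivative of the orthogonality relation `Ψ η⁻¹ Ψᵀ = 1`. -/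
theorem rot_transpose (hv : v ∈ X.D) (a : Vec n) : (X.rot v a).transpose = -X.rot v a := by
  have h1 : (fun w => X.Ψ w * M.η⁻¹ * (X.Ψ w).transpose) =ᶠ[𝓝 v] fun _ => 1 :=
    (X.isOpen_D.eventually_mem hv).mono fun w hw => X.Ψ_mul_η_inv hw
  have h2 := matDeriv_congr a h1
  have hΨ := X.Ψ_analytic hv
  rw [matDeriv_const, matDeriv_mul a (hΨ.mul (matAnalyticAt_const _ _)) hΨ.transpose,
    matDeriv_mul_const a _ hΨ, matDeriv_transpose, X.matDeriv_Ψ hv, Matrix.transpose_mul] at h2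
  have h3 : X.rot v a * (X.Ψ v * M.η⁻¹ * (X.Ψ v).transpose)
      + (X.Ψ v * M.η⁻¹ * (X.Ψ v).transpose) * (X.rot v a).transpose = 0 := by
    rw [← h2]; noncomm_ring
  rw [X.Ψ_mul_η_inv hv, one_mul, mul_one] at h3
  exact (neg_eq_of_add_eq_zero_right h3).symm

/-- Differentiating `Ψ 𝒰 = diag(u) Ψ` gives `[rot, diag u] = [V, diag du(a)]`, which determines the
off-diagonal entries of the rotation matrix. -/
theorem rot_commutator (hv : v ∈ X.D) (a : Vec n) (i j : Fin n) :
    X.rot v a i j * (X.u i v - X.u j v)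
      = (fderiv ℂ (X.u i) v a - fderiv ℂ (X.u j) v a) * X.V v i j := by
  set u := Matrix.diagonal fun i => X.u i v with hu
  set d := Matrix.diagonal fun i => fderiv ℂ (X.u i) v a with hd
  have h1 : (fun w => X.Ψ w * M.calU w) =ᶠ[𝓝 v]
      fun w => (Matrix.diagonal fun i => X.u i w) * X.Ψ w := by
    refine (X.isOpen_D.eventually_mem hv).mono fun w hw => ?_
    change X.Ψ w * M.calU w = _
    rw [X.calU_eq_Ψ hw, mul_assoc, ← mul_assoc (X.Ψ w), X.Ψ_mul_inv hw, one_mul]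
  have hdan : MatAnalyticAt (fun w => Matrix.diagonal fun i => X.u i w) v := by
    intro i j
    by_cases h : i = j
    · subst h; simpa using X.u_analytic i v hv
    · simpa [h] using analyticAt_const
  have hdd : matDeriv a (fun w => Matrix.diagonal fun i => X.u i w) v = d := by
    ext i j
    rw [matDeriv_apply]
    by_cases h : i = j
    · subst h; simp [hd]
    · simp [h, hd]
  have hΨ := X.Ψ_analytic hv
  have h2 := matDeriv_congr a h1
  have hC : ∑ α, a α • M.mulBy α v = (X.Ψ v)⁻¹ * d * X.Ψ v := by
    rw [X.sum_smul_mulBy hv, X.jac_mulVec, X.Ψ_conj_diagonal hv]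
  rw [matDeriv_mul a hΨ (calU_analytic (X.D_subset hv)), matDeriv_mul a hdan hΨ, hdd,
    matDeriv_calU (X.D_subset hv), X.matDeriv_Ψ hv, hC, X.calU_eq_Ψ hv, ← hu] at h2
  have h3 := congrArg (· * (X.Ψ v)⁻¹) h2
  have e1 := X.Ψ_mul_inv hv
  have h4 : X.rot v a * u + d * X.V v - X.V v * d = u * X.rot v a := by
    set P := X.Ψ v
    have e : (X.rot v a * P * (P⁻¹ * u * P) + P * (P⁻¹ * d * P + P⁻¹ * d * P * M.μ
        - M.μ * (P⁻¹ * d * P))) * P⁻¹ = X.rot v a * (P * P⁻¹) * u * (P * P⁻¹)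
        + (P * P⁻¹) * d * (P * P⁻¹) + (P * P⁻¹) * d * (P * M.μ * P⁻¹)
        - (P * M.μ * P⁻¹) * d * (P * P⁻¹) := by noncomm_ring
    have e' : (d * P + u * (X.rot v a * P)) * P⁻¹ = d * (P * P⁻¹) + u * X.rot v a * (P * P⁻¹) := by
      noncomm_ring
    simp only [e, e', e1, mul_one, one_mul] at h3
    have hV : X.V v = P * M.μ * P⁻¹ := rfl
    rw [hV]
    -- The diagonal matrix `d` appears on both sides: once from the term `C_a` in the derivative of
    -- `𝒰`, once from the derivative of the `u_i`.
    refine add_left_cancel (a := d) (Eq.trans ?_ h3)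
    abel
  have h5 := congrFun (congrFun h4 i) j
  simp only [Matrix.sub_apply, Matrix.add_apply, hu, hd, Matrix.mul_diagonal,
    Matrix.diagonal_mul] at h5
  linear_combination -h5

/-- The field `1/(E - λe)` has `du_i = (u_i - λ)⁻¹`, and the divided difference of these numbers at
`u_i, u_j` is `-(u_i - λ)⁻¹ (u_j - λ)⁻¹`. -/
theorem rot_poleVec (hv : v ∈ X.D) (h : ∀ i, lam ≠ X.u i v) :
    X.rot v (X.poleVec v lam) = -(Matrix.diagonal (X.poleFn v lam) * X.V v *
      Matrix.diagonal (X.poleFn v lam)) := by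
  ext i j
  rw [Matrix.neg_apply, Matrix.mul_diagonal, Matrix.diagonal_mul]
  by_cases hij : i = j
  · subst hij
    have := congrFun (congrFun (X.rot_transpose hv (X.poleVec v lam)) i) i
    rw [Matrix.transpose_apply, Matrix.neg_apply] at this
    rw [X.V_diag hv, self_eq_neg.1 this]; simp
  · have h1 := X.rot_commutator hv (X.poleVec v lam) i j
    rw [X.fderiv_u_poleVec hv, X.fderiv_u_poleVec hv] at h1
    have hi : X.u i v - lam ≠ 0 := sub_ne_zero.2 (h i).symm
    have hj : X.u j v - lam ≠ 0 := sub_ne_zero.2 (h j).symm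
    have hu := sub_ne_zero.2 (X.u_distinct v hv i j hij)
    refine mul_right_cancel₀ hu (h1.trans ?_)
    simp only [poleFn]
    field_simp
    ring

/-- Row `i` of the derivative of `Ψ`, applied to `b`: the left side is the product rule for `ψ_{iα}
= √h_i ∂_α u_i`, the right side comes from the rotation matrix. -/
theorem fderiv_sqrtH_poleVec (hv : v ∈ X.D) (h : ∀ i, lam ≠ X.u i v) (i : Fin n) (b : Vec n) :
    fderiv ℂ (X.sqrtH i) v (X.poleVec v lam) * fderiv ℂ (X.u i) v b
      + X.sqrtH i v * fderiv ℂ (fun w => fderiv ℂ (X.u i) w b) v (X.poleVec v lam)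
      = -(Matrix.diagonal (X.poleFn v lam) * X.V v *
      Matrix.diagonal (X.poleFn v lam) * X.Ψ v).mulVec b i := by
  have h1 : matDeriv (X.poleVec v lam) X.Ψ v = -(Matrix.diagonal (X.poleFn v lam) * X.V v *
      Matrix.diagonal (X.poleFn v lam) * X.Ψ v) := by
    rw [X.matDeriv_Ψ hv, X.rot_poleVec hv h, neg_mul]
  have h2 : -(Matrix.diagonal (X.poleFn v lam) * X.V v *
      Matrix.diagonal (X.poleFn v lam) * X.Ψ v).mulVec b i
      = ∑ α, matDeriv (X.poleVec v lam) X.Ψ v i α * b α := by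
    rw [h1]; simp [Matrix.mulVec, dotProduct]
  have h3 : ∀ α, matDeriv (X.poleVec v lam) X.Ψ v i α
      = fderiv ℂ (X.sqrtH i) v (X.poleVec v lam) * pd α (X.u i) v
        + X.sqrtH i v * fderiv ℂ (fun w => pd α (X.u i) w) v (X.poleVec v lam) := by
    intro α
    have := fderiv_fun_mul (X.sqrtH_analytic i v hv).differentiableAt
      (X.jac_analytic hv i α).differentiableAt
    have h' : matDeriv (X.poleVec v lam) X.Ψ v i α = _ :=
      congrArg (fun L : Vec n →L[ℂ] ℂ => L (X.poleVec v lam)) this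
    rw [h']
    simp only [add_apply, smul_apply, smul_eq_mul]
    rw [add_comm, mul_comm (jac X.u v i α)]
    rfl
  have hd : ∀ α, DifferentiableAt ℂ (fun w => pd α (X.u i) w) v := fun α =>
    (X.jac_analytic hv i α).differentiableAt
  have h4 : fderiv ℂ (fun w => fderiv ℂ (X.u i) w b) v (X.poleVec v lam)
      = ∑ α, b α * fderiv ℂ (fun w => pd α (X.u i) w) v (X.poleVec v lam) := by
    have e : (fun w => fderiv ℂ (X.u i) w b) = fun w => ∑ α, b α * pd α (X.u i) w :=
      funext fun w => fderiv_eq_sum_pd _ _ _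
    rw [e, fderiv_fun_sum fun α _ => (hd α).const_mul _]
    simp only [sum_apply]
    refine Finset.sum_congr rfl fun α _ => ?_
    rw [fderiv_const_mul (hd α)]
    rfl
  rw [h2, h4, fderiv_eq_sum_pd (X.u i), Finset.mul_sum, Finset.mul_sum, ← Finset.sum_add_distrib]
  exact Finset.sum_congr rfl fun α _ => by rw [h3]; ring

/-- In the orthonormal frame the trace is `∑ d_i d_j V_ij² + ¼ ∑ d_i²`, as `V` is skew with zero
diagonal. Symmetrizing `∑ H_i d_i` in `i, j` produces `(d_i - d_j)/(u_i - u_j) = -d_i d_j`, hence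
the first sum. -/
theorem trace_res (hv : v ∈ X.D) (h : ∀ i, lam ≠ X.u i v) :
    -(1 / 4) * (M.res lam v * M.muPlus * M.res lam v * M.muMinus).trace
      = ∑ i, X.H i v * X.poleFn v lam i - (1 / 16) * ∑ i, X.poleFn v lam i ^ 2 := by
  set d := X.poleFn v lam with hd
  set D := Matrix.diagonal d with hD
  have hΨ := X.Ψ_mul_inv hv
  set P := X.Ψ v with hP
  have hVp : P * M.muPlus * P⁻¹ = X.V v + (1 / 2 : ℂ) • 1 := by
    rw [muPlus, mul_add, add_mul, Matrix.mul_smul, Matrix.smul_mul, mul_one, hΨ, V]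
  have hVm : P * M.muMinus * P⁻¹ = (1 / 2 : ℂ) • 1 - X.V v := by
    rw [muMinus, mul_sub, sub_mul, Matrix.mul_smul, Matrix.smul_mul, mul_one, hΨ, V]
  have hres : M.res lam v = P⁻¹ * D * P := X.res_eq_Ψ hv h
  have h1 : (M.res lam v * M.muPlus * M.res lam v * M.muMinus).trace
      = (D * (X.V v + (1 / 2 : ℂ) • 1) * D * ((1 / 2 : ℂ) • 1 - X.V v)).trace := by
    rw [hres, ← hVp, ← hVm]
    calc _ = (P⁻¹ * (D * P * M.muPlus * P⁻¹ * D * P * M.muMinus)).trace := by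
          congr 1; noncomm_ring
      _ = _ := by rw [Matrix.trace_mul_comm]; congr 1; noncomm_ring
  have h2 : (D * (X.V v + (1 / 2 : ℂ) • 1) * D * ((1 / 2 : ℂ) • 1 - X.V v)).trace
      = ∑ i, ∑ j, (d i * d j * X.V v i j ^ 2 + if i = j then 1 / 4 * d i ^ 2 else 0) := by
    rw [Matrix.trace]
    refine Finset.sum_congr rfl fun i _ => ?_
    rw [Matrix.diag_apply, Matrix.mul_apply]
    refine Finset.sum_congr rfl fun j _ => ?_
    rw [Matrix.mul_diagonal, Matrix.diagonal_mul, Matrix.add_apply, Matrix.sub_apply,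
      Matrix.smul_apply, Matrix.smul_apply, X.V_symm hv i j]
    by_cases hij : i = j
    · subst hij
      rw [X.V_diag hv]; simp; ring
    · rw [Matrix.one_apply_ne hij, Matrix.one_apply_ne (Ne.symm hij)]
      simp [hij]; ring
  have h3 : ∑ i, X.H i v * d i = -(1 / 4) * ∑ i, ∑ j, d i * d j * X.V v i j ^ 2 := by
    have e1 : ∀ i, X.H i v * d i = (1 / 2) * ∑ j, d i * (X.V v i j ^ 2 / (X.u i v - X.u j v)) := by
      intro i
      rw [H, ← Finset.mul_sum, ← Finset.add_sum_erase _ _ (Finset.mem_univ i), X.V_diag hv]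
      simp; ring
    have e2 : ∀ i j, d i * (X.V v i j ^ 2 / (X.u i v - X.u j v))
        + d j * (X.V v j i ^ 2 / (X.u j v - X.u i v)) = -(d i * d j * X.V v i j ^ 2) := by
      intro i j
      by_cases hij : i = j
      · subst hij; simp [X.V_diag hv]
      · have hu := sub_ne_zero.2 (X.u_distinct v hv i j hij)
        have hu' := sub_ne_zero.2 (X.u_distinct v hv j i (Ne.symm hij))
        have hi : X.u i v - lam ≠ 0 := sub_ne_zero.2 (h i).symm
        have hj : X.u j v - lam ≠ 0 := sub_ne_zero.2 (h j).symm
        rw [X.V_symm hv i j, hd, poleFn, poleFn, ← neg_sub (X.u i v) (X.u j v), div_neg]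
        field_simp
        ring
    have e3 : ∑ i, ∑ j, d i * (X.V v i j ^ 2 / (X.u i v - X.u j v))
        = ∑ i, ∑ j, d j * (X.V v j i ^ 2 / (X.u j v - X.u i v)) := Finset.sum_comm
    have e4 : ∑ i, ∑ j, d i * (X.V v i j ^ 2 / (X.u i v - X.u j v))
        + ∑ i, ∑ j, d j * (X.V v j i ^ 2 / (X.u j v - X.u i v))
        = -∑ i, ∑ j, d i * d j * X.V v i j ^ 2 := by
      simp only [← Finset.sum_add_distrib, e2, Finset.sum_neg_distrib]
    rw [Finset.sum_congr rfl fun i _ => e1 i, ← Finset.mul_sum]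
    linear_combination (1 / 4) * e3 + (1 / 4) * e4
  rw [h1, h2, h3]
  simp only [Finset.sum_add_distrib, Finset.sum_ite_eq, Finset.mem_univ, if_true]
  rw [← Finset.mul_sum]
  ring

/-- In the orthonormal frame `L μ₋ L` is `½ D² - D V D`, with `D` the diagonal matrix of the `(u_i -
λ)⁻¹`. -/
theorem fderiv_u_res_muMinus_res (hv : v ∈ X.D) (h : ∀ i, lam ≠ X.u i v) (i : Fin n) (b : Vec n) :
    X.sqrtH i v *
      fderiv ℂ (X.u i) v ((M.res lam v * M.muMinus * M.res lam v).mulVec b)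
      = (1 / 2) * X.poleFn v lam i ^ 2 * (X.sqrtH i v * fderiv ℂ (X.u i) v b)
        - (Matrix.diagonal (X.poleFn v lam) * X.V v *
      Matrix.diagonal (X.poleFn v lam) * X.Ψ v).mulVec b i := by
  have hΨ := X.Ψ_mul_inv hv
  have e0 : ∀ a, X.sqrtH i v * fderiv ℂ (X.u i) v a = (X.Ψ v).mulVec a i := by
    intro a
    rw [← congrFun (X.jac_mulVec v a) i, X.Ψ_eq, ← Matrix.mulVec_mulVec, Matrix.mulVec_diagonal]
  rw [e0, e0, Matrix.mulVec_mulVec]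
  set D := Matrix.diagonal (X.poleFn v lam) with hD
  set P := X.Ψ v with hP
  have hres : M.res lam v = P⁻¹ * D * P := X.res_eq_Ψ hv h
  have hVm : P * M.muMinus * P⁻¹ = (1 / 2 : ℂ) • 1 - X.V v := by
    rw [muMinus, mul_sub, sub_mul, Matrix.mul_smul, Matrix.smul_mul, mul_one, hΨ, V]
  have h1 : P * (M.res lam v * M.muMinus * M.res lam v)
      = (1 / 2 : ℂ) • (D * D * P) - D * X.V v * D * P := by
    rw [hres]
    calc _ = (P * P⁻¹) * D * (P * M.muMinus * P⁻¹) * D * P := by noncomm_ring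
      _ = _ := by
        rw [hΨ, hVm, one_mul, mul_sub, sub_mul, sub_mul, Matrix.mul_smul, Matrix.smul_mul,
          Matrix.smul_mul, mul_one]
  rw [h1, Matrix.sub_mulVec, Pi.sub_apply, Matrix.smul_mulVec, Pi.smul_apply, hD,
    Matrix.diagonal_mul_diagonal, ← Matrix.mulVec_mulVec, Matrix.mulVec_diagonal, smul_eq_mul]
  ring

section Curve

variable (j : Jet N n)

theorem curveK_zero (γ : Fin n) :
    X.curveK j γ 0 lam = X.poleVec (j 0) lam γ := by
  simp [curveK, jetCurve_zero, poleVec, poleFn, Matrix.mulVec, dotProduct]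

theorem poleVec_analytic (hv : v ∈ X.D) (h : ∀ i, lam ≠ X.u i v) (γ : Fin n) :
    AnalyticAt ℂ (fun w => X.poleVec w lam γ) v := by
  change AnalyticAt ℂ (fun w => ∑ i, invJac X.u w γ i * (X.u i w - lam)⁻¹) v
  exact Finset.analyticAt_fun_sum _ fun i _ => (X.invJac_analytic hv γ i).mul
    (((X.u_analytic i v hv).sub analyticAt_const).inv (sub_ne_zero.2 (h i).symm))

/-- The only term of the sum has `k = 1` and weight `1`. There `∂_λ ∂_x p = ⟨v_x, L μ₊ ∇p⟩`, and
taking the adjoint turns `μ₊` into `μ₋`. -/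
theorem curveK_one (hN : 1 ≤ N) (hv : j 0 ∈ X.D) (h : ∀ i, lam ≠ X.u i (j 0)) (γ : Fin n) :
    X.curveK j γ 1 lam = 2 * fderiv ℂ (fun w => X.poleVec w lam γ) (j 0) (j ⟨1, by omega⟩)
      + (M.res lam (j 0) * M.muMinus * M.res lam (j 0)).mulVec (j ⟨1, by omega⟩) γ := by
  have hy : ((0 : ℂ), lam) ∈ X.regularSet j := by
    simpa [regularSet, jetCurve_zero] using ⟨hv, h⟩
  have h1 : deriv (fun x => ∑ i, invJac X.u (jetCurve j x) γ i
      * (X.u i (jetCurve j x) - lam)⁻¹) 0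
      = fderiv ℂ (fun w => X.poleVec w lam γ) (j 0) (j ⟨1, by omega⟩) := by
    have e1 : HasFDerivAt (fun w => X.poleVec w lam γ)
        (fderiv ℂ (fun w => X.poleVec w lam γ) (j 0)) (jetCurve j 0) := by
      rw [jetCurve_zero]
      exact (X.poleVec_analytic hv h γ).differentiableAt.hasFDerivAt
    have e2 := e1.comp_hasDerivAt (0 : ℂ) (jetCurve_analytic j 0).differentiableAt.hasDerivAt
    rw [show deriv (jetCurve j) 0 = j ⟨1, by omega⟩ from jetVel_zero j hN] at e2
    exact e2.deriv
  -- The row `⟨v_x, ·⟩` does not involve `λ`.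
  have h2 : matDeriv (0, 1) (rowJet M j 0) ((0 : ℂ), lam) = 0 := by
    ext i γ
    rw [matDeriv_apply, ← fderiv_slice_right (X.rowJet_analytic 0 hy i γ).differentiableAt]
    simp [rowJet]
  have h3 : rowJet M j 0 ((0 : ℂ), lam)
      = (Matrix.of fun (_ : Unit) δ => j ⟨1, by omega⟩ δ) * M.η := by
    ext; simp [rowJet, Matrix.mul_apply, jetVel_zero j hN]
  have h4 : curveRes M j ((0 : ℂ), lam) = M.res lam (j 0) := by simp [curveRes, jetCurve_zero]
  have hη : M.η⁻¹ * M.muPlus.transpose = M.muMinus * M.η⁻¹ := by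
    calc _ = M.η⁻¹ * (M.muPlus.transpose * M.η) * M.η⁻¹ := by
          rw [mul_assoc, mul_assoc, η_mul_inv, mul_one]
      _ = _ := by rw [← η_muMinus, ← mul_assoc, η_inv_mul, one_mul]
  rw [curveK, iteratedDeriv_one, h1]
  congr 1
  · push_cast; ring
  · rw [Finset.Icc_self, Finset.sum_singleton]
    simp only [gradJet, Nat.sub_self, rowJetDeriv, h2, h3, h4, zero_add, Matrix.one_mul]
    rw [Matrix.transpose_mul, Matrix.transpose_mul, Matrix.transpose_mul, M.η_symm.eq]
    have e : M.res lam (j 0) * M.η⁻¹ * (M.muPlus.transpose * (M.res lam (j 0)).transpose *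
        (M.η * (Matrix.of fun (_ : Unit) δ => j ⟨1, by omega⟩ δ).transpose))
        = (M.res lam (j 0) * M.muMinus * M.res lam (j 0)) *
          (Matrix.of fun (_ : Unit) δ => j ⟨1, by omega⟩ δ).transpose := by
      calc _ = M.res lam (j 0) * (M.η⁻¹ * M.muPlus.transpose) *
            ((M.res lam (j 0)).transpose * M.η) *
            (Matrix.of fun (_ : Unit) δ => j ⟨1, by omega⟩ δ).transpose := by
            simp only [Matrix.mul_assoc]
        _ = M.res lam (j 0) * M.muMinus * (M.η⁻¹ * M.η) * M.res lam (j 0) *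
            (Matrix.of fun (_ : Unit) δ => j ⟨1, by omega⟩ δ).transpose := by
            rw [hη, ← η_res (X.D_subset hv)]; simp only [Matrix.mul_assoc]
        _ = _ := by rw [η_inv_mul, mul_one]
    rw [e]
    simp [Matrix.mul_apply, Matrix.mulVec, dotProduct]

/-- The contraction of the loop operator with `d u_{i,x}`. -/
theorem fderiv_u_curveK (hN : 1 ≤ N) (hv : j 0 ∈ X.D) (h : ∀ i, lam ≠ X.u i (j 0)) (i : Fin n) :
    X.sqrtH i (j 0) * (fderiv ℂ (X.u i) (j 0) (fun γ => X.curveK j γ 1 lam)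
      + fderiv ℂ (fun w => fderiv ℂ (X.u i) w (j ⟨1, by omega⟩)) (j 0) (X.poleVec (j 0) lam))
      = fderiv ℂ (X.u i) (j 0) (j ⟨1, by omega⟩) *
        (-(3 / 2) * X.poleFn (j 0) lam i ^ 2 * X.sqrtH i (j 0)
          + fderiv ℂ (X.sqrtH i) (j 0) (X.poleVec (j 0) lam)) := by
  set b := j ⟨1, by omega⟩ with hb
  set v := j 0 with hv0
  have hu := X.u_analytic i v hv
  have hpd : ∀ γ, DifferentiableAt ℂ (fun w => pd γ (X.u i) w) v := fun γ =>
    (X.jac_analytic hv i γ).differentiableAt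
  have hpv : ∀ γ, DifferentiableAt ℂ (fun w => X.poleVec w lam γ) v := fun γ =>
    (X.poleVec_analytic hv h γ).differentiableAt
  have hdir : ∀ a b : Vec n, fderiv ℂ (fun w => fderiv ℂ (X.u i) w a) v b
      = fderiv ℂ (fderiv ℂ (X.u i)) v b a := by
    intro a b
    have h0 : HasFDerivAt (fun w => fderiv ℂ (X.u i) w a) _ v :=
      (ContinuousLinearMap.apply ℂ ℂ a).hasFDerivAt.comp v hu.fderiv.differentiableAt.hasFDerivAt
    rw [h0.fderiv]
    rfl
  -- Symmetry of the second derivative of `u_i`: the differentiation along `1/(E - λe)` is traded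
  -- for one along `b = v_x`.
  have hsymm : fderiv ℂ (fun w => fderiv ℂ (X.u i) w b) v (X.poleVec v lam)
      = ∑ γ, fderiv ℂ (fun w => pd γ (X.u i) w) v b * X.poleVec v lam γ := by
    have h1 : IsSymmSndFDerivAt ℂ (X.u i) v := (hu.contDiffAt (n := 2)).isSymmSndFDerivAt (by simp)
    rw [hdir, h1.eq, ← hdir]
    have e : (fun w => fderiv ℂ (X.u i) w (X.poleVec v lam))
        = fun w => ∑ α, X.poleVec v lam α * pd α (X.u i) w :=
      funext fun w => fderiv_eq_sum_pd _ _ _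
    rw [e, fderiv_fun_sum fun α _ => (hpd α).const_mul _]
    simp only [sum_apply]
    refine Finset.sum_congr rfl fun α _ => ?_
    rw [fderiv_const_mul (hpd α)]
    simp [mul_comm]
  -- The derivative along `b` of the identity `du_i(1/(E - λe)) = (u_i - λ)⁻¹`.
  have h1 : ∑ γ, (fderiv ℂ (fun w => X.poleVec w lam γ) v b * pd γ (X.u i) v
      + fderiv ℂ (fun w => pd γ (X.u i) w) v b * X.poleVec v lam γ)
      = -(X.poleFn v lam i ^ 2 * fderiv ℂ (X.u i) v b) := by
    have e1 : (fun w => ∑ γ, X.poleVec w lam γ * pd γ (X.u i) w) =ᶠ[𝓝 v]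
        fun w => (X.u i w - lam)⁻¹ := by
      refine (X.isOpen_D.eventually_mem hv).mono fun w hw => ?_
      exact (fderiv_eq_sum_pd _ _ _).symm.trans (X.fderiv_u_poleVec hw i)
    have e2 := congrArg (fun L : Vec n →L[ℂ] ℂ => L b) e1.fderiv_eq
    have hne : X.u i v - lam ≠ 0 := sub_ne_zero.2 (h i).symm
    have e3 : HasFDerivAt (fun w => (X.u i w - lam)⁻¹) _ v :=
      (hasDerivAt_inv hne).comp_hasFDerivAt v (hu.differentiableAt.hasFDerivAt.sub_const lam)
    rw [e3.fderiv, fderiv_fun_sum fun γ _ => (hpv γ).fun_mul (hpd γ)] at e2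
    simp only [sum_apply, smul_apply, smul_eq_mul] at e2
    have e4 : ∀ γ, fderiv ℂ (fun w => X.poleVec w lam γ * pd γ (X.u i) w) v b
        = fderiv ℂ (fun w => X.poleVec w lam γ) v b * pd γ (X.u i) v
      + fderiv ℂ (fun w => pd γ (X.u i) w) v b * X.poleVec v lam γ := by
      intro γ
      rw [fderiv_fun_mul (hpv γ) (hpd γ)]
      simp only [add_apply, smul_apply, smul_eq_mul]
      ring
    simp only [e4] at e2
    rw [e2, poleFn, inv_pow]
    ring
  have h2 : fderiv ℂ (X.u i) v (fun γ => X.curveK j γ 1 lam)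
      = 2 * ∑ γ, fderiv ℂ (fun w => X.poleVec w lam γ) v b * pd γ (X.u i) v
        + fderiv ℂ (X.u i) v ((M.res lam v * M.muMinus * M.res lam v).mulVec b) := by
    rw [fderiv_eq_sum_pd, fderiv_eq_sum_pd (X.u i) v (_ : Vec n), Finset.mul_sum,
      ← Finset.sum_add_distrib]
    refine Finset.sum_congr rfl fun γ _ => ?_
    rw [X.curveK_one j hN hv h]
    ring
  rw [Finset.sum_add_distrib, ← hsymm] at h1
  have h3 := X.fderiv_u_res_muMinus_res hv h i b
  have h4 := X.fderiv_sqrtH_poleVec hv h i b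
  rw [h2]
  -- The coefficient of `(u_i - λ)⁻²` is `-2` from the derivative of the pole and `+½` from `L μ₋
  -- L`, in all `-3/2`. The terms with `D V D` cancel between the last two identities.
  linear_combination 2 * X.sqrtH i v * h1 + h3 - h4

end Curve

end CanonicalChart

/-! ### Differentials of functions on jet spaces -/

section Jets

variable {N n : ℕ}

/-- It makes the left side of the loop equation the differential of `F` on the single vector
`(K^{γ,s})`. -/
theorem fderiv_eq_sum_jetPd (F : Jet N n → ℂ) (j b : Jet N n) :
    fderiv ℂ F j b = ∑ s, ∑ γ, jetPd s γ F j * b s γ := by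
  have h : b = ∑ s, ∑ γ, b s γ • (Pi.single s (Pi.single γ 1) : Jet N n) := by
    ext s γ
    simp [Finset.sum_apply, Pi.single_apply, apply_ite, ite_apply]
  conv_lhs => rw [h]
  simp only [map_sum, map_smul, smul_eq_mul]
  exact Finset.sum_congr rfl fun _ _ => Finset.sum_congr rfl fun _ _ => mul_comm _ _

/-- Truncation of jets to first order as a continuous linear map. -/
def truncOneL (hN : 1 ≤ N) : Jet N n →L[ℂ] Jet 1 n :=
  ContinuousLinearMap.pi fun k =>
    ContinuousLinearMap.proj (R := ℂ) (φ := fun _ : Fin (N + 1) => Vec n)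
      (Fin.castLE (Nat.succ_le_succ hN) k)

theorem truncOneL_apply (hN : 1 ≤ N) (j : Jet N n) : truncOneL hN j = truncOne hN j := rfl

theorem truncOne_zero (hN : 1 ≤ N) (j : Jet N n) : truncOne hN j 0 = j 0 := rfl

theorem truncOne_one (hN : 1 ≤ N) (j : Jet N n) : truncOne hN j 1 = j ⟨1, by omega⟩ := rfl

end Jets

/-! ### The loop equation for the genus one free energy -/

namespace GenFrobeniusManifold

variable {n : ℕ} (M : GenFrobeniusManifold n)

/-- The explicit form of the function `G^{αβ} ∂_λ p_α * ∂_λ p_β`. -/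
def starSum (v : Vec n) (lam : ℂ) : ℂ :=
  -(1 / 2) * (M.res lam v * M.muPlus * M.res lam v * M.muMinus).trace
    + 1 / (2 * lam ^ 2) * ((1 / 4 : ℂ) • (1 : Matrix (Fin n) (Fin n) ℂ) - M.μ * M.μ).trace

end GenFrobeniusManifold

namespace CanonicalChart

open GenFrobeniusManifold

variable {n N : ℕ} {M : GenFrobeniusManifold n} (X : CanonicalChart M) {v : Vec n} {lam : ℂ}

theorem canonicalX_eq (i : Fin n) (j : Jet 1 n) :
    canonicalX X i j = fderiv ℂ (X.u i) (j 0) (j 1) := (fderiv_eq_sum_pd _ _ _).symm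

theorem fderiv_canonicalX (i : Fin n) {j : Jet 1 n} (hv : j 0 ∈ X.D) (b : Jet 1 n) :
    fderiv ℂ (canonicalX X i) j b = fderiv ℂ (X.u i) (j 0) (b 1)
      + fderiv ℂ (fun w => fderiv ℂ (X.u i) w (j 1)) (j 0) (b 0) := by
  have hu := X.u_analytic i _ hv
  have e : canonicalX X i = fun j : Jet 1 n => fderiv ℂ (X.u i) (j 0) (j 1) :=
    funext fun j => X.canonicalX_eq i j
  have h0 : HasFDerivAt (fun j : Jet 1 n => fderiv ℂ (X.u i) (j 0)) _ j :=
    HasFDerivAt.comp (g := fderiv ℂ (X.u i)) (f := fun j : Jet 1 n => j 0) j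
      hu.fderiv.differentiableAt.hasFDerivAt
      (ContinuousLinearMap.proj (R := ℂ) (φ := fun _ : Fin 2 => Vec n) 0).hasFDerivAt
  have h1 : HasFDerivAt (fun j : Jet 1 n => j 1) _ j :=
    (ContinuousLinearMap.proj (R := ℂ) (φ := fun _ : Fin 2 => Vec n) 1).hasFDerivAt
  have h2 : HasFDerivAt (fun w => fderiv ℂ (X.u i) w (j 1)) _ (j 0) :=
    (ContinuousLinearMap.apply ℂ ℂ (j 1)).hasFDerivAt.comp (j 0)
      hu.fderiv.differentiableAt.hasFDerivAt
  rw [e, (h0.clm_apply h1).fderiv, h2.fderiv]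
  simp

/-- Logarithmic differentiation of `J24 ^ 24 = ∏ √h_i`; it is valid for every branch of the root. -/
theorem exists_dlog_J24 {J24 : Vec n → ℂ} (hJ24 : AnalyticOnNhd ℂ J24 X.D)
    (hpow : ∀ v ∈ X.D, J24 v ^ 24 = X.J v) (hv : v ∈ X.D) (a : Vec n) :
    J24 v ≠ 0 ∧ fderiv ℂ J24 v a / J24 v
      = (1 / 24) * ∑ i, fderiv ℂ (X.sqrtH i) v a / X.sqrtH i v := by
  have hJ : X.J v ≠ 0 := Finset.prod_ne_zero_iff.2 fun i _ => X.sqrtH_ne_zero hv i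
  have hne : J24 v ≠ 0 := fun h => hJ (by rw [← hpow v hv, h]; simp)
  refine ⟨hne, ?_⟩
  have e1 : (fun w => J24 w ^ 24) =ᶠ[𝓝 v] X.J :=
    (X.isOpen_D.eventually_mem hv).mono hpow
  have e2 := congrArg (fun L : Vec n →L[ℂ] ℂ => L a) e1.fderiv_eq
  have e3 : HasFDerivAt X.J _ v :=
    HasFDerivAt.finsetProd (u := Finset.univ)
      fun i _ => (X.sqrtH_analytic i v hv).differentiableAt.hasFDerivAt
  rw [e3.fderiv, ((hJ24 v hv).differentiableAt.hasFDerivAt.pow 24).fderiv] at e2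
  simp only [sum_apply, smul_apply, smul_eq_mul] at e2
  have e4 : ∑ i, (∏ k ∈ Finset.univ.erase i, X.sqrtH k v) * fderiv ℂ (X.sqrtH i) v a
      = X.J v * ∑ i, fderiv ℂ (X.sqrtH i) v a / X.sqrtH i v := by
    rw [Finset.mul_sum]
    refine Finset.sum_congr rfl fun i _ => ?_
    have := X.sqrtH_ne_zero hv i
    rw [J, ← Finset.mul_prod_erase _ _ (Finset.mem_univ i)]
    field_simp
  rw [e4, ← hpow v hv] at e2
  have h23 : J24 v ^ 23 ≠ 0 := pow_ne_zero _ hne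
  rw [div_eq_iff hne]
  refine mul_left_cancel₀ (mul_ne_zero (by norm_num : (24 : ℂ) ≠ 0) h23) ?_
  refine (Eq.trans ?_ e2).trans ?_
  · norm_num
  · ring

/-- The genus one free energy satisfies the loop equation, with the loop operator written in terms
of the structure constants. -/
theorem genusOne_curveK {τ : Vec n → ℂ} (hτ : X.IsTau τ)
    {J24 : Vec n → ℂ} (hJ24 : AnalyticOnNhd ℂ J24 X.D) (hJ24_pow : ∀ v ∈ X.D, J24 v ^ 24 = X.J v)
    {logτJ : Vec n → ℂ} (hlogτJ : AnalyticOnNhd ℂ logτJ X.D)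
    (hlogτJ_exp : ∀ v ∈ X.D, Complex.exp (logτJ v) = τ v / J24 v)
    {U : Set (Jet 1 n)} (hU : IsOpen U) (hUD : ∀ j ∈ U, j 0 ∈ X.D)
    {logux : Fin n → Jet 1 n → ℂ} (hlogux : ∀ i, AnalyticOnNhd ℂ (logux i) U)
    (hlogux_exp : ∀ i, ∀ j ∈ U, Complex.exp (logux i j) = canonicalX X i j)
    (hN : 1 ≤ N) (j : Jet N n) (hj : truncOne hN j ∈ U) (h : ∀ i, lam ≠ X.u i (j 0)) :
    ∑ s : Fin (N + 1), ∑ γ, jetPd s γ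
      (fun j => logτJ (truncOne hN j 0) + (1 / 24) * ∑ i, logux i (truncOne hN j)) j
        * X.curveK j γ s lam
      = (1 / 2) * M.starSum (j 0) lam - 1 / (4 * lam ^ 2) *
          ((1 / 4 : ℂ) • (1 : Matrix (Fin n) (Fin n) ℂ) - M.μ * M.μ).trace := by
  have hv : j 0 ∈ X.D := hUD _ hj
  set v := j 0 with hv0
  set b : Jet N n := fun s γ => X.curveK j γ s lam with hb
  have hb0 : truncOne hN b 0 = X.poleVec v lam := funext fun γ => X.curveK_zero j γ
  rw [← fderiv_eq_sum_jetPd _ j b]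
  set G : Jet 1 n → ℂ := fun j => logτJ (j 0) + (1 / 24) * ∑ i, logux i j with hG
  have hlog : DifferentiableAt ℂ logτJ v := (hlogτJ v hv).differentiableAt
  have hux : ∀ i, DifferentiableAt ℂ (logux i) (truncOne hN j) := fun i =>
    (hlogux i _ hj).differentiableAt
  have hG1 : HasFDerivAt (fun j : Jet 1 n => logτJ (j 0)) _ (truncOne hN j) :=
    HasFDerivAt.comp (g := logτJ) (f := fun j : Jet 1 n => j 0) (truncOne hN j) hlog.hasFDerivAt
      (ContinuousLinearMap.proj (R := ℂ) (φ := fun _ : Fin 2 => Vec n) 0).hasFDerivAt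
  have hG2 : HasFDerivAt (fun j : Jet 1 n => (1 / 24 : ℂ) * ∑ i, logux i j) _ (truncOne hN j) :=
    (HasFDerivAt.fun_sum fun i _ => (hux i).hasFDerivAt).const_mul (1 / 24 : ℂ)
  have hF : HasFDerivAt (fun j => G (truncOne hN j)) _ j :=
    HasFDerivAt.comp (g := G) (f := truncOneL hN) j (hG1.add hG2) (truncOneL hN).hasFDerivAt
  have hval : fderiv ℂ (fun j => G (truncOne hN j)) j b
      = fderiv ℂ logτJ v (X.poleVec v lam)
        + (1 / 24) * ∑ i, fderiv ℂ (logux i) (truncOne hN j) (truncOne hN b) := by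
    rw [hF.fderiv, ← hb0]
    simp [truncOneL_apply, truncOne_zero, hv0]
  rw [hval]
  -- Differentiating `exp (log u_{i,x}) = u_{i,x}` reduces this to the contraction with `d u_{i,x}`;
  -- the factors `√h_i` and `u_{i,x}` are not zero and are divided out.
  have hlogux' : ∀ i, fderiv ℂ (logux i) (truncOne hN j) (truncOne hN b)
      = -(3 / 2) * X.poleFn v lam i ^ 2
        + fderiv ℂ (X.sqrtH i) v (X.poleVec v lam) / X.sqrtH i v := by
    intro i
    have e1 : (fun j => Complex.exp (logux i j)) =ᶠ[𝓝 (truncOne hN j)] canonicalX X i :=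
      (hU.eventually_mem hj).mono fun j hj => hlogux_exp i j hj
    have e2 := congrArg (fun L : Jet 1 n →L[ℂ] ℂ => L (truncOne hN b)) e1.fderiv_eq
    rw [((hux i).hasFDerivAt.cexp).fderiv, X.fderiv_canonicalX i hv, hlogux_exp i _ hj,
      hb0, canonicalX_eq, truncOne_one, truncOne_zero, truncOne_one] at e2
    have e3 := X.fderiv_u_curveK j hN hv h i
    have hs := X.sqrtH_ne_zero hv i
    have hx : fderiv ℂ (X.u i) (j 0) (j ⟨1, by omega⟩) ≠ 0 := by
      have := hlogux_exp i _ hj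
      rw [canonicalX_eq, truncOne_one, truncOne_zero] at this
      rw [← this]; exact Complex.exp_ne_zero _
    have e4 : fderiv ℂ (X.u i) (j 0) (b ⟨1, by omega⟩)
        + fderiv ℂ (fun w => fderiv ℂ (X.u i) w (j ⟨1, by omega⟩)) (j 0) (X.poleVec v lam)
        = fderiv ℂ (X.u i) (j 0) (j ⟨1, by omega⟩)
          * fderiv ℂ (logux i) (truncOne hN j) (truncOne hN b) := by
      rw [← e2]; rfl
    rw [e4] at e3
    refine mul_left_cancel₀ (mul_ne_zero hs hx) ?_
    refine (Eq.trans (by ring) e3).trans ?_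
    rw [← hv0] at hx ⊢
    field_simp
  obtain ⟨hJne, hJd⟩ := X.exists_dlog_J24 hJ24 hJ24_pow hv (X.poleVec v lam)
  -- Since `du_i` of the field `1/(E - λe)` is `(u_i - λ)⁻¹`, the form `∑ H_i du_i` contributes `∑
  -- H_i (u_i - λ)⁻¹`.
  have hlog' : fderiv ℂ logτJ v (X.poleVec v lam)
      = ∑ i, X.H i v * X.poleFn v lam i
        - (1 / 24) * ∑ i, fderiv ℂ (X.sqrtH i) v (X.poleVec v lam) / X.sqrtH i v := by
    rw [← hJd]
    have hτd := (hτ.analytic v hv).differentiableAt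
    have hτne := hτ.ne_zero v hv
    have e1 : (fun w => Complex.exp (logτJ w) * J24 w) =ᶠ[𝓝 v] τ := by
      refine (X.isOpen_D.eventually_mem hv).mono fun w hw => ?_
      change Complex.exp (logτJ w) * J24 w = τ w
      rw [hlogτJ_exp w hw, div_mul_cancel₀ _ (X.exists_dlog_J24 hJ24 hJ24_pow hw 0).1]
    have e2 := congrArg (fun L : Vec n →L[ℂ] ℂ => L (X.poleVec v lam)) e1.fderiv_eq
    rw [(hlog.hasFDerivAt.cexp.fun_mul (hJ24 v hv).differentiableAt.hasFDerivAt).fderiv,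
      hlogτJ_exp v hv] at e2
    simp only [add_apply, smul_apply, smul_eq_mul] at e2
    have e3 : fderiv ℂ τ v (X.poleVec v lam) / τ v = ∑ i, X.H i v * X.poleFn v lam i := by
      have e4 : ∀ α, pd α τ v = τ v * ∑ i, X.H i v * pd α (X.u i) v := by
        intro α
        rw [← hτ.dlog v hv α, mul_div_cancel₀ _ hτne]
      rw [fderiv_eq_sum_pd, div_eq_iff hτne]
      simp only [e4, ← X.fderiv_u_poleVec hv, fderiv_eq_sum_pd (X.u _), Finset.mul_sum,
        Finset.sum_mul]
      rw [Finset.sum_comm]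
      exact Finset.sum_congr rfl fun _ _ => Finset.sum_congr rfl fun _ _ => by ring
    rw [← e3, ← e2]
    field_simp
    ring
  rw [hlog', Finset.sum_congr rfl fun i _ => hlogux' i, Finset.sum_add_distrib,
    ← Finset.mul_sum]
  have ht := X.trace_res hv h
  rw [starSum]
  -- The derivatives of `log √h_i` from `J^{1/24}` and from the `log u_{i,x}` cancel, `(1/24)(3/2) =
  -- 1/16`, and the two terms in `λ⁻²` cancel.
  linear_combination -ht

end CanonicalChart

/-! ### Poles along a graph -/

/-- Near the point `(0, u 0)` of the graph of `u`, the function `f` has a pole of order at most `m`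
along the graph, with leading coefficient `a` at that point. -/
def HasPole (u : ℂ → ℂ) (m : ℕ) (f : ℂ × ℂ → ℂ) (a : ℂ) : Prop :=
  ∃ g : ℂ × ℂ → ℂ, AnalyticAt ℂ g (0, u 0) ∧ g (0, u 0) = a ∧
    ∀ᶠ y in 𝓝 ((0, u 0) : ℂ × ℂ), y.2 ≠ u y.1 → f y = g y * (u y.1 - y.2)⁻¹ ^ m

namespace HasPole

variable {u : ℂ → ℂ} {m k : ℕ} {f f' : ℂ × ℂ → ℂ} {a b : ℂ}

theorem of_analytic (hf : AnalyticAt ℂ f (0, u 0)) : HasPole u 0 f (f (0, u 0)) :=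
  ⟨f, hf, rfl, Eventually.of_forall fun y _ => by simp⟩

theorem congr (hf : HasPole u m f a)
    (h : ∀ᶠ y in 𝓝 ((0, u 0) : ℂ × ℂ), y.2 ≠ u y.1 → f' y = f y) : HasPole u m f' a := by
  obtain ⟨g, hg, h0, hfg⟩ := hf
  refine ⟨g, hg, h0, ?_⟩
  filter_upwards [hfg, h] with y h1 h2 hy
  rw [h2 hy, h1 hy]

theorem add (hf : HasPole u m f a) (hf' : HasPole u m f' b) :
    HasPole u m (fun y => f y + f' y) (a + b) := by
  obtain ⟨g, hg, h0, hfg⟩ := hf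
  obtain ⟨g', hg', h0', hfg'⟩ := hf'
  refine ⟨fun y => g y + g' y, hg.fun_add hg', by simp only [h0, h0'], ?_⟩
  filter_upwards [hfg, hfg'] with y h1 h2 hy
  rw [h1 hy, h2 hy]
  ring

theorem mul (hf : HasPole u m f a) (hf' : HasPole u k f' b) :
    HasPole u (m + k) (fun y => f y * f' y) (a * b) := by
  obtain ⟨g, hg, h0, hfg⟩ := hf
  obtain ⟨g', hg', h0', hfg'⟩ := hf'
  refine ⟨fun y => g y * g' y, hg.fun_mul hg', by simp only [h0, h0'], ?_⟩
  filter_upwards [hfg, hfg'] with y h1 h2 hy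
  rw [h1 hy, h2 hy]
  ring

theorem const_mul (c : ℂ) (hf : HasPole u m f a) : HasPole u m (fun y => c * f y) (c * a) := by
  obtain ⟨g, hg, h0, hfg⟩ := hf
  refine ⟨fun y => c * g y, analyticAt_const.fun_mul hg, by simp only [h0], ?_⟩
  filter_upwards [hfg] with y h1 hy
  rw [h1 hy]
  ring

theorem zero : HasPole u m (fun _ => 0) 0 :=
  ⟨fun _ => 0, analyticAt_const, rfl, Eventually.of_forall fun y _ => by simp⟩

theorem sum {ι : Type*} (s : Finset ι) {f : ι → ℂ × ℂ → ℂ} {a : ι → ℂ}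
    (h : ∀ i ∈ s, HasPole u m (f i) (a i)) :
    HasPole u m (fun y => ∑ i ∈ s, f i y) (∑ i ∈ s, a i) := by
  classical
  induction s using Finset.induction_on with
  | empty => simpa using zero
  | insert i s hi ih =>
    simp only [Finset.sum_insert hi]
    exact (h i (Finset.mem_insert_self _ _)).add
      (ih fun i' hi' => h i' (Finset.mem_insert_of_mem hi'))

/-- A pole of order at most `m` is one of order at most `m + 1` with leading coefficient `0`; terms
of different orders can thus be added. -/
theorem raise_succ (hu : AnalyticAt ℂ u 0) (hf : HasPole u m f a) : HasPole u (m + 1) f 0 := by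
  obtain ⟨g, hg, -, hfg⟩ := hf
  have hd : AnalyticAt ℂ (fun y : ℂ × ℂ => u y.1 - y.2) (0, u 0) :=
    (AnalyticAt.fun_comp (f := fun y : ℂ × ℂ => y.1) hu analyticAt_fst).fun_sub analyticAt_snd
  refine ⟨fun y => g y * (u y.1 - y.2), hg.fun_mul hd, by simp, ?_⟩
  filter_upwards [hfg] with y h1 hy
  have : u y.1 - y.2 ≠ 0 := sub_ne_zero.2 (Ne.symm hy)
  rw [h1 hy, pow_succ]
  field_simp

/-- The graph moves with `x`, so differentiation in either variable raises the order by one: for `g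
(u - λ)⁻ᵐ` the new numerator is `(u - λ) dg - m g d(u - λ)`. -/
theorem fderiv_apply (hu : AnalyticAt ℂ u 0) (hf : HasPole u m f a) (c : ℂ × ℂ) :
    HasPole u (m + 1) (fun y => fderiv ℂ f y c) (-(m * a * (deriv u 0 * c.1 - c.2))) := by
  obtain ⟨g, hg, h0, hfg⟩ := hf
  have hud : ∀ᶠ y in 𝓝 ((0, u 0) : ℂ × ℂ), AnalyticAt ℂ u y.1 :=
    (continuousAt_fst (p := ((0, u 0) : ℂ × ℂ))).eventually hu.eventually_analyticAt
  have hd : AnalyticAt ℂ (fun y : ℂ × ℂ => u y.1 - y.2) (0, u 0) :=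
    (AnalyticAt.fun_comp (f := fun y : ℂ × ℂ => y.1) hu analyticAt_fst).fun_sub analyticAt_snd
  have hdu : AnalyticAt ℂ (fun y : ℂ × ℂ => deriv u y.1) (0, u 0) :=
    AnalyticAt.fun_comp (f := fun y : ℂ × ℂ => y.1) hu.deriv analyticAt_fst
  refine ⟨fun y => fderiv ℂ g y c * (u y.1 - y.2) - m * g y * (deriv u y.1 * c.1 - c.2),
    ((analyticAt_fderiv_apply hg c).fun_mul hd).fun_sub
      ((analyticAt_const.fun_mul hg).fun_mul
        ((hdu.fun_mul analyticAt_const).fun_sub analyticAt_const)), by simp [h0], ?_⟩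
  filter_upwards [hfg.eventually_nhds, hud, hg.eventually_analyticAt] with y h1 h2 h3 hy
  have hne : u y.1 - y.2 ≠ 0 := sub_ne_zero.2 (Ne.symm hy)
  have hcu : ContinuousAt (fun z : ℂ × ℂ => u z.1) y :=
    ContinuousAt.comp (f := fun z : ℂ × ℂ => z.1) h2.continuousAt continuousAt_fst
  have h4 : ∀ᶠ z in 𝓝 y, z.2 ≠ u z.1 :=
    (ContinuousAt.ne_iff_eventually_ne continuousAt_snd hcu).1 hy
  have h5 : f =ᶠ[𝓝 y] fun z => g z * (u z.1 - z.2)⁻¹ ^ m := by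
    filter_upwards [h1, h4] with z h6 h7 using h6 h7
  have hdd : HasFDerivAt (fun z : ℂ × ℂ => u z.1 - z.2) _ y :=
    (h2.differentiableAt.hasDerivAt.hasFDerivAt.comp y
      (hasFDerivAt_fst (𝕜 := ℂ) (E := ℂ) (F := ℂ) (p := y))).sub
      (hasFDerivAt_snd (𝕜 := ℂ) (E := ℂ) (F := ℂ) (p := y))
  have hinv : HasFDerivAt (fun z : ℂ × ℂ => (u z.1 - z.2)⁻¹) _ y :=
    (hasDerivAt_inv hne).comp_hasFDerivAt y hdd
  rw [h5.fderiv_eq, (h3.differentiableAt.hasFDerivAt.fun_mul (hinv.pow m)).fderiv]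
  -- The case `m = 0` is separate because the power rule has the exponent `m - 1`.
  rcases m with _ | m
  · simp only [add_apply, smul_apply, smul_eq_mul]
    simp
    field_simp
  · simp [pow_succ]
    field_simp
    ring

theorem tendsto (hf : HasPole u m f a) :
    Tendsto (fun l => (u 0 - l) ^ m * f (0, l)) (𝓝[≠] (u 0)) (𝓝 a) := by
  obtain ⟨g, hg, h0, hfg⟩ := hf
  have hc : ContinuousAt (fun l : ℂ => ((0, l) : ℂ × ℂ)) (u 0) :=
    (Continuous.prodMk_right (0 : ℂ)).continuousAt
  have h1 : Tendsto (fun l => g (0, l)) (𝓝[≠] (u 0)) (𝓝 a) := by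
    rw [← h0]
    exact (ContinuousAt.comp (f := fun l : ℂ => ((0, l) : ℂ × ℂ)) hg.continuousAt hc).tendsto.mono_left
      nhdsWithin_le_nhds
  refine h1.congr' ?_
  filter_upwards [(hc.eventually hfg).filter_mono nhdsWithin_le_nhds, self_mem_nhdsWithin]
    with l h2 h3
  have hne : u 0 - l ≠ 0 := sub_ne_zero.2 (Ne.symm h3)
  rw [h2 h3, inv_pow]
  field_simp

end HasPole

/-- Entrywise version of `HasPole`. -/
def MatHasPole {m n : Type*} (u : ℂ → ℂ) (k : ℕ) (F : ℂ × ℂ → Matrix m n ℂ) (A : Matrix m n ℂ) :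
    Prop :=
  ∀ i j, HasPole u k (fun y => F y i j) (A i j)

namespace MatHasPole

variable {m n l : Type*} {u : ℂ → ℂ} {k k' : ℕ} {F F' : ℂ × ℂ → Matrix m n ℂ} {A A' : Matrix m n ℂ}

theorem of_analytic (hF : MatAnalyticAt F (0, u 0)) : MatHasPole u 0 F (F (0, u 0)) := fun i j =>
  HasPole.of_analytic (hF i j)

theorem add (hF : MatHasPole u k F A) (hF' : MatHasPole u k F' A') :
    MatHasPole u k (fun y => F y + F' y) (A + A') := fun i j => (hF i j).add (hF' i j)

theorem neg (hF : MatHasPole u k F A) : MatHasPole u k (fun y => -F y) (-A) := fun i j => by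
  simpa using (hF i j).const_mul (-1)

theorem mul [Fintype n] {G : ℂ × ℂ → Matrix n l ℂ} {B : Matrix n l ℂ} (hF : MatHasPole u k F A)
    (hG : MatHasPole u k' G B) : MatHasPole u (k + k') (fun y => F y * G y) (A * B) := fun i j => by
  simp only [Matrix.mul_apply]
  exact HasPole.sum _ fun x _ => (hF i x).mul (hG x j)

theorem transpose (hF : MatHasPole u k F A) :
    MatHasPole u k (fun y => (F y).transpose) A.transpose := fun i j => hF j i

theorem matDeriv (hu : AnalyticAt ℂ u 0) (hF : MatHasPole u k F A) (c : ℂ × ℂ) :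
    MatHasPole u (k + 1) (matDeriv c F) ((-(k * (deriv u 0 * c.1 - c.2))) • A) := fun i j => by
  have := (hF i j).fderiv_apply hu c
  have e : ((-(k * (deriv u 0 * c.1 - c.2))) • A) i j
      = -(k * A i j * (deriv u 0 * c.1 - c.2)) := by
    rw [Matrix.smul_apply, smul_eq_mul]; ring
  rw [e]
  exact this

theorem of_eq {B : Matrix m n ℂ} (hF : MatHasPole u k F A) (h : A = B) : MatHasPole u k F B :=
  h ▸ hF

end MatHasPole

/-! ### The numbers `½ (½ + 1) ⋯ (½ + k - 1)` -/

/-- The rising factorial of `½`. -/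
def halfRising : ℕ → ℝ
  | 0 => 1
  | k + 1 => (k + 1 / 2) * halfRising k

theorem halfRising_pos (k : ℕ) : 0 < halfRising k := by
  induction k with
  | zero => exact one_pos
  | succ k ih => exact mul_pos (by positivity) ih

/-- Vandermonde convolution `∑ C(s,k) (½)_k (½)_{s-k} = (1)_s`, or the fact that the square of `(1 -
x)^{-1/2}` is `(1 - x)⁻¹`. In the induction Pascal's rule produces the factor `(i + ½) + (j + ½) = s
+ 1`. -/
theorem sum_choose_halfRising (s : ℕ) :
    ∑ x ∈ Finset.HasAntidiagonal.antidiagonal s, (s.choose x.1 : ℝ) * (halfRising x.1 * halfRising x.2)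
      = s.factorial := by
  induction s with
  | zero => simp [halfRising]
  | succ s ih =>
    rw [Finset.sum_antidiagonal_choose_succ_mul (fun i j => halfRising i * halfRising j),
      Nat.factorial_succ, Nat.cast_mul, ← ih, Finset.mul_sum, ← Finset.sum_add_distrib]
    refine Finset.sum_congr rfl fun x hx => ?_
    have hx' := Finset.HasAntidiagonal.mem_antidiagonal.1 hx
    have h1 : s.choose x.2 = s.choose x.1 := by
      rw [← hx', Nat.add_comm x.1, Nat.choose_symm_add, Nat.add_comm]
    have h2 : ((s + 1 : ℕ) : ℝ) = x.1 + x.2 + 1 := by rw [← hx']; push_cast; ring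
    rw [h1, h2, halfRising, halfRising]
    ring

/-- By the convolution and `(s+1) C(s,k) = (k+1) C(s+1,k+1)`, the factorial `(s+1)!` is the same sum
with weight `k + 1` in place of `k`. The difference is `∑ C(s+1,k+1) (½)_k (½)_{s-k}` over `0 ≤ k ≤
s`. -/
theorem factorial_sub_sum_pos (s : ℕ) :
    0 < ((s + 1).factorial : ℝ) - ∑ k ∈ Finset.Icc 1 s,
      (k : ℝ) * ((s + 1).choose (k + 1) : ℝ) * (halfRising k * halfRising (s - k)) := by
  have h0 : ∑ k ∈ Finset.Icc 1 s,
      (k : ℝ) * ((s + 1).choose (k + 1) : ℝ) * (halfRising k * halfRising (s - k))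
      = ∑ k ∈ Finset.range (s + 1),
      (k : ℝ) * ((s + 1).choose (k + 1) : ℝ) * (halfRising k * halfRising (s - k)) := by
    refine Finset.sum_subset (fun k hk => ?_) fun k hk hk' => ?_
    · have := Finset.mem_Icc.1 hk
      exact Finset.mem_range.2 (by omega)
    · have h1 := Finset.mem_range.1 hk
      have : k = 0 := by
        by_contra h2
        exact hk' (Finset.mem_Icc.2 ⟨by omega, by omega⟩)
      simp [this]
  have h1 : ((s + 1).factorial : ℝ) = ∑ k ∈ Finset.range (s + 1),
      ((s + 1 : ℕ) : ℝ) * (s.choose k : ℝ) * (halfRising k * halfRising (s - k)) := by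
    rw [Nat.factorial_succ, Nat.cast_mul, ← sum_choose_halfRising s,
      Finset.Nat.sum_antidiagonal_eq_sum_range_succ
        (fun i j => (s.choose i : ℝ) * (halfRising i * halfRising j)), Finset.mul_sum]
    exact Finset.sum_congr rfl fun _ _ => by ring
  rw [h0, h1, ← Finset.sum_sub_distrib]
  refine Finset.sum_pos (fun k hk => ?_) ⟨0, by simp⟩
  have h2 : ((s + 1 : ℕ) : ℝ) * (s.choose k : ℝ) = ((s + 1).choose (k + 1) : ℝ) * (k + 1) := by
    exact_mod_cast Nat.add_one_mul_choose_eq s k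
  have h3 : 0 < (s + 1).choose (k + 1) := Nat.choose_pos (by have := Finset.mem_range.1 hk; omega)
  have h4 : (0 : ℝ) < (s + 1).choose (k + 1) := by exact_mod_cast h3
  rw [h2, ← sub_mul]
  have := halfRising_pos k
  have := halfRising_pos (s - k)
  have h5 : ((s + 1).choose (k + 1) : ℝ) * (k + 1) - k * (s + 1).choose (k + 1)
      = (s + 1).choose (k + 1) := by ring
  rw [h5]
  positivity

/-! ### Poles of `K^{γ,s}` at the canonical coordinates -/

namespace CanonicalChart

open GenFrobeniusManifold

variable {n N : ℕ} {M : GenFrobeniusManifold n} (X : CanonicalChart M) {v : Vec n}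

/-- Multiplication by the idempotent `∂/∂u_i`. -/
def idem (i : Fin n) (v : Vec n) : Matrix (Fin n) (Fin n) ℂ :=
  invJac X.u v * Matrix.diagonal (Pi.single i 1) * jac X.u v

theorem idem_eq_Ψ (hv : v ∈ X.D) (i : Fin n) :
    X.idem i v = (X.Ψ v)⁻¹ * Matrix.diagonal (Pi.single i 1) * X.Ψ v :=
  (X.Ψ_conj_diagonal hv _).symm

/-- The diagonal of `V` vanishes, so only the `½` of `μ + ½` survives between two copies of an
idempotent. This is the origin of the rising factorials of `½`. -/
theorem idem_muPlus_idem (hv : v ∈ X.D) (i : Fin n) :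
    X.idem i v * M.muPlus * X.idem i v = (1 / 2 : ℂ) • X.idem i v := by
  have h : Matrix.diagonal (Pi.single i (1 : ℂ)) * (X.Ψ v * M.muPlus * (X.Ψ v)⁻¹)
      * Matrix.diagonal (Pi.single i 1) = (1 / 2 : ℂ) • Matrix.diagonal (Pi.single i 1) := by
    have h1 : X.Ψ v * M.muPlus * (X.Ψ v)⁻¹ = X.V v + (1 / 2 : ℂ) • 1 := by
      rw [muPlus, V, Matrix.mul_add, Matrix.add_mul, Matrix.mul_smul, Matrix.smul_mul, Matrix.mul_one,
        X.Ψ_mul_inv hv]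
    rw [h1]
    ext k l
    rw [Matrix.mul_diagonal, Matrix.diagonal_mul]
    by_cases hk : k = i
    · subst hk
      by_cases hl : l = k
      · subst hl; simp [X.V_diag hv]
      · simp [hl, Ne.symm hl]
    · by_cases hl : l = k
      · subst hl; simp [hk]
      · simp [hk, Ne.symm hl]
  rw [X.idem_eq_Ψ hv]
  calc _ = (X.Ψ v)⁻¹ * (Matrix.diagonal (Pi.single i 1) * (X.Ψ v * M.muPlus * (X.Ψ v)⁻¹)
      * Matrix.diagonal (Pi.single i 1)) * X.Ψ v := by noncomm_ring
    _ = _ := by rw [h, Matrix.mul_smul, Matrix.smul_mul]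

theorem idem_η_inv (hv : v ∈ X.D) (i : Fin n) :
    X.idem i v * M.η⁻¹ = M.η⁻¹ * (X.idem i v).transpose := by
  have h : X.idem i v * M.η⁻¹
      = (X.Ψ v)⁻¹ * Matrix.diagonal (Pi.single i 1) * (X.Ψ v)⁻¹.transpose := by
    rw [X.idem_eq_Ψ hv, Matrix.mul_assoc, X.Ψ_inv_transpose hv]
  have h2 : (X.idem i v * M.η⁻¹).transpose = X.idem i v * M.η⁻¹ := by
    rw [h, Matrix.transpose_mul, Matrix.transpose_mul, Matrix.transpose_transpose,
      Matrix.diagonal_transpose, Matrix.mul_assoc]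
  rw [← h2, Matrix.transpose_mul, η_inv_symm]

section Pole

variable (j : Jet N n) (i : Fin n)

/-- The canonical coordinate along the curve. -/
def curveU (x : ℂ) : ℂ := X.u i (jetCurve j x)

variable {j} (hj : j 0 ∈ X.D)
include hj

theorem jetCurve_zero_mem : jetCurve j 0 ∈ X.D := by rwa [jetCurve_zero]

theorem curveU_analytic : AnalyticAt ℂ (X.curveU j i) 0 :=
  (X.u_analytic i _ (X.jetCurve_zero_mem hj)).fun_comp (jetCurve_analytic j 0)

omit hj in
theorem curveU_zero : X.curveU j i 0 = X.u i (j 0) := by rw [curveU, jetCurve_zero]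

theorem deriv_curveU : deriv (X.curveU j i) 0 = fderiv ℂ (X.u i) (j 0) (jetVel j 0) := by
  have h := (X.u_analytic i _ (X.jetCurve_zero_mem hj)).differentiableAt.hasFDerivAt.comp_hasDerivAt
    0 (jetCurve_analytic j 0).differentiableAt.hasDerivAt
  have h2 := h.deriv
  rw [jetCurve_zero] at h2
  exact h2

/-- The values `u_k` are distinct, so near `λ = u_i` no other canonical coordinate is met. -/
theorem eventually_regular : ∀ᶠ y in 𝓝 ((0, X.curveU j i 0) : ℂ × ℂ),
    y.2 ≠ X.curveU j i y.1 → y ∈ X.regularSet j := by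
  have hD : ∀ᶠ y in 𝓝 ((0, X.curveU j i 0) : ℂ × ℂ), jetCurve j y.1 ∈ X.D :=
    (((jetCurve_analytic j 0).continuousAt.comp_of_eq continuousAt_fst rfl).eventually
      (X.isOpen_D.eventually_mem (X.jetCurve_zero_mem hj)))
  have hk : ∀ᶠ y in 𝓝 ((0, X.curveU j i 0) : ℂ × ℂ), ∀ k, k ≠ i → y.2 ≠ X.curveU j k y.1 := by
    refine eventually_all.2 fun k => ?_
    by_cases hki : k = i
    · exact Eventually.of_forall fun y h => absurd hki h
    have h1 : ContinuousAt (fun y : ℂ × ℂ => X.curveU j k y.1) (0, X.curveU j i 0) :=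
      (X.curveU_analytic k hj).continuousAt.comp_of_eq continuousAt_fst rfl
    refine ((ContinuousAt.ne_iff_eventually_ne continuousAt_snd h1).1 ?_).mono fun y hy _ => hy
    exact X.u_distinct _ (X.jetCurve_zero_mem hj) i k (Ne.symm hki)
  filter_upwards [hD, hk] with y h1 h2 hy
  refine ⟨h1, fun k => ?_⟩
  by_cases hki : k = i
  · rw [hki]; exact hy
  · exact h2 k hki

theorem hasPole_curveU_inv (k : Fin n) :
    HasPole (X.curveU j i) 1 (fun y => (X.curveU j k y.1 - y.2)⁻¹) (Pi.single (M := fun _ => ℂ) i 1 k) := by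
  by_cases hki : k = i
  · subst hki
    rw [Pi.single_eq_same]
    exact ⟨fun _ => 1, analyticAt_const, rfl, Eventually.of_forall fun y _ => by simp⟩
  · rw [Pi.single_eq_of_ne hki]
    refine HasPole.raise_succ (X.curveU_analytic i hj) (HasPole.of_analytic ?_)
    refine AnalyticAt.fun_inv ?_ ?_
    · exact (AnalyticAt.fun_comp (f := fun y : ℂ × ℂ => y.1) (X.curveU_analytic k hj)
        analyticAt_fst).fun_sub analyticAt_snd
    · exact sub_ne_zero.2 (X.u_distinct _ (X.jetCurve_zero_mem hj) k i hki)

omit hj in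
theorem curve_matAnalytic {F : Vec n → Matrix (Fin n) (Fin n) ℂ} (hF : MatAnalyticAt F (jetCurve j 0)) (l : ℂ) :
    MatAnalyticAt (fun y : ℂ × ℂ => F (jetCurve j y.1)) (0, l) :=
  MatAnalyticAt.comp (f := fun y : ℂ × ℂ => jetCurve j y.1) hF
    ((jetCurve_analytic j 0).fun_comp_of_eq analyticAt_fst rfl)

/-- Among the eigenvalues `(u_k - λ)⁻¹` of the resolvent only the one with `k = i` is singular; its
eigenprojection is multiplication by `∂/∂u_i`. -/
theorem curveRes_hasPole : MatHasPole (X.curveU j i) 1 (curveRes M j) (X.idem i (j 0)) := by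
  have h1 : MatHasPole (X.curveU j i) (0 + 1 + 0) (fun y => invJac X.u (jetCurve j y.1)
      * (Matrix.diagonal fun k => (X.curveU j k y.1 - y.2)⁻¹) * jac X.u (jetCurve j y.1))
      (X.idem i (j 0)) := by
    refine MatHasPole.of_eq (((MatHasPole.of_analytic (curve_matAnalytic
      (X.invJac_analytic (X.jetCurve_zero_mem hj)) _)).mul ?_).mul
      (MatHasPole.of_analytic (curve_matAnalytic
      (X.jac_analytic (X.jetCurve_zero_mem hj)) _)))
      (by rw [idem, jetCurve_zero])
    intro k l
    by_cases hkl : k = l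
    · subst hkl
      simpa using X.hasPole_curveU_inv i hj k
    · simpa [hkl] using HasPole.zero
  intro k l
  refine (h1 k l).congr ?_
  filter_upwards [X.eventually_regular i hj] with y hy hne
  rw [curveRes, X.res_eq (hy hne).1 (hy hne).2]
  rfl

theorem velMul_zero : velMul M j 0 = invJac X.u (j 0) *
    (Matrix.diagonal ((jac X.u (j 0)).mulVec (jetVel j 0))) * jac X.u (j 0) := by
  rw [velMul, jetCurve_zero, X.sum_smul_mulBy hj]

theorem jac_mulVec_vel : (jac X.u (j 0)).mulVec (jetVel j 0) i = deriv (X.curveU j i) 0 := by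
  rw [X.deriv_curveU i hj, fderiv_eq_sum_pd]
  simp [Matrix.mulVec, dotProduct, jac, mul_comm]

theorem idem_mul_velMul :
    X.idem i (j 0) * velMul M j 0 = deriv (X.curveU j i) 0 • X.idem i (j 0) := by
  rw [X.velMul_zero hj, idem]
  have h : Matrix.diagonal (Pi.single i (1 : ℂ))
      * Matrix.diagonal ((jac X.u (j 0)).mulVec (jetVel j 0))
      = deriv (X.curveU j i) 0 • Matrix.diagonal (Pi.single i 1) := by
    rw [Matrix.diagonal_mul_diagonal, ← Matrix.diagonal_smul]
    congr 1; funext k; by_cases hk : k = i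
    · subst hk; simp [X.jac_mulVec_vel k hj]
    · simp [hk]
  calc _ = invJac X.u (j 0) * (Matrix.diagonal (Pi.single i 1) * (jac X.u (j 0) * invJac X.u (j 0))
        * Matrix.diagonal ((jac X.u (j 0)).mulVec (jetVel j 0))) * jac X.u (j 0) := by noncomm_ring
    _ = _ := by rw [X.jac_mul_invJac hj, mul_one, h, Matrix.mul_smul, Matrix.smul_mul]

theorem idem_mulVec_vel (γ : Fin n) : (X.idem i (j 0)).mulVec (jetVel j 0) γ
    = deriv (X.curveU j i) 0 * invJac X.u (j 0) γ i := by
  rw [idem, ← Matrix.mulVec_mulVec, ← Matrix.mulVec_mulVec]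
  have h : (Matrix.diagonal (Pi.single i (1 : ℂ))).mulVec ((jac X.u (j 0)).mulVec (jetVel j 0))
      = Pi.single i (deriv (X.curveU j i) 0) := by
    funext k
    rw [Matrix.mulVec_diagonal]
    by_cases hk : k = i
    · subst hk; simp [X.jac_mulVec_vel k hj]
    · simp [hk]
  rw [h, Matrix.mulVec_single]
  simp [mul_comm]

theorem curveConn_hasPole : MatHasPole (X.curveU j i) 1 (curveConn M j)
    (-(deriv (X.curveU j i) 0 • (X.idem i (j 0) * M.muPlus))) := by
  have h : MatHasPole (X.curveU j i) (1 + 0 + 0) _ _ :=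
    (((X.curveRes_hasPole i hj).mul (MatHasPole.of_analytic
      (MatAnalyticAt.comp (f := fun y : ℂ × ℂ => y.1)
        (X.velMul_analytic j (X.jetCurve_zero_mem hj)) analyticAt_fst))).mul
      (MatHasPole.of_analytic (matAnalyticAt_const M.muPlus _))).neg
  refine MatHasPole.of_eq h ?_
  rw [X.idem_mul_velMul i hj, Matrix.smul_mul]

/-- The leading coefficients of `gradJet`. -/
def gradPole (j : Jet N n) (i : Fin n) : ℕ → Matrix (Fin n) (Fin n) ℂ
  | 0 => 1
  | m + 1 => -(deriv (X.curveU j i) 0 • ((m : ℂ) • gradPole j i m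
      + gradPole j i m * (X.idem i (j 0) * M.muPlus)))

/-- Each application of `∂_x` multiplies the leading coefficient by `-m u_{i,x}` through the moving
pole, and the connection adds the term with `-u_{i,x} π_i μ₊`, where `π_i` is the idempotent. -/
theorem gradJet_hasPole (m : ℕ) :
    MatHasPole (X.curveU j i) m (gradJet M j m) (X.gradPole j i m) := by
  induction m with
  | zero => exact MatHasPole.of_analytic (matAnalyticAt_const _ _)
  | succ m ih =>
    refine MatHasPole.of_eq ((ih.matDeriv (X.curveU_analytic i hj) (1, 0)).add
      (ih.mul (X.curveConn_hasPole i hj))) ?_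
    rw [gradPole, Matrix.mul_neg, Matrix.mul_smul, smul_add, smul_smul]
    simp only [mul_one, sub_zero]
    rw [neg_smul, ← neg_add, mul_comm (m : ℂ)]

/-- The row vector `⟨v_x, ·⟩`. -/
def velRow (M : GenFrobeniusManifold n) (j : Jet N n) : Matrix Unit (Fin n) ℂ :=
  Matrix.of fun _ γ => ∑ δ, jetVel j 0 δ * M.η δ γ

theorem rowJet_hasPole (k : ℕ) :
    MatHasPole (X.curveU j i) k (rowJet M j k) (velRow M j * X.gradPole j i k) := by
  induction k with
  | zero =>
    refine MatHasPole.of_eq (MatHasPole.of_analytic ?_) (Matrix.mul_one _).symm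
    intro _ γ
    change AnalyticAt ℂ (fun w : ℂ × ℂ => ∑ δ, jetVel j w.1 δ * M.η δ γ) _
    refine Finset.analyticAt_fun_sum _ fun δ _ => AnalyticAt.mul ?_ analyticAt_const
    have h : AnalyticAt ℂ (fun z : ℂ × ℂ => jetVel j z.1) (0, X.curveU j i 0) :=
      (jetVel_analytic j 0).fun_comp_of_eq analyticAt_fst rfl
    exact ((ContinuousLinearMap.proj (R := ℂ) (φ := fun _ : Fin n => ℂ) δ).analyticAt _).fun_comp h
  | succ k ih =>
    refine MatHasPole.of_eq ((ih.matDeriv (X.curveU_analytic i hj) (1, 0)).add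
      (ih.mul (X.curveConn_hasPole i hj))) ?_
    rw [gradPole, Matrix.mul_neg, Matrix.mul_neg, Matrix.mul_smul, Matrix.mul_smul, Matrix.mul_add,
      smul_add, Matrix.mul_smul, smul_smul]
    simp only [mul_one, sub_zero]
    rw [neg_smul, ← neg_add, mul_comm (k : ℂ), Matrix.mul_assoc]

theorem rowJetDeriv_hasPole (k : ℕ) :
    MatHasPole (X.curveU j i) (k + 1) (rowJetDeriv M j k)
      (velRow M j * ((k : ℂ) • X.gradPole j i k + X.gradPole j i k * (X.idem i (j 0) * M.muPlus))) := by
  have h : MatHasPole (X.curveU j i) (1 + 0) _ _ := (X.curveRes_hasPole i hj).mul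
      (MatHasPole.of_analytic (matAnalyticAt_const M.muPlus _))
  refine MatHasPole.of_eq (((X.rowJet_hasPole i hj k).matDeriv (X.curveU_analytic i hj) (0, 1)).add
    ((X.rowJet_hasPole i hj k).mul h)) ?_
  simp [Matrix.mul_add, Matrix.mul_assoc]

/-- Because `π_i μ₊ π_i = ½ π_i`, the matrix recursion becomes scalar on the range of `π_i`, with
factors `-u_{i,x}(m + ½)`. -/
theorem gradPole_mul_idem (m : ℕ) : X.gradPole j i m * X.idem i (j 0)
    = ((-deriv (X.curveU j i) 0) ^ m * (halfRising m : ℂ)) • X.idem i (j 0) := by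
  induction m with
  | zero => simp [gradPole, halfRising]
  | succ m ih =>
    rw [gradPole, Matrix.neg_mul, Matrix.smul_mul, Matrix.add_mul, Matrix.smul_mul,
      Matrix.mul_assoc _ (_ * _), X.idem_muPlus_idem hj, Matrix.mul_smul, ← add_smul, ih, smul_smul,
      smul_smul, ← neg_smul, halfRising]
    congr 1
    push_cast
    ring

/-- The derivatives `∂_x^s (1 / (E - λe))^γ` along the curve. -/
def poleJet (j : Jet N n) (γ : Fin n) : ℕ → ℂ × ℂ → ℂ
  | 0 => fun y => ∑ k, invJac X.u (jetCurve j y.1) γ k * (X.curveU j k y.1 - y.2)⁻¹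
  | s + 1 => fun y => fderiv ℂ (poleJet j γ s) y (1, 0)

omit hj in
theorem poleJet_analytic {y : ℂ × ℂ} (hy : y ∈ X.regularSet j) (γ : Fin n) (s : ℕ) :
    AnalyticAt ℂ (X.poleJet j γ s) y := by
  induction s with
  | zero =>
    refine Finset.analyticAt_fun_sum _ fun k _ => AnalyticAt.fun_mul ?_ (AnalyticAt.fun_inv ?_ ?_)
    · exact AnalyticAt.fun_comp (f := fun y : ℂ × ℂ => jetCurve j y.1)
        (X.invJac_analytic hy.1 γ k) ((jetCurve_analytic j y.1).fun_comp analyticAt_fst)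
    · exact (AnalyticAt.fun_comp (f := fun y : ℂ × ℂ => jetCurve j y.1)
        (X.u_analytic k _ hy.1) ((jetCurve_analytic j y.1).fun_comp analyticAt_fst)).fun_sub
        analyticAt_snd
    · exact sub_ne_zero.2 (hy.2 k).symm
  | succ s ih => exact analyticAt_fderiv_apply ih _

omit hj in
theorem iteratedDeriv_poleJet (γ : Fin n) (s : ℕ) {x l : ℂ} (hy : (x, l) ∈ X.regularSet j) :
    iteratedDeriv s (fun x => X.poleJet j γ 0 (x, l)) x = X.poleJet j γ s (x, l) := by
  induction s generalizing x with
  | zero => simp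
  | succ s ih =>
    have h1 : ∀ᶠ x' in 𝓝 x, (x', l) ∈ X.regularSet j :=
      (Continuous.prodMk_left l).continuousAt.eventually (X.eventually_mem_regularSet j hy)
    have h2 := h1.mono fun x' hx' => ih hx'
    rw [iteratedDeriv_succ, Filter.EventuallyEq.deriv_eq h2, ← fderiv_apply_one_eq_deriv,
      fderiv_slice_left (X.poleJet_analytic hy γ s).differentiableAt]
    rfl

/-- Only the summand `k = i` is singular, and each derivative of a pole of order `s + 1` in `u_i -
λ` contributes the factor `-(s + 1) u_{i,x}`. -/
theorem poleJet_hasPole (γ : Fin n) (s : ℕ) :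
    HasPole (X.curveU j i) (s + 1) (X.poleJet j γ s)
      ((-deriv (X.curveU j i) 0) ^ s * (s.factorial : ℂ) * invJac X.u (j 0) γ i) := by
  induction s with
  | zero =>
    have h : HasPole (X.curveU j i) (0 + 1) _ _ := HasPole.sum Finset.univ fun k _ =>
      (HasPole.of_analytic (curve_matAnalytic (X.invJac_analytic (X.jetCurve_zero_mem hj))
        (X.curveU j i 0) γ k)).mul (X.hasPole_curveU_inv i hj k)
    have e : ∑ k, invJac X.u (jetCurve j ((0, X.curveU j i 0) : ℂ × ℂ).1) γ k
        * Pi.single (M := fun _ => ℂ) i 1 k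
        = (-deriv (X.curveU j i) 0) ^ 0 * ((0 : ℕ).factorial : ℂ) * invJac X.u (j 0) γ i := by
      simp [jetCurve_zero, Pi.single_apply]
    rw [← e]
    exact h
  | succ s ih =>
    have h := ih.fderiv_apply (X.curveU_analytic i hj) (1, 0)
    have e : -(((s + 1 : ℕ) : ℂ) * ((-deriv (X.curveU j i) 0) ^ s * (s.factorial : ℂ)
        * invJac X.u (j 0) γ i) * (deriv (X.curveU j i) 0 * 1 - 0))
        = (-deriv (X.curveU j i) 0) ^ (s + 1) * ((s + 1).factorial : ℂ) * invJac X.u (j 0) γ i := by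
      rw [Nat.factorial_succ]; push_cast; ring
    rw [← e]
    exact h

omit hj in
theorem velRow_transpose : (velRow M j).transpose = M.η * Matrix.of fun γ _ => jetVel j 0 γ := by
  ext γ _
  simp only [velRow, Matrix.transpose_apply, Matrix.of_apply, Matrix.mul_apply]
  exact Finset.sum_congr rfl fun δ _ => by rw [mul_comm, M.η_symm.apply]

/-- The gradient factor gives `(½)_{s-k}`. The other factor has `k - 1` derivatives in `x` and one
in `λ` beyond the regular row `⟨v_x, ·⟩`, hence `(½)_k`. The derivative in `λ` comes without the
factor `-u_{i,x}`, whereas `⟨v_x, ·⟩` supplies a factor `u_{i,x}`, which explains the minus sign. -/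
theorem curveK_term_hasPole (γ : Fin n) {s k : ℕ} (hk : 1 ≤ k) (hks : k ≤ s) :
    HasPole (X.curveU j i) (s + 1) (fun y => (gradJet M j (s - k) y * (curveRes M j y * M.η⁻¹)
        * (rowJetDeriv M j (k - 1) y).transpose) γ ())
      (-((-deriv (X.curveU j i) 0) ^ s * ((halfRising k : ℂ) * (halfRising (s - k) : ℂ))
        * invJac X.u (j 0) γ i)) := by
  obtain ⟨k, rfl⟩ : ∃ k', k = k' + 1 := ⟨k - 1, by omega⟩
  obtain ⟨r, rfl⟩ : ∃ r, s = k + 1 + r := ⟨s - (k + 1), by omega⟩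
  rw [Nat.add_sub_cancel, Nat.add_sub_cancel_left]
  have h : MatHasPole (X.curveU j i) (r + (1 + 0) + (k + 1)) _ _ :=
    (((X.gradJet_hasPole i hj r).mul ((X.curveRes_hasPole i hj).mul
    (MatHasPole.of_analytic (matAnalyticAt_const M.η⁻¹ _)))).mul
      (X.rowJetDeriv_hasPole i hj k).transpose)
  have e : r + (1 + 0) + (k + 1) = k + 1 + r + 1 := by omega
  rw [e] at h
  refine cast (congrArg (HasPole _ _ _) ?_) (h γ ())
  set P := X.idem i (j 0) with hP
  set ux := deriv (X.curveU j i) 0 with hux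
  set B := (k : ℂ) • X.gradPole j i k + X.gradPole j i k * (P * M.muPlus) with hB
  have hBP : B * P = (((k : ℂ) + 1 / 2) * ((-ux) ^ k * (halfRising k : ℂ))) • P := by
    rw [hB, Matrix.add_mul, Matrix.smul_mul, Matrix.mul_assoc _ (_ * _), X.idem_muPlus_idem hj,
      Matrix.mul_smul, ← add_smul, X.gradPole_mul_idem i hj, smul_smul]
  have h1 : X.gradPole j i r * (P * M.η⁻¹) * (velRow M j * B).transpose
      = ((-ux) ^ r * (halfRising r : ℂ)) • (M.η⁻¹ * (B * P).transpose * (velRow M j).transpose) := by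
    have h3 : X.gradPole j i r * P = ((-ux) ^ r * (halfRising r : ℂ)) • P :=
      X.gradPole_mul_idem i hj r
    have h4 : P * M.η⁻¹ = M.η⁻¹ * P.transpose := X.idem_η_inv hj i
    rw [← Matrix.mul_assoc, h3, Matrix.smul_mul, h4, Matrix.transpose_mul, Matrix.transpose_mul,
      Matrix.smul_mul]
    simp only [Matrix.mul_assoc]
  rw [h1, hBP, Matrix.transpose_smul, Matrix.mul_smul, ← X.idem_η_inv hj, velRow_transpose,
    Matrix.smul_mul, ← Matrix.mul_assoc, Matrix.mul_assoc P, η_inv_mul, Matrix.mul_one, smul_smul,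
    Matrix.smul_apply, Matrix.mul_apply]
  have h2 := X.idem_mulVec_vel i hj γ
  rw [Matrix.mulVec, dotProduct] at h2
  simp only [Matrix.of_apply]
  rw [h2, halfRising, ← hux, smul_eq_mul]
  push_cast
  ring

/-- The leading coefficient of `K^{γ,s}` at `λ = u_i`, without the factor `u_{i,x}^s ∂v^γ/∂u_i`. -/
def poleConst (s : ℕ) : ℝ := (-1) ^ s * (((s + 1).factorial : ℝ) - ∑ k ∈ Finset.Icc 1 s,
      (k : ℝ) * ((s + 1).choose (k + 1) : ℝ) * (halfRising k * halfRising (s - k)))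

omit hj in
theorem poleConst_ne_zero (s : ℕ) : poleConst s ≠ 0 :=
  mul_ne_zero (pow_ne_zero _ (by norm_num)) (factorial_sub_sum_pos s).ne'

/-- The vector field `1/(E - λe)` contributes `(s + 1) s! = (s + 1)!`, and the terms `k = 1, …, s`
subtract the weighted products of rising factorials. -/
theorem curveK_tendsto (γ : Fin n) (s : ℕ) :
    Tendsto (fun l => (X.u i (j 0) - l) ^ (s + 1) * X.curveK j γ s l) (𝓝[≠] (X.u i (j 0)))
      (𝓝 ((poleConst s : ℂ) * deriv (X.curveU j i) 0 ^ s * invJac X.u (j 0) γ i)) := by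
  have h := ((X.poleJet_hasPole i hj γ s).const_mul ((s : ℂ) + 1)).add
    (HasPole.sum (Finset.Icc 1 s) fun k hk =>
      (X.curveK_term_hasPole i hj γ (Finset.mem_Icc.1 hk).1 (Finset.mem_Icc.1 hk).2).const_mul
        ((k : ℂ) * ((s + 1).choose (k + 1) : ℂ)))
  have ht := h.tendsto
  rw [X.curveU_zero i] at ht
  have e : ((s : ℂ) + 1) * ((-deriv (X.curveU j i) 0) ^ s * (s.factorial : ℂ) * invJac X.u (j 0) γ i)
      + ∑ k ∈ Finset.Icc 1 s, (k : ℂ) * ((s + 1).choose (k + 1) : ℂ) *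
        (-((-deriv (X.curveU j i) 0) ^ s * ((halfRising k : ℂ) * (halfRising (s - k) : ℂ))
        * invJac X.u (j 0) γ i))
      = (poleConst s : ℂ) * deriv (X.curveU j i) 0 ^ s * invJac X.u (j 0) γ i := by
    rw [poleConst, Nat.factorial_succ]
    push_cast
    rw [neg_pow, mul_sub, sub_mul, sub_mul, sub_eq_add_neg, Finset.mul_sum, Finset.sum_mul,
      Finset.sum_mul, ← Finset.sum_neg_distrib]
    congr 1
    · ring
    · exact Finset.sum_congr rfl fun _ _ => by ring
  rw [← e]
  refine ht.congr' ?_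
  have hreg : ∀ᶠ l in 𝓝[≠] (X.u i (j 0)), ((0 : ℂ), l) ∈ X.regularSet j := by
    have hc : ContinuousAt (fun l : ℂ => ((0, l) : ℂ × ℂ)) (X.curveU j i 0) :=
      (Continuous.prodMk_right (0 : ℂ)).continuousAt
    have := (hc.eventually (X.eventually_regular i hj)).filter_mono
      (nhdsWithin_le_nhds (s := {X.curveU j i 0}ᶜ))
    rw [X.curveU_zero i] at this
    filter_upwards [this, self_mem_nhdsWithin] with l h1 h2
    refine h1 ?_
    rw [X.curveU_zero i]
    exact h2
  filter_upwards [hreg] with l hl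
  rw [curveK]
  congr 2
  congr 1
  exact (X.iteratedDeriv_poleJet γ s hl).symm

end Pole

end CanonicalChart

/-! ### Linear independence of the `K^{γ,s}` and uniqueness of the solution -/

namespace CanonicalChart

open GenFrobeniusManifold

variable {n N : ℕ} {M : GenFrobeniusManifold n} (X : CanonicalChart M)

section Uniqueness

variable {j : Jet N n} (hj : j 0 ∈ X.D)
include hj

theorem curveK_analyticOnNhd (γ : Fin n) (s : ℕ) :
    AnalyticOnNhd ℂ (X.curveK j γ s) {l | ∀ i, l ≠ X.u i (j 0)} := by
  intro l hl
  have hreg : ∀ {l}, (∀ i, l ≠ X.u i (j 0)) → ((0 : ℂ), l) ∈ X.regularSet j := fun h =>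
    ⟨X.jetCurve_zero_mem hj, fun i => by rw [jetCurve_zero]; exact h i⟩
  have hopen : ∀ᶠ l' in 𝓝 l, ∀ i, l' ≠ X.u i (j 0) :=
    eventually_all.2 fun i => isOpen_ne.eventually_mem (hl i)
  have e : X.curveK j γ s =ᶠ[𝓝 l] fun l => ((s : ℂ) + 1) * X.poleJet j γ s (0, l)
      + ∑ k ∈ Finset.Icc 1 s, (k : ℂ) * ((s + 1).choose (k + 1) : ℂ) *
      (gradJet M j (s - k) (0, l) * (curveRes M j (0, l) * M.η⁻¹)
        * (rowJetDeriv M j (k - 1) (0, l)).transpose) γ () := by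
    filter_upwards [hopen] with l' hl'
    rw [curveK]
    congr 2
    exact X.iteratedDeriv_poleJet γ s (hreg hl')
  refine AnalyticAt.congr ?_ e.symm
  have hy := hreg hl
  have hc : AnalyticAt ℂ (fun l : ℂ => ((0, l) : ℂ × ℂ)) l := analyticAt_const.prod analyticAt_id
  refine AnalyticAt.fun_add (analyticAt_const.fun_mul ((X.poleJet_analytic hy γ s).fun_comp hc))
    (Finset.analyticAt_fun_sum _ fun k _ => analyticAt_const.fun_mul ?_)
  exact ((((X.gradJet_analytic (s - k) hy).mul ((X.curveRes_analytic hy).mul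
    (matAnalyticAt_const M.η⁻¹ _))).mul (X.rowJetDeriv_analytic (k - 1) hy).transpose).comp hc) γ ()

/-- The functions `K^{γ,s}` of `λ` are linearly independent. -/
theorem eq_zero_of_sum_curveK (hux : ∀ i, fderiv ℂ (X.u i) (j 0) (jetVel j 0) ≠ 0)
    (a : Fin (N + 1) → Fin n → ℂ)
    (h : ∀ l, (∀ i, l ≠ X.u i (j 0)) → ∑ s : Fin (N + 1), ∑ γ, a s γ * X.curveK j γ s l = 0) :
    a = 0 := by
  funext s
  -- Descending induction on the order `s`. The relation is multiplied by `(u_i - λ)^{s+1}` and `λ`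
  -- tends to `u_i`: lower orders have weaker poles and disappear in the limit, higher ones have
  -- zero coefficients already.
  refine (wellFounded_gt (α := Fin (N + 1))).induction (C := fun s => a s = 0) s fun s ih => ?_
  have key : ∀ i, ∑ γ, a s γ * invJac X.u (j 0) γ i = 0 := by
    intro i
    set w := X.u i (j 0) with hw
    have hlim : Tendsto (fun l => ∑ s' : Fin (N + 1), ∑ γ, (w - l) ^ ((s : ℕ) + 1) *
        (a s' γ * X.curveK j γ s' l)) (𝓝[≠] w)
        (𝓝 (∑ s' : Fin (N + 1), ∑ γ, if s' = s then a s γ * ((poleConst s : ℂ) *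
          deriv (X.curveU j i) 0 ^ (s : ℕ) * invJac X.u (j 0) γ i) else 0)) := by
      refine tendsto_finsetSum _ fun s' _ => tendsto_finsetSum _ fun γ _ => ?_
      have ht := X.curveK_tendsto i hj γ s'
      rcases lt_trichotomy s' s with hlt | rfl | hgt
      · rw [if_neg hlt.ne]
        have h0 : Tendsto (fun l => a s' γ * (w - l) ^ ((s : ℕ) - (s' : ℕ))) (𝓝[≠] w) (𝓝 0) := by
          have : Continuous fun l => a s' γ * (w - l) ^ ((s : ℕ) - (s' : ℕ)) := by fun_prop
          have h1 := (this.tendsto w).mono_left (nhdsWithin_le_nhds (s := {w}ᶜ))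
          have h2 : (s : ℕ) - (s' : ℕ) ≠ 0 := by have : (s' : ℕ) < s := hlt; omega
          simpa [h2] using h1
        have h1 := h0.mul ht
        rw [zero_mul] at h1
        refine h1.congr fun l => ?_
        have h2 : (s : ℕ) + 1 = ((s : ℕ) - (s' : ℕ)) + ((s' : ℕ) + 1) := by
          have : (s' : ℕ) < s := hlt
          omega
        conv_rhs => rw [h2, pow_add]
        ring
      · rw [if_pos rfl]
        exact (ht.const_mul (a s' γ)).congr fun l => by ring
      · rw [if_neg hgt.ne', ih s' hgt]
        simp
    have hzero : (fun l => ∑ s' : Fin (N + 1), ∑ γ, (w - l) ^ ((s : ℕ) + 1) *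
        (a s' γ * X.curveK j γ s' l)) =ᶠ[𝓝[≠] w] fun _ => 0 := by
      have h1 : ∀ᶠ l in 𝓝[≠] w, ∀ k, l ≠ X.u k (j 0) := by
        refine eventually_all.2 fun k => ?_
        by_cases hk : X.u k (j 0) = w
        · rw [hk]; exact self_mem_nhdsWithin
        · exact (isOpen_ne.eventually_mem (Ne.symm hk)).filter_mono nhdsWithin_le_nhds
      filter_upwards [h1] with l hl
      rw [← mul_zero ((w - l) ^ ((s : ℕ) + 1)), ← h l hl, Finset.mul_sum]
      simp only [Finset.mul_sum]
    have h2 := tendsto_nhds_unique (hlim.congr' hzero) tendsto_const_nhds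
    rw [Finset.sum_eq_single s (fun s' _ hs' => by simp [hs']) (by simp)] at h2
    simp only [if_true] at h2
    have hc : (poleConst s : ℂ) * deriv (X.curveU j i) 0 ^ (s : ℕ) ≠ 0 := by
      refine mul_ne_zero (by exact_mod_cast poleConst_ne_zero s) (pow_ne_zero _ ?_)
      rw [X.deriv_curveU i hj]; exact hux i
    refine (mul_eq_zero.1 ((?_ : _ = _).trans h2)).resolve_left hc
    rw [Finset.mul_sum]
    exact Finset.sum_congr rfl fun _ _ => by ring
  -- The limits at all the `u_i` say that the covector `a s` vanishes on every `∂/∂u_i`.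
  have h3 : Matrix.vecMul (a s) (invJac X.u (j 0)) = 0 := by
    funext i; simpa [Matrix.vecMul, dotProduct] using key i
  exact Matrix.eq_zero_of_vecMul_eq_zero (X.det_invJac_ne_zero hj) h3

end Uniqueness

/-- Uniqueness of the solution of the loop equation, for period bases existing at all regular
points. -/
theorem exists_eq_add_const
    (hbasis : ∀ v ∈ X.D, ∃ lam : ℂ, lam ≠ 0 ∧ ∃ (W : Set (Vec n × ℂ)) (p : Fin n → Vec n → ℂ → ℂ),
      X.IsPeriodBasis W p ∧ (v, lam) ∈ W)
    {S : Vec n → ℂ → ℂ} (hN : 1 ≤ N) {U' : Set (Jet N n)} (hU' : IsOpen U')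
    (hpre : IsPreconnected U') (hD : ∀ j ∈ U', j 0 ∈ X.D)
    (hux : ∀ j ∈ U', ∀ i, fderiv ℂ (X.u i) (j 0) (j ⟨1, by omega⟩) ≠ 0)
    {F F₁ : Jet N n → ℂ} (hF : SolvesGenusOne X S U' F) (hF₁ : SolvesGenusOne X S U' F₁) :
    ∃ C : ℂ, ∀ j ∈ U', F j = F₁ j + C := by
  have hdiff : ∀ j ∈ U', DifferentiableAt ℂ (fun j => F j - F₁ j) j := fun j hj =>
    (hF.analytic j hj).differentiableAt.fun_sub (hF₁.analytic j hj).differentiableAt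
  have hzero : ∀ j ∈ U', fderiv ℂ (fun j => F j - F₁ j) j = 0 := by
    intro j hj
    have hjD := hD j hj
    set a : Fin (N + 1) → Fin n → ℂ := fun s γ => jetPd s γ (fun j => F j - F₁ j) j with ha
    have hsub : ∀ s γ, a s γ = jetPd s γ F j - jetPd s γ F₁ j := by
      intro s γ
      simp only [ha, jetPd]
      rw [fderiv_fun_sub (hF.analytic j hj).differentiableAt (hF₁.analytic j hj).differentiableAt]
      rfl
    -- The plane without finitely many points is connected, so that an identity in `λ` near one
    -- point extends to all regular `λ`.
    have hpc : IsPreconnected {l : ℂ | ∀ i, l ≠ X.u i (j 0)} := by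
      have : {l : ℂ | ∀ i, l ≠ X.u i (j 0)} = (Set.range fun i => X.u i (j 0))ᶜ := by
        ext l; simp [eq_comm]
      rw [this]
      exact ((Set.finite_range _).countable.isConnected_compl_of_one_lt_rank
        (by simp)).isPreconnected
    have han : AnalyticOnNhd ℂ (fun l => ∑ s : Fin (N + 1), ∑ γ, a s γ * X.curveK j γ s l)
        {l | ∀ i, l ≠ X.u i (j 0)} := fun l hl =>
      Finset.analyticAt_fun_sum _ fun s _ => Finset.analyticAt_fun_sum _ fun γ _ =>
        analyticAt_const.fun_mul (X.curveK_analyticOnNhd hjD γ s l hl)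
    obtain ⟨lam, hlam, W, p, hp, hmem⟩ := hbasis _ hjD
    -- Subtracting the two equations for one basis of periods removes the right side, for `λ` in an
    -- open set.
    have hev : (fun l => ∑ s : Fin (N + 1), ∑ γ, a s γ * X.curveK j γ s l) =ᶠ[𝓝 lam] 0 := by
      have h1 : ∀ᶠ l in 𝓝 lam, (j 0, l) ∈ W :=
        (Continuous.prodMk_right (j 0)).continuousAt.eventually (hp.isOpen.eventually_mem hmem)
      filter_upwards [h1, isOpen_ne.eventually_mem hlam] with l hl hl0
      have e1 := hF.equation W p hp j hj l hl hl0
      have e2 := hF₁.equation W p hp j hj l hl hl0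
      simp only [hp.K_eq hl] at e1 e2
      simp only [hsub, sub_mul, Finset.sum_sub_distrib, e1, e2, sub_self, Pi.zero_apply]
    have hall := han.eqOn_zero_of_preconnected_of_eventuallyEq_zero hpc
      (fun i => hp.ne_u hmem i) hev
    have ha0 := X.eq_zero_of_sum_curveK hjD
      (fun i => by rw [jetVel_zero j hN]; exact hux j hj i) a fun l hl => hall hl
    ext b
    rw [fderiv_eq_sum_jetPd]
    have : ∀ s γ, jetPd s γ (fun j => F j - F₁ j) j = 0 := fun s γ =>
      congrFun (congrFun ha0 s) γ
    simp [this]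
  rcases U'.eq_empty_or_nonempty with rfl | ⟨j₀, hj₀⟩
  · exact ⟨0, fun j hj => absurd hj (Set.notMem_empty j)⟩
  refine ⟨F j₀ - F₁ j₀, fun j hj => ?_⟩
  have := hU'.is_const_of_fderiv_eq_zero (𝕜 := ℂ) hpre
    (fun j hj => (hdiff j hj).differentiableWithinAt) (fun j hj => hzero j hj) hj hj₀
  rw [← this]
  ring

end CanonicalChart

section

open scoped unitInterval

/-! ### Superposition operators -/

section Superposition

variable {K E E' G : Type*} [TopologicalSpace K] [CompactSpace K]
  [NormedAddCommGroup E] [NormedSpace ℂ E] [NormedAddCommGroup E'] [NormedSpace ℂ E']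
  [NormedAddCommGroup G] [NormedSpace ℂ G] [CompleteSpace G]

/-- The pointwise extension of a multilinear map to continuous functions on a compact space. -/
def superMultilinear (k : ℕ) (p : ContinuousMultilinearMap ℂ (fun _ : Fin k => E) G) :
    ContinuousMultilinearMap ℂ (fun _ : Fin k => C(K, E)) C(K, G) :=
  MultilinearMap.mkContinuous
    { toFun := fun y => ⟨fun t => p fun i => y i t, by fun_prop⟩
      map_update_add' := fun y i a b => by
        ext t
        have h : ∀ c : C(K, E), (fun i' => Function.update y i c i' t)
            = Function.update (fun i' => y i' t) i (c t) := fun c => by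
          funext i'
          exact Function.apply_update (fun _ (z : C(K, E)) => z t) y i c i'
        simp [h]
      map_update_smul' := fun y i a b => by
        ext t
        have h : ∀ c : C(K, E), (fun i' => Function.update y i c i' t)
            = Function.update (fun i' => y i' t) i (c t) := fun c => by
          funext i'
          exact Function.apply_update (fun _ (z : C(K, E)) => z t) y i c i'
        simp [h] }
    ‖p‖ fun y => by
      refine (ContinuousMap.norm_le _ (by positivity)).2 fun t => (p.le_opNorm _).trans ?_
      gcongr with i
      exact ContinuousMap.norm_coe_le_norm _ _

omit [CompleteSpace G] in
theorem norm_superMultilinear_le {k : ℕ} (p : ContinuousMultilinearMap ℂ (fun _ : Fin k => E) G) :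
    ‖superMultilinear (K := K) k p‖ ≤ ‖p‖ :=
  MultilinearMap.mkContinuous_norm_le _ (norm_nonneg _) _

/-- Composition with an analytic function is an analytic operator on continuous functions. -/
theorem exists_superposition {f : E → G} {z₀ : E} (hf : AnalyticAt ℂ f z₀) :
    ∃ Fc : C(K, E) → C(K, G), AnalyticAt ℂ Fc 0 ∧
      ∀ᶠ w in 𝓝 (0 : C(K, E)), ∀ t, Fc w t = f (z₀ + w t) := by
  obtain ⟨p, r, hp⟩ := hf
  obtain ⟨r', hr'0, hr'⟩ : ∃ r' : NNReal, 0 < r' ∧ (r' : ENNReal) < r := by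
    obtain ⟨r', h1, h2⟩ := ENNReal.lt_iff_exists_nnreal_btwn.1 hp.r_pos
    exact ⟨r', by exact_mod_cast h1, h2⟩
  obtain ⟨C, -, hC⟩ := p.norm_mul_pow_le_of_lt_radius (hr'.trans_le hp.r_le)
  -- Acting pointwise does not increase the norms of the Taylor coefficients, so the extended series
  -- converges at least in the ball of radius `r'`.
  set q : FormalMultilinearSeries ℂ C(K, E) C(K, G) := fun k => superMultilinear k (p k) with hq
  have hqr : (r' : ENNReal) ≤ q.radius := q.le_radius_of_bound C fun k =>
    (mul_le_mul_of_nonneg_right (norm_superMultilinear_le _) (by positivity)).trans (hC k)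
  have hpos : 0 < q.radius := lt_of_lt_of_le (by exact_mod_cast hr'0) hqr
  have hqs := q.hasFPowerSeriesOnBall hpos
  refine ⟨q.sum, hqs.analyticAt, ?_⟩
  filter_upwards [Metric.ball_mem_nhds (0 : C(K, E)) (show (0 : ℝ) < r' by exact_mod_cast hr'0)]
    with w hw t
  have hw' : ‖w‖ < r' := by simpa using hw
  have h1 : w ∈ Metric.eball (0 : C(K, E)) q.radius := by
    rw [Metric.mem_eball, edist_zero_right]
    refine lt_of_lt_of_le ?_ hqr
    rw [← ofReal_norm, ENNReal.ofReal_lt_iff_lt_toReal (norm_nonneg _) ENNReal.coe_ne_top]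
    simpa using hw'
  have h2 := (hqs.hasSum h1).map (ContinuousMap.evalCLM ℂ t : C(K, G) →L[ℂ] G)
    (ContinuousMap.evalCLM ℂ t : C(K, G) →L[ℂ] G).continuous
  have h3 : w t ∈ Metric.eball (0 : E) r := by
    rw [Metric.mem_eball, edist_zero_right]
    refine lt_trans ?_ hr'
    rw [← ofReal_norm, ENNReal.ofReal_lt_iff_lt_toReal (norm_nonneg _) ENNReal.coe_ne_top]
    simpa using (ContinuousMap.norm_coe_le_norm w t).trans_lt hw'
  have h4 := hp.hasSum h3
  rw [zero_add] at h2
  exact h2.unique h4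

/-- The map `w ↦ (t ↦ t L₁ w + L₂ w)`. -/
def rayL (L₁ L₂ : E →L[ℂ] E') : E →L[ℂ] C(I, E') :=
  LinearMap.mkContinuous
    { toFun := fun w => ⟨fun t => ((t : ℝ) : ℂ) • L₁ w + L₂ w, by fun_prop⟩
      map_add' := fun a b => by ext t; simp [smul_add]; abel
      map_smul' := fun c a => by ext t; simp [smul_add, smul_comm c] }
    (‖L₁‖ + ‖L₂‖) fun w => by
      refine (ContinuousMap.norm_le _ (by positivity)).2 fun t => ?_
      refine (norm_add_le _ _).trans ?_
      rw [add_mul]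
      refine add_le_add ?_ (L₂.le_opNorm w)
      rw [norm_smul]
      refine (mul_le_of_le_one_left (norm_nonneg _) ?_).trans (L₁.le_opNorm w)
      rw [Complex.norm_real, Real.norm_of_nonneg t.2.1]
      exact t.2.2

theorem rayL_apply (L₁ L₂ : E →L[ℂ] E') (w : E) (t : I) :
    rayL L₁ L₂ w t = ((t : ℝ) : ℂ) • L₁ w + L₂ w := rfl

/-- The values of `f` along a segment, seen as one element of `C(I, G)`, depend analytically on the
endpoint. Analytic dependence of solutions on their endpoints is reduced to this. -/
theorem exists_ray_superposition {f : E' → G} {z₀ : E'} (hf : AnalyticAt ℂ f z₀)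
    (L₁ L₂ : E →L[ℂ] E') :
    ∃ Fc : E → C(I, G), AnalyticAt ℂ Fc 0 ∧
      ∀ᶠ w in 𝓝 (0 : E), ∀ t : I, Fc w t = f (z₀ + (((t : ℝ) : ℂ) • L₁ w + L₂ w)) := by
  obtain ⟨Fc, hF, h⟩ := exists_superposition (K := I) hf
  have h0 : rayL L₁ L₂ 0 = 0 := map_zero _
  refine ⟨fun w => Fc (rayL L₁ L₂ w), ?_, ?_⟩
  · exact AnalyticAt.fun_comp (by rw [h0]; exact hF) ((rayL L₁ L₂).analyticAt 0)
  · have hc : Tendsto (rayL L₁ L₂) (𝓝 0) (𝓝 0) := by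
      simpa [h0] using (rayL L₁ L₂).continuous.tendsto 0
    exact (hc.eventually h).mono fun w hw t => hw t

/-- Near `0`, the segment from `z₀` along `t L₁ w + L₂ w` stays in a given neighbourhood. -/
theorem eventually_forall_ray {P : E' → Prop} {z₀ : E'} (h : ∀ᶠ z in 𝓝 z₀, P z)
    (L₁ L₂ : E →L[ℂ] E') :
    ∀ᶠ w in 𝓝 (0 : E), ∀ t : I, P (z₀ + (((t : ℝ) : ℂ) • L₁ w + L₂ w)) := by
  obtain ⟨ε, hε, hP⟩ := Metric.eventually_nhds_iff.1 h
  have hc : Tendsto (rayL L₁ L₂) (𝓝 0) (𝓝 0) := by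
    simpa using (rayL L₁ L₂).continuous.tendsto 0
  filter_upwards [hc (Metric.ball_mem_nhds 0 hε)] with w hw t
  refine hP ?_
  have : ‖rayL L₁ L₂ w‖ < ε := by simpa using hw
  rw [dist_eq_norm, add_sub_cancel_left, ← rayL_apply]
  exact (ContinuousMap.norm_coe_le_norm _ t).trans_lt this

end Superposition

/-! ### The Volterra operator -/

section Volterra

variable {G : Type*} [NormedAddCommGroup G] [NormedSpace ℂ G]

omit [NormedSpace ℂ G] in
theorem continuous_extend (f : C(I, G)) : Continuous (Set.IccExtend zero_le_one f) :=
  f.continuous.Icc_extend'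

omit [NormedSpace ℂ G] in
theorem norm_extend_le (f : C(I, G)) (s : ℝ) : ‖Set.IccExtend zero_le_one f s‖ ≤ ‖f‖ :=
  ContinuousMap.norm_coe_le_norm f _

/-- The operator `f ↦ (t ↦ ∫₀ᵗ f)`. -/
def volterra : C(I, G) →L[ℂ] C(I, G) :=
  LinearMap.mkContinuous
    { toFun := fun f => ⟨fun t => ∫ s in (0 : ℝ)..t, Set.IccExtend zero_le_one f s,
        (intervalIntegral.continuous_primitive
          (fun _ _ => (continuous_extend f).intervalIntegrable _ _) 0).comp continuous_subtype_val⟩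
      map_add' := fun f g => by
        ext t
        exact intervalIntegral.integral_add ((continuous_extend f).intervalIntegrable _ _)
          ((continuous_extend g).intervalIntegrable _ _)
      map_smul' := fun c f => by
        ext t
        exact intervalIntegral.integral_smul c _ }
    1 fun f => by
      refine (ContinuousMap.norm_le _ (by positivity)).2 fun t => ?_
      have h := intervalIntegral.norm_integral_le_of_norm_le_const (a := 0) (b := (t : ℝ))
        fun s _ => norm_extend_le f s
      refine h.trans ?_
      rw [sub_zero, abs_of_nonneg t.2.1, one_mul]
      exact mul_le_of_le_one_right (norm_nonneg _) t.2.2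

theorem volterra_apply (f : C(I, G)) (t : I) :
    volterra f t = ∫ s in (0 : ℝ)..t, Set.IccExtend zero_le_one f s := rfl

variable [CompleteSpace G]

theorem volterra_of_hasDerivAt {k : ℝ → G} {f : C(I, G)} (h0 : k 0 = 0)
    (h : ∀ t : I, HasDerivAt k (f t) t) (t : I) : volterra f t = k t := by
  rw [volterra_apply, intervalIntegral.integral_eq_sub_of_hasDerivAt (f := k), h0, sub_zero]
  · intro s hs
    rw [Set.uIcc_of_le t.2.1] at hs
    have hs' : s ∈ I := ⟨hs.1, hs.2.trans t.2.2⟩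
    rw [Set.IccExtend_of_mem _ _ hs']
    exact h ⟨s, hs'⟩
  · exact (continuous_extend f).intervalIntegrable _ _

end Volterra

end

/-! ### Integrable Pfaffian systems and the Poincaré lemma -/

section

open scoped unitInterval Ring

section Frobenius

variable {E Λ 𝔄 : Type*} [NormedAddCommGroup E] [NormedSpace ℂ E] [NormedAddCommGroup Λ]
  [NormedSpace ℂ Λ]

theorem hasDerivAt_ray {G : Type*} [NormedAddCommGroup G] [NormedSpace ℂ G] {A : E → G}
    {z₀ w : E} {t : ℝ} (hA : DifferentiableAt ℂ A (z₀ + (t : ℂ) • w)) :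
    HasDerivAt (fun s : ℝ => A (z₀ + (s : ℂ) • w)) (fderiv ℂ A (z₀ + (t : ℂ) • w) w) t := by
  have h1 : HasDerivAt (fun s : ℝ => z₀ + (s : ℂ) • w) w t := by
    have := ((Complex.ofRealCLM.hasDerivAt (x := t)).smul_const w).const_add z₀
    simpa using this
  exact (hA.hasFDerivAt.restrictScalars ℝ).comp_hasDerivAt t h1

theorem hasDerivAt_ray_apply {G : Type*} [NormedAddCommGroup G] [NormedSpace ℂ G]
    {A : E → Λ →L[ℂ] G} {z₀ w : E} {t : ℝ} (hA : DifferentiableAt ℂ A (z₀ + (t : ℂ) • w)) (b : Λ) :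
    HasDerivAt (fun s : ℝ => A (z₀ + (s : ℂ) • w) b) (fderiv ℂ A (z₀ + (t : ℂ) • w) w b) t := by
  have h : HasFDerivAt (fun z => A z b) _ (z₀ + (t : ℂ) • w) :=
    (ContinuousLinearMap.apply ℂ G b).hasFDerivAt.comp _ hA.hasFDerivAt
  have h2 := hasDerivAt_ray h.differentiableAt
  rw [h.fderiv] at h2
  exact h2

theorem analyticAt_clm_apply {G : Type*} [NormedAddCommGroup G] [NormedSpace ℂ G]
    {A : E → Λ →L[ℂ] G} {g : E → Λ} {z : E} (hA : AnalyticAt ℂ A z) (hg : AnalyticAt ℂ g z) :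
    AnalyticAt ℂ (fun z => A z (g z)) z :=
  ((ContinuousLinearMap.id ℂ (Λ →L[ℂ] G)).analyticAt_bilinear (A z, g z)).comp₂ hA hg

theorem fderiv_eval {X : Type*} [TopologicalSpace X] [CompactSpace X] {G : Type*}
    [NormedAddCommGroup G] [NormedSpace ℂ G] {F : E → C(X, G)} {w : E}
    (hF : DifferentiableAt ℂ F w) (b : E) (t : X) :
    fderiv ℂ F w b t = fderiv ℂ (fun w => F w t) w b := by
  have h := (ContinuousMap.evalCLM ℂ t : C(X, G) →L[ℂ] G).hasFDerivAt.comp w hF.hasFDerivAt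
  exact (congrArg (fun L : E →L[ℂ] G => L b) h.fderiv).symm

variable [NormedRing 𝔄] [NormedAlgebra ℂ 𝔄] [CompleteSpace 𝔄]

omit [CompleteSpace 𝔄] in
theorem fderiv_mul_apply {f g : E → 𝔄} {w : E} (hf : DifferentiableAt ℂ f w)
    (hg : DifferentiableAt ℂ g w) (b : E) :
    fderiv ℂ (fun w => f w * g w) w b = fderiv ℂ f w b * g w + f w * fderiv ℂ g w b := by
  rw [fderiv_fun_mul' hf hg]
  exact add_comm _ _

omit [CompleteSpace 𝔄] in
-- The derivative of a solution solves the linearized equation with the source `V(d𝒜 · f)`.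
theorem fderiv_fixedPoint {𝒜 f : E → 𝔄} {w : E} (V : 𝔄 →L[ℂ] 𝔄) (h𝒜 : DifferentiableAt ℂ 𝒜 w)
    (hf : DifferentiableAt ℂ f w) (h : ∀ᶠ w in 𝓝 w, f w = 1 + V (𝒜 w * f w)) (b : E) :
    fderiv ℂ f w b = V (fderiv ℂ 𝒜 w b * f w + 𝒜 w * fderiv ℂ f w b) := by
  have e1 : HasFDerivAt (fun w => 1 + V (𝒜 w * f w)) _ w :=
    (V.hasFDerivAt.comp w (h𝒜.fun_mul hf).hasFDerivAt).const_add 1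
  have e2 : f =ᶠ[𝓝 w] fun w => 1 + V (𝒜 w * f w) := h
  rw [← fderiv_mul_apply h𝒜 hf]
  conv_lhs => rw [e2.fderiv_eq, e1.fderiv]
  rfl

/-- A linear fixed point equation `f = 1 + V (𝒜 f)` in a Banach algebra. -/
theorem exists_fixedPoint {𝒜 : E → 𝔄} (h𝒜 : AnalyticAt ℂ 𝒜 0) (h0 : 𝒜 0 = 0) (V : 𝔄 →L[ℂ] 𝔄) :
    ∃ f : E → 𝔄, AnalyticAt ℂ f 0 ∧ f 0 = 1 ∧
      ∀ᶠ w in 𝓝 (0 : E), f w = 1 + V (𝒜 w * f w) ∧ ∀ g, g = V (𝒜 w * g) → g = 0 := by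
  -- The equation is `(1 - T 𝒜) f = 1` with `T 𝒜 = V(𝒜 · )`. As `𝒜` vanishes at `0`, the operator is
  -- invertible nearby, and inversion is analytic.
  set T : 𝔄 →L[ℂ] 𝔄 →L[ℂ] 𝔄 :=
    (ContinuousLinearMap.compL ℂ 𝔄 𝔄 𝔄 V).comp (ContinuousLinearMap.mul ℂ 𝔄) with hT
  have hTa : ∀ f g, T f g = V (f * g) := fun f g => rfl
  have hTan : AnalyticAt ℂ (fun w => T (𝒜 w)) 0 := (T.analyticAt _).fun_comp h𝒜
  set f : E → 𝔄 := fun w => (1 - T (𝒜 w))⁻¹ʳ 1 with hf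
  have hfan : AnalyticAt ℂ f 0 := by
    have h1 : AnalyticAt ℂ (fun w => (1 - T (𝒜 w))⁻¹ʳ) 0 :=
      AnalyticAt.fun_comp (g := fun x : 𝔄 →L[ℂ] 𝔄 => (1 - x)⁻¹ʳ) (f := fun w => T (𝒜 w))
        (by rw [h0, map_zero]; exact analyticAt_inverse_one_sub ℂ _) hTan
    exact analyticAt_clm_apply h1 analyticAt_const
  have hunit : ∀ᶠ w in 𝓝 (0 : E), IsUnit (1 - T (𝒜 w)) := by
    have hc : Tendsto (fun w => 1 - T (𝒜 w)) (𝓝 0) (𝓝 1) := by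
      have h1 : ContinuousAt (fun w => (1 : 𝔄 →L[ℂ] 𝔄) - T (𝒜 w)) 0 :=
        continuousAt_const.fun_sub hTan.continuousAt
      have h2 := h1.tendsto
      rwa [h0, map_zero, sub_zero] at h2
    exact hc.eventually (Units.isOpen.eventually_mem isUnit_one)
  have hall : ∀ᶠ w in 𝓝 (0 : E), f w = 1 + V (𝒜 w * f w) ∧ ∀ g, g = V (𝒜 w * g) → g = 0 := by
    filter_upwards [hunit] with w hw
    refine ⟨?_, fun g hg => ?_⟩
    · have h1 : (1 - T (𝒜 w)) (f w) = 1 := by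
        change ((1 - T (𝒜 w)) * (1 - T (𝒜 w))⁻¹ʳ) 1 = 1
        rw [Ring.mul_inverse_cancel _ hw]
        rfl
      have h2 : (1 - T (𝒜 w)) (f w) = f w - V (𝒜 w * f w) := rfl
      rw [← h1, h2]
      abel
    · have h1 : (1 - T (𝒜 w)) g = 0 := by
        have h2 : (1 - T (𝒜 w)) g = g - V (𝒜 w * g) := rfl
        rw [h2, ← hg, sub_self]
      have h2 : ((1 - T (𝒜 w))⁻¹ʳ * (1 - T (𝒜 w))) g = 0 := by
        change (1 - T (𝒜 w))⁻¹ʳ ((1 - T (𝒜 w)) g) = 0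
        rw [h1, map_zero]
      rw [Ring.inverse_mul_cancel _ hw] at h2
      exact h2
  refine ⟨f, hfan, ?_, hall⟩
  rw [hall.self_of_nhds.1, h0, zero_mul, map_zero, add_zero]

/-- A linear Pfaffian system `dΦ = A Φ` with analytic coefficients that satisfies the integrability
condition has an analytic solution with `Φ(z₀) = 1`. -/
theorem exists_pfaffian_solution {A : E → E →L[ℂ] 𝔄} {z₀ : E} (hA : AnalyticAt ℂ A z₀)
    (hint : ∀ᶠ z in 𝓝 z₀, ∀ a b,
      fderiv ℂ A z a b - fderiv ℂ A z b a = A z a * A z b - A z b * A z a) :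
    ∃ Φ : E → 𝔄, AnalyticAt ℂ Φ z₀ ∧ Φ z₀ = 1 ∧ ∀ᶠ z in 𝓝 z₀, ∀ a, fderiv ℂ Φ z a = A z a * Φ z := by
  have hA2 : AnalyticAt ℂ (fun y : E × E => A y.1 y.2) (z₀, 0) :=
    analyticAt_clm_apply (AnalyticAt.fun_comp_of_eq hA analyticAt_fst rfl) analyticAt_snd
  -- Here `𝒜 w` is the function `t ↦ A(z₀ + t w) w`, so the fixed point `f w` is the solution along
  -- the ray from `z₀` to `z₀ + w`, and the candidate is `Φ(z) = f(z - z₀)` at `t = 1`.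
  obtain ⟨𝒜, h𝒜, hev⟩ := exists_ray_superposition hA2 (ContinuousLinearMap.inl ℂ E E)
    (ContinuousLinearMap.inr ℂ E E)
  simp only [ContinuousLinearMap.inl_apply, ContinuousLinearMap.inr_apply, Prod.smul_mk, smul_zero,
    Prod.mk_add_mk, add_zero, zero_add] at hev
  have h𝒜0 : 𝒜 0 = 0 := by
    ext t
    rw [hev.self_of_nhds t]
    simp
  obtain ⟨f, hfan, hf0, hfall⟩ := exists_fixedPoint h𝒜 h𝒜0 volterra
  have hmain : ∀ᶠ w in 𝓝 (0 : E), ∀ b, fderiv ℂ f w b 1 = A (z₀ + w) b * f w 1 := by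
    have hray := eventually_forall_ray (hint.and hA.eventually_analyticAt)
      (ContinuousLinearMap.id ℂ E) (0 : E →L[ℂ] E)
    filter_upwards [hev.eventually_nhds, (hfall.mono fun w hw => hw.1).eventually_nhds, hfall,
      h𝒜.eventually_analyticAt,      hfan.eventually_analyticAt, hray] with w hev hfeq hinj h𝒜 hfan hray b
    simp only [ContinuousLinearMap.id_apply, zero_apply, add_zero] at hray
    have hd𝒜 : ∀ t : I, fderiv ℂ 𝒜 w b t = ((t : ℝ) : ℂ) • fderiv ℂ A (z₀ + ((t : ℝ) : ℂ) • w) b w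
        + A (z₀ + ((t : ℝ) : ℂ) • w) b := by
      intro t
      rw [fderiv_eval h𝒜.differentiableAt]
      have e1 : (fun w => 𝒜 w t) =ᶠ[𝓝 w] fun w => A (z₀ + ((t : ℝ) : ℂ) • w) w :=
        hev.mono fun w hw => hw t
      have e2 : HasFDerivAt (fun w : E => z₀ + ((t : ℝ) : ℂ) • w) _ w :=
        ((hasFDerivAt_id (𝕜 := ℂ) w).const_smul ((t : ℝ) : ℂ)).const_add z₀
      have e3 : HasFDerivAt (fun w : E => A (z₀ + ((t : ℝ) : ℂ) • w)) _ w :=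
        HasFDerivAt.comp (g := A) w (hray t).2.differentiableAt.hasFDerivAt e2
      have e4 : HasFDerivAt (fun w : E => w) (ContinuousLinearMap.id ℂ E) w := hasFDerivAt_id w
      rw [e1.fderiv_eq, (e3.clm_apply e4).fderiv]
      simp [add_comm]
    set h := fderiv ℂ f w b with hh
    have hheq : h = volterra (fderiv ℂ 𝒜 w b * f w + 𝒜 w * h) :=
      fderiv_fixedPoint volterra h𝒜.differentiableAt hfan.differentiableAt hfeq b
    set F : ℝ → 𝔄 := fun s => 1 + ∫ x in (0 : ℝ)..s, Set.IccExtend zero_le_one (𝒜 w * f w) x with hF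
    have hFf : ∀ t : I, F t = f w t := by
      intro t
      conv_rhs => rw [hfeq.self_of_nhds]
      rfl
    have hFd : ∀ t : I, HasDerivAt F (A (z₀ + ((t : ℝ) : ℂ) • w) w * F t) t := by
      intro t
      have := ((continuous_extend (𝒜 w * f w)).integral_hasStrictDerivAt 0 t).hasDerivAt.const_add 1
      rw [Set.IccExtend_val, ContinuousMap.mul_apply, hev.self_of_nhds t, ← hFf] at this
      exact this
    -- If `dΦ = A Φ` holds, the derivative in the direction `b` of `w ↦ Φ(z₀ + t w)` has to be `t
    -- A(z₀ + t w)(b) Φ`. It is shown that this expression satisfies the Volterra equation of the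
    -- actual derivative `h`.
    set k : ℝ → 𝔄 := fun s => (s : ℂ) • (A (z₀ + (s : ℂ) • w) b * F s) with hk
    have hkd : ∀ t : I, HasDerivAt k ((A (z₀ + ((t : ℝ) : ℂ) • w) b * F t) + ((t : ℝ) : ℂ) •
        (fderiv ℂ A (z₀ + ((t : ℝ) : ℂ) • w) w b * F t
          + A (z₀ + ((t : ℝ) : ℂ) • w) b * (A (z₀ + ((t : ℝ) : ℂ) • w) w * F t))) t := by
      intro t
      have e1 : HasDerivAt (fun s : ℝ => A (z₀ + (s : ℂ) • w) b) _ (t : ℝ) :=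
        hasDerivAt_ray_apply (hray t).2.differentiableAt b
      have e2 := (Complex.ofRealCLM.hasDerivAt (x := (t : ℝ))).smul (e1.mul (hFd t))
      refine HasDerivAt.congr_deriv e2 ?_
      simp only [Complex.ofRealCLM_apply, Complex.ofReal_one, one_smul]
      exact add_comm _ _
    set kc : C(I, 𝔄) := ⟨fun t => k t, continuous_iff_continuousAt.2 fun t =>
      (hkd t).continuousAt.comp continuous_subtype_val.continuousAt⟩ with hkc
    have hkceq : kc = volterra (fderiv ℂ 𝒜 w b * f w + 𝒜 w * kc) := by
      ext t
      rw [volterra_of_hasDerivAt (k := k) (by simp [hk])]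
      · rfl
      intro t
      refine (hkd t).congr_deriv ?_
      rw [ContinuousMap.add_apply, ContinuousMap.mul_apply, ContinuousMap.mul_apply, hd𝒜,
        hev.self_of_nhds t, ← hFf]
      -- The only use of integrability: it exchanges the derivative of `A` along the ray with the
      -- one in the direction `b`.
      have hi := (hray t).1 b w
      have : kc t = k t := rfl
      rw [this, hk, eq_add_of_sub_eq hi]
      simp only [smul_add, add_mul, sub_mul, mul_smul_comm, smul_mul_assoc, mul_assoc, smul_sub]
      abel
    -- Both satisfy the same inhomogeneous equation, and the homogeneous one has only the zero
    -- solution.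
    have hhk : h = kc := by
      refine sub_eq_zero.1 (hinj.2 _ ?_)
      rw [mul_sub, map_sub]
      conv_lhs => rw [hheq, hkceq, map_add, map_add]
      abel
    have h1 := hFf 1
    rw [hhk]
    change k ((1 : I) : ℝ) = _
    simp only [hk]
    rw [h1]
    simp
  have htr : Tendsto (fun z => z - z₀) (𝓝 z₀) (𝓝 0) := by
    have : ContinuousAt (fun z => z - z₀) z₀ := by fun_prop
    simpa using this.tendsto
  refine ⟨fun z => f (z - z₀) 1, ?_, by simp [hf0], ?_⟩
  · have h1 : AnalyticAt ℂ (fun z => f (z - z₀)) z₀ :=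
      AnalyticAt.fun_comp (f := fun z => z - z₀) (by rw [sub_self]; exact hfan)
        (analyticAt_id.fun_sub analyticAt_const)
    exact ((ContinuousMap.evalCLM ℂ (1 : I) : C(I, 𝔄) →L[ℂ] 𝔄).analyticAt _).fun_comp h1
  · filter_upwards [htr.eventually hmain, htr.eventually hfan.eventually_analyticAt] with z h1 h2 a
    have h3 := h1 a
    rw [add_sub_cancel, fderiv_eval h2.differentiableAt] at h3
    rw [← h3]
    exact congrArg (fun L : E →L[ℂ] 𝔄 => L a) (fderiv_comp_sub z₀ (x := z) (f := fun w => f w 1))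

/-- The Poincaré lemma with parameters. -/
theorem exists_potential {φ : E × Λ → E →L[ℂ] ℂ} {z₀ : E × Λ} (hφ : AnalyticAt ℂ φ z₀)
    (hclosed : ∀ᶠ z in 𝓝 z₀, ∀ a b, fderiv ℂ φ z (a, 0) b = fderiv ℂ φ z (b, 0) a) :
    ∃ p : E × Λ → ℂ, AnalyticAt ℂ p z₀ ∧ ∀ᶠ z in 𝓝 z₀, ∀ a, fderiv ℂ p z (a, 0) = φ z a := by
  have hφ2 : AnalyticAt ℂ (fun y : (E × Λ) × E => φ y.1 y.2) (z₀, 0) :=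
    analyticAt_clm_apply (AnalyticAt.fun_comp_of_eq hφ analyticAt_fst rfl) analyticAt_snd
  -- The potential is the integral of `φ` along the ray on which only the `E` component is scaled;
  -- the parameter in `Λ` keeps its full value.
  set iE : E × Λ →L[ℂ] E × Λ := (ContinuousLinearMap.inl ℂ E Λ).comp (ContinuousLinearMap.fst ℂ E Λ)
  set iΛ : E × Λ →L[ℂ] E × Λ := (ContinuousLinearMap.inr ℂ E Λ).comp (ContinuousLinearMap.snd ℂ E Λ)
  obtain ⟨𝒜, h𝒜, hev⟩ := exists_ray_superposition hφ2
    ((ContinuousLinearMap.inl ℂ (E × Λ) E).comp iE)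
    (iΛ.prod (ContinuousLinearMap.fst ℂ E Λ))
  have hev' : ∀ᶠ w in 𝓝 (0 : E × Λ), ∀ t : I,
      𝒜 w t = φ (z₀ + (((t : ℝ) : ℂ) • iE w + iΛ w)) w.1 := by
    refine hev.mono fun w hw t => ?_
    rw [hw t]
    simp
  have hmain : ∀ᶠ w in 𝓝 (0 : E × Λ), ∀ b,
      volterra (fderiv ℂ 𝒜 w (b, 0)) 1 = φ (z₀ + w) b := by
    have hray := eventually_forall_ray (hclosed.and hφ.eventually_analyticAt) iE iΛ
    filter_upwards [hev'.eventually_nhds, h𝒜.eventually_analyticAt, hray] with w hev h𝒜 hray b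
    have hd𝒜 : ∀ t : I, fderiv ℂ 𝒜 w (b, 0) t
        = ((t : ℝ) : ℂ) • fderiv ℂ φ (z₀ + (((t : ℝ) : ℂ) • iE w + iΛ w)) (b, 0) w.1
        + φ (z₀ + (((t : ℝ) : ℂ) • iE w + iΛ w)) b := by
      intro t
      rw [fderiv_eval h𝒜.differentiableAt]
      have e1 : (fun w => 𝒜 w t) =ᶠ[𝓝 w] fun w => φ (z₀ + (((t : ℝ) : ℂ) • iE w + iΛ w)) w.1 :=
        hev.mono fun w hw => hw t
      have e2 : HasFDerivAt (fun w : E × Λ => z₀ + (((t : ℝ) : ℂ) • iE w + iΛ w)) _ w :=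
        ((iE.hasFDerivAt.const_smul ((t : ℝ) : ℂ)).add iΛ.hasFDerivAt).const_add z₀
      have e3 : HasFDerivAt (fun w : E × Λ => φ (z₀ + (((t : ℝ) : ℂ) • iE w + iΛ w))) _ w :=
        HasFDerivAt.comp (g := φ) w (hray t).2.differentiableAt.hasFDerivAt e2
      have e4 : ((t : ℝ) : ℂ) • iE (b, 0) + iΛ (b, 0) = ((t : ℝ) : ℂ) • ((b, 0) : E × Λ) := by
        simp [iE, iΛ]
      rw [e1.fderiv_eq, (e3.clm_apply (hasFDerivAt_fst (p := w))).fderiv]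
      simp only [add_apply, ContinuousLinearMap.comp_apply, smul_apply,
        ContinuousLinearMap.flip_apply, ContinuousLinearMap.coe_fst', e4, map_smul]
      rw [add_comm]
    -- A primitive in `t` of the derivative of the integrand in the direction `b`; closedness
    -- exchanges `b` with the direction of the ray.
    set k : ℝ → ℂ := fun s => (s : ℂ) • φ (z₀ + iΛ w + (s : ℂ) • iE w) b with hk
    have hz : ∀ s : ℂ, z₀ + iΛ w + s • iE w = z₀ + (s • iE w + iΛ w) := fun s => by abel
    have hkd : ∀ t : I, HasDerivAt k (fderiv ℂ 𝒜 w (b, 0) t) t := by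
      intro t
      have e0 : DifferentiableAt ℂ φ (z₀ + iΛ w + ((t : ℝ) : ℂ) • iE w) := by
        rw [hz]; exact (hray t).2.differentiableAt
      have e1 : HasDerivAt (fun s : ℝ => φ (z₀ + iΛ w + (s : ℂ) • iE w) b) _ (t : ℝ) :=
        hasDerivAt_ray_apply e0 b
      have e2 := (Complex.ofRealCLM.hasDerivAt (x := (t : ℝ))).smul e1
      refine HasDerivAt.congr_deriv e2 ?_
      have e3 := (hray t).1 w.1 b
      rw [hd𝒜, hz, ← e3]
      simp [iE]
    rw [volterra_of_hasDerivAt (by simp [hk]) hkd]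
    have e5 : z₀ + iΛ w + iE w = z₀ + w := by
      rw [add_assoc]; congr 1; ext <;> simp [iE, iΛ]
    simp [hk, e5]
  have htr : Tendsto (fun z => z - z₀) (𝓝 z₀) (𝓝 0) := by
    have : ContinuousAt (fun z => z - z₀) z₀ := by fun_prop
    simpa using this.tendsto
  set ev : C(I, ℂ) →L[ℂ] ℂ := (ContinuousMap.evalCLM ℂ (1 : I)).comp volterra with hev1
  refine ⟨fun z => ev (𝒜 (z - z₀)), ?_, ?_⟩
  · have h1 : AnalyticAt ℂ (fun z => 𝒜 (z - z₀)) z₀ :=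
      AnalyticAt.fun_comp (f := fun z => z - z₀) (by rw [sub_self]; exact h𝒜)
        (analyticAt_id.fun_sub analyticAt_const)
    exact (ev.analyticAt _).fun_comp h1
  · filter_upwards [htr.eventually hmain, htr.eventually h𝒜.eventually_analyticAt] with z h1 h2 a
    have h3 := h1 a
    rw [add_sub_cancel] at h3
    rw [← h3]
    have h4 := fderiv_comp_sub z₀ (x := z) (f := fun w => ev (𝒜 w)) (𝕜 := ℂ)
    have h5 := (ev.hasFDerivAt.comp (z - z₀) h2.differentiableAt.hasFDerivAt).fderiv
    refine (congrArg (fun L : E × Λ →L[ℂ] ℂ => L (a, 0)) h4).trans ?_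
    exact congrArg (fun L : E × Λ →L[ℂ] ℂ => L (a, 0)) h5

end Frobenius

end

/-! ### Operator-valued forms and their derivatives -/

section Abstract

variable {E F G : Type*} [NormedAddCommGroup E] [NormedSpace ℂ E] [NormedAddCommGroup F]
  [NormedSpace ℂ F] [NormedAddCommGroup G] [NormedSpace ℂ G]

theorem analyticAt_smulRight (ℓ : F →L[ℂ] ℂ) {f : E → G} {z : E} (hf : AnalyticAt ℂ f z) :
    AnalyticAt ℂ (fun z => ℓ.smulRight (f z)) z :=
  (ContinuousLinearMap.analyticAt (ContinuousLinearMap.smulRightL ℂ F G ℓ) (f z)).fun_comp hf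

theorem fderiv_clm_apply_const {A : E → F →L[ℂ] G} {z : E} (hA : DifferentiableAt ℂ A z)
    (a : E) (b : F) : fderiv ℂ (fun z => A z b) z a = fderiv ℂ A z a b :=
  congrArg (fun L : E →L[ℂ] G => L a)
    ((ContinuousLinearMap.apply ℂ G b).hasFDerivAt.comp z hA.hasFDerivAt).fderiv

end Abstract

/-! ### Pfaffian systems for matrices -/

section MatrixPfaffian

variable {E : Type*} [NormedAddCommGroup E] [NormedSpace ℂ E] {n : ℕ}

/-- Square matrices as continuous linear maps. -/
def matCLM : Matrix (Fin n) (Fin n) ℂ ≃ₐ[ℂ] (Vec n →L[ℂ] Vec n) :=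
  Matrix.toLinAlgEquiv'.trans (Module.End.toContinuousLinearMap (Vec n))

theorem matCLM_eq_sum (A : Matrix (Fin n) (Fin n) ℂ) :
    matCLM A = ∑ i, ∑ j, A i j • matCLM (Matrix.single i j 1) := by
  conv_lhs => rw [Matrix.matrix_eq_sum_single A]
  simp only [map_sum]
  refine Finset.sum_congr rfl fun i _ => Finset.sum_congr rfl fun j _ => ?_
  rw [← map_smul, Matrix.smul_single, smul_eq_mul, mul_one]

theorem MatAnalyticAt.matCLM {F : E → Matrix (Fin n) (Fin n) ℂ} {z : E} (hF : MatAnalyticAt F z) :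
    AnalyticAt ℂ (fun z => matCLM (F z)) z := by
  have h : (fun z => GFM.matCLM (F z))
      = fun z => ∑ i, ∑ j, F z i j • GFM.matCLM (Matrix.single i j 1) :=
    funext fun z => matCLM_eq_sum _
  rw [h]
  exact Finset.analyticAt_fun_sum _ fun i _ => Finset.analyticAt_fun_sum _ fun j _ =>
    (hF i j).fun_smul analyticAt_const

theorem fderiv_matCLM {F : E → Matrix (Fin n) (Fin n) ℂ} {z : E} (hF : MatAnalyticAt F z) (a : E) :
    fderiv ℂ (fun z => matCLM (F z)) z a = matCLM (matDeriv a F z) := by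
  have h : (fun z => matCLM (F z)) = fun z => ∑ i, ∑ j, F z i j • matCLM (Matrix.single i j 1) :=
    funext fun z => matCLM_eq_sum _
  have h1 : HasFDerivAt (fun z => ∑ i, ∑ j, F z i j • matCLM (Matrix.single i j 1)) _ z :=
    HasFDerivAt.fun_sum fun i _ => HasFDerivAt.fun_sum fun j _ =>
      (hF i j).differentiableAt.hasFDerivAt.smul_const (matCLM (Matrix.single i j (1 : ℂ)))
  rw [h, h1.fderiv, matCLM_eq_sum (matDeriv a F z)]
  simp [matDeriv_apply]

theorem matCLM_apply_entry (A : Matrix (Fin n) (Fin n) ℂ) (i j : Fin n) :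
    matCLM A (Pi.single j 1) i = A i j := by
  have h : matCLM A (Pi.single j 1) = A.mulVec (Pi.single j 1) := rfl
  rw [h, Matrix.mulVec_single_one, Matrix.col_apply]

/-- The matrix version of `exists_pfaffian_solution`: the coefficients of the system are
`∑ ℓ_k N_k` with linear forms `ℓ_k`. -/
theorem exists_matrix_pfaffian_solution {ι : Type*} [Fintype ι] (ℓ : ι → E →L[ℂ] ℂ)
    {N : ι → E → Matrix (Fin n) (Fin n) ℂ} {z₀ : E} (hN : ∀ k, MatAnalyticAt (N k) z₀)
    (hint : ∀ᶠ z in 𝓝 z₀, ∀ a b,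
      ∑ k, ℓ k b • matDeriv a (N k) z - ∑ k, ℓ k a • matDeriv b (N k) z
        = (∑ k, ℓ k a • N k z) * (∑ k, ℓ k b • N k z)
          - (∑ k, ℓ k b • N k z) * (∑ k, ℓ k a • N k z)) :
    ∃ Φ : E → Matrix (Fin n) (Fin n) ℂ, MatAnalyticAt Φ z₀ ∧ Φ z₀ = 1 ∧
      ∀ᶠ z in 𝓝 z₀, ∀ a, matDeriv a Φ z = (∑ k, ℓ k a • N k z) * Φ z := by
  set A : E → E →L[ℂ] Vec n →L[ℂ] Vec n := fun z => ∑ k, (ℓ k).smulRight (matCLM (N k z)) with hA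
  have hAa : ∀ z a, A z a = matCLM (∑ k, ℓ k a • N k z) := fun z a => by
    simp [hA, sum_apply]
  have hAan : AnalyticAt ℂ A z₀ :=
    Finset.analyticAt_fun_sum _ fun k _ => analyticAt_smulRight (ℓ k) (hN k).matCLM
  have hNan : ∀ᶠ z in 𝓝 z₀, ∀ k, MatAnalyticAt (N k) z := eventually_all.2 fun k =>
    eventually_all.2 fun i => eventually_all.2 fun j => (hN k i j).eventually_analyticAt
  have hAd : ∀ᶠ z in 𝓝 z₀, ∀ a b, fderiv ℂ A z a b = matCLM (∑ k, ℓ k b • matDeriv a (N k) z) := by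
    filter_upwards [hNan, hAan.eventually_analyticAt] with z h1 h2 a b
    have e2 : (fun z => A z b) = fun z => matCLM (∑ k, ℓ k b • N k z) := funext fun z => hAa z b
    rw [← fderiv_clm_apply_const h2.differentiableAt, e2, fderiv_matCLM (MatAnalyticAt.sum _ fun k _ =>
      MatAnalyticAt.smul analyticAt_const (h1 k)), matDeriv_sum _ _ fun k _ =>
      MatAnalyticAt.smul analyticAt_const (h1 k)]
    refine congrArg _ (Finset.sum_congr rfl fun k _ => ?_)
    rw [matDeriv_smul _ analyticAt_const (h1 k)]
    simp
  obtain ⟨Φ, hΦ, hΦ0, hΦd⟩ := exists_pfaffian_solution hAan (by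
    filter_upwards [hint, hAd] with z h1 h2 a b
    rw [h2, h2, hAa, hAa, ← map_sub, h1, map_sub, map_mul, map_mul])
  -- The matrix entries of the operator-valued solution, obtained by evaluation on basis vectors.
  set Ψ : E → Matrix (Fin n) (Fin n) ℂ := fun z => Matrix.of fun i j => Φ z (Pi.single j 1) i with hΨ
  have hΨΦ : ∀ z, Φ z = matCLM (Ψ z) := by
    intro z
    obtain ⟨B, hB⟩ := (matCLM (n := n)).surjective (Φ z)
    rw [← hB]
    congr 1
    ext i j
    change B i j = Φ z (Pi.single j 1) i
    rw [← hB, matCLM_apply_entry]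
  set entry : Fin n → Fin n → (Vec n →L[ℂ] Vec n) →L[ℂ] ℂ := fun i j =>
    (ContinuousLinearMap.proj i).comp (ContinuousLinearMap.apply ℂ (Vec n) (Pi.single j 1)) with hentry
  have hΨan : ∀ z, AnalyticAt ℂ Φ z → MatAnalyticAt Ψ z := fun z hz i j =>
    ((entry i j).analyticAt _).fun_comp hz
  refine ⟨Ψ, hΨan _ hΦ, ?_, ?_⟩
  · refine (matCLM (n := n)).injective ?_
    rw [← hΨΦ, hΦ0, map_one]
  · filter_upwards [hΦd, hΦ.eventually_analyticAt] with z h1 h2 a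
    refine (matCLM (n := n)).injective ?_
    rw [← fderiv_matCLM (hΨan z h2), map_mul, ← hΨΦ, ← hAa, ← h1]
    simp only [← hΨΦ]

end MatrixPfaffian

/-! ### Integrability of the Gauss–Manin system -/

namespace GenFrobeniusManifold

variable {n : ℕ} {M : GenFrobeniusManifold n}

/-- The linear forms `dv^α`, `dλ`. -/
def coordForm : Fin n ⊕ Unit → Vec n × ℂ →L[ℂ] ℂ :=
  Sum.elim (fun α => (ContinuousLinearMap.proj α).comp (ContinuousLinearMap.fst ℂ (Vec n) ℂ))
    fun _ => ContinuousLinearMap.snd ℂ (Vec n) ℂ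

variable (M) in
/-- The coefficients of the Gauss–Manin system for the gradients of the periods. -/
def gaussManinCoeff : Fin n ⊕ Unit → Vec n × ℂ → Matrix (Fin n) (Fin n) ℂ :=
  Sum.elim (fun α z => -(M.res z.2 z.1 * M.mulBy α z.1 * M.muPlus))
    fun _ z => M.res z.2 z.1 * M.muPlus

variable (M) in
/-- The operator `l - a ·`. -/
def subMul (a : Vec n × ℂ) (v : Vec n) : Matrix (Fin n) (Fin n) ℂ :=
  a.2 • (1 : Matrix (Fin n) (Fin n) ℂ) - ∑ α, a.1 α • M.mulBy α v

/-- On a tangent vector `(a, l)` the connection form is `L (l - C_a) μ₊`, a single expression for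
the derivatives in `v` and in `λ`. -/
theorem sum_gaussManinCoeff (a z : Vec n × ℂ) :
    ∑ k, coordForm k a • M.gaussManinCoeff k z
      = M.res z.2 z.1 * M.subMul a z.1 * M.muPlus := by
  simp only [Fintype.sum_sum_type, coordForm, gaussManinCoeff, Sum.elim_inl, Sum.elim_inr,
    Finset.univ_unique, Finset.sum_singleton, subMul, Matrix.mul_sub, Matrix.sub_mul,
    Matrix.mul_smul, Matrix.smul_mul, Matrix.mul_one, Finset.mul_sum, Finset.sum_mul, smul_neg,
    Finset.sum_neg_distrib]
  simp
  abel

theorem subMul_comm {v : Vec n} (hv : v ∈ M.domain) (a b : Vec n × ℂ) :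
    M.subMul a v * M.subMul b v = M.subMul b v * M.subMul a v := by
  have h : ∀ α, Commute (M.mulBy α v) (∑ β, b.1 β • M.mulBy β v) := fun α =>
    Commute.sum_right _ _ _ fun β _ => Commute.smul_right (mulBy_comm hv α β) _
  have h2 : Commute (∑ α, a.1 α • M.mulBy α v) (∑ β, b.1 β • M.mulBy β v) :=
    Commute.sum_left _ _ _ fun α _ => Commute.smul_left (h α) _
  refine Commute.sub_left ?_ (Commute.sub_right ?_ h2)
  · exact Commute.smul_left (Commute.one_left _) _
  · exact Commute.smul_right (Commute.one_right _) _

theorem res_subMul_comm {v : Vec n} {lam : ℂ} (hv : v ∈ M.domain)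
    (h : (M.eulerSub lam v).det ≠ 0) (a : Vec n × ℂ) :
    M.res lam v * M.subMul a v = M.subMul a v * M.res lam v := by
  refine Commute.sub_right ?_ ?_
  · exact Commute.smul_right (Commute.one_right _) _
  · exact Commute.sum_right _ _ _ fun α _ => Commute.smul_right (res_mulBy_comm hv h α) _

theorem matDeriv_res {z : Vec n × ℂ} (hv : z.1 ∈ M.domain) (h : (M.eulerSub z.2 z.1).det ≠ 0)
    (a : Vec n × ℂ) :
    matDeriv a (fun z : Vec n × ℂ => M.res z.2 z.1) z
      = M.res z.2 z.1 * (a.2 • (1 : Matrix (Fin n) (Fin n) ℂ)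
        - ∑ α, a.1 α • (M.mulBy α z.1 * M.muPlus + M.muMinus * M.mulBy α z.1)) * M.res z.2 z.1 := by
  have h1 : matDeriv a (fun z : Vec n × ℂ => M.eulerSub z.2 z.1) z
      = ∑ α, a.1 α • (M.mulBy α z.1 * M.muPlus + M.muMinus * M.mulBy α z.1)
        - a.2 • (1 : Matrix (Fin n) (Fin n) ℂ) := by
    have e1 : MatAnalyticAt (fun z : Vec n × ℂ => M.calU z.1) z :=
      MatAnalyticAt.comp (f := Prod.fst) (calU_analytic hv) analyticAt_fst
    have e2 : MatAnalyticAt (fun z : Vec n × ℂ => z.2 • (1 : Matrix (Fin n) (Fin n) ℂ)) z :=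
      MatAnalyticAt.smul analyticAt_snd (matAnalyticAt_const _ _)
    change matDeriv a (fun z : Vec n × ℂ => M.calU z.1 - z.2 • (1 : Matrix (Fin n) (Fin n) ℂ)) z = _
    rw [matDeriv_sub a e1 e2, matDeriv_comp (F := M.calU) (f := fun z : Vec n × ℂ => z.1)
      (calU_analytic hv) differentiableAt_fst,
      matDeriv_smul a analyticAt_snd (matAnalyticAt_const _ _), matDeriv_const, smul_zero, add_zero]
    congr 1
    · have e3 : fderiv ℂ (fun z : Vec n × ℂ => z.1) z a = ∑ α, a.1 α • (Pi.single α 1 : Vec n) := by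
        rw [show (fun z : Vec n × ℂ => z.1) = Prod.fst from rfl, fderiv_fst]
        exact pi_eq_sum_univ' a.1
      rw [e3, matDeriv_sum_dir]
      exact Finset.sum_congr rfl fun α _ => by rw [matDeriv_smul_dir, ← mpd_calU' hv]
    · rw [show (fun w : Vec n × ℂ => w.2) = Prod.snd from rfl, fderiv_snd]
      rfl
  have h2 := matDeriv_inv a (eulerSub_analytic₂ (lam := z.2) hv) h
  rw [show (fun z : Vec n × ℂ => M.res z.2 z.1) = fun w => (M.eulerSub w.2 w.1)⁻¹ from rfl, h2, h1]
  change -(M.res z.2 z.1 * _ * M.res z.2 z.1) = _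
  rw [← Matrix.neg_mul, ← Matrix.mul_neg, neg_sub]

end GenFrobeniusManifold

namespace GenFrobeniusManifold

variable {n : ℕ} {M : GenFrobeniusManifold n}

/-- Let `A, B` be the operators `l - C_a` of two tangent vectors. The derivatives of the structure
constants drop out by the symmetry of `∇c`. Since `dL = L (A μ₊ + μ₋ A) L`, the remaining terms are
the required commutator plus `L μ₋ (A L B - B L A) μ₊`, which vanishes because `A`, `B`, `L`
commute. -/
theorem gaussManin_integrable {z : Vec n × ℂ} (hv : z.1 ∈ M.domain)
    (h : (M.eulerSub z.2 z.1).det ≠ 0) (a b : Vec n × ℂ) :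
    ∑ k, coordForm k b • matDeriv a (M.gaussManinCoeff k) z
        - ∑ k, coordForm k a • matDeriv b (M.gaussManinCoeff k) z
      = (∑ k, coordForm k a • M.gaussManinCoeff k z) * (∑ k, coordForm k b • M.gaussManinCoeff k z)
        - (∑ k, coordForm k b • M.gaussManinCoeff k z)
          * (∑ k, coordForm k a • M.gaussManinCoeff k z) := by
  have hres := res_analytic₂ (M := M) (v := z.1) (lam := z.2) hv h
  have hC : ∀ α, MatAnalyticAt (fun z : Vec n × ℂ => M.mulBy α z.1) z := fun α =>
    MatAnalyticAt.comp (f := Prod.fst) (mulBy_analytic hv α) analyticAt_fst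
  have hCd : ∀ α a, matDeriv a (fun z : Vec n × ℂ => M.mulBy α z.1) z
      = ∑ β, a.1 β • mpd β (M.mulBy α) z.1 := by
    intro α a
    have e3 : fderiv ℂ (fun z : Vec n × ℂ => z.1) z a = ∑ α, a.1 α • (Pi.single α 1 : Vec n) := by
      rw [show (fun z : Vec n × ℂ => z.1) = Prod.fst from rfl, fderiv_fst]
      exact pi_eq_sum_univ' a.1
    rw [matDeriv_comp (F := M.mulBy α) (f := fun z : Vec n × ℂ => z.1)
      (mulBy_analytic hv α) differentiableAt_fst, e3, matDeriv_sum_dir]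
    exact Finset.sum_congr rfl fun β _ => by rw [matDeriv_smul_dir]
  have hd : ∀ a b, ∑ k, coordForm k b • matDeriv a (M.gaussManinCoeff k) z
      = matDeriv a (fun z : Vec n × ℂ => M.res z.2 z.1) z * M.subMul b z.1 * M.muPlus
        - M.res z.2 z.1 * (∑ α, ∑ β, (b.1 α * a.1 β) • mpd β (M.mulBy α) z.1) * M.muPlus := by
    intro a b
    have e1 : matDeriv a (M.gaussManinCoeff (Sum.inr ())) z
        = matDeriv a (fun z : Vec n × ℂ => M.res z.2 z.1) z * M.muPlus := by
      rw [show M.gaussManinCoeff (Sum.inr ()) = fun z => M.res z.2 z.1 * M.muPlus from rfl,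
        matDeriv_mul_const a _ hres]
    have e2 : ∀ α, matDeriv a (M.gaussManinCoeff (Sum.inl α)) z
        = -((matDeriv a (fun z : Vec n × ℂ => M.res z.2 z.1) z * M.mulBy α z.1
          + M.res z.2 z.1 * ∑ β, a.1 β • mpd β (M.mulBy α) z.1) * M.muPlus) := by
      intro α
      rw [show M.gaussManinCoeff (Sum.inl α)
        = fun z => -(M.res z.2 z.1 * M.mulBy α z.1 * M.muPlus) from rfl, matDeriv_neg, matDeriv_mul_const a _ (hres.mul (hC α)),
        matDeriv_mul a hres (hC α), hCd]
    simp only [Fintype.sum_sum_type, Finset.univ_unique, Finset.sum_singleton, PUnit.default_eq_unit,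
      e1, e2, coordForm, Sum.elim_inl, Sum.elim_inr, subMul, Matrix.mul_sub, Matrix.sub_mul,
      Matrix.mul_smul, Matrix.smul_mul, Matrix.mul_one, Finset.mul_sum, Finset.sum_mul, smul_neg,
      Finset.sum_neg_distrib, Matrix.add_mul, smul_add, Finset.sum_add_distrib, Finset.smul_sum,
      smul_smul]
    simp
    abel
  have hsymm : ∑ α, ∑ β, (b.1 α * a.1 β) • mpd β (M.mulBy α) z.1
      = ∑ α, ∑ β, (a.1 α * b.1 β) • mpd β (M.mulBy α) z.1 := by
    rw [Finset.sum_comm]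
    exact Finset.sum_congr rfl fun α _ => Finset.sum_congr rfl fun β _ => by
      rw [mpd_mulBy_symm hv, mul_comm]
  have hrd : ∀ a, matDeriv a (fun z : Vec n × ℂ => M.res z.2 z.1) z
      = M.res z.2 z.1 * (M.subMul a z.1 * M.muPlus + M.muMinus * M.subMul a z.1)
        * M.res z.2 z.1 := by
    intro a
    rw [matDeriv_res hv h]
    congr 2
    -- The identity `1 = μ₊ + μ₋` divides the derivative in `λ` in the same way as the derivatives
    -- in `v`.
    have e : a.2 • (1 : Matrix (Fin n) (Fin n) ℂ) = a.2 • M.muPlus + a.2 • M.muMinus := by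
      rw [muMinus_eq, ← smul_add, add_sub_cancel]
    rw [e]
    simp only [subMul, Matrix.mul_sub, Matrix.sub_mul, Matrix.mul_smul, Matrix.smul_mul,
      Matrix.mul_one, Matrix.one_mul, Finset.mul_sum, Finset.sum_mul, smul_add,
      Finset.sum_add_distrib]
    abel
  rw [hd, hd, hsymm, sum_gaussManinCoeff, sum_gaussManinCoeff, hrd, hrd]
  have hab := subMul_comm hv a b
  have ha := res_subMul_comm hv h a
  have hb := res_subMul_comm hv h b
  set L := M.res z.2 z.1
  set A := M.subMul a z.1
  set B := M.subMul b z.1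
  have hALB : A * L * B = B * L * A := by
    rw [← ha, mul_assoc, hab, ← mul_assoc, hb]
  have h2 : L * (A * M.muPlus + M.muMinus * A) * L * B * M.muPlus
      - L * (B * M.muPlus + M.muMinus * B) * L * A * M.muPlus
      = L * A * M.muPlus * (L * B * M.muPlus) - L * B * M.muPlus * (L * A * M.muPlus)
        + L * M.muMinus * (A * L * B - B * L * A) * M.muPlus := by noncomm_ring
  rw [sub_sub_sub_cancel_right, h2, hALB]
  simp

end GenFrobeniusManifold

/-! ### Local existence of bases of periods -/

namespace CanonicalChart

open GenFrobeniusManifold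

variable {n : ℕ} {M : GenFrobeniusManifold n} (X : CanonicalChart M)

/-- Bases of periods exist near every point off the discriminant. -/
theorem exists_isPeriodBasis {z₀ : Vec n × ℂ} (hv₀ : z₀.1 ∈ X.D) (h₀ : ∀ i, z₀.2 ≠ X.u i z₀.1) :
    ∃ (W : Set (Vec n × ℂ)) (p : Fin n → Vec n → ℂ → ℂ), X.IsPeriodBasis W p ∧ z₀ ∈ W := by
  have hdet₀ := (X.det_eulerSub_ne_zero_iff hv₀).2 h₀
  have hreg : ∀ᶠ z in 𝓝 z₀, z.1 ∈ X.D ∧ (M.eulerSub z.2 z.1).det ≠ 0 :=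
    (continuousAt_fst.eventually (X.isOpen_D.eventually_mem hv₀)).and
      ((eulerSub_analytic₂ (lam := z₀.2) (X.D_subset hv₀)).eventually_det_ne_zero hdet₀)
  have hres := res_analytic₂ (M := M) (v := z₀.1) (lam := z₀.2) (X.D_subset hv₀) hdet₀
  have hN : ∀ k, MatAnalyticAt (M.gaussManinCoeff k) z₀ := by
    rintro (α | _)
    · exact ((hres.mul (MatAnalyticAt.comp (f := Prod.fst) (mulBy_analytic (X.D_subset hv₀) α)
        analyticAt_fst)).mul (matAnalyticAt_const _ _)).neg
    · exact hres.mul (matAnalyticAt_const _ _)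
  -- A fundamental solution of the system for the gradients; its columns still have to be integrated
  -- to functions.
  obtain ⟨Φ, hΦ, hΦ1, hΦd⟩ := exists_matrix_pfaffian_solution coordForm hN
    (hreg.mono fun z hz a b => gaussManin_integrable (X.D_subset hz.1) hz.2 a b)
  simp only [sum_gaussManinCoeff] at hΦd
  set Q : Vec n × ℂ → Matrix (Fin n) (Fin n) ℂ := fun z => M.η * Φ z with hQ
  have hQan : ∀ z, MatAnalyticAt Φ z → MatAnalyticAt Q z := fun z hz =>
    (matAnalyticAt_const _ _).mul hz
  have hΦan : ∀ᶠ z in 𝓝 z₀, MatAnalyticAt Φ z :=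
    eventually_all.2 fun i => eventually_all.2 fun j => (hΦ i j).eventually_analyticAt
  have hQd : ∀ᶠ z in 𝓝 z₀, ∀ a, matDeriv a Q z = M.η * M.res z.2 z.1 * M.subMul a z.1 * M.muPlus
      * Φ z := by
    filter_upwards [hΦan, hΦd] with z h1 h2 a
    rw [hQ, matDeriv_const_mul _ _ h1, h2]
    simp only [Matrix.mul_assoc]
  set φ : Fin n → Vec n × ℂ → Vec n →L[ℂ] ℂ := fun β z =>
    ∑ α, Q z α β • ContinuousLinearMap.proj (R := ℂ) (φ := fun _ : Fin n => ℂ) α with hφ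
  have hφa : ∀ β z a, φ β z a = ∑ α, Q z α β * a α := fun β z a => by simp [hφ, sum_apply]
  have hφan : ∀ β z, MatAnalyticAt Φ z → AnalyticAt ℂ (φ β) z := fun β z hz =>
    Finset.analyticAt_fun_sum _ fun α _ => (hQan z hz α β).fun_smul analyticAt_const
  -- For fixed `λ` each column of `η Φ` is a closed one-form, because `η L C_δ` is symmetric in all
  -- its indices.
  have hclosed : ∀ β, ∀ᶠ z in 𝓝 z₀, ∀ a b, fderiv ℂ (φ β) z (a, 0) b = fderiv ℂ (φ β) z (b, 0) a := by
    intro β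
    filter_upwards [hΦan, hQd, hreg] with z h1 h2 h3
    have e1 : ∀ a b, fderiv ℂ (φ β) z (a, 0) b
        = -∑ γ, (M.muPlus * Φ z) γ β *
          ∑ α, ∑ δ, b α * a δ * (M.η * M.res z.2 z.1 * M.mulBy δ z.1) α γ := by
      intro a b
      rw [← fderiv_clm_apply_const (hφan β z h1).differentiableAt]
      simp only [hφa]
      have e2 : HasFDerivAt (fun z => ∑ α, Q z α β * b α) _ z := HasFDerivAt.fun_sum fun α _ =>
        (hQan z h1 α β).differentiableAt.hasFDerivAt.mul_const (b α)
      rw [e2.fderiv]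
      simp only [sum_apply, smul_apply, smul_eq_mul]
      have e3 : ∀ α, fderiv ℂ (fun z => Q z α β) z (a, 0)
          = -∑ γ, (∑ δ, a δ * (M.η * M.res z.2 z.1 * M.mulBy δ z.1) α γ)
            * (M.muPlus * Φ z) γ β := by
        intro α
        rw [← matDeriv_apply, h2, subMul]
        have e4 : M.η * M.res z.2 z.1 * (((a, 0) : Vec n × ℂ).2 • (1 : Matrix (Fin n) (Fin n) ℂ)
            - ∑ δ, ((a, 0) : Vec n × ℂ).1 δ • M.mulBy δ z.1) * M.muPlus * Φ z
            = -((∑ δ, a δ • (M.η * M.res z.2 z.1 * M.mulBy δ z.1)) * (M.muPlus * Φ z)) := by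
          simp only [zero_smul, zero_sub, Matrix.mul_neg, Matrix.neg_mul, Finset.mul_sum,
            Matrix.mul_smul, Matrix.mul_assoc]
        rw [e4, Matrix.neg_apply, Matrix.mul_apply]
        simp [Matrix.sum_apply]
      simp only [e3, Finset.mul_sum, Finset.sum_mul, mul_neg, ← Finset.sum_neg_distrib]
      rw [Finset.sum_comm]
      refine Finset.sum_congr rfl fun γ _ => Finset.sum_congr rfl fun α _ =>
        Finset.sum_congr rfl fun δ _ => by ring
    intro a b
    rw [e1, e1]
    congr 1
    refine Finset.sum_congr rfl fun γ _ => ?_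
    congr 1
    rw [Finset.sum_comm]
    refine Finset.sum_congr rfl fun α _ => Finset.sum_congr rfl fun δ _ => ?_
    rw [η_res_mulBy_symm (X.D_subset h3.1) h3.2 α δ]
    ring
  choose p hpan hpd using fun β => exists_potential (hφan β z₀ hΦan.self_of_nhds) (hclosed β)
  have hdetΦ : ∀ᶠ z in 𝓝 z₀, (Φ z).det ≠ 0 := hΦ.eventually_det_ne_zero (by rw [hΦ1]; simp)
  have hall : ∀ᶠ z in 𝓝 z₀, (z.1 ∈ X.D ∧ (M.eulerSub z.2 z.1).det ≠ 0) ∧ MatAnalyticAt Φ z ∧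
      (∀ a, matDeriv a Φ z = M.res z.2 z.1 * M.subMul a z.1 * M.muPlus * Φ z) ∧
      (Φ z).det ≠ 0 ∧ ∀ β, AnalyticAt ℂ (p β) z ∧ ∀ a, fderiv ℂ (p β) z (a, 0) = φ β z a := by
    filter_upwards [hreg, hΦan, hΦd, hdetΦ, eventually_all.2 fun β => (hpan β).eventually_analyticAt,
      eventually_all.2 hpd] with z h1 h2 h3 h4 h5 h6
    exact ⟨h1, h2, h3, h4, fun β => ⟨h5 β, h6 β⟩⟩
  obtain ⟨W, hW, hWopen, hzW⟩ := eventually_nhds_iff.1 hall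
  have hpd' : ∀ β z, z ∈ W → ∀ α, pd α (fun w => p β (w, z.2)) z.1 = Q z α β := by
    intro β z hz α
    rw [pd, fderiv_slice_left (f := p β) (x := z.1) (y := z.2)
      ((hW z hz).2.2.2.2 β).1.differentiableAt, ((hW z hz).2.2.2.2 β).2, hφa]
    simp [Pi.single_apply]
  have hWslice : ∀ z ∈ W, ∀ᶠ w in 𝓝 z.1, (w, z.2) ∈ W := fun z hz =>
    (Continuous.prodMk_left z.2).continuousAt.eventually (hWopen.eventually_mem hz)
  have hgrad : ∀ β z, z ∈ W → ∀ γ, M.grad (fun w => p β (w, z.2)) γ z.1 = Φ z γ β := by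
    intro β z hz γ
    have e : Φ z = M.η⁻¹ * Q z := by rw [hQ, ← Matrix.mul_assoc, η_inv_mul, Matrix.one_mul]
    rw [grad, e, Matrix.mul_apply]
    exact Finset.sum_congr rfl fun α _ => by rw [hpd' β z hz]
  refine ⟨W, fun β v lam => p β (v, lam), ⟨hWopen, ?_, ?_, ?_⟩, hzW⟩
  · intro v lam hz
    obtain ⟨h1, h2⟩ := (hW _ hz).1
    exact ⟨h1, (GenFrobeniusManifold.det_eulerSub_ne_zero_iff (X.D_subset h1)).2 h2⟩
  · intro β
    refine ⟨fun z hz => ((hW z hz).2.2.2.2 β).1, ?_, ?_⟩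
    · intro v lam hz α δ
      obtain ⟨⟨h1, h2⟩, h3, h4, -⟩ := hW _ hz
      have e1 : (pd δ fun w => p β (w, lam)) =ᶠ[𝓝 v] fun w => Q (w, lam) δ β :=
        (hWslice _ hz).mono fun w hw => hpd' β (w, lam) hw δ
      have e2 : fderiv ℂ (fun w => Q (w, lam) δ β) v (Pi.single α 1)
          = matDeriv (Pi.single α 1, 0) Q (v, lam) δ β :=
        fderiv_slice_left (f := fun z => Q z δ β) (hQan _ h3 δ β).differentiableAt _
      rw [pd, e1.fderiv_eq, e2, hQ, matDeriv_const_mul _ _ h3, h4]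
      have e3 : M.subMul (Pi.single α 1, 0) v = -M.mulBy α v := by
        simp [subMul, Pi.single_apply]
      have e4 : M.η * (M.res lam v * M.subMul (Pi.single α 1, 0) v * M.muPlus * Φ (v, lam))
          = -(M.η * M.res lam v * M.mulBy α v * M.muPlus * M.η⁻¹) * Q (v, lam) := by
        rw [e3, hQ]
        calc _ = -(M.η * M.res lam v * M.mulBy α v * M.muPlus * 1 * Φ (v, lam)) := by noncomm_ring
          _ = _ := by rw [← η_inv_mul (M := M)]; noncomm_ring
      refine (congrFun (congrFun e4 δ) β).trans ?_
      rw [Matrix.mul_apply]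
      refine Finset.sum_congr rfl fun γ _ => ?_
      rw [christoffel_eq (X.D_subset h1) h2, hpd' β (v, lam) hz, Matrix.neg_apply]
    · intro v lam hz α
      obtain ⟨⟨h1, h2⟩, h3, h4, -⟩ := hW _ hz
      have e1 : ∀ δ, deriv (fun l => M.grad (fun w => p β (w, l)) δ v) lam
          = matDeriv (0, 1) Φ (v, lam) δ β := by
        intro δ
        have e2 : (fun l => M.grad (fun w => p β (w, l)) δ v) =ᶠ[𝓝 lam] fun l => Φ (v, l) δ β := by
          have : ∀ᶠ l in 𝓝 lam, (v, l) ∈ W :=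
            (Continuous.prodMk_right v).continuousAt.eventually (hWopen.eventually_mem hz)
          exact this.mono fun l hl => hgrad β (v, l) hl δ
        rw [e2.deriv_eq]
        exact deriv_slice_right (f := fun z => Φ z δ β) (h3 δ β).differentiableAt
      have e3 : M.subMul ((0 : Vec n), (1 : ℂ)) v = 1 := by simp [subMul]
      have e4 : M.eulerSub lam v * matDeriv (0, 1) Φ (v, lam) = M.muPlus * Φ (v, lam) := by
        rw [h4, e3, Matrix.mul_one, ← Matrix.mul_assoc, ← Matrix.mul_assoc, mul_res h2,
          Matrix.one_mul]
      have e5 := congrFun (congrFun e4 α) β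
      rw [Matrix.mul_apply, Matrix.mul_apply] at e5
      simp only [e1]
      refine e5.trans (Finset.sum_congr rfl fun δ _ => ?_)
      rw [hgrad β (v, lam) hz]
      rfl
  · intro v lam hz
    have e : (Matrix.of fun α β : Fin n => pd β (fun w => p α (w, lam)) v) = (Q (v, lam)).transpose := by
      ext α β
      exact hpd' α (v, lam) hz β
    rw [e, Matrix.det_transpose, hQ, Matrix.det_mul]
    exact mul_ne_zero M.η_det (hW _ hz).2.2.2.1

end CanonicalChart

/-! ### The grading of matrices by the eigenvalues of `ad μ` -/

section Grading

variable {n : ℕ} {μ : Matrix (Fin n) (Fin n) ℂ} {X Y : Matrix (Fin n) (Fin n) ℂ}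

/-- `X` is homogeneous of degree `k`: `[μ, X] = k X`. -/
def IsDeg (μ : Matrix (Fin n) (Fin n) ℂ) (k : ℕ) (X : Matrix (Fin n) (Fin n) ℂ) : Prop :=
  μ * X - X * μ = (k : ℂ) • X

theorem IsDeg.mul {j k : ℕ} (hX : IsDeg μ j X) (hY : IsDeg μ k Y) : IsDeg μ (j + k) (X * Y) := by
  have e : μ * (X * Y) - X * Y * μ = (μ * X - X * μ) * Y + X * (μ * Y - Y * μ) := by noncomm_ring
  unfold IsDeg at *
  rw [e, hX, hY, smul_mul_assoc, mul_smul_comm, ← add_smul, Nat.cast_add]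

/-- A commutator has trace zero, so `k tr X = 0`. -/
theorem IsDeg.trace {k : ℕ} (hk : 1 ≤ k) (hX : IsDeg μ k X) : X.trace = 0 := by
  have h := congrArg Matrix.trace hX
  rw [Matrix.trace_sub, Matrix.trace_mul_comm, sub_self, Matrix.trace_smul, smul_eq_mul] at h
  exact (mul_eq_zero.1 h.symm).resolve_left (Nat.cast_ne_zero.2 (by omega))

variable (μ) in
-- A nonzero homogeneous matrix of degree `k` makes `k` an eigenvalue of `ad μ`, which has only
-- finitely many. In particular `R_k = 0` for large `k`, and matrices of positive degree are
-- nilpotent.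
theorem exists_isDeg_eq_zero : ∃ K : ℕ, ∀ k, K ≤ k → ∀ X, IsDeg μ k X → X = 0 := by
  let ad : Module.End ℂ (Matrix (Fin n) (Fin n) ℂ) := LinearMap.mulLeft ℂ μ - LinearMap.mulRight ℂ μ
  have hfin : {k : ℕ | ad.HasEigenvalue (k : ℂ)}.Finite :=
    (Module.End.finite_hasEigenvalue ad).preimage (Nat.cast_injective.injOn)
  obtain ⟨K, hK⟩ := hfin.bddAbove
  refine ⟨K + 1, fun k hk X hX => by_contra fun hne => ?_⟩
  have : ad.HasEigenvalue (k : ℂ) :=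
    Module.End.hasEigenvalue_of_hasEigenvector (x := X)
      ⟨Module.End.mem_eigenspace_iff.2 (by simpa [ad, IsDeg] using hX), hne⟩
  have := hK this
  omega

variable (μ) in
/-- The span of the homogeneous matrices of degree at least `k`. -/
def degGE (k : ℕ) : Submodule ℂ (Matrix (Fin n) (Fin n) ℂ) :=
  Submodule.span ℂ {X | ∃ j, k ≤ j ∧ IsDeg μ j X}

theorem IsDeg.mem {j k : ℕ} (hX : IsDeg μ j X) (h : k ≤ j) : X ∈ degGE μ k :=
  Submodule.subset_span ⟨j, h, hX⟩

theorem degGE_anti {j k : ℕ} (h : k ≤ j) : degGE μ j ≤ degGE μ k :=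
  Submodule.span_mono fun _ ⟨i, hi, hX⟩ => ⟨i, h.trans hi, hX⟩

theorem degGE_mul {j k : ℕ} (hX : X ∈ degGE μ j) (hY : Y ∈ degGE μ k) : X * Y ∈ degGE μ (j + k) := by
  have h : X * Y ∈ degGE μ j * degGE μ k := Submodule.mul_mem_mul hX hY
  rw [degGE, degGE, Submodule.span_mul_span] at h
  refine Submodule.span_le.2 ?_ h
  rintro _ ⟨A, ⟨i, hi, hA⟩, B, ⟨l, hl, hB⟩, rfl⟩
  exact (hA.mul hB).mem (by omega)

theorem trace_of_mem_degGE {k : ℕ} (hk : 1 ≤ k) (hX : X ∈ degGE μ k) : X.trace = 0 := by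
  induction hX using Submodule.span_induction with
  | mem x hx => obtain ⟨j, hj, hx⟩ := hx; exact hx.trace (hk.trans hj)
  | zero => simp
  | add x y _ _ hx hy => rw [Matrix.trace_add, hx, hy, add_zero]
  | smul c x _ hx => rw [Matrix.trace_smul, hx, smul_zero]

theorem degGE_eq_zero {K : ℕ} (hK : ∀ k, K ≤ k → ∀ X, IsDeg μ k X → X = 0) {k : ℕ} (hk : K ≤ k)
    (hX : X ∈ degGE μ k) : X = 0 := by
  have : degGE μ k ≤ ⊥ := Submodule.span_le.2 fun Y ⟨j, hj, hY⟩ => hK j (hk.trans hj) Y hY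
  simpa using this hX

theorem one_mem_degGE : (1 : Matrix (Fin n) (Fin n) ℂ) ∈ degGE μ 0 :=
  IsDeg.mem (j := 0) (by simp [IsDeg]) le_rfl

theorem self_mem_degGE : μ ∈ degGE μ 0 := IsDeg.mem (j := 0) (by simp [IsDeg]) le_rfl

/-- The geometric series terminates, since high powers of `X` have degrees that do not occur. -/
theorem exists_inv_one_sub (hX : X ∈ degGE μ 1) :
    ∃ G, (1 - X) * G = 1 ∧ G - 1 ∈ degGE μ 1 := by
  obtain ⟨K, hK⟩ := exists_isDeg_eq_zero μ
  have hpow : ∀ k, X ^ k ∈ degGE μ k := by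
    intro k
    induction k with
    | zero => simpa using one_mem_degGE
    | succ k ih => rw [pow_succ]; exact degGE_mul ih hX
  refine ⟨∑ i ∈ Finset.range (K + 1), X ^ i, ?_, ?_⟩
  · rw [mul_neg_geom_sum, degGE_eq_zero hK (Nat.le_succ K) (hpow (K + 1)), sub_zero]
  · rw [Finset.sum_range_succ', pow_zero, add_sub_cancel_right]
    exact Submodule.sum_mem _ fun i _ => degGE_anti (by omega) (hpow (i + 1))

end Grading

/-! ### The adjoint with respect to `η` and the grading -/

namespace GenFrobeniusManifold

variable {n : ℕ} (M : GenFrobeniusManifold n) {X Y : Matrix (Fin n) (Fin n) ℂ}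

/-- The adjoint with respect to `η`. -/
def adj (X : Matrix (Fin n) (Fin n) ℂ) : Matrix (Fin n) (Fin n) ℂ := M.η⁻¹ * X.transpose * M.η

theorem transpose_mul_η (X : Matrix (Fin n) (Fin n) ℂ) : X.transpose * M.η = M.η * M.adj X := by
  rw [adj, ← mul_assoc, ← mul_assoc, M.η_mul_inv, one_mul]

/-- Taking adjoints reverses a commutator and changes the sign of `μ`; the two signs cancel and the
degree is preserved. -/
theorem adj_mem {k : ℕ} (hX : X ∈ degGE M.μ k) : M.adj X ∈ degGE M.μ k := by
  induction hX using Submodule.span_induction with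
  | mem x hx =>
    obtain ⟨j, hj, hx⟩ := hx
    refine IsDeg.mem (j := j) ?_ hj
    have h1 : M.μ * M.η⁻¹ = -(M.η⁻¹ * M.μ.transpose) := by
      have h2 : M.η⁻¹ * (M.η * M.μ) * M.η⁻¹ = -(M.η⁻¹ * (M.μ.transpose * M.η) * M.η⁻¹) := by
        rw [M.η_μ, mul_neg, neg_mul]
      rwa [← mul_assoc, M.η_inv_mul, one_mul, mul_assoc M.η⁻¹ (_ * _), mul_assoc M.μ.transpose,
        M.η_mul_inv, mul_one] at h2
    have h3 := congrArg Matrix.transpose hx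
    rw [Matrix.transpose_sub, Matrix.transpose_mul, Matrix.transpose_mul, Matrix.transpose_smul] at h3
    rw [IsDeg, adj, ← mul_assoc, ← mul_assoc, h1, mul_assoc _ M.η, M.η_μ,
      ← smul_mul_assoc, ← mul_smul_comm, ← h3]
    noncomm_ring
  | zero => simp [adj]
  | add x y _ _ hx hy =>
    have : M.adj (x + y) = M.adj x + M.adj y := by
      rw [adj, adj, adj, Matrix.transpose_add]; noncomm_ring
    rw [this]; exact Submodule.add_mem _ hx hy
  | smul c x _ hx =>
    have : M.adj (c • x) = c • M.adj x := by
      rw [adj, adj, Matrix.transpose_smul, mul_smul_comm, smul_mul_assoc]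
    rw [this]; exact Submodule.smul_mem _ c hx

theorem adj_muPlus : M.adj M.muPlus = M.muMinus := by
  have h : M.muPlus.transpose * M.η = M.η * M.muMinus := M.η_muMinus.symm
  rw [adj, mul_assoc, h, ← mul_assoc, M.η_inv_mul, one_mul]

end GenFrobeniusManifold

/-! ### Sequences of factorial growth -/

section Growth

variable {l m n : Type*} [Fintype l] [Fintype m] [Fintype n]

/-- The sum of the absolute values of the entries. -/
def entryNorm (A : Matrix m n ℂ) : ℝ := ∑ i, ∑ j, ‖A i j‖

theorem entryNorm_nonneg (A : Matrix m n ℂ) : 0 ≤ entryNorm A :=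
  Finset.sum_nonneg fun _ _ => Finset.sum_nonneg fun _ _ => norm_nonneg _

theorem norm_apply_le_entryNorm (A : Matrix m n ℂ) (i : m) (j : n) : ‖A i j‖ ≤ entryNorm A :=
  (Finset.single_le_sum (f := fun j => ‖A i j‖) (fun _ _ => norm_nonneg _) (Finset.mem_univ j)).trans
    (Finset.single_le_sum (f := fun i => ∑ j, ‖A i j‖)
      (fun _ _ => Finset.sum_nonneg fun _ _ => norm_nonneg _) (Finset.mem_univ i))

theorem entryNorm_add (A B : Matrix m n ℂ) : entryNorm (A + B) ≤ entryNorm A + entryNorm B := by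
  simp only [entryNorm, ← Finset.sum_add_distrib]
  exact Finset.sum_le_sum fun i _ => Finset.sum_le_sum fun j _ => norm_add_le _ _

theorem entryNorm_smul (c : ℂ) (A : Matrix m n ℂ) : entryNorm (c • A) = ‖c‖ * entryNorm A := by
  simp only [entryNorm, Finset.mul_sum, Matrix.smul_apply, norm_smul]

theorem entryNorm_zero : entryNorm (0 : Matrix m n ℂ) = 0 := by simp [entryNorm]

theorem entryNorm_neg (A : Matrix m n ℂ) : entryNorm (-A) = entryNorm A := by
  simp [entryNorm]

theorem entryNorm_sub (A B : Matrix m n ℂ) : entryNorm (A - B) ≤ entryNorm A + entryNorm B := by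
  rw [sub_eq_add_neg, ← entryNorm_neg B]; exact entryNorm_add _ _

theorem entryNorm_sum {ι : Type*} (s : Finset ι) (A : ι → Matrix m n ℂ) :
    entryNorm (∑ k ∈ s, A k) ≤ ∑ k ∈ s, entryNorm (A k) := by
  classical
  induction s using Finset.induction_on with
  | empty => simp [entryNorm_zero]
  | insert a s ha ih =>
    rw [Finset.sum_insert ha, Finset.sum_insert ha]
    exact (entryNorm_add _ _).trans (by gcongr)

theorem entryNorm_transpose (A : Matrix m n ℂ) : entryNorm A.transpose = entryNorm A :=
  Finset.sum_comm

theorem entryNorm_mul (A : Matrix l m ℂ) (B : Matrix m n ℂ) :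
    entryNorm (A * B) ≤ entryNorm A * entryNorm B := by
  have h : ∀ i j, ‖(A * B) i j‖ ≤ ∑ k, ‖A i k‖ * ‖B k j‖ := fun i j => by
    rw [Matrix.mul_apply]
    exact (norm_sum_le _ _).trans (le_of_eq (by simp only [norm_mul]))
  calc entryNorm (A * B) ≤ ∑ i, ∑ j, ∑ k, ‖A i k‖ * ‖B k j‖ :=
        Finset.sum_le_sum fun i _ => Finset.sum_le_sum fun j _ => h i j
    _ = ∑ i, ∑ k, ‖A i k‖ * ∑ j, ‖B k j‖ := by
        refine Finset.sum_congr rfl fun i _ => ?_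
        rw [Finset.sum_comm]; simp only [Finset.mul_sum]
    _ ≤ ∑ i, ∑ k, ‖A i k‖ * entryNorm B := by
        gcongr with i _ k _
        exact Finset.single_le_sum (f := fun k => ∑ j, ‖B k j‖)
          (fun _ _ => Finset.sum_nonneg fun _ _ => norm_nonneg _) (Finset.mem_univ k)
    _ = entryNorm A * entryNorm B := by simp only [entryNorm, Finset.sum_mul]

theorem entryNorm_diagonal_mul [DecidableEq m] {d : m → ℂ} {ρ : ℝ} (hd : ∀ i, ‖d i‖ ≤ ρ)
    (A : Matrix m n ℂ) : entryNorm (Matrix.diagonal d * A) ≤ ρ * entryNorm A := by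
  simp only [entryNorm, Finset.mul_sum, Matrix.diagonal_mul, norm_mul]
  exact Finset.sum_le_sum fun i _ => Finset.sum_le_sum fun j _ => by gcongr; exact hd i

/-- A family of sequences with `x_{p+1} ≤ κ x_p + E`, `κ < 1`, for large `p`, is uniformly bounded. -/
theorem exists_bound_of_contracting {β : Type*} {s : Set β} {x : β → ℕ → ℝ} {κ E : ℝ}
    (hκ0 : 0 ≤ κ) (hκ : κ < 1)
    (hbdd : ∀ p, ∃ C, ∀ b ∈ s, x b p ≤ C) {N : ℕ}
    (hrec : ∀ p, N ≤ p → ∀ b ∈ s, x b (p + 1) ≤ κ * x b p + E) :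
    ∃ C, ∀ p, ∀ b ∈ s, x b p ≤ C := by
  choose c hc using hbdd
  -- `E / (1 - κ)` is the fixed point of `y ↦ κ y + E`, so `C` bounds it together with the first `N
  -- + 1` terms, to which the recursion does not apply.
  set C : ℝ := max (E / (1 - κ)) (∑ p ∈ Finset.range (N + 1), |c p|) with hC
  have h1 : E ≤ (1 - κ) * C := by
    rw [mul_comm, ← div_le_iff₀ (by linarith)]; exact le_max_left _ _
  have h2 : ∀ p, p ≤ N → ∀ b ∈ s, x b p ≤ C := fun p hp b hb =>
    ((hc p b hb).trans (le_abs_self _)).trans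
      ((Finset.single_le_sum (f := fun p => |c p|) (fun _ _ => abs_nonneg _)
        (Finset.mem_range.2 (Nat.lt_succ_of_le hp))).trans (le_max_right _ _))
  refine ⟨C, fun p => ?_⟩
  induction p with
  | zero => exact h2 0 (Nat.zero_le _)
  | succ p ih =>
    intro b hb
    rcases le_or_gt (p + 1) N with h | h
    · exact h2 _ h b hb
    · have h3 := hrec p (by omega) b hb
      have h4 := mul_le_mul_of_nonneg_left (ih b hb) hκ0
      linarith

variable (m n) in
/-- The sequences of matrices of size `O(p! / r^p)` for every positive `r < ℓ`. -/
def factorialGrowth (ℓ : ℝ) : Submodule ℂ (ℕ → Matrix m n ℂ) where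
  carrier := {a | ∀ r, 0 < r → r < ℓ → ∃ C, ∀ p, entryNorm (a p) ≤ C * (p.factorial : ℝ) / r ^ p}
  add_mem' := by
    intro a b ha hb r hr hrl
    obtain ⟨C, hC⟩ := ha r hr hrl
    obtain ⟨D, hD⟩ := hb r hr hrl
    refine ⟨C + D, fun p => (entryNorm_add _ _).trans ?_⟩
    rw [add_mul, add_div]; exact add_le_add (hC p) (hD p)
  zero_mem' := fun r hr hrl => ⟨0, fun p => by simp [entryNorm_zero]⟩
  smul_mem' := by
    intro c a ha r hr hrl
    obtain ⟨C, hC⟩ := ha r hr hrl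
    refine ⟨‖c‖ * C, fun p => ?_⟩
    change entryNorm (c • a p) ≤ _
    rw [entryNorm_smul, mul_assoc, mul_div_assoc]
    exact mul_le_mul_of_nonneg_left (hC p) (norm_nonneg c)

variable {ℓ : ℝ}

theorem factorialGrowth.const_mul {a : ℕ → Matrix m n ℂ} (ha : a ∈ factorialGrowth m n ℓ)
    (A : Matrix l m ℂ) : (fun p => A * a p) ∈ factorialGrowth l n ℓ := by
  intro r hr hrl
  obtain ⟨C, hC⟩ := ha r hr hrl
  refine ⟨entryNorm A * C, fun p => (entryNorm_mul _ _).trans ?_⟩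
  rw [mul_assoc, mul_div_assoc]
  exact mul_le_mul_of_nonneg_left (hC p) (entryNorm_nonneg A)

/-- `(p + 1) κ^p` is bounded for `0 ≤ κ < 1`. -/
theorem exists_bound_succ_mul_pow {κ : ℝ} (h0 : 0 ≤ κ) (h1 : κ < 1) :
    ∃ B, ∀ p : ℕ, ((p : ℝ) + 1) * κ ^ p ≤ B := by
  have h : Tendsto (fun p : ℕ => ((p : ℝ) + 1) * κ ^ p) atTop (𝓝 0) := by
    have h2 := (tendsto_self_mul_const_pow_of_lt_one h0 h1).add (tendsto_pow_atTop_nhds_zero_of_lt_one h0 h1)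
    simpa [add_mul] using h2
  obtain ⟨B, hB⟩ := h.bddAbove_range
  exact ⟨B, fun p => hB ⟨p, rfl⟩⟩

/-- A radius strictly between `r` and `ℓ` absorbs the factor `p + 1` in a geometric sequence. -/
theorem factorialGrowth.succ_mul {a : ℕ → Matrix m n ℂ} (ha : a ∈ factorialGrowth m n ℓ) {r : ℝ}
    (hr : 0 < r) (hrl : r < ℓ) :
    ∃ C, ∀ p : ℕ, ((p : ℝ) + 1) * entryNorm (a p) ≤ C * (p.factorial : ℝ) / r ^ p := by
  have hr' : r < (r + ℓ) / 2 := by linarith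
  obtain ⟨C, hC⟩ := ha ((r + ℓ) / 2) (by linarith) (by linarith)
  generalize (r + ℓ) / 2 = r' at hr' hC
  have hr0 : 0 < r' := hr.trans hr'
  obtain ⟨B, hB⟩ := exists_bound_succ_mul_pow (κ := r / r') (by positivity) ((div_lt_one hr0).2 hr')
  have hC0 : 0 ≤ C := by simpa using (entryNorm_nonneg _).trans (hC 0)
  refine ⟨B * C, fun p => ?_⟩
  calc ((p : ℝ) + 1) * entryNorm (a p) ≤ ((p : ℝ) + 1) * (C * (p.factorial : ℝ) / r' ^ p) := by
        gcongr; exact hC p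
    _ = (((p : ℝ) + 1) * (r / r') ^ p) * (C * (p.factorial : ℝ) / r ^ p) := by
        rw [div_pow]; field_simp
    _ ≤ B * (C * (p.factorial : ℝ) / r ^ p) := by gcongr; exact hB p
    _ = _ := by ring

theorem factorialGrowth.natCast_smul {a : ℕ → Matrix m n ℂ} (ha : a ∈ factorialGrowth m n ℓ) :
    (fun p : ℕ => (p : ℂ) • a p) ∈ factorialGrowth m n ℓ := by
  intro r hr hrl
  obtain ⟨C, hC⟩ := succ_mul ha hr hrl
  refine ⟨C, fun p => ?_⟩
  rw [entryNorm_smul, Complex.norm_natCast]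
  exact (mul_le_mul_of_nonneg_right (by linarith) (entryNorm_nonneg _)).trans (hC p)

theorem factorialGrowth.shift_one {a : ℕ → Matrix m n ℂ} (ha : a ∈ factorialGrowth m n ℓ) :
    (fun p => a (p + 1)) ∈ factorialGrowth m n ℓ := by
  intro r hr hrl
  obtain ⟨C, hC⟩ := succ_mul ha hr hrl
  refine ⟨C / r, fun p => ?_⟩
  have h := hC (p + 1)
  have hp : (0 : ℝ) < (p : ℝ) + 1 := by positivity
  have h2 : ((p : ℝ) + 1) * entryNorm (a (p + 1)) ≤ C * ((p + 1).factorial : ℝ) / r ^ (p + 1) := by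
    refine le_trans ?_ h
    gcongr
    · exact entryNorm_nonneg _
    · linarith
  rw [← le_div_iff₀' hp] at h2
  refine h2.trans (le_of_eq ?_)
  rw [Nat.factorial_succ]; push_cast; field_simp; ring

theorem factorialGrowth.shift {a : ℕ → Matrix m n ℂ} (ha : a ∈ factorialGrowth m n ℓ) (k : ℕ) :
    (fun p => a (p + k)) ∈ factorialGrowth m n ℓ := by
  induction k with
  | zero => exact ha
  | succ k ih => simpa [add_assoc, add_comm 1 k] using shift_one ih

/-- Solutions of `λ a_{p+1} = (p + B) a_p + b_p` with `|λ| = ℓ` have factorial growth if `b` has. -/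
theorem factorialGrowth_of_rec {lam : ℂ} (hlam : lam ≠ 0) {a b : ℕ → Matrix m n ℂ}
    {B : Matrix m m ℂ} (hb : b ∈ factorialGrowth m n ‖lam‖)
    (h : ∀ p, lam • a (p + 1) = (p : ℂ) • a p + B * a p + b p) :
    a ∈ factorialGrowth m n ‖lam‖ := by
  intro r hr hrl
  obtain ⟨D, hD⟩ := hb r hr hrl
  have hl : 0 < ‖lam‖ := norm_pos_iff.2 hlam
  have hD0 : 0 ≤ D := by simpa using (entryNorm_nonneg _).trans (hD 0)
  -- The midpoint of `r/|λ|` and `1`. For `a_p r^p / p!` the recursion has the factor `(r/|λ|) (p +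
  -- c)/(p + 1)`, which is at most `κ` from the index `N` on.
  set κ : ℝ := (r / ‖lam‖ + 1) / 2
  have hκ1 : r / ‖lam‖ < 1 := (div_lt_one hl).2 hrl
  have hq : 0 < r / ‖lam‖ := by positivity
  set c := entryNorm B
  have hc : 0 ≤ c := entryNorm_nonneg B
  obtain ⟨N, hN⟩ := exists_nat_ge ((r / ‖lam‖) * c / (κ - r / ‖lam‖))
  have hκq : 0 < κ - r / ‖lam‖ := by simp only [κ]; linarith
  rw [div_le_iff₀ hκq] at hN
  obtain ⟨C, hC⟩ := exists_bound_of_contracting (s := (Set.univ : Set Unit))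
    (x := fun _ p => entryNorm (a p) * r ^ p / p.factorial) (κ := κ) (E := r / ‖lam‖ * D)
    (by simp only [κ]; linarith) (by simp only [κ]; linarith) (fun p => ⟨_, fun _ _ => le_rfl⟩)
    (N := N) (by
      intro p hp _ _
      have h1 : ‖lam‖ * entryNorm (a (p + 1)) ≤ (p + c) * entryNorm (a p)
          + D * (p.factorial : ℝ) / r ^ p := by
        rw [← entryNorm_smul, h]
        refine (entryNorm_add _ _).trans (add_le_add ((entryNorm_add _ _).trans ?_) (hD p))
        rw [entryNorm_smul, Complex.norm_natCast, add_mul]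
        exact add_le_add le_rfl (entryNorm_mul _ _)
      have h2 : entryNorm (a (p + 1)) ≤ ((p + c) * entryNorm (a p)
          + D * (p.factorial : ℝ) / r ^ p) / ‖lam‖ := by rwa [le_div_iff₀' hl]
      have hp1 : (0 : ℝ) < (p : ℝ) + 1 := by positivity
      have hfac : (0 : ℝ) < p.factorial := by positivity
      have ha0 := entryNorm_nonneg (a p)
      calc entryNorm (a (p + 1)) * r ^ (p + 1) / ((p + 1).factorial : ℝ)
          ≤ (((p + c) * entryNorm (a p) + D * (p.factorial : ℝ) / r ^ p) / ‖lam‖) * r ^ (p + 1)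
            / ((p + 1).factorial : ℝ) := by gcongr
        _ = (r / ‖lam‖ * (p + c) / (p + 1)) * (entryNorm (a p) * r ^ p / p.factorial)
            + r / ‖lam‖ * D / (p + 1) := by
            rw [Nat.factorial_succ]; push_cast; field_simp; ring
        _ ≤ κ * (entryNorm (a p) * r ^ p / p.factorial) + r / ‖lam‖ * D := by
            gcongr
            · rw [div_le_iff₀ hp1]
              have : (N : ℝ) ≤ p := by exact_mod_cast hp
              nlinarith [mul_le_mul_of_nonneg_right this hκq.le]
            · exact div_le_self (by positivity) (by linarith [(Nat.cast_nonneg p : (0 : ℝ) ≤ p)]))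
  refine ⟨C, fun p => ?_⟩
  have h3 := hC p () trivial
  rw [le_div_iff₀ (by positivity)]
  rwa [div_le_iff₀ (by positivity)] at h3

end Growth

/-! ### Euler identities for the calibration and the two-point functions -/

namespace Calibration

variable {n : ℕ} {M : GenFrobeniusManifold n} {X : CanonicalChart M} (Θ : Calibration X) {v : Vec n}

/-- The matrix `Θ_p = (∇θ_{1,p}, …, ∇θ_{n,p})`. -/
def mat (p : ℕ) (v : Vec n) : Matrix (Fin n) (Fin n) ℂ := gradMatrix M (fun γ => Θ.θ γ p) v

/-- The constants `R_k`, `k ≥ 1`, extended by `R_0 = 0`. -/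
def mon (k : ℕ) : Matrix (Fin n) (Fin n) ℂ := if k = 0 then 0 else Θ.R k

/-- The matrix of inner products `⟨∇θ_{α,p}, ∇θ_{β,q}⟩`. -/
def inn (p q : ℕ) (v : Vec n) : Matrix (Fin n) (Fin n) ℂ :=
  (Θ.mat p v).transpose * M.η * Θ.mat q v

/-- The matrix of two-point functions `Ω_{α,p;β,q}`. -/
def twoPt (p q : ℕ) (v : Vec n) : Matrix (Fin n) (Fin n) ℂ := Matrix.of fun α β => Θ.Ω α p β q v

theorem mon_isDeg (k : ℕ) : IsDeg M.μ k (Θ.mon k) := by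
  rcases Nat.eq_zero_or_pos k with rfl | hk
  · simp [IsDeg, mon]
  · rw [IsDeg, mon, if_neg hk.ne']; exact Θ.μ_R k hk

theorem mon_mem (k : ℕ) : Θ.mon k ∈ degGE M.μ 1 := by
  rcases Nat.eq_zero_or_pos k with rfl | hk
  · simp [mon]
  · exact (Θ.mon_isDeg k).mem hk

theorem mat_zero (hv : v ∈ X.D) : Θ.mat 0 v = 1 := by
  have h : ∀ γ β, pd β (Θ.θ γ 0) v = M.η β γ := fun γ β => by
    have h1 : Θ.θ γ 0 =ᶠ[𝓝 v] fun w => ∑ δ, M.η γ δ * w δ :=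
      Filter.eventually_of_mem (X.isOpen_D.mem_nhds hv) fun w hw => Θ.θ_zero γ w hw
    have h2 : HasFDerivAt (fun w : Vec n => ∑ δ, M.η γ δ * w δ)
        (∑ δ, M.η γ δ • ContinuousLinearMap.proj (R := ℂ) (φ := fun _ : Fin n => ℂ) δ) v :=
      HasFDerivAt.fun_sum fun δ _ => (hasFDerivAt_apply δ v).const_mul _
    rw [pd, h1.fderiv_eq, h2.fderiv, sum_apply]
    simp only [smul_apply, ContinuousLinearMap.proj_apply, Pi.single_apply, smul_eq_mul, mul_ite,
      mul_one, mul_zero, Finset.sum_ite_eq', Finset.mem_univ, if_true]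
    exact M.η_symm.apply β γ
  rw [← M.η_inv_mul]
  ext α γ
  rw [mat, gradMatrix, Matrix.of_apply, GenFrobeniusManifold.grad, Matrix.mul_apply]
  exact Finset.sum_congr rfl fun β _ => by rw [h]

theorem sum_mat_mon (p : ℕ) (F : ℕ → Matrix (Fin n) (Fin n) ℂ) :
    ∑ k ∈ Finset.Icc 1 p, F (p - k) * Θ.R k = ∑ k ∈ Finset.range (p + 1), F (p - k) * Θ.mon k := by
  have h : ∀ k ∈ Finset.Icc 1 p, F (p - k) * Θ.R k = F (p - k) * Θ.mon k := fun k hk => by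
    rw [mon, if_neg (by have := (Finset.mem_Icc.1 hk).1; omega)]
  rw [Finset.sum_congr rfl h]
  refine Finset.sum_subset (fun k hk => ?_) fun k hk hk' => ?_
  · rw [Finset.mem_Icc] at hk; exact Finset.mem_range.2 (by omega)
  · have : k = 0 := by rw [Finset.mem_range] at hk; rw [Finset.mem_Icc] at hk'; omega
    rw [mon, if_pos this, mul_zero]

/-- The coefficient of `z^p` in `(z ∂_z + [· , μ]) Θ + Θ R(z)`, which equals that of `z 𝒰 Θ`. -/
def eulerMat (p : ℕ) (v : Vec n) : Matrix (Fin n) (Fin n) ℂ :=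
  (p : ℂ) • Θ.mat p v + Θ.mat p v * M.μ - M.μ * Θ.mat p v
    + ∑ k ∈ Finset.range (p + 1), Θ.mat (p - k) v * Θ.mon k

theorem eulerMat_zero (hv : v ∈ X.D) : Θ.eulerMat 0 v = 0 := by
  simp [eulerMat, Θ.mat_zero hv, mon]

theorem eulerMat_succ (hv : v ∈ X.D) (p : ℕ) : Θ.eulerMat (p + 1) v = M.calU v * Θ.mat p v := by
  have h := Θ.θ_homogeneous v hv p
  rw [eulerMat, ← Θ.sum_mat_mon (p + 1) fun k => Θ.mat k v]
  simp only [mat]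
  rw [sub_add_eq_add_sub, sub_eq_iff_eq_add, ← h]

theorem transpose_μ_η : M.μ.transpose * M.η = -(M.η * M.μ) := by rw [M.η_μ, neg_neg]

/-- Leibniz rule for the grading on inner products. The two occurrences of `μ` next to `η` cancel
because `μ` is skew-adjoint, and only the outer ones remain. -/
theorem eulerMat_inn (a b : ℕ) :
    (Θ.eulerMat a v).transpose * M.η * Θ.mat b v + (Θ.mat a v).transpose * M.η * Θ.eulerMat b v
      = ((a + b : ℕ) : ℂ) • Θ.inn a b v + M.μ.transpose * Θ.inn a b v + Θ.inn a b v * M.μ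
        + ∑ k ∈ Finset.range (a + 1), (Θ.mon k).transpose * Θ.inn (a - k) b v
        + ∑ k ∈ Finset.range (b + 1), Θ.inn a (b - k) v * Θ.mon k := by
  have h1 : (∑ k ∈ Finset.range (a + 1), Θ.mat (a - k) v * Θ.mon k).transpose * M.η * Θ.mat b v
      = ∑ k ∈ Finset.range (a + 1), (Θ.mon k).transpose * Θ.inn (a - k) b v := by
    rw [Matrix.transpose_sum, Finset.sum_mul, Finset.sum_mul]
    refine Finset.sum_congr rfl fun k _ => ?_
    rw [Matrix.transpose_mul, inn]; simp only [mul_assoc]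
  have h2 : (Θ.mat a v).transpose * M.η * (∑ k ∈ Finset.range (b + 1), Θ.mat (b - k) v * Θ.mon k)
      = ∑ k ∈ Finset.range (b + 1), Θ.inn a (b - k) v * Θ.mon k := by
    rw [Finset.mul_sum]
    refine Finset.sum_congr rfl fun k _ => ?_
    rw [inn]; simp only [mul_assoc]
  have h3 : (Θ.mat a v).transpose * (M.μ.transpose * M.η + M.η * M.μ) * Θ.mat b v = 0 := by
    rw [transpose_μ_η, neg_add_cancel, mul_zero, zero_mul]
  rw [eulerMat, eulerMat, Matrix.transpose_add, Matrix.transpose_sub, Matrix.transpose_add,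
    add_mul, add_mul, mul_add, h1, h2, Matrix.transpose_mul, Matrix.transpose_mul,
    Matrix.transpose_smul, Nat.cast_add, add_smul]
  rw [← sub_eq_zero]
  rw [← neg_eq_zero] at h3
  rw [← h3, inn]
  simp only [add_mul, sub_mul, mul_add, mul_sub, smul_mul_assoc, mul_smul_comm]
  noncomm_ring

theorem sum_inn (hv : v ∈ X.D) (m : ℕ) (hm : 1 ≤ m) :
    ∑ k ∈ Finset.range (m + 1), (-1 : ℂ) ^ k • Θ.inn k (m - k) v = 0 := Θ.θ_orth v hv m hm

theorem inn_zero_zero (hv : v ∈ X.D) : Θ.inn 0 0 v = M.η := by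
  rw [inn, Θ.mat_zero hv, Matrix.transpose_one, one_mul, mul_one]

/-- `R_k^T η = (-1)^{k+1} η R_k`. -/
theorem mon_transpose (hv : v ∈ X.D) (k : ℕ) :
    (Θ.mon k).transpose * M.η = (-1 : ℂ) ^ (k + 1) • (M.η * Θ.mon k) := by
  rcases Nat.eq_zero_or_pos k with rfl | hk
  · simp [mon]
  -- Generating series: `A` is `Θ(-z)ᵀ η` and `B` is `Θ(z)`, so orthogonality says that `A B` is the
  -- constant `η`; `A'` and `B'` are built in the same way from the Euler expressions.
  let A : PowerSeries (Matrix (Fin n) (Fin n) ℂ) :=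
    PowerSeries.mk fun p => (-1 : ℂ) ^ p • ((Θ.mat p v).transpose * M.η)
  let B : PowerSeries (Matrix (Fin n) (Fin n) ℂ) := PowerSeries.mk fun p => Θ.mat p v
  let A' : PowerSeries (Matrix (Fin n) (Fin n) ℂ) :=
    PowerSeries.mk fun p => (-1 : ℂ) ^ p • ((Θ.eulerMat p v).transpose * M.η)
  let B' : PowerSeries (Matrix (Fin n) (Fin n) ℂ) := PowerSeries.mk fun p => Θ.eulerMat p v
  let Rz : PowerSeries (Matrix (Fin n) (Fin n) ℂ) := PowerSeries.mk fun p => Θ.mon p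
  let Rt : PowerSeries (Matrix (Fin n) (Fin n) ℂ) :=
    PowerSeries.mk fun p => (-1 : ℂ) ^ p • (Θ.mon p).transpose
  have hAB : A * B = PowerSeries.C M.η := by
    ext1 m
    rw [PowerSeries.coeff_mul, Finset.Nat.sum_antidiagonal_eq_sum_range_succ_mk, PowerSeries.coeff_C]
    simp only [A, B, PowerSeries.coeff_mk, smul_mul_assoc]
    split_ifs with h
    · subst h; simpa [inn] using Θ.inn_zero_zero hv
    · exact Θ.sum_inn hv m (by omega)
  have hA' : A' = -(PowerSeries.X * (A * PowerSeries.C (M.calU v))) := by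
    ext1 m
    rw [map_neg]
    rcases m with _ | m
    · simp [A', Θ.eulerMat_zero hv]
    · rw [PowerSeries.coeff_succ_X_mul, PowerSeries.coeff_mul_C]
      simp only [A, A', PowerSeries.coeff_mk]
      rw [Θ.eulerMat_succ hv, Matrix.transpose_mul, mul_assoc, ← M.η_calU (X.mem_domain hv), pow_succ,
        mul_neg_one, neg_smul, smul_mul_assoc, mul_assoc]
  have hB' : B' = PowerSeries.X * (PowerSeries.C (M.calU v) * B) := by
    ext1 m
    rcases m with _ | m
    · simp [B', Θ.eulerMat_zero hv]
    · rw [PowerSeries.coeff_succ_X_mul, PowerSeries.coeff_C_mul]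
      simp only [B, B', PowerSeries.coeff_mk]
      rw [Θ.eulerMat_succ hv]
  -- By homogeneity `B' = z 𝒰 B` and `A' = -z A 𝒰`. When the Leibniz rule is applied to `A B = η`,
  -- whose coefficients of positive order vanish, only the terms with `R_k` and its transpose are
  -- left in order `k`.
  have h0 : A' * B + A * B' = 0 := by
    have hx : A * (PowerSeries.X * (PowerSeries.C (M.calU v) * B))
        = PowerSeries.X * (A * (PowerSeries.C (M.calU v) * B)) := by
      rw [← mul_assoc, ← PowerSeries.X_mul, mul_assoc]
    rw [hA', hB', hx, neg_mul, mul_assoc, mul_assoc, neg_add_cancel]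
  have h1 := congrArg (PowerSeries.coeff k) h0
  rw [map_add, PowerSeries.coeff_mul, PowerSeries.coeff_mul, ← Finset.sum_add_distrib, map_zero] at h1
  have h2 : ∀ x ∈ Finset.HasAntidiagonal.antidiagonal k,
      PowerSeries.coeff x.1 A' * PowerSeries.coeff x.2 B + PowerSeries.coeff x.1 A * PowerSeries.coeff x.2 B'
      = (k : ℂ) • ((PowerSeries.coeff x.1 A) * PowerSeries.coeff x.2 B)
        + M.μ.transpose * (PowerSeries.coeff x.1 A * PowerSeries.coeff x.2 B)
        + (PowerSeries.coeff x.1 A * PowerSeries.coeff x.2 B) * M.μ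
        + PowerSeries.coeff x.1 (Rt * A) * PowerSeries.coeff x.2 B
        + PowerSeries.coeff x.1 A * PowerSeries.coeff x.2 (B * Rz) := by
    intro x hx
    obtain ⟨a, b⟩ := x
    have hab : a + b = k := Finset.HasAntidiagonal.mem_antidiagonal.1 hx
    have h3 : PowerSeries.coeff a (Rt * A)
        = (-1 : ℂ) ^ a • ∑ j ∈ Finset.range (a + 1),
            (Θ.mon j).transpose * ((Θ.mat (a - j) v).transpose * M.η) := by
      rw [PowerSeries.coeff_mul, Finset.Nat.sum_antidiagonal_eq_sum_range_succ_mk, Finset.smul_sum]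
      refine Finset.sum_congr rfl fun j hj => ?_
      simp only [Rt, A, PowerSeries.coeff_mk]
      rw [smul_mul_smul_comm, ← pow_add, Nat.add_sub_cancel' (by rw [Finset.mem_range] at hj; omega)]
    have h4 : PowerSeries.coeff b (B * Rz) = ∑ j ∈ Finset.range (b + 1), Θ.mat (b - j) v * Θ.mon j := by
      rw [PowerSeries.coeff_mul, Finset.Nat.sum_antidiagonal_eq_sum_range_succ_mk,
        ← Finset.sum_range_reflect]
      refine Finset.sum_congr rfl fun j hj => ?_
      rw [Finset.mem_range] at hj
      simp only [Rz, B, PowerSeries.coeff_mk]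
      congr 2
      omega
    rw [h3, h4]
    simp only [A, B, A', B', PowerSeries.coeff_mk]
    have h5 := Θ.eulerMat_inn (v := v) a b
    rw [hab] at h5
    have h6 : (∑ j ∈ Finset.range (a + 1), (Θ.mon j).transpose * ((Θ.mat (a - j) v).transpose * M.η))
        * Θ.mat b v = ∑ j ∈ Finset.range (a + 1), (Θ.mon j).transpose * Θ.inn (a - j) b v := by
      rw [Finset.sum_mul]; simp only [inn, mul_assoc]
    have h7 : (Θ.mat a v).transpose * M.η * ∑ j ∈ Finset.range (b + 1), Θ.mat (b - j) v * Θ.mon j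
        = ∑ j ∈ Finset.range (b + 1), Θ.inn a (b - j) v * Θ.mon j := by
      rw [Finset.mul_sum]; simp only [inn, mul_assoc]
    simp only [smul_mul_assoc, mul_smul_comm]
    rw [h6, h7, smul_comm (k : ℂ), ← smul_add, h5]
    simp only [smul_add, inn]
  rw [Finset.sum_congr rfl h2] at h1
  simp only [Finset.sum_add_distrib, ← Finset.smul_sum, ← Finset.mul_sum, ← Finset.sum_mul] at h1
  rw [← PowerSeries.coeff_mul, ← PowerSeries.coeff_mul, ← PowerSeries.coeff_mul, mul_assoc Rt,
    ← mul_assoc A B Rz, hAB, PowerSeries.coeff_C, if_neg hk.ne', PowerSeries.coeff_mul_C,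
    PowerSeries.coeff_C_mul] at h1
  simp only [Rt, Rz, PowerSeries.coeff_mk, smul_zero, mul_zero, zero_mul, zero_add, smul_mul_assoc] at h1
  have h8 : (-1 : ℂ) ^ k * (-1 : ℂ) ^ k = 1 := by rw [← mul_pow]; norm_num
  have h9 := congrArg (fun Z => (-1 : ℂ) ^ k • Z) (eq_neg_of_add_eq_zero_left h1)
  simp only [smul_smul, h8, one_smul] at h9
  rw [h9, pow_succ, mul_neg_one, neg_smul, smul_neg]

theorem pairing_eq (α : Fin n) (p : ℕ) (β : Fin n) (q : ℕ) (hpq : ¬(p = 0 ∧ q = 0)) :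
    Θ.pairing α p β q v = Θ.inn p q v α β := by
  rw [pairing, if_neg hpq, sub_zero, inn, mul_assoc, Matrix.mul_apply]
  refine Finset.sum_congr rfl fun γ _ => ?_
  rw [Matrix.mul_apply, Finset.mul_sum]
  refine Finset.sum_congr rfl fun δ _ => ?_
  simp only [Matrix.transpose_apply, mat, gradMatrix, Matrix.of_apply]
  ring

theorem twoPt_eq (p q : ℕ) :
    Θ.twoPt p q v = ∑ k ∈ Finset.range (q + 1), (-1 : ℂ) ^ k • Θ.inn (p + 1 + k) (q - k) v := by
  ext α β
  rw [twoPt, Matrix.of_apply, Ω, Matrix.sum_apply]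
  refine Finset.sum_congr rfl fun k _ => ?_
  rw [Matrix.smul_apply, smul_eq_mul, Θ.pairing_eq _ _ _ _ (by omega)]

theorem twoPt_zero_right (p : ℕ) : Θ.twoPt p 0 v = Θ.inn (p + 1) 0 v := by simp [twoPt_eq]

/-- The coefficientwise form of `(z + w) Ω = ⟨∇θ(z), ∇θ(w)⟩ - η`; the alternating sums overlap
except for one term. -/
theorem twoPt_succ (p q : ℕ) :
    Θ.twoPt p (q + 1) v + Θ.twoPt (p + 1) q v = Θ.inn (p + 1) (q + 1) v := by
  rw [twoPt_eq, twoPt_eq, Finset.sum_range_succ']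
  have : ∀ k ∈ Finset.range (q + 1), (-1 : ℂ) ^ (k + 1) • Θ.inn (p + 1 + (k + 1)) (q + 1 - (k + 1)) v
      = -((-1 : ℂ) ^ k • Θ.inn (p + 1 + 1 + k) (q - k) v) := fun k _ => by
    rw [pow_succ, mul_neg_one, neg_smul, Nat.add_sub_add_right]
    congr 3; ring
  rw [Finset.sum_congr rfl this, Finset.sum_neg_distrib]
  simp

/-- The numerator is divisible by `z + w` exactly because of the orthogonality relation, and this
boundary case is where that enters. -/
theorem twoPt_zero_left (hv : v ∈ X.D) (q : ℕ) : Θ.twoPt 0 q v = Θ.inn 0 (q + 1) v := by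
  have h := Θ.sum_inn hv (q + 1) (by omega)
  rw [Finset.sum_range_succ'] at h
  have : ∀ k ∈ Finset.range (q + 1), (-1 : ℂ) ^ (k + 1) • Θ.inn (k + 1) (q + 1 - (k + 1)) v
      = -((-1 : ℂ) ^ k • Θ.inn (0 + 1 + k) (q - k) v) := fun k _ => by
    rw [pow_succ, mul_neg_one, neg_smul, Nat.add_sub_add_right]
    congr 3; ring
  rw [Finset.sum_congr rfl this, Finset.sum_neg_distrib, ← twoPt_eq] at h
  simpa using (neg_add_eq_zero.1 h)

/-- The Euler identity for the two-point functions. -/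
theorem euler_twoPt (hv : v ∈ X.D) (p q : ℕ) :
    (Θ.mat p v).transpose * M.η * (M.calU v * Θ.mat q v)
      = ((p + q + 1 : ℕ) : ℂ) • Θ.twoPt p q v + M.μ.transpose * Θ.twoPt p q v + Θ.twoPt p q v * M.μ
        + ∑ k ∈ Finset.range (p + 1), (Θ.mon k).transpose * Θ.twoPt (p - k) q v
        + ∑ k ∈ Finset.range (q + 1), Θ.twoPt p (q - k) v * Θ.mon k
        + (-1 : ℂ) ^ p • (M.η * Θ.mon (p + q + 1)) := by
  have hU : ∀ a b, (Θ.eulerMat (a + 1) v).transpose * M.η * Θ.mat b v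
      = (Θ.mat a v).transpose * M.η * (M.calU v * Θ.mat b v) := fun a b => by
    rw [Θ.eulerMat_succ hv, Matrix.transpose_mul, mul_assoc _ _ M.η, ← M.η_calU (X.mem_domain hv)]
    simp only [mul_assoc]
  induction q generalizing p with
  | zero =>
    have h := Θ.eulerMat_inn (v := v) (p + 1) 0
    rw [hU, Θ.eulerMat_zero hv, mul_zero, add_zero, Finset.sum_range_succ] at h
    have h1 : ∀ k ∈ Finset.range (p + 1), (Θ.mon k).transpose * Θ.inn (p + 1 - k) 0 v
        = (Θ.mon k).transpose * Θ.twoPt (p - k) 0 v := fun k hk => by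
      rw [Θ.twoPt_zero_right, Nat.sub_add_comm (by rw [Finset.mem_range] at hk; omega)]
    rw [Finset.sum_congr rfl h1, Nat.sub_self, Θ.inn_zero_zero hv, Θ.mon_transpose hv,
      ← Θ.twoPt_zero_right, Finset.sum_range_one, Nat.sub_zero, ← Θ.twoPt_zero_right] at h
    rw [h, Finset.sum_range_one, Nat.sub_zero, pow_add _ p 2, show (-1 : ℂ) ^ 2 = 1 by norm_num, mul_one,
      Nat.add_zero]
    abel
  | succ q ih =>
    -- Induction on `q` along the relation between `Ω_{p,q+1}`, `Ω_{p+1,q}` and the inner products.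
    -- The term `(-1)^p η R_{p+q+1}` arises at `q = 0` from the transpose of `R` and changes sign
    -- with each step.
    have h := Θ.eulerMat_inn (v := v) (p + 1) (q + 1)
    rw [hU, Θ.eulerMat_succ hv, ih (p + 1)] at h
    have h1 : ∑ k ∈ Finset.range (p + 1 + 1), (Θ.mon k).transpose * Θ.inn (p + 1 - k) (q + 1) v
        = ∑ k ∈ Finset.range (p + 1), (Θ.mon k).transpose * Θ.twoPt (p - k) (q + 1) v
          + ∑ k ∈ Finset.range (p + 1 + 1), (Θ.mon k).transpose * Θ.twoPt (p + 1 - k) q v := by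
      rw [Finset.sum_range_succ, Finset.sum_range_succ _ (p + 1), ← add_assoc, ← Finset.sum_add_distrib,
        Nat.sub_self, Θ.twoPt_zero_left hv]
      congr 1
      refine Finset.sum_congr rfl fun k hk => ?_
      rw [Nat.sub_add_comm (by rw [Finset.mem_range] at hk; omega), ← Θ.twoPt_succ, mul_add]
    have h2 : ∑ k ∈ Finset.range (q + 1 + 1), Θ.inn (p + 1) (q + 1 - k) v * Θ.mon k
        = ∑ k ∈ Finset.range (q + 1 + 1), Θ.twoPt p (q + 1 - k) v * Θ.mon k
          + ∑ k ∈ Finset.range (q + 1), Θ.twoPt (p + 1) (q - k) v * Θ.mon k := by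
      rw [Finset.sum_range_succ, Finset.sum_range_succ _ (q + 1), add_right_comm, ← Finset.sum_add_distrib,
        Nat.sub_self, Θ.twoPt_zero_right]
      congr 1
      refine Finset.sum_congr rfl fun k hk => ?_
      rw [Nat.sub_add_comm (by rw [Finset.mem_range] at hk; omega), ← Θ.twoPt_succ, add_mul]
    rw [h1, h2, ← Θ.twoPt_succ] at h
    rw [eq_sub_of_add_eq h, pow_succ, mul_neg_one, neg_smul, show p + 1 + q + 1 = p + (q + 1) + 1 by ring,
      show p + 1 + (q + 1) = p + (q + 1) + 1 by ring]
    simp only [smul_add, mul_add, add_mul]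
    abel

end Calibration

namespace Calibration

variable {n : ℕ} {M : GenFrobeniusManifold n} {X : CanonicalChart M} (Θ : Calibration X)

/-! ### The expansion coefficients of the periods -/

/-- The solution of `λ a_{p+1} = (p + μ + ½) a_p + b_p` with `a_0 = A₀`. -/
def solveRec (M : GenFrobeniusManifold n) (lam : ℂ) (A₀ : Matrix (Fin n) (Fin n) ℂ)
    (b : ℕ → Matrix (Fin n) (Fin n) ℂ) : ℕ → Matrix (Fin n) (Fin n) ℂ
  | 0 => A₀
  | p + 1 => lam⁻¹ • ((p : ℂ) • solveRec M lam A₀ b p + M.muPlus * solveRec M lam A₀ b p + b p)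

/-- The part of the expansion coefficients of order `m` in the matrices `R_k`. -/
def coeffPart (lam : ℂ) (K : ℕ) : ℕ → ℕ → Matrix (Fin n) (Fin n) ℂ
  | 0 => solveRec M lam 1 0
  | m + 1 => solveRec M lam 0 fun p => ∑ k ∈ Finset.range K, Θ.mon k * coeffPart lam K m (p + k)

theorem _root_.GFM.GenFrobeniusManifold.muPlus_mem (M : GenFrobeniusManifold n) :
    M.muPlus ∈ degGE M.μ 0 :=
  Submodule.add_mem _ self_mem_degGE (Submodule.smul_mem _ _ one_mem_degGE)

theorem solveRec_mem (lam : ℂ) {A₀ : Matrix (Fin n) (Fin n) ℂ} {b : ℕ → Matrix (Fin n) (Fin n) ℂ}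
    {j : ℕ} (hA₀ : A₀ ∈ degGE M.μ j) (hb : ∀ p, b p ∈ degGE M.μ j) (p : ℕ) :
    solveRec M lam A₀ b p ∈ degGE M.μ j := by
  induction p with
  | zero => exact hA₀
  | succ p ih =>
    have h := degGE_mul M.muPlus_mem ih
    rw [zero_add] at h
    exact Submodule.smul_mem _ _ (Submodule.add_mem _ (Submodule.add_mem _ (Submodule.smul_mem _ _ ih) h)
      (hb p))

theorem solveRec_succ {lam : ℂ} (hlam : lam ≠ 0) (A₀ : Matrix (Fin n) (Fin n) ℂ)
    (b : ℕ → Matrix (Fin n) (Fin n) ℂ) (p : ℕ) : lam • solveRec M lam A₀ b (p + 1)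
      = (p : ℂ) • solveRec M lam A₀ b p + M.muPlus * solveRec M lam A₀ b p + b p := by
  rw [solveRec, smul_smul, mul_inv_cancel₀ hlam, one_smul]

theorem coeffPart_succ (lam : ℂ) (K m : ℕ) : Θ.coeffPart lam K (m + 1) = solveRec M lam 0 fun p =>
    ∑ k ∈ Finset.range K, Θ.mon k * Θ.coeffPart lam K m (p + k) := by
  rw [coeffPart]

/-- Each order of the perturbation in the `R_k` contributes at least one factor of positive degree.
-/
theorem coeffPart_mem (lam : ℂ) (K m p : ℕ) : Θ.coeffPart lam K m p ∈ degGE M.μ m := by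
  induction m generalizing p with
  | zero => exact solveRec_mem lam one_mem_degGE (fun _ => Submodule.zero_mem _) p
  | succ m ih =>
    refine solveRec_mem lam (Submodule.zero_mem _) (fun p => Submodule.sum_mem _ fun k _ => ?_) p
    rw [add_comm m]
    exact degGE_mul (Θ.mon_mem k) (ih _)

theorem coeffPart_growth {lam : ℂ} (hlam : lam ≠ 0) (K m : ℕ) :
    Θ.coeffPart lam K m ∈ factorialGrowth (Fin n) (Fin n) ‖lam‖ := by
  induction m with
  | zero => exact factorialGrowth_of_rec hlam (Submodule.zero_mem _) (solveRec_succ hlam 1 0)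
  | succ m ih =>
    refine factorialGrowth_of_rec hlam ?_ (solveRec_succ hlam 0 _)
    have : (fun p => ∑ k ∈ Finset.range K, Θ.mon k * Θ.coeffPart lam K m (p + k))
        = ∑ k ∈ Finset.range K, fun p => Θ.mon k * Θ.coeffPart lam K m (p + k) := by
      ext1 p; rw [Finset.sum_apply]
    rw [this]
    exact Submodule.sum_mem _ fun k _ => factorialGrowth.const_mul (factorialGrowth.shift ih k) _

/-- The sum of the parts of order at most `K`. -/
def coeff (lam : ℂ) (K p : ℕ) : Matrix (Fin n) (Fin n) ℂ :=
  ∑ m ∈ Finset.range (K + 1), Θ.coeffPart lam K m p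

theorem coeff_zero (lam : ℂ) (K : ℕ) : Θ.coeff lam K 0 = 1 := by
  have h1 : ∀ m, Θ.coeffPart lam K (m + 1) 0 = 0 := fun m => by rw [coeffPart, solveRec]
  rw [coeff, Finset.sum_range_succ', Finset.sum_eq_zero fun m _ => h1 m, zero_add, coeffPart, solveRec]

theorem coeff_growth {lam : ℂ} (hlam : lam ≠ 0) (K : ℕ) :
    Θ.coeff lam K ∈ factorialGrowth (Fin n) (Fin n) ‖lam‖ := by
  have : Θ.coeff lam K = ∑ m ∈ Finset.range (K + 1), Θ.coeffPart lam K m := by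
    ext1 p; rw [coeff, Finset.sum_apply]
  rw [this]
  exact Submodule.sum_mem _ fun m _ => Θ.coeffPart_growth hlam K m

theorem coeff_mem (lam : ℂ) (K p : ℕ) : Θ.coeff lam K p ∈ degGE M.μ 0 :=
  Submodule.sum_mem _ fun m _ => degGE_anti (Nat.zero_le m) (Θ.coeffPart_mem lam K m p)

/-- The recursion is not triangular, since `R_k` couples `a_p` to `a_{p+k}`. It is solved as a
perturbation series in the `R_k`: every order is a triangular recursion with the previous order as
source, and the order `K` vanishes for reasons of degree. -/
theorem coeff_succ {lam : ℂ} (hlam : lam ≠ 0) {K : ℕ}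
    (hK : ∀ k, K ≤ k → ∀ Y, IsDeg M.μ k Y → Y = 0) (p : ℕ) :
    lam • Θ.coeff lam K (p + 1) = (p : ℂ) • Θ.coeff lam K p + M.muPlus * Θ.coeff lam K p
      + ∑ k ∈ Finset.range K, Θ.mon k * Θ.coeff lam K (p + k) := by
  have hDK : ∀ p, Θ.coeffPart lam K K p = 0 := fun p => degGE_eq_zero hK le_rfl (Θ.coeffPart_mem lam K K p)
  have h1 : ∑ k ∈ Finset.range K, Θ.mon k * Θ.coeff lam K (p + k)
      = ∑ m ∈ Finset.range K, ∑ k ∈ Finset.range K, Θ.mon k * Θ.coeffPart lam K m (p + k) := by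
    rw [Finset.sum_comm]
    refine Finset.sum_congr rfl fun k _ => ?_
    rw [coeff, Finset.sum_range_succ, hDK, add_zero, Finset.mul_sum]
  have h2 : ∀ m, lam • Θ.coeffPart lam K (m + 1) (p + 1) = (p : ℂ) • Θ.coeffPart lam K (m + 1) p
      + M.muPlus * Θ.coeffPart lam K (m + 1) p
      + ∑ k ∈ Finset.range K, Θ.mon k * Θ.coeffPart lam K m (p + k) := fun m => by
    rw [coeffPart_succ, solveRec_succ hlam]
  have h3 : lam • Θ.coeffPart lam K 0 (p + 1) = (p : ℂ) • Θ.coeffPart lam K 0 p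
      + M.muPlus * Θ.coeffPart lam K 0 p := by
    rw [coeffPart, solveRec_succ hlam, Pi.zero_apply, add_zero]
  rw [h1, coeff, coeff, Finset.sum_range_succ', Finset.sum_range_succ', smul_add, h3, Finset.smul_sum,
    Finset.sum_congr rfl fun m _ => h2 m, Finset.sum_add_distrib, Finset.sum_add_distrib,
    ← Finset.smul_sum, ← Finset.mul_sum, smul_add, mul_add]
  abel

/-- The first step of the recursion from `a_0 = 1`; the sources all contain some `R_k`. -/
theorem coeff_one {lam : ℂ} (hlam : lam ≠ 0) {K : ℕ}
    (hK : ∀ k, K ≤ k → ∀ Y, IsDeg M.μ k Y → Y = 0) :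
    lam • Θ.coeff lam K 1 - M.muPlus ∈ degGE M.μ 1 := by
  have h1 := Θ.coeff_succ hlam hK 0
  rw [Θ.coeff_zero, Nat.cast_zero, zero_smul, zero_add, mul_one] at h1
  rw [h1, zero_add, add_sub_cancel_left]
  refine Submodule.sum_mem _ fun k _ => ?_
  have h2 := degGE_mul (Θ.mon_mem k) (Θ.coeff_mem lam K (0 + k))
  rwa [add_zero] at h2

/-! ### Bounds for the deformed flat coordinates -/

theorem mat_analytic {v : Vec n} (hv : v ∈ X.D) (p : ℕ) : MatAnalyticAt (Θ.mat p) v := fun α γ => by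
  have : (fun w => Θ.mat p w α γ) = fun w => ∑ β, M.η⁻¹ α β * pd β (Θ.θ γ p) w := rfl
  rw [this]
  exact Finset.analyticAt_fun_sum _ fun β _ =>
    analyticAt_const.mul (analyticAt_fderiv_apply (Θ.θ_analytic γ p v hv) _)

theorem _root_.GFM.exists_entryNorm_bound {E : Type*} [NormedAddCommGroup E] [NormedSpace ℂ E]
    {k l : Type*} [Fintype k] [Fintype l] {s : Set E} (hs : IsCompact s) {F : E → Matrix k l ℂ}
    (hF : ∀ w ∈ s, MatAnalyticAt F w) :
    ∃ C, ∀ w ∈ s, entryNorm (F w) ≤ C := by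
  have hc : ContinuousOn (fun w => entryNorm (F w)) s := fun w hw =>
    ContinuousAt.continuousWithinAt (tendsto_finsetSum _ fun i _ => tendsto_finsetSum _ fun j _ =>
      (hF w hw i j).continuousAt.norm)
  obtain ⟨C, hC⟩ := hs.exists_bound_of_continuousOn hc
  exact ⟨C, fun w hw => (le_abs_self _).trans (hC w hw)⟩

theorem V_mul_Ψ {v : Vec n} (hv : v ∈ X.D) : X.V v * X.Ψ v = X.Ψ v * M.μ := by
  rw [CanonicalChart.V, mul_assoc, X.Ψ_inv_mul hv, mul_one]

theorem Ψ_mul_calU {v : Vec n} (hv : v ∈ X.D) :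
    X.Ψ v * M.calU v = Matrix.diagonal (fun i => X.u i v) * X.Ψ v := by
  rw [X.calU_eq_Ψ hv, ← mul_assoc, ← mul_assoc, X.Ψ_mul_inv hv, one_mul]

theorem V_analytic {v : Vec n} (hv : v ∈ X.D) : MatAnalyticAt X.V v :=
  ((X.Ψ_analytic hv).mul (matAnalyticAt_const _ _)).mul ((X.Ψ_analytic hv).inv (X.Ψ_det hv))

/-- The homogeneity equation in the frame of normalized idempotents, applied to a matrix of
degree `m`. -/
theorem frame_rec {v : Vec n} (hv : v ∈ X.D) {m : ℕ} {Y : Matrix (Fin n) (Fin n) ℂ}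
    (hY : IsDeg M.μ m Y) (p : ℕ) :
    ((p + 1 + m : ℕ) : ℂ) • (X.Ψ v * Θ.mat (p + 1) v * Y)
      = Matrix.diagonal (fun i => X.u i v) * (X.Ψ v * Θ.mat p v * Y)
        + (X.V v * (X.Ψ v * Θ.mat (p + 1) v * Y) - X.Ψ v * Θ.mat (p + 1) v * Y * M.μ)
        - ∑ k ∈ Finset.range (p + 1 + 1), X.Ψ v * Θ.mat (p + 1 - k) v * (Θ.mon k * Y) := by
  have h := congrArg (fun Z => X.Ψ v * Z * Y) (Θ.eulerMat_succ hv p)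
  simp only [eulerMat] at h
  have h1 : X.V v * (X.Ψ v * Θ.mat (p + 1) v * Y) = X.Ψ v * M.μ * Θ.mat (p + 1) v * Y := by
    rw [← V_mul_Ψ hv]; simp only [mul_assoc]
  have h2 : Matrix.diagonal (fun i => X.u i v) * (X.Ψ v * Θ.mat p v * Y)
      = X.Ψ v * (M.calU v * Θ.mat p v) * Y := by
    rw [← mul_assoc, ← mul_assoc, ← Ψ_mul_calU hv]; simp only [mul_assoc]
  have h3 : X.Ψ v * (∑ k ∈ Finset.range (p + 1 + 1), Θ.mat (p + 1 - k) v * Θ.mon k) * Y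
      = ∑ k ∈ Finset.range (p + 1 + 1), X.Ψ v * Θ.mat (p + 1 - k) v * (Θ.mon k * Y) := by
    rw [Finset.mul_sum, Finset.sum_mul]; simp only [mul_assoc]
  have h4 : X.Ψ v * Θ.mat (p + 1) v * (M.μ * Y)
      = X.Ψ v * Θ.mat (p + 1) v * Y * M.μ + (m : ℂ) • (X.Ψ v * Θ.mat (p + 1) v * Y) := by
    rw [sub_eq_iff_eq_add.1 hY, mul_add, mul_smul_comm]; simp only [mul_assoc]; abel
  rw [h1, h2, ← h, ← h3, Nat.cast_add, add_smul, mul_add, add_mul, mul_sub, sub_mul,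
    mul_add, add_mul]
  have h5 : X.Ψ v * (Θ.mat (p + 1) v * M.μ) * Y = X.Ψ v * Θ.mat (p + 1) v * (M.μ * Y) := by
    simp only [mul_assoc]
  rw [h5, h4]
  simp only [mul_smul_comm, smul_mul_assoc, mul_assoc]
  abel

/-- In the idempotent frame `𝒰` is diagonal with entries bounded by `ρ₀`, so the recursion forces
decay like `ρ^p / p!` were it not for the terms `Θ_{p+1-k} R_k`, which have lower index. Since `R_k
Y` has degree higher by `k`, a bound with `(p + m)!` for matrices of degree `m` compensates this
loss. -/
theorem exists_frame_bound {s : Set (Vec n)} (hs : IsCompact s) (hsD : s ⊆ X.D) {ρ₀ ρ : ℝ}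
    (h0 : 0 ≤ ρ₀) (hρ : ρ₀ < ρ) (hu : ∀ w ∈ s, ∀ i, ‖X.u i w‖ ≤ ρ₀) {K : ℕ}
    (hK : ∀ k, K ≤ k → ∀ Y, IsDeg M.μ k Y → Y = 0) :
    ∀ d m, K ≤ m + d → ∀ Y, IsDeg M.μ m Y →
      ∃ C, ∀ p, ∀ w ∈ s, entryNorm (X.Ψ w * Θ.mat p w * Y) ≤ C * ρ ^ p / ((p + m).factorial : ℝ) := by
  -- The variable `d` measures the distance of the degree `m` from `K`, beyond which there is
  -- nothing to prove; the induction descends in the degree.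
  intro d
  induction d with
  | zero =>
    intro m hm Y hY
    refine ⟨0, fun p w _ => ?_⟩
    rw [hK m (by omega) Y hY, mul_zero, entryNorm_zero]; simp
  | succ d ih =>
    intro m hm Y hY
    have hρ0 : 0 < ρ := h0.trans_lt hρ
    -- contributions of the `R_k`
    have hc : ∀ k, ∃ C, 0 ≤ C ∧ (K ≤ k → C = 0) ∧ ∀ p, k ≤ p → ∀ w ∈ s,
        entryNorm (X.Ψ w * Θ.mat (p - k) w * (Θ.mon k * Y)) ≤ C * ρ ^ p / ((p + m).factorial : ℝ) := by
      intro k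
      by_cases hz : Θ.mon k * Y = 0
      · exact ⟨0, le_rfl, fun _ => rfl, fun p _ w _ => by rw [hz, mul_zero, entryNorm_zero]; simp⟩
      · have hkK : k < K := by
          by_contra hk
          exact hz (by rw [hK k (not_lt.1 hk) _ (Θ.mon_isDeg k), zero_mul])
        have hk0 : k ≠ 0 := by
          rintro rfl; exact hz (by simp [mon])
        obtain ⟨C, hC⟩ := ih (k + m) (by omega) _ ((Θ.mon_isDeg k).mul hY)
        refine ⟨|C| / ρ ^ k, by positivity, fun h => absurd h (by omega), fun p hp w hw => ?_⟩
        refine (hC (p - k) w hw).trans ?_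
        -- The index is lowered by `k` and the degree raised by `k`, so the factorial is unchanged.
        rw [show p - k + (k + m) = p + m by omega, pow_sub₀ ρ hρ0.ne' hp,
          div_mul_eq_mul_div, mul_div_assoc |C|, div_eq_mul_inv (ρ ^ p)]
        gcongr
        exact le_abs_self C
    choose c hc0 hcK hc using hc
    set S := ∑ k ∈ Finset.range K, c k
    have hS0 : 0 ≤ S := Finset.sum_nonneg fun k _ => hc0 k
    have hS : ∀ N, ∑ k ∈ Finset.range N, c k ≤ S := fun N => by
      refine (Finset.sum_le_sum_of_subset_of_nonneg (Finset.range_mono (Nat.le_add_right N K))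
        fun k _ _ => hc0 k).trans (le_of_eq ?_)
      refine (Finset.sum_subset (Finset.range_mono (Nat.le_add_left K N)) fun k _ hk => ?_).symm
      exact hcK k (by simpa using hk)
    obtain ⟨cV, hcV⟩ := exists_entryNorm_bound hs (F := X.V) fun w hw => V_analytic (hsD hw)
    set b := |cV| + entryNorm M.μ
    have hb : 0 ≤ b := add_nonneg (abs_nonneg _) (entryNorm_nonneg _)
    set κ : ℝ := (ρ₀ / ρ + 1) / 2
    have hq0 : 0 ≤ ρ₀ / ρ := by positivity
    have hq1 : ρ₀ / ρ < 1 := (div_lt_one hρ0).2 hρ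
    have hκq : 0 < κ - ρ₀ / ρ := by simp only [κ]; linarith
    have hκ1 : κ < 1 := by simp only [κ]; linarith
    -- From `N` on, `t = p + 1 + m` satisfies `t - b ≥ 1` and `(ρ₀/ρ) t ≤ κ (t - b)`, so the terms
    -- with `V` and `μ`, of total size `b`, can be moved to the left side.
    obtain ⟨N, hN⟩ := exists_nat_ge (max (b + 1) (κ * b / (κ - ρ₀ / ρ)))
    have hN1 : b + 1 ≤ N := (le_max_left _ _).trans hN
    have hN2 : κ * b ≤ N * (κ - ρ₀ / ρ) := (div_le_iff₀ hκq).1 ((le_max_right _ _).trans hN)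
    obtain ⟨C, hC⟩ := exists_bound_of_contracting (s := s)
      (x := fun w p => entryNorm (X.Ψ w * Θ.mat p w * Y) * ((p + m).factorial : ℝ) / ρ ^ p)
      (κ := κ) (E := S) (by linarith) hκ1
      (by
        intro p
        obtain ⟨C, hC⟩ := exists_entryNorm_bound hs (F := fun w => X.Ψ w * Θ.mat p w * Y) fun w hw =>
          ((X.Ψ_analytic (hsD hw)).mul (Θ.mat_analytic (hsD hw) p)).mul (matAnalyticAt_const Y w)
        refine ⟨C * ((p + m).factorial : ℝ) / ρ ^ p, fun w hw => ?_⟩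
        exact div_le_div_of_nonneg_right (mul_le_mul_of_nonneg_right (hC w hw) (Nat.cast_nonneg _))
          (pow_nonneg hρ0.le _))
      (N := N) (by
        intro p hp w hw
        set ξ := entryNorm (X.Ψ w * Θ.mat p w * Y)
        set ξ' := entryNorm (X.Ψ w * Θ.mat (p + 1) w * Y)
        have hξ : 0 ≤ ξ := entryNorm_nonneg _
        have hξ' : 0 ≤ ξ' := entryNorm_nonneg _
        have h1 : ((p + 1 + m : ℕ) : ℝ) * ξ' ≤ ρ₀ * ξ + b * ξ'
            + S * ρ ^ (p + 1) / ((p + 1 + m).factorial : ℝ) := by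
          have h := congrArg entryNorm (Θ.frame_rec (hsD hw) hY p)
          rw [entryNorm_smul, Complex.norm_natCast] at h
          rw [h]
          refine (entryNorm_sub _ _).trans (add_le_add ((entryNorm_add _ _).trans (add_le_add ?_ ?_)) ?_)
          · exact entryNorm_diagonal_mul (hu w hw) _
          · refine (entryNorm_sub _ _).trans ?_
            rw [add_mul]
            refine add_le_add ((entryNorm_mul _ _).trans ?_) ((entryNorm_mul _ _).trans (mul_comm _ _).le)
            exact mul_le_mul_of_nonneg_right ((hcV w hw).trans (le_abs_self _)) hξ'
          · refine (entryNorm_sum _ _).trans ((Finset.sum_le_sum fun k hk =>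
              hc k (p + 1) (by rw [Finset.mem_range] at hk; omega) w hw).trans ?_)
            rw [← Finset.sum_div, ← Finset.sum_mul]
            gcongr
            exact hS _
        set t : ℝ := ((p + 1 + m : ℕ) : ℝ)
        have htN : (N : ℝ) ≤ t := by simp only [t]; exact_mod_cast (by omega : N ≤ p + 1 + m)
        have htb : 1 ≤ t - b := by linarith
        have hfac : ((p + 1 + m).factorial : ℝ) = t * ((p + m).factorial : ℝ) := by
          rw [show p + 1 + m = (p + m) + 1 by ring, Nat.factorial_succ]; simp only [t]; push_cast; ring
        have hf0 : (0 : ℝ) < ((p + m).factorial : ℝ) := by positivity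
        have ht0 : 0 < t := by linarith
        set y := ξ * ((p + m).factorial : ℝ) / ρ ^ p
        have hy : 0 ≤ y := by positivity
        have h2 : (t - b) * (ξ' * ((p + 1 + m).factorial : ℝ) / ρ ^ (p + 1)) ≤ ρ₀ / ρ * t * y + S := by
          have h3 : (t - b) * ξ' ≤ ρ₀ * ξ + S * ρ ^ (p + 1) / ((p + 1 + m).factorial : ℝ) := by linarith
          calc (t - b) * (ξ' * ((p + 1 + m).factorial : ℝ) / ρ ^ (p + 1))
              = ((t - b) * ξ') * (((p + 1 + m).factorial : ℝ) / ρ ^ (p + 1)) := by ring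
            _ ≤ (ρ₀ * ξ + S * ρ ^ (p + 1) / ((p + 1 + m).factorial : ℝ))
                * (((p + 1 + m).factorial : ℝ) / ρ ^ (p + 1)) := by gcongr
            _ = _ := by rw [hfac]; simp only [y]; field_simp; ring
        have h4 : ρ₀ / ρ * t * y + S ≤ (t - b) * (κ * y + S) := by
          have h5 : ρ₀ / ρ * t ≤ (t - b) * κ := by
            nlinarith [mul_le_mul_of_nonneg_right htN hκq.le]
          nlinarith [mul_le_mul_of_nonneg_right h5 hy, mul_le_mul_of_nonneg_right htb hS0]
        exact le_of_mul_le_mul_left (h2.trans h4) (by linarith))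
    refine ⟨C, fun p w hw => ?_⟩
    have h3 := hC p w hw
    rw [le_div_iff₀ (by positivity)]
    rwa [div_le_iff₀ (by positivity)] at h3

theorem exists_mat_bound {s : Set (Vec n)} (hs : IsCompact s) (hsD : s ⊆ X.D) {ρ₀ ρ : ℝ}
    (h0 : 0 ≤ ρ₀) (hρ : ρ₀ < ρ) (hu : ∀ w ∈ s, ∀ i, ‖X.u i w‖ ≤ ρ₀) :
    ∃ C, ∀ p, ∀ w ∈ s, entryNorm (Θ.mat p w) ≤ C * ρ ^ p / (p.factorial : ℝ) := by
  obtain ⟨K, hK⟩ := exists_isDeg_eq_zero M.μ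
  obtain ⟨C, hC⟩ := Θ.exists_frame_bound hs hsD h0 hρ hu hK K 0 (by omega) 1 (by simp [IsDeg])
  obtain ⟨c, hc⟩ := exists_entryNorm_bound hs (F := fun w => (X.Ψ w)⁻¹) fun w hw =>
    (X.Ψ_analytic (hsD hw)).inv (X.Ψ_det (hsD hw))
  refine ⟨|c| * C, fun p w hw => ?_⟩
  have h := hC p w hw
  rw [mul_one, add_zero] at h
  have e : Θ.mat p w = (X.Ψ w)⁻¹ * (X.Ψ w * Θ.mat p w) := by
    rw [← mul_assoc, X.Ψ_inv_mul (hsD hw), one_mul]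
  rw [e, mul_assoc, mul_div_assoc]
  exact (entryNorm_mul _ _).trans (mul_le_mul ((hc w hw).trans (le_abs_self c)) h (entryNorm_nonneg _)
    (abs_nonneg c))

end Calibration

/-! ### Convergence of matrix series and shifts of the index -/

theorem matHasSum_iff {ι m n : Type*} {f : ι → Matrix m n ℂ} {S : Matrix m n ℂ} :
    HasSum f S ↔ ∀ i j, HasSum (fun x => f x i j) (S i j) := by
  have h1 : HasSum f S ↔ ∀ i, HasSum (fun x => f x i) (S i) := Pi.hasSum
  rw [h1]
  exact forall_congr' fun i => Pi.hasSum

theorem summable_of_entryNorm {ι m n : Type*} [Fintype m] [Fintype n] {f : ι → Matrix m n ℂ}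
    {g : ι → ℝ} (hg : Summable g) (h : ∀ x, entryNorm (f x) ≤ g x) : Summable f := by
  have h1 : ∀ i j, HasSum (fun x => f x i j) (∑' x, f x i j) := fun i j =>
    (Summable.of_norm_bounded hg fun x => (norm_apply_le_entryNorm _ i j).trans (h x)).hasSum
  exact ⟨Matrix.of fun i j => ∑' x, f x i j, matHasSum_iff.2 h1⟩

/-- The sums over `k ≤ p` get a range independent of `p`, so that they can be exchanged with the
infinite sum over `p`. -/
theorem sum_range_succ_eq_ite {A : Type*} [AddCommMonoid A] {K : ℕ} {G : ℕ → A}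
    (hG : ∀ k, K ≤ k → G k = 0) (p : ℕ) :
    ∑ k ∈ Finset.range (p + 1), G k = ∑ k ∈ Finset.range K, if k ≤ p then G k else 0 := by
  rw [← Finset.sum_filter]
  have h : Finset.filter (fun k => k ≤ p) (Finset.range K) ⊆ Finset.range (p + 1) := fun k hk => by
    rw [Finset.mem_filter] at hk; exact Finset.mem_range.2 (by omega)
  refine (Finset.sum_subset h fun k hk hk' => hG k ?_).symm
  by_contra hlt
  exact hk' (Finset.mem_filter.2 ⟨Finset.mem_range.2 (not_le.1 hlt), by
    rw [Finset.mem_range] at hk; omega⟩)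

theorem factorialGrowth.exists_geometric {m n : Type*} [Fintype m] [Fintype n] {ℓ : ℝ}
    {a : ℕ → Matrix m n ℂ} (ha : a ∈ factorialGrowth m n ℓ) (C : ℝ) {ρ : ℝ} (hρ : 0 < ρ) (hρl : ρ < ℓ) :
    ∃ D κ, 0 ≤ κ ∧ κ < 1 ∧ ∀ p, C * ρ ^ p / (p.factorial : ℝ) * entryNorm (a p) ≤ D * κ ^ p := by
  obtain ⟨D, hD⟩ := ha ((ρ + ℓ) / 2) (by linarith) (by linarith)
  have hr : ρ < (ρ + ℓ) / 2 := by linarith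
  generalize (ρ + ℓ) / 2 = r at hD hr
  have hr0 : 0 < r := hρ.trans hr
  refine ⟨|C| * D, ρ / r, by positivity, (div_lt_one hr0).2 hr, fun p => ?_⟩
  calc _ ≤ |C| * ρ ^ p / (p.factorial : ℝ) * (D * (p.factorial : ℝ) / r ^ p) :=
        mul_le_mul (by gcongr; exact le_abs_self C) (hD p) (entryNorm_nonneg _) (by positivity)
    _ = _ := by rw [div_pow]; field_simp

/-- Shifting the summation index. -/
theorem HasSum.shift_ite {A : Type*} [AddCommMonoid A] [TopologicalSpace A] {f : ℕ → A} {s : A} {k : ℕ}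
    (h : HasSum (fun p => f (p + k)) s) : HasSum (fun p => if k ≤ p then f p else 0) s := by
  have hinj : Function.Injective fun p : ℕ => p + k := add_left_injective k
  refine (hinj.hasSum_iff fun p hp => if_neg fun hk => hp ⟨p - k, Nat.sub_add_cancel hk⟩).1 ?_
  refine h.congr_fun fun p => ?_
  simp

/-! ### The series `∑ Θ_p a_p` and `∑ a_pᵀ Ω_{p,q} b_q` -/

namespace Calibration

variable {n : ℕ} {M : GenFrobeniusManifold n} {X : CanonicalChart M} (Θ : Calibration X) {v : Vec n}
  {ℓ : ℝ} {a b : ℕ → Matrix (Fin n) (Fin n) ℂ}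

/-- At `v` the matrices `Θ_p` are of size `O(ρ^p / p!)` for some `ρ < ℓ / 2`. -/
def BoundedAt (ℓ : ℝ) (v : Vec n) : Prop :=
  ∃ C ρ : ℝ, 0 < ρ ∧ 2 * ρ < ℓ ∧ ∀ p, entryNorm (Θ.mat p v) ≤ C * ρ ^ p / (p.factorial : ℝ)

/-- `∑_p Θ_p a_p`. -/
def eval (v : Vec n) (a : ℕ → Matrix (Fin n) (Fin n) ℂ) : Matrix (Fin n) (Fin n) ℂ :=
  ∑' p, Θ.mat p v * a p

/-- `∑_{p,q} a_p^T Ω_{p,q} b_q`. -/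
def star (v : Vec n) (a b : ℕ → Matrix (Fin n) (Fin n) ℂ) : Matrix (Fin n) (Fin n) ℂ :=
  ∑' x : ℕ × ℕ, (a x.1).transpose * Θ.twoPt x.1 x.2 v * b x.2

variable {Θ}

theorem BoundedAt.entryNorm_mul_le (hv : Θ.BoundedAt ℓ v)
    (ha : a ∈ factorialGrowth (Fin n) (Fin n) ℓ) :
    ∃ C κ, 0 ≤ κ ∧ κ < 1 ∧ ∀ p, entryNorm (Θ.mat p v) * entryNorm (a p) ≤ C * κ ^ p := by
  obtain ⟨C, ρ, hρ, hρl, hC⟩ := hv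
  obtain ⟨D, κ, h0, h1, h⟩ := factorialGrowth.exists_geometric ha C hρ (by linarith)
  exact ⟨D, κ, h0, h1, fun p =>
    (mul_le_mul_of_nonneg_right (hC p) (entryNorm_nonneg _)).trans (h p)⟩

theorem BoundedAt.summable_norm (hv : Θ.BoundedAt ℓ v) (ha : a ∈ factorialGrowth (Fin n) (Fin n) ℓ) :
    Summable fun p => entryNorm (Θ.mat p v * a p) := by
  obtain ⟨C, κ, h0, h1, h⟩ := hv.entryNorm_mul_le ha
  exact Summable.of_nonneg_of_le (fun p => entryNorm_nonneg _)
    (fun p => (entryNorm_mul _ _).trans (h p)) ((summable_geometric_of_lt_one h0 h1).mul_left C)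

theorem BoundedAt.hasSum_eval (hv : Θ.BoundedAt ℓ v) (ha : a ∈ factorialGrowth (Fin n) (Fin n) ℓ) :
    HasSum (fun p => Θ.mat p v * a p) (Θ.eval v a) :=
  (summable_of_entryNorm (hv.summable_norm ha) fun _ => le_rfl).hasSum

/-- The products `1/((p+1+k)! (q-k)!)` are binomial coefficients divided by `(p+q+1)!`, and they add
up to at most `2^{p+q+1}/(p+q+1)!`. This doubling of `ρ` is the reason for the condition `|λ| > 2
max |u_i|`. -/
theorem BoundedAt.twoPt_bound (hv : Θ.BoundedAt ℓ v) :
    ∃ C ρ : ℝ, 0 < ρ ∧ ρ < ℓ ∧ ∀ p q,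
      entryNorm (Θ.twoPt p q v) ≤ C * ρ ^ (p + q) / ((p.factorial : ℝ) * (q.factorial : ℝ)) := by
  obtain ⟨C, ρ, hρ, hρl, hC⟩ := hv
  have hC0 : 0 ≤ C := by simpa using (entryNorm_nonneg _).trans (hC 0)
  have hη := entryNorm_nonneg M.η
  have hinn : ∀ i j, entryNorm (Θ.inn i j v)
      ≤ C * C * entryNorm M.η * ρ ^ (i + j) / ((i.factorial : ℝ) * (j.factorial : ℝ)) := fun i j => by
    calc entryNorm (Θ.inn i j v) ≤ entryNorm (Θ.mat i v) * entryNorm M.η * entryNorm (Θ.mat j v) := by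
          refine (entryNorm_mul _ _).trans ?_
          refine mul_le_mul_of_nonneg_right ((entryNorm_mul _ _).trans ?_) (entryNorm_nonneg _)
          rw [entryNorm_transpose]
      _ ≤ (C * ρ ^ i / (i.factorial : ℝ)) * entryNorm M.η * (C * ρ ^ j / (j.factorial : ℝ)) := by
          gcongr
          · exact entryNorm_nonneg _
          · exact hC i
          · exact hC j
      _ = _ := by rw [pow_add]; field_simp
  refine ⟨C * C * entryNorm M.η * (2 * ρ), 2 * ρ, by linarith, hρl, fun p q => ?_⟩
  have h1 : ∀ k ∈ Finset.range (q + 1), entryNorm ((-1 : ℂ) ^ k • Θ.inn (p + 1 + k) (q - k) v)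
      ≤ C * C * entryNorm M.η * ρ ^ (p + q + 1) / ((p + q + 1).factorial : ℝ)
        * ((p + q + 1).choose (q - k) : ℝ) := by
    intro k hk
    rw [Finset.mem_range] at hk
    rw [entryNorm_smul, norm_pow, norm_neg, norm_one, one_pow, one_mul]
    refine (hinn _ _).trans (le_of_eq ?_)
    rw [Nat.cast_choose ℝ (by omega : q - k ≤ p + q + 1), show p + 1 + k + (q - k) = p + q + 1 by omega,
      show p + q + 1 - (q - k) = p + 1 + k by omega]
    field_simp
  have h2 : (∑ k ∈ Finset.range (q + 1), ((p + q + 1).choose (q - k) : ℝ)) ≤ 2 ^ (p + q + 1) := by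
    have h3 : ∑ k ∈ Finset.range (q + 1), (p + q + 1).choose (q - k)
        = ∑ k ∈ Finset.range (q + 1), (p + q + 1).choose k := by
      rw [← Finset.sum_range_reflect (fun k => (p + q + 1).choose k)]
      simp
    have h4 : ∑ k ∈ Finset.range (q + 1), (p + q + 1).choose k ≤ 2 ^ (p + q + 1) := by
      rw [← Nat.sum_range_choose]
      exact Finset.sum_le_sum_of_subset (Finset.range_mono (by omega))
    exact_mod_cast h3 ▸ h4
  have h5 : (p.factorial : ℝ) * (q.factorial : ℝ) ≤ ((p + q + 1).factorial : ℝ) := by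
    have := (Nat.le_of_dvd (Nat.factorial_pos _) (Nat.factorial_mul_factorial_dvd_factorial_add p q)).trans
      (Nat.factorial_le (Nat.le_succ (p + q)))
    exact_mod_cast this
  rw [Θ.twoPt_eq]
  calc _ ≤ ∑ k ∈ Finset.range (q + 1), C * C * entryNorm M.η * ρ ^ (p + q + 1)
        / ((p + q + 1).factorial : ℝ) * ((p + q + 1).choose (q - k) : ℝ) :=
        (entryNorm_sum _ _).trans (Finset.sum_le_sum h1)
    _ ≤ C * C * entryNorm M.η * ρ ^ (p + q + 1) / ((p + q + 1).factorial : ℝ) * 2 ^ (p + q + 1) := by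
        rw [← Finset.mul_sum]; gcongr
    _ = C * C * entryNorm M.η * (2 * ρ) * (2 * ρ) ^ (p + q) / ((p + q + 1).factorial : ℝ) := by
        rw [mul_pow, pow_succ, pow_succ]; ring
    _ ≤ _ := by gcongr

theorem BoundedAt.star_bound (hv : Θ.BoundedAt ℓ v) (ha : a ∈ factorialGrowth (Fin n) (Fin n) ℓ)
    (hb : b ∈ factorialGrowth (Fin n) (Fin n) ℓ) :
    ∃ g : ℕ × ℕ → ℝ, Summable g ∧ ∀ x, entryNorm (a x.1) * entryNorm (Θ.twoPt x.1 x.2 v)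
      * entryNorm (b x.2) ≤ g x := by
  obtain ⟨C, ρ, hρ, hρl, hC⟩ := hv.twoPt_bound
  obtain ⟨D, hD⟩ := ha ((ρ + ℓ) / 2) (by linarith) (by linarith)
  obtain ⟨D', hD'⟩ := hb ((ρ + ℓ) / 2) (by linarith) (by linarith)
  have hr : ρ < (ρ + ℓ) / 2 := by linarith
  generalize (ρ + ℓ) / 2 = r at hD hD' hr
  have hr0 : 0 < r := hρ.trans hr
  have hκ : Summable fun p : ℕ => (ρ / r) ^ p :=
    summable_geometric_of_lt_one (by positivity) ((div_lt_one hr0).2 hr)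
  refine ⟨fun x => C * D * D' * ((ρ / r) ^ x.1 * (ρ / r) ^ x.2),
    (hκ.mul_of_nonneg hκ (fun p => by positivity) fun p => by positivity).mul_left _, fun x => ?_⟩
  have hD0 := (entryNorm_nonneg _).trans (hD x.1)
  have hC0 := (entryNorm_nonneg _).trans (hC x.1 x.2)
  calc _ ≤ (D * (x.1.factorial : ℝ) / r ^ x.1)
        * (C * ρ ^ (x.1 + x.2) / ((x.1.factorial : ℝ) * (x.2.factorial : ℝ)))
        * (D' * (x.2.factorial : ℝ) / r ^ x.2) :=
        mul_le_mul (mul_le_mul (hD _) (hC _ _) (entryNorm_nonneg _) hD0) (hD' _) (entryNorm_nonneg _)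
          (mul_nonneg hD0 hC0)
    _ = C * D * D' * ((ρ / r) ^ x.1 * (ρ / r) ^ x.2) := by rw [div_pow, div_pow, pow_add]; field_simp

theorem BoundedAt.hasSum_star (hv : Θ.BoundedAt ℓ v) (ha : a ∈ factorialGrowth (Fin n) (Fin n) ℓ)
    (hb : b ∈ factorialGrowth (Fin n) (Fin n) ℓ) :
    HasSum (fun x : ℕ × ℕ => (a x.1).transpose * Θ.twoPt x.1 x.2 v * b x.2) (Θ.star v a b) := by
  obtain ⟨g, hg, h⟩ := hv.star_bound ha hb
  refine (summable_of_entryNorm hg fun x => ?_).hasSum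
  refine (entryNorm_mul _ _).trans (le_trans ?_ (h x))
  refine mul_le_mul_of_nonneg_right ((entryNorm_mul _ _).trans (le_of_eq ?_)) (entryNorm_nonneg _)
  rw [entryNorm_transpose]

theorem BoundedAt.hasSum_eval_mul_eval (hv : Θ.BoundedAt ℓ v)
    (ha : a ∈ factorialGrowth (Fin n) (Fin n) ℓ) (hb : b ∈ factorialGrowth (Fin n) (Fin n) ℓ)
    (B : Matrix (Fin n) (Fin n) ℂ) :
    HasSum (fun x : ℕ × ℕ => (a x.1).transpose * ((Θ.mat x.1 v).transpose * B * Θ.mat x.2 v) * b x.2)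
      ((Θ.eval v a).transpose * B * Θ.eval v b) := by
  have h1 : HasSum (fun p => (Θ.mat p v * a p).transpose * B) ((Θ.eval v a).transpose * B) :=
    ((hv.hasSum_eval ha).matrix_transpose).mul_right B
  have h2 : Summable fun x : ℕ × ℕ => ((Θ.mat x.1 v * a x.1).transpose * B) * (Θ.mat x.2 v * b x.2) := by
    have h3 := (((hv.summable_norm ha).mul_right (entryNorm B)).mul_of_nonneg (hv.summable_norm hb)
      (fun p => mul_nonneg (entryNorm_nonneg _) (entryNorm_nonneg _)) fun p => entryNorm_nonneg _)
    refine summable_of_entryNorm h3 fun x => (entryNorm_mul _ _).trans ?_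
    refine mul_le_mul_of_nonneg_right ((entryNorm_mul _ _).trans (le_of_eq ?_)) (entryNorm_nonneg _)
    rw [entryNorm_transpose]
  refine (h1.mul (hv.hasSum_eval hb) h2).congr_fun fun x => ?_
  rw [Matrix.transpose_mul]
  simp only [mul_assoc]

/-- The sequence `(p + μ) a_p + ∑_k R_k a_{p+k}`. -/
def eulerSeq (Θ : Calibration X) (K : ℕ) (a : ℕ → Matrix (Fin n) (Fin n) ℂ) (p : ℕ) :
    Matrix (Fin n) (Fin n) ℂ :=
  ((p : ℂ) • a p + M.μ * a p) + ∑ k ∈ Finset.range K, Θ.mon k * a (p + k)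

theorem eulerSeq_eq (K : ℕ) : Θ.eulerSeq K a = (fun p : ℕ => (p : ℂ) • a p + M.μ * a p)
    + ∑ k ∈ Finset.range K, fun p => Θ.mon k * a (p + k) := by
  ext1 p; rw [Pi.add_apply, Finset.sum_apply]; rfl

theorem degree_growth (ha : a ∈ factorialGrowth (Fin n) (Fin n) ℓ) :
    (fun p : ℕ => (p : ℂ) • a p + M.μ * a p) ∈ factorialGrowth (Fin n) (Fin n) ℓ :=
  Submodule.add_mem _ (factorialGrowth.natCast_smul ha) (factorialGrowth.const_mul ha M.μ)

theorem mon_shift_growth (ha : a ∈ factorialGrowth (Fin n) (Fin n) ℓ) (k : ℕ) :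
    (fun p => Θ.mon k * a (p + k)) ∈ factorialGrowth (Fin n) (Fin n) ℓ :=
  factorialGrowth.const_mul (factorialGrowth.shift ha k) _

theorem eulerSeq_growth (K : ℕ) (ha : a ∈ factorialGrowth (Fin n) (Fin n) ℓ) :
    Θ.eulerSeq K a ∈ factorialGrowth (Fin n) (Fin n) ℓ := by
  rw [eulerSeq_eq]
  exact Submodule.add_mem _ (degree_growth ha) (Submodule.sum_mem _ fun k _ => mon_shift_growth ha k)

/-- `𝒰 ∑ Θ_p a_{p+1} = ∑ Θ_p (N a)_p - μ ∑ Θ_p a_p`. -/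
theorem BoundedAt.calU_mul_eval (hv : Θ.BoundedAt ℓ v) (hvD : v ∈ X.D)
    {K : ℕ} (hK : ∀ k, K ≤ k → ∀ Y, IsDeg M.μ k Y → Y = 0)
    (ha : a ∈ factorialGrowth (Fin n) (Fin n) ℓ) :
    M.calU v * Θ.eval v (fun p => a (p + 1)) = Θ.eval v (Θ.eulerSeq K a) - M.μ * Θ.eval v a := by
  -- `𝒰 Θ_p` is the Euler expression of index `p + 1`, and the one of index `0` vanishes, so the
  -- shifted sum runs over all indices.
  have h1 : HasSum (fun p => Θ.eulerMat p v * a p) (M.calU v * Θ.eval v fun p => a (p + 1)) := by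
    have h := (hv.hasSum_eval (factorialGrowth.shift_one ha)).mul_left (M.calU v)
    have h' : HasSum (fun p => Θ.eulerMat (p + 1) v * a (p + 1))
        (M.calU v * Θ.eval v fun p => a (p + 1)) :=
      h.congr_fun fun p => by rw [Θ.eulerMat_succ hvD, mul_assoc]
    have h2 := (hasSum_nat_add_iff' (f := fun p => Θ.eulerMat p v * a p)
      (g := M.calU v * Θ.eval v fun p => a (p + 1)) 1)
    rw [Finset.sum_range_one, Θ.eulerMat_zero hvD, zero_mul, sub_zero] at h2
    exact h2.1 h'
  have h2 : ∀ k, HasSum (fun p => if k ≤ p then Θ.mat (p - k) v * Θ.mon k * a p else 0)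
      (Θ.eval v fun p => Θ.mon k * a (p + k)) := fun k =>
    HasSum.shift_ite ((hv.hasSum_eval (mon_shift_growth (Θ := Θ) ha k)).congr_fun fun p => by
      rw [Nat.add_sub_cancel, mul_assoc])
  have h3 := ((hv.hasSum_eval (degree_growth (M := M) ha)).sub
    ((hv.hasSum_eval ha).mul_left M.μ)).add (hasSum_sum fun k (_ : k ∈ Finset.range K) => h2 k)
  have h4 : HasSum (fun p => Θ.mat p v * Θ.eulerSeq K a p)
      (Θ.eval v (fun p : ℕ => (p : ℂ) • a p + M.μ * a p)
        + ∑ k ∈ Finset.range K, Θ.eval v fun p => Θ.mon k * a (p + k)) :=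
    ((hv.hasSum_eval (degree_growth (M := M) ha)).add (hasSum_sum fun k (_ : k ∈ Finset.range K) =>
      hv.hasSum_eval (mon_shift_growth (Θ := Θ) ha k))).congr_fun fun p => by
        rw [eulerSeq, mul_add, Finset.mul_sum]
  rw [(hv.hasSum_eval (eulerSeq_growth K ha)).unique h4, add_sub_right_comm]
  refine h1.unique (h3.congr_fun fun p => ?_)
  rw [eulerMat, sum_range_succ_eq_ite (K := K) (fun k hk => by
    rw [hK k hk _ (Θ.mon_isDeg k), mul_zero]), add_mul, Finset.sum_mul]
  congr 1
  · rw [sub_mul, add_mul, mul_add, mul_smul_comm, smul_mul_assoc]; simp only [mul_assoc]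
  · exact Finset.sum_congr rfl fun k _ => by rw [ite_mul, zero_mul]

end Calibration

theorem HasSum.shift_ite_left {A : Type*} [AddCommMonoid A] [TopologicalSpace A] {f : ℕ × ℕ → A} {s : A}
    {k : ℕ} (h : HasSum (fun x : ℕ × ℕ => f (x.1 + k, x.2)) s) :
    HasSum (fun x : ℕ × ℕ => if k ≤ x.1 then f x else 0) s := by
  have hinj : Function.Injective fun x : ℕ × ℕ => (x.1 + k, x.2) := fun x y hxy => by
    rw [Prod.mk.injEq] at hxy
    exact Prod.ext (by omega) hxy.2
  refine (hinj.hasSum_iff fun x hx => if_neg fun hk => hx ⟨(x.1 - k, x.2), ?_⟩).1 ?_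
  · exact Prod.ext (Nat.sub_add_cancel hk) rfl
  · refine h.congr_fun fun x => ?_
    simp

theorem HasSum.shift_ite_right {A : Type*} [AddCommMonoid A] [TopologicalSpace A] {f : ℕ × ℕ → A} {s : A}
    {k : ℕ} (h : HasSum (fun x : ℕ × ℕ => f (x.1, x.2 + k)) s) :
    HasSum (fun x : ℕ × ℕ => if k ≤ x.2 then f x else 0) s := by
  have hinj : Function.Injective fun x : ℕ × ℕ => (x.1, x.2 + k) := fun x y hxy => by
    rw [Prod.mk.injEq] at hxy
    exact Prod.ext hxy.1 (by omega)
  refine (hinj.hasSum_iff fun x hx => if_neg fun hk => hx ⟨(x.1, x.2 - k), ?_⟩).1 ?_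
  · exact Prod.ext rfl (Nat.sub_add_cancel hk)
  · refine h.congr_fun fun x => ?_
    simp

/-! ### Shift relation and Euler identity for the star product of series -/

namespace Calibration

variable {n : ℕ} {M : GenFrobeniusManifold n} {X : CanonicalChart M} {Θ : Calibration X} {v : Vec n}
  {ℓ : ℝ} {a b : ℕ → Matrix (Fin n) (Fin n) ℂ}

theorem inn_eq_ite (hv : v ∈ X.D) (p q : ℕ) : Θ.inn p q v
    = (if 1 ≤ p then Θ.twoPt (p - 1) q v else 0) + (if 1 ≤ q then Θ.twoPt p (q - 1) v else 0)
      + if (p, q) = (0, 0) then M.η else 0 := by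
  rcases p with _ | p <;> rcases q with _ | q
  · simp [Θ.inn_zero_zero hv]
  · simp [Θ.twoPt_zero_left hv]
  · simp [Θ.twoPt_zero_right]
  · simp [← Θ.twoPt_succ, add_comm]

/-- The relation `(z + w) Ω(z, w) = ⟨∇θ(z), ∇θ(w)⟩ - η`. -/
theorem BoundedAt.star_shift (hv : Θ.BoundedAt ℓ v) (hvD : v ∈ X.D)
    (ha : a ∈ factorialGrowth (Fin n) (Fin n) ℓ) (hb : b ∈ factorialGrowth (Fin n) (Fin n) ℓ) :
    Θ.star v (fun p => a (p + 1)) b + Θ.star v a (fun p => b (p + 1))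
      = (Θ.eval v a).transpose * M.η * Θ.eval v b - (a 0).transpose * M.η * b 0 := by
  have h1 : HasSum (fun x : ℕ × ℕ => if 1 ≤ x.1 then
      (a x.1).transpose * Θ.twoPt (x.1 - 1) x.2 v * b x.2 else 0) (Θ.star v (fun p => a (p + 1)) b) :=
    HasSum.shift_ite_left ((hv.hasSum_star (factorialGrowth.shift_one ha) hb).congr_fun fun x => rfl)
  have h2 : HasSum (fun x : ℕ × ℕ => if 1 ≤ x.2 then
      (a x.1).transpose * Θ.twoPt x.1 (x.2 - 1) v * b x.2 else 0) (Θ.star v a (fun p => b (p + 1))) :=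
    HasSum.shift_ite_right ((hv.hasSum_star ha (factorialGrowth.shift_one hb)).congr_fun fun x => rfl)
  have h3 := hasSum_ite_eq ((0, 0) : ℕ × ℕ) ((a 0).transpose * M.η * b 0)
  refine eq_sub_of_add_eq (((h1.add h2).add h3).unique
    ((hv.hasSum_eval_mul_eval ha hb M.η).congr_fun fun x => ?_))
  have h4 := inn_eq_ite (Θ := Θ) hvD x.1 x.2
  rw [inn] at h4
  rw [h4, mul_add, mul_add, add_mul, add_mul]
  congr 1
  · congr 1 <;> split_ifs <;> simp
  · by_cases hx : x = (0, 0)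
    · subst hx; simp
    · rw [if_neg hx, if_neg hx, mul_zero, zero_mul]

/-- The contribution of the matrices `R_k` to the Euler identity. -/
def monForm (Θ : Calibration X) (K : ℕ) (a b : ℕ → Matrix (Fin n) (Fin n) ℂ) : Matrix (Fin n) (Fin n) ℂ :=
  ∑ x ∈ Finset.range K ×ˢ Finset.range K,
    (-1 : ℂ) ^ x.1 • ((a x.1).transpose * (M.η * Θ.mon (x.1 + x.2 + 1)) * b x.2)

/-- The Euler identity for the series `∑ a_p^T Ω_{p,q} b_q`. -/
theorem BoundedAt.star_euler (hv : Θ.BoundedAt ℓ v) (hvD : v ∈ X.D)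
    {K : ℕ} (hK : ∀ k, K ≤ k → ∀ Y, IsDeg M.μ k Y → Y = 0)
    (ha : a ∈ factorialGrowth (Fin n) (Fin n) ℓ) (hb : b ∈ factorialGrowth (Fin n) (Fin n) ℓ) :
    Θ.star v (Θ.eulerSeq K a) b + Θ.star v a (Θ.eulerSeq K b) + Θ.star v a b + Θ.monForm K a b
      = (Θ.eval v a).transpose * (M.η * M.calU v) * Θ.eval v b := by
  have hmon : ∀ k, K ≤ k → Θ.mon k = 0 := fun k hk => hK k hk _ (Θ.mon_isDeg k)
  have h1 : ∀ k, HasSum (fun x : ℕ × ℕ => if k ≤ x.1 then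
      (a x.1).transpose * ((Θ.mon k).transpose * Θ.twoPt (x.1 - k) x.2 v) * b x.2 else 0)
      (Θ.star v (fun p => Θ.mon k * a (p + k)) b) := fun k =>
    HasSum.shift_ite_left ((hv.hasSum_star (mon_shift_growth (Θ := Θ) ha k) hb).congr_fun fun x => by
      rw [Nat.add_sub_cancel, Matrix.transpose_mul]; simp only [mul_assoc])
  have h2 : ∀ k, HasSum (fun x : ℕ × ℕ => if k ≤ x.2 then
      (a x.1).transpose * (Θ.twoPt x.1 (x.2 - k) v * Θ.mon k) * b x.2 else 0)
      (Θ.star v a (fun p => Θ.mon k * b (p + k))) := fun k =>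
    HasSum.shift_ite_right ((hv.hasSum_star ha (mon_shift_growth (Θ := Θ) hb k)).congr_fun fun x => by
      rw [Nat.add_sub_cancel]; simp only [mul_assoc])
  -- Finitely many terms, because `R_k = 0` for `k ≥ K`.
  have h3 : HasSum (fun x : ℕ × ℕ => (-1 : ℂ) ^ x.1 •
      ((a x.1).transpose * (M.η * Θ.mon (x.1 + x.2 + 1)) * b x.2)) (Θ.monForm K a b) := by
    refine hasSum_sum_of_ne_finset_zero fun x hx => ?_
    have : K ≤ x.1 + x.2 + 1 := by
      by_contra hlt
      exact hx (Finset.mem_product.2 ⟨Finset.mem_range.2 (by omega), Finset.mem_range.2 (by omega)⟩)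
    rw [hmon _ this, mul_zero, mul_zero, zero_mul, smul_zero]
  have hda := degree_growth (M := M) ha
  have hdb := degree_growth (M := M) hb
  have h4 : Θ.star v (Θ.eulerSeq K a) b = Θ.star v (fun p : ℕ => (p : ℂ) • a p + M.μ * a p) b
      + ∑ k ∈ Finset.range K, Θ.star v (fun p => Θ.mon k * a (p + k)) b :=
    (hv.hasSum_star (eulerSeq_growth K ha) hb).unique (((hv.hasSum_star hda hb).add
      (hasSum_sum fun k (_ : k ∈ Finset.range K) =>
        hv.hasSum_star (mon_shift_growth (Θ := Θ) ha k) hb)).congr_fun fun x => by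
          rw [eulerSeq, Matrix.transpose_add, Matrix.transpose_sum, add_mul, add_mul, Finset.sum_mul,
            Finset.sum_mul])
  have h5 : Θ.star v a (Θ.eulerSeq K b) = Θ.star v a (fun p : ℕ => (p : ℂ) • b p + M.μ * b p)
      + ∑ k ∈ Finset.range K, Θ.star v a (fun p => Θ.mon k * b (p + k)) :=
    (hv.hasSum_star ha (eulerSeq_growth K hb)).unique (((hv.hasSum_star ha hdb).add
      (hasSum_sum fun k (_ : k ∈ Finset.range K) =>
        hv.hasSum_star ha (mon_shift_growth (Θ := Θ) hb k))).congr_fun fun x => by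
          rw [eulerSeq, mul_add, Finset.mul_sum])
  rw [h4, h5]
  refine HasSum.unique ((((((hv.hasSum_star hda hb).add
    (hasSum_sum fun k (_ : k ∈ Finset.range K) => h1 k)).add ((hv.hasSum_star ha hdb).add
    (hasSum_sum fun k (_ : k ∈ Finset.range K) => h2 k))).add (hv.hasSum_star ha hb)).add h3))
    ((hv.hasSum_eval_mul_eval ha hb (M.η * M.calU v)).congr_fun fun x => ?_)
  have h6 := Θ.euler_twoPt hvD x.1 x.2
  rw [sum_range_succ_eq_ite (K := K) (fun k hk => by rw [hmon k hk, Matrix.transpose_zero, zero_mul]),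
    sum_range_succ_eq_ite (K := K) (fun k hk => by rw [hmon k hk, mul_zero])] at h6
  rw [← mul_assoc (Θ.mat x.1 v).transpose, mul_assoc _ _ (Θ.mat x.2 v), h6]
  simp only [mul_add, add_mul, Finset.mul_sum, Finset.sum_mul, mul_ite, ite_mul, mul_zero, zero_mul,
    Matrix.transpose_add, Matrix.transpose_smul, Matrix.transpose_mul, smul_mul_assoc, mul_smul_comm,
    Nat.cast_add, Nat.cast_one, add_smul, one_smul, mul_assoc]
  abel

theorem BoundedAt.star_smul_sub_left {a' : ℕ → Matrix (Fin n) (Fin n) ℂ} (hv : Θ.BoundedAt ℓ v)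
    (ha : a ∈ factorialGrowth (Fin n) (Fin n) ℓ) (ha' : a' ∈ factorialGrowth (Fin n) (Fin n) ℓ)
    (hb : b ∈ factorialGrowth (Fin n) (Fin n) ℓ) (s t : ℂ) :
    Θ.star v (s • a - t • a') b = s • Θ.star v a b - t • Θ.star v a' b :=
  (hv.hasSum_star (Submodule.sub_mem _ (Submodule.smul_mem _ s ha) (Submodule.smul_mem _ t ha')) hb).unique
    ((((hv.hasSum_star ha hb).const_smul s).sub ((hv.hasSum_star ha' hb).const_smul t)).congr_fun
      fun x => by
        rw [Pi.sub_apply, Pi.smul_apply, Pi.smul_apply, Matrix.transpose_sub, Matrix.transpose_smul,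
          Matrix.transpose_smul, sub_mul, sub_mul]
        simp only [smul_mul_assoc])

theorem BoundedAt.star_smul_sub_right {b' : ℕ → Matrix (Fin n) (Fin n) ℂ} (hv : Θ.BoundedAt ℓ v)
    (ha : a ∈ factorialGrowth (Fin n) (Fin n) ℓ) (hb : b ∈ factorialGrowth (Fin n) (Fin n) ℓ)
    (hb' : b' ∈ factorialGrowth (Fin n) (Fin n) ℓ) (s t : ℂ) :
    Θ.star v a (s • b - t • b') = s • Θ.star v a b - t • Θ.star v a b' :=
  (hv.hasSum_star ha (Submodule.sub_mem _ (Submodule.smul_mem _ s hb) (Submodule.smul_mem _ t hb'))).unique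
    ((((hv.hasSum_star ha hb).const_smul s).sub ((hv.hasSum_star ha hb').const_smul t)).congr_fun
      fun x => by
        rw [Pi.sub_apply, Pi.smul_apply, Pi.smul_apply, mul_sub]
        simp only [mul_smul_comm])

theorem BoundedAt.eval_smul_sub {a' : ℕ → Matrix (Fin n) (Fin n) ℂ} (hv : Θ.BoundedAt ℓ v)
    (ha : a ∈ factorialGrowth (Fin n) (Fin n) ℓ) (ha' : a' ∈ factorialGrowth (Fin n) (Fin n) ℓ) (s t : ℂ) :
    Θ.eval v (s • a - t • a') = s • Θ.eval v a - t • Θ.eval v a' :=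
  (hv.hasSum_eval (Submodule.sub_mem _ (Submodule.smul_mem _ s ha) (Submodule.smul_mem _ t ha'))).unique
    ((((hv.hasSum_eval ha).const_smul s).sub ((hv.hasSum_eval ha').const_smul t)).congr_fun
      fun x => by
        rw [Pi.sub_apply, Pi.smul_apply, Pi.smul_apply, mul_sub]
        simp only [mul_smul_comm])

/-- If `λ a_{p+1} = (N a)_p + ν a_p` then `(𝒰 - λ) ∑ Θ_p a_{p+1} = -(μ + ν) ∑ Θ_p a_p`. -/
theorem BoundedAt.eulerSub_mul_eval (hv : Θ.BoundedAt ℓ v) (hvD : v ∈ X.D) {K : ℕ}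
    (hK : ∀ k, K ≤ k → ∀ Y, IsDeg M.μ k Y → Y = 0) (ha : a ∈ factorialGrowth (Fin n) (Fin n) ℓ)
    {lam ν : ℂ} (hrec : Θ.eulerSeq K a = lam • (fun p => a (p + 1)) - ν • a) :
    M.eulerSub lam v * Θ.eval v (fun p => a (p + 1))
      = -((M.μ + ν • (1 : Matrix (Fin n) (Fin n) ℂ)) * Θ.eval v a) := by
  have h := hv.calU_mul_eval hvD hK ha
  rw [hrec, hv.eval_smul_sub (factorialGrowth.shift_one ha) ha] at h
  rw [GenFrobeniusManifold.eulerSub, sub_mul, h, smul_mul_assoc, one_mul, add_mul, smul_mul_assoc, one_mul]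
  abel

/-- If `λ a_{p+1} = (N a)_p + ν a_p`, the series `∑ a_p^T Ω_{p,q} a_q` is given by
`∑ Θ_p a_p`, up to a contribution of the initial terms. -/
theorem BoundedAt.star_self (hv : Θ.BoundedAt ℓ v) (hvD : v ∈ X.D) {K : ℕ}
    (hK : ∀ k, K ≤ k → ∀ Y, IsDeg M.μ k Y → Y = 0) (ha : a ∈ factorialGrowth (Fin n) (Fin n) ℓ)
    {lam ν : ℂ} (hrec : Θ.eulerSeq K a = lam • (fun p => a (p + 1)) - ν • a) :
    (2 * ν - 1) • Θ.star v a a = -((Θ.eval v a).transpose * (M.η * M.eulerSub lam v) * Θ.eval v a)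
      - lam • ((a 0).transpose * M.η * a 0) + Θ.monForm K a a := by
  have h1 := hv.star_euler hvD hK ha ha
  have hs := factorialGrowth.shift_one ha
  rw [hrec, hv.star_smul_sub_left hs ha ha, hv.star_smul_sub_right ha hs ha] at h1
  -- By the recursion the Euler identity contains `λ` times the two shifted series. Their sum is
  -- known from the shift relation, and what is left is a multiple of the series itself.
  have h2 := congrArg (fun Z => lam • Z) (hv.star_shift hvD ha ha)
  simp only [smul_add, smul_sub] at h2
  have h3 : (Θ.eval v a).transpose * (M.η * M.eulerSub lam v) * Θ.eval v a
      = (Θ.eval v a).transpose * (M.η * M.calU v) * Θ.eval v a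
        - lam • ((Θ.eval v a).transpose * M.η * Θ.eval v a) := by
    rw [GenFrobeniusManifold.eulerSub, mul_sub, mul_sub, sub_mul]
    simp only [mul_smul_comm, smul_mul_assoc, mul_one]
  rw [h3, ← h1, ← sub_eq_zero]
  rw [← sub_eq_zero] at h2
  rw [← h2, sub_smul, two_mul, add_smul, one_smul]
  abel

end Calibration

/-! ### The Gram matrix of the series and the trace of the star product -/

namespace Calibration

variable {n : ℕ} {M : GenFrobeniusManifold n} {X : CanonicalChart M} (Θ : Calibration X) {v : Vec n}
  {lam : ℂ} {K : ℕ}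

theorem coeff_eulerSeq (hlam : lam ≠ 0) (hK : ∀ k, K ≤ k → ∀ Y, IsDeg M.μ k Y → Y = 0) :
    Θ.eulerSeq K (Θ.coeff lam K)
      = lam • (fun p => Θ.coeff lam K (p + 1)) - (1 / 2 : ℂ) • Θ.coeff lam K := by
  ext1 p
  rw [Pi.sub_apply, Pi.smul_apply, Pi.smul_apply, Θ.coeff_succ hlam hK, eulerSeq,
    GenFrobeniusManifold.muPlus, add_mul, smul_mul_assoc, one_mul]
  abel

/-- For the sequence `A_{p+1}` the factor `p + 1 + μ + ½` is `p + μ + 3/2`. -/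
theorem coeff_eulerSeq_shift (hlam : lam ≠ 0) (hK : ∀ k, K ≤ k → ∀ Y, IsDeg M.μ k Y → Y = 0) :
    Θ.eulerSeq K (fun p => Θ.coeff lam K (p + 1))
      = lam • (fun p => Θ.coeff lam K (p + 1 + 1)) - (3 / 2 : ℂ) • fun p => Θ.coeff lam K (p + 1) := by
  ext1 p
  have h : (3 / 2 : ℂ) = 1 + 1 / 2 := by norm_num
  rw [Pi.sub_apply, Pi.smul_apply, Pi.smul_apply, Θ.coeff_succ hlam hK, eulerSeq,
    GenFrobeniusManifold.muPlus, add_mul, smul_mul_assoc, one_mul, h, add_smul, Nat.cast_add, Nat.cast_one,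
    add_smul]
  simp only [add_right_comm p 1]
  abel

/-- Every term contains a factor `R_k`, of positive degree, between factors of nonnegative degree.
-/
theorem monForm_mem (K : ℕ) {a b : ℕ → Matrix (Fin n) (Fin n) ℂ} (ha : ∀ p, a p ∈ degGE M.μ 0)
    (hb : ∀ p, b p ∈ degGE M.μ 0) : M.η⁻¹ * Θ.monForm K a b ∈ degGE M.μ 1 := by
  rw [monForm, Finset.mul_sum]
  refine Submodule.sum_mem _ fun x _ => ?_
  rw [mul_smul_comm]
  refine Submodule.smul_mem _ _ ?_
  have h : M.η⁻¹ * ((a x.1).transpose * (M.η * Θ.mon (x.1 + x.2 + 1)) * b x.2)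
      = M.adj (a x.1) * Θ.mon (x.1 + x.2 + 1) * b x.2 := by
    rw [GenFrobeniusManifold.adj]; simp only [mul_assoc]
  rw [h]
  have h1 := degGE_mul (degGE_mul (M.adj_mem (ha x.1)) (Θ.mon_mem (x.1 + x.2 + 1))) (hb x.2)
  rwa [zero_add, add_zero] at h1

/-- The constant Gram matrix of the series `∑ Θ_p A_p`. -/
def gramConst (lam : ℂ) (K : ℕ) : Matrix (Fin n) (Fin n) ℂ :=
  -(lam • M.η) + Θ.monForm K (Θ.coeff lam K) (Θ.coeff lam K)

/-- The inverse of the constant Gram matrix is `-λ⁻¹ η⁻¹` up to terms of positive degree. -/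
theorem exists_gramConst_inv (hlam : lam ≠ 0) (K : ℕ) :
    ∃ G, Θ.gramConst lam K * -(lam⁻¹ • (G * M.η⁻¹)) = 1 ∧ G - 1 ∈ degGE M.μ 1 := by
  have h1 := Submodule.smul_mem _ lam⁻¹
    (Θ.monForm_mem K (Θ.coeff_mem lam K) (Θ.coeff_mem lam K))
  obtain ⟨G, hG, hG1⟩ := exists_inv_one_sub h1
  refine ⟨G, ?_, hG1⟩
  set F := Θ.monForm K (Θ.coeff lam K) (Θ.coeff lam K)
  have h2 : Θ.gramConst lam K = -(lam • (M.η * (1 - lam⁻¹ • (M.η⁻¹ * F)))) := by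
    rw [gramConst, mul_sub, mul_one, smul_sub, mul_smul_comm, smul_smul, mul_inv_cancel₀ hlam, one_smul,
      ← mul_assoc, M.η_mul_inv, one_mul, neg_sub, sub_eq_neg_add]
  rw [h2, neg_mul_neg, smul_mul_smul_comm, mul_inv_cancel₀ hlam, one_smul, mul_assoc, ← mul_assoc _ G, hG,
    one_mul, M.η_mul_inv]

variable {Θ}

/-- For `ν = ½` the factor `2ν - 1` is zero: the star product drops out, and the identity expresses
the Gram matrix through constants. -/
theorem BoundedAt.eval_gram (hv : Θ.BoundedAt ‖lam‖ v) (hvD : v ∈ X.D) (hlam : lam ≠ 0)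
    (hK : ∀ k, K ≤ k → ∀ Y, IsDeg M.μ k Y → Y = 0) :
    (Θ.eval v (Θ.coeff lam K)).transpose * (M.η * M.eulerSub lam v) * Θ.eval v (Θ.coeff lam K)
      = Θ.gramConst lam K := by
  have h := hv.star_self hvD hK (Θ.coeff_growth hlam K) (Θ.coeff_eulerSeq hlam hK)
  rw [show (2 * (1 / 2) - 1 : ℂ) = 0 by norm_num, zero_smul, Θ.coeff_zero, Matrix.transpose_one, one_mul,
    mul_one] at h
  rw [gramConst, ← sub_eq_zero, ← neg_eq_zero, h]
  abel

/-- The constant Gram matrix is invertible, being `-λ η` up to terms of positive degree. -/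
theorem BoundedAt.det_eval_ne_zero (hv : Θ.BoundedAt ‖lam‖ v) (hvD : v ∈ X.D) (hlam : lam ≠ 0)
    (hK : ∀ k, K ≤ k → ∀ Y, IsDeg M.μ k Y → Y = 0) : (Θ.eval v (Θ.coeff lam K)).det ≠ 0 := by
  intro h0
  obtain ⟨G, hG, -⟩ := Θ.exists_gramConst_inv hlam K
  have h := congrArg Matrix.det hG
  rw [← hv.eval_gram hvD hlam hK, Matrix.det_mul, Matrix.det_mul _ (Θ.eval v _), h0, Matrix.det_one] at h
  simp at h

theorem BoundedAt.eulerSub_mul_eval_coeff (hv : Θ.BoundedAt ‖lam‖ v) (hvD : v ∈ X.D) (hlam : lam ≠ 0)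
    (hK : ∀ k, K ≤ k → ∀ Y, IsDeg M.μ k Y → Y = 0) :
    M.eulerSub lam v * Θ.eval v (fun p => Θ.coeff lam K (p + 1))
      = -(M.muPlus * Θ.eval v (Θ.coeff lam K)) :=
  hv.eulerSub_mul_eval hvD hK (Θ.coeff_growth hlam K) (Θ.coeff_eulerSeq hlam hK)

theorem trace_muMinus_mul_muPlus : (M.muMinus * M.muPlus).trace
    = ((1 / 4 : ℂ) • (1 : Matrix (Fin n) (Fin n) ℂ) - M.μ * M.μ).trace := by
  congr 1
  rw [GenFrobeniusManifold.muMinus, GenFrobeniusManifold.muPlus]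
  simp only [sub_mul, mul_add, smul_mul_assoc, mul_smul_comm, one_mul, mul_one, smul_sub, smul_smul]
  rw [show (1 / 2 * (1 / 2) : ℂ) = 1 / 4 by norm_num]
  abel

/-- The trace of `∑ A_{p+1}^T Ω_{p,q} A_{q+1}` against the inverse Gram matrix. -/
theorem BoundedAt.trace_star (hv : Θ.BoundedAt ‖lam‖ v) (hvD : v ∈ X.D) (hlam : lam ≠ 0)
    (hK : ∀ k, K ≤ k → ∀ Y, IsDeg M.μ k Y → Y = 0) (hdet : (M.eulerSub lam v).det ≠ 0)
    {Z : Matrix (Fin n) (Fin n) ℂ}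
    (hZ : Θ.eval v (Θ.coeff lam K) * Z * (Θ.eval v (Θ.coeff lam K)).transpose = M.res lam v * M.η⁻¹) :
    (Z.transpose * Θ.star v (fun p => Θ.coeff lam K (p + 1)) (fun p => Θ.coeff lam K (p + 1))).trace
      = M.starSum v lam := by
  have hdom := X.mem_domain hvD
  have hG := hv.eval_gram hvD hlam hK
  have hT1 := hv.eulerSub_mul_eval_coeff hvD hlam hK
  have hTdet := hv.det_eval_ne_zero hvD hlam hK
  -- Now `ν = 3/2`, and `2ν - 1 = 2` leaves twice the star product on the left.
  have hstar := hv.star_self hvD hK (factorialGrowth.shift_one (Θ.coeff_growth hlam K))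
    (Θ.coeff_eulerSeq_shift hlam hK)
  rw [show (2 * (3 / 2) - 1 : ℂ) = 2 by norm_num] at hstar
  obtain ⟨G', hG', hG'1⟩ := Θ.exists_gramConst_inv hlam K
  set T := Θ.eval v (Θ.coeff lam K)
  set T₁ := Θ.eval v fun p => Θ.coeff lam K (p + 1)
  set G := Θ.gramConst lam K
  set O := Θ.star v (fun p => Θ.coeff lam K (p + 1)) (fun p => Θ.coeff lam K (p + 1))
  set F := Θ.monForm K (fun p => Θ.coeff lam K (p + 1)) (fun p => Θ.coeff lam K (p + 1)) with hF
  set A := Θ.coeff lam K 1 with hA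
  set L := M.res lam v
  set L' := M.eulerSub lam v
  have hLL : L * L' = 1 := GenFrobeniusManifold.res_mul hdet
  have hTT : T⁻¹ * T = 1 := Matrix.nonsing_inv_mul _ (Ne.isUnit hTdet)
  -- the inverse Gram matrix
  have hZG : Z * G = 1 := by
    have h1 : T * (Z * G) = T := by
      rw [← hG]
      calc _ = (T * Z * T.transpose) * M.η * L' * T := by noncomm_ring
        _ = L * (M.η⁻¹ * M.η) * L' * T := by rw [hZ]; noncomm_ring
        _ = T := by rw [M.η_inv_mul, mul_one, hLL, one_mul]
    calc Z * G = T⁻¹ * (T * (Z * G)) := by rw [← mul_assoc, hTT, one_mul]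
      _ = 1 := by rw [h1, hTT]
  have hGZ : G * Z = 1 := mul_eq_one_comm.1 hZG
  have hGt : G.transpose = G := by
    rw [← hG, Matrix.transpose_mul, Matrix.transpose_mul, Matrix.transpose_transpose, Matrix.transpose_mul,
      M.η_symm.eq, ← GenFrobeniusManifold.η_eulerSub hdom]
    simp only [mul_assoc]
    rfl
  have hZt : Z.transpose = Z := by
    have h1 : Z.transpose * G = 1 := by
      rw [← hGt, ← Matrix.transpose_mul, hGZ, Matrix.transpose_one]
    calc Z.transpose = Z.transpose * (G * Z) := by rw [hGZ, mul_one]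
      _ = Z := by rw [← mul_assoc, h1, one_mul]
  have hZ' : Z = -(lam⁻¹ • (G' * M.η⁻¹)) := by
    calc Z = Z * (G * -(lam⁻¹ • (G' * M.η⁻¹))) := by rw [hG', mul_one]
      _ = _ := by rw [← mul_assoc, hZG, one_mul]
  -- the first term
  have hT1' : T₁ = -(L * M.muPlus * T) := by
    calc T₁ = L * (L' * T₁) := by rw [← mul_assoc, hLL, one_mul]
      _ = _ := by rw [hT1, mul_neg, mul_assoc]
  have h1 : (Z * (T₁.transpose * (M.η * L') * T₁)).trace
      = (L * M.muPlus * L * M.muMinus).trace := by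
    have e1 : T₁.transpose * (M.η * L') * T₁ = T.transpose * M.muPlus.transpose * L.transpose * M.η
        * M.muPlus * T := by
      rw [mul_assoc, mul_assoc M.η, hT1, hT1', Matrix.transpose_neg, Matrix.transpose_mul,
        Matrix.transpose_mul]
      noncomm_ring
    have e2 : L.transpose * M.η = M.η * L := (GenFrobeniusManifold.η_res hdom).symm
    have e3 : M.η⁻¹ * (M.muPlus.transpose * M.η) = M.muMinus := by
      rw [← GenFrobeniusManifold.η_muMinus, ← mul_assoc, M.η_inv_mul, one_mul]
    rw [e1]
    calc _ = ((Z * T.transpose * (M.muPlus.transpose * (L.transpose * M.η) * M.muPlus)) * T).trace := by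
          congr 1; noncomm_ring
      _ = (T * (Z * T.transpose * (M.muPlus.transpose * (L.transpose * M.η) * M.muPlus))).trace :=
          Matrix.trace_mul_comm _ _
      _ = ((T * Z * T.transpose) * (M.muPlus.transpose * M.η * L * M.muPlus)).trace := by
          rw [e2]; congr 1; noncomm_ring
      _ = ((L * (M.η⁻¹ * (M.muPlus.transpose * M.η))) * (L * M.muPlus)).trace := by
          rw [hZ]; congr 1; noncomm_ring
      _ = _ := by rw [e3, Matrix.trace_mul_comm]; congr 1; noncomm_ring
  -- the second term
  have h2 : (Z * (-(lam • (A.transpose * M.η * A)) + F)).trace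
      = (lam ^ 2)⁻¹ * (M.muMinus * M.muPlus).trace := by
    have hFm : M.η⁻¹ * F ∈ degGE M.μ 1 := Θ.monForm_mem K (fun p => Θ.coeff_mem lam K (p + 1))
      (fun p => Θ.coeff_mem lam K (p + 1))
    have e1 : Z * (-(lam • (A.transpose * M.η * A)) + F)
        = G' * (M.adj A * A) - lam⁻¹ • (G' * (M.η⁻¹ * F)) := by
      rw [hZ', M.transpose_mul_η, mul_add, neg_mul_neg, smul_mul_smul_comm, inv_mul_cancel₀ hlam, one_smul,
        neg_mul, smul_mul_assoc, ← sub_eq_add_neg]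
      congr 1
      · calc _ = G' * (M.η⁻¹ * M.η) * (M.adj A * A) := by noncomm_ring
          _ = _ := by rw [M.η_inv_mul, mul_one]
      · rw [mul_assoc]
    have hA1 := Θ.coeff_one hlam hK
    rw [← hA] at hA1
    have hG0 : G' ∈ degGE M.μ 0 := by
      have := Submodule.add_mem _ (degGE_anti (Nat.zero_le 1) hG'1) (one_mem_degGE (μ := M.μ))
      rwa [sub_add_cancel] at this
    have m1 : G' * (M.η⁻¹ * F) ∈ degGE M.μ 1 := by
      have := degGE_mul hG0 hFm
      rwa [zero_add] at this
    have hadj : M.adj (lam • A - M.muPlus) = lam • M.adj A - M.muMinus := by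
      rw [← M.adj_muPlus]
      simp only [GenFrobeniusManifold.adj, Matrix.transpose_sub, Matrix.transpose_smul, mul_sub, sub_mul,
        mul_smul_comm, smul_mul_assoc]
    have hAd : lam • M.adj A - M.muMinus ∈ degGE M.μ 1 := hadj ▸ M.adj_mem hA1
    have hm0 : M.muMinus ∈ degGE M.μ 0 := by
      rw [← M.adj_muPlus]; exact M.adj_mem M.muPlus_mem
    have hA0 : A ∈ degGE M.μ 0 := Θ.coeff_mem lam K 1
    -- Modulo positive degree, `G'` is `1`, `λ A` is `μ₊` and the adjoint of `λ A` is `μ₋`; the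
    -- difference has trace zero.
    have m2 : (lam ^ 2) • (G' * (M.adj A * A)) - M.muMinus * M.muPlus ∈ degGE M.μ 1 := by
      have e2 : (lam ^ 2) • (G' * (M.adj A * A)) - M.muMinus * M.muPlus
          = (G' - 1) * (lam • M.adj A * (lam • A)) + (lam • M.adj A - M.muMinus) * (lam • A)
            + M.muMinus * (lam • A - M.muPlus) := by
        rw [sub_mul, one_mul, sub_mul, mul_sub, smul_mul_smul_comm, mul_smul_comm, pow_two]
        abel
      rw [e2]
      have k1 := degGE_mul hG'1 (degGE_mul (Submodule.smul_mem _ lam (M.adj_mem hA0))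
        (Submodule.smul_mem _ lam hA0))
      have k2 := degGE_mul hAd (Submodule.smul_mem _ lam hA0)
      have k3 := degGE_mul hm0 hA1
      rw [zero_add, add_zero] at k1
      rw [add_zero] at k2
      rw [zero_add] at k3
      exact Submodule.add_mem _ (Submodule.add_mem _ k1 k2) k3
    have t1 := trace_of_mem_degGE le_rfl m1
    have t2 := trace_of_mem_degGE le_rfl m2
    rw [Matrix.trace_sub, Matrix.trace_smul, sub_eq_zero, smul_eq_mul] at t2
    rw [e1, Matrix.trace_sub, Matrix.trace_smul, t1, smul_zero, sub_zero, ← t2, inv_mul_cancel_left₀]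
    exact pow_ne_zero 2 hlam
  have h3 : (2 : ℂ) * (Z.transpose * O).trace = -(L * M.muPlus * L * M.muMinus).trace
      + (lam ^ 2)⁻¹ * (M.muMinus * M.muPlus).trace := by
    rw [hZt, ← smul_eq_mul, ← Matrix.trace_smul, ← mul_smul_comm, hstar, ← h1, ← h2, ← Matrix.trace_neg,
      ← Matrix.trace_add]
    congr 1
    noncomm_ring
  rw [trace_muMinus_mul_muPlus] at h3
  rw [GenFrobeniusManifold.starSum]
  have h4 : (Z.transpose * O).trace = (1 / 2) * ((2 : ℂ) * (Z.transpose * O).trace) := by ring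
  rw [h4, h3]
  change _ = -(1 / 2) * (L * M.muPlus * L * M.muMinus).trace + _
  field_simp

end Calibration

/-! ### Linear differential equations along complex lines -/

open GFM.GenFrobeniusManifold (mpd)

section LineCalculus

variable {n : ℕ}

/-- The parameters for which an affine line lies in a ball form a convex set. -/
theorem isPreconnected_line_preimage (v b : Vec n) (δ : ℝ) :
    IsPreconnected {t : ℂ | v + t • b ∈ Metric.ball v δ} := by
  have : Convex ℝ {t : ℂ | v + t • b ∈ Metric.ball v δ} := by
    intro x hx y hy s t hs ht hst
    have h := convex_ball v δ hx hy hs ht hst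
    have e : v + (s • x + t • y) • b = s • (v + x • b) + t • (v + y • b) := by
      rw [smul_add, smul_add, add_smul, smul_assoc, smul_assoc]
      nth_rewrite 1 [← one_smul ℝ v]
      rw [← hst, add_smul]
      abel
    change v + (s • x + t • y) • b ∈ Metric.ball v δ
    rwa [e]
  exact this.isPreconnected

theorem line_analytic (v b : Vec n) (t : ℂ) : AnalyticAt ℂ (fun t : ℂ => v + t • b) t :=
  analyticAt_const.fun_add (analyticAt_id.fun_smul analyticAt_const)

theorem fderiv_line (v b : Vec n) (t : ℂ) : fderiv ℂ (fun t : ℂ => v + t • b) t 1 = b := by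
  have h : HasDerivAt (fun t : ℂ => v + t • b) ((1 : ℂ) • b) t :=
    ((hasDerivAt_id t).smul_const b).const_add v
  rw [fderiv_apply_one_eq_deriv, h.deriv, one_smul]

theorem matDeriv_line {l m : Type*} {F : Vec n → Matrix l m ℂ} {v b : Vec n} {t : ℂ}
    (hF : MatAnalyticAt F (v + t • b)) :
    matDeriv 1 (fun t : ℂ => F (v + t • b)) t = ∑ α, b α • mpd α F (v + t • b) := by
  rw [matDeriv_comp (f := fun t : ℂ => v + t • b) hF (line_analytic v b t).differentiableAt, fderiv_line]
  generalize v + t • b = z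
  have h : b = ∑ α, b α • (Pi.single α 1 : Vec n) := pi_eq_sum_univ' b
  conv_lhs => rw [h]
  rw [matDeriv_sum_dir]
  simp only [matDeriv_smul_dir]

/-- Two solutions of a linear equation `Y' = B Y` differ by a constant right factor. -/
theorem inv_mul_eq_of_matDeriv {S : Set ℂ} (hS : IsOpen S) (hS' : IsPreconnected S)
    {T Φ B : ℂ → Matrix (Fin n) (Fin n) ℂ} (hT : ∀ t ∈ S, MatAnalyticAt T t)
    (hΦ : ∀ t ∈ S, MatAnalyticAt Φ t) (hdet : ∀ t ∈ S, (T t).det ≠ 0)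
    (hT' : ∀ t ∈ S, matDeriv 1 T t = B t * T t) (hΦ' : ∀ t ∈ S, matDeriv 1 Φ t = B t * Φ t)
    {x y : ℂ} (hx : x ∈ S) (hy : y ∈ S) : (T x)⁻¹ * Φ x = (T y)⁻¹ * Φ y := by
  have hzero : ∀ t ∈ S, matDeriv 1 (fun t => (T t)⁻¹ * Φ t) t = 0 := by
    intro t ht
    have e : T t * (T t)⁻¹ = 1 := Matrix.mul_nonsing_inv _ (Ne.isUnit (hdet t ht))
    rw [matDeriv_mul 1 ((hT t ht).inv (hdet t ht)) (hΦ t ht), matDeriv_inv 1 (hT t ht) (hdet t ht),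
      hT' t ht, hΦ' t ht]
    calc _ = -((T t)⁻¹ * B t * (T t * (T t)⁻¹) * Φ t) + (T t)⁻¹ * B t * Φ t := by noncomm_ring
      _ = 0 := by rw [e]; noncomm_ring
  ext i j
  have hd : ∀ t ∈ S, AnalyticAt ℂ (fun t => ((T t)⁻¹ * Φ t) i j) t := fun t ht =>
    (((hT t ht).inv (hdet t ht)).mul (hΦ t ht)) i j
  exact hS.is_const_of_deriv_eq_zero hS' (fun t ht => (hd t ht).differentiableAt.differentiableWithinAt)
    (fun t ht => by
      have h := congrFun (congrFun (hzero t ht) i) j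
      rw [matDeriv_apply, fderiv_apply_one_eq_deriv] at h
      exact h) hx hy

end LineCalculus

/-! ### The gradients of the periods as series in the deformed flat coordinates -/

namespace Calibration

variable {n : ℕ} {M : GenFrobeniusManifold n} {X : CanonicalChart M} (Θ : Calibration X) {v : Vec n}
  {lam : ℂ} {K : ℕ}

theorem η_mat (p : ℕ) (v : Vec n) : M.η * Θ.mat p v = Matrix.of fun β γ => pd β (Θ.θ γ p) v := by
  have h : Θ.mat p v = M.η⁻¹ * Matrix.of fun β γ => pd β (Θ.θ γ p) v := by
    ext α γ
    rw [Matrix.mul_apply]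
    rfl
  rw [h, ← mul_assoc, M.η_mul_inv, one_mul]

theorem mpd_mat_succ (hv : v ∈ X.D) (α : Fin n) (p : ℕ) :
    mpd α (Θ.mat (p + 1)) v = M.mulBy α v * Θ.mat p v := by
  have h1 : mpd α (fun w => M.η * Θ.mat (p + 1) w) v
      = (M.mulBy α v).transpose * (M.η * Θ.mat p v) := by
    ext β γ
    change fderiv ℂ (fun w => (M.η * Θ.mat (p + 1) w) β γ) v (Pi.single α 1) = _
    rw [Matrix.mul_apply]
    simp only [η_mat, Matrix.of_apply]
    refine (Θ.θ_rec v hv α β γ p).trans (Finset.sum_congr rfl fun ε _ => ?_)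
    rfl
  have h0 : mpd α (fun w => M.η * Θ.mat (p + 1) w) v = M.η * mpd α (Θ.mat (p + 1)) v :=
    matDeriv_const_mul _ _ (Θ.mat_analytic hv _)
  rw [h0, ← mul_assoc, ← M.η_mulBy (X.mem_domain hv), mul_assoc] at h1
  have h2 := congrArg (fun Z => M.η⁻¹ * Z) h1
  simpa only [← mul_assoc, M.η_inv_mul, one_mul] using h2

theorem mpd_mat_zero (hv : v ∈ X.D) (α : Fin n) : mpd α (Θ.mat 0) v = 0 := by
  have h : Θ.mat 0 =ᶠ[𝓝 v] fun _ => 1 :=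
    (X.isOpen_D.eventually_mem hv).mono fun w hw => Θ.mat_zero hw
  rw [mpd, matDeriv_congr _ h, matDeriv_const]

/-- On the set `s` the matrices `Θ_p` are uniformly of size `O(ρ^p / p!)` for some `ρ < ℓ / 2`. -/
def BoundedOn (ℓ : ℝ) (s : Set (Vec n)) : Prop :=
  ∃ C ρ : ℝ, 0 < ρ ∧ 2 * ρ < ℓ ∧ ∀ p, ∀ w ∈ s, entryNorm (Θ.mat p w) ≤ C * ρ ^ p / (p.factorial : ℝ)

variable {Θ}

theorem BoundedOn.boundedAt {ℓ : ℝ} {s : Set (Vec n)} (h : Θ.BoundedOn ℓ s) {w : Vec n} (hw : w ∈ s) :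
    Θ.BoundedAt ℓ w := by
  obtain ⟨C, ρ, h0, h1, h2⟩ := h
  exact ⟨C, ρ, h0, h1, fun p => h2 p w hw⟩

/-- Termwise differentiation of `∑ Θ_p a_p` along a line. -/
theorem BoundedOn.hasDerivAt_eval {ℓ δ : ℝ} (hs : Θ.BoundedOn ℓ (Metric.closedBall v δ))
    (hD : Metric.closedBall v δ ⊆ X.D) {a : ℕ → Matrix (Fin n) (Fin n) ℂ}
    (ha : a ∈ factorialGrowth (Fin n) (Fin n) ℓ) (b : Vec n) {t : ℂ} (ht : v + t • b ∈ Metric.ball v δ)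
    (i j : Fin n) :
    HasDerivAt (fun t : ℂ => Θ.eval (v + t • b) a i j)
      (((∑ α, b α • M.mulBy α (v + t • b)) * Θ.eval (v + t • b) fun p => a (p + 1)) i j) t := by
  set S : Set ℂ := {t : ℂ | v + t • b ∈ Metric.ball v δ} with hS
  have hSo : IsOpen S := Metric.isOpen_ball.preimage (by fun_prop)
  have hball : ∀ t ∈ S, v + t • b ∈ Metric.closedBall v δ := fun t ht => Metric.ball_subset_closedBall ht
  set c : Vec n → Matrix (Fin n) (Fin n) ℂ := fun w => ∑ α, b α • M.mulBy α w with hc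
  have hca : ∀ w ∈ Metric.closedBall v δ, MatAnalyticAt c w := fun w hw =>
    MatAnalyticAt.sum _ fun α _ => MatAnalyticAt.smul analyticAt_const
      (M.mulBy_analytic (X.mem_domain (hD hw)) α)
  obtain ⟨B, hB⟩ := exists_entryNorm_bound (isCompact_closedBall v δ) hca
  set g : ℕ → ℂ → ℂ := fun p t => (Θ.mat p (v + t • b) * a p) i j
  -- `Θ_0` is constant and `∂_α Θ_{p+1} = C_α Θ_p`, so the term of index `0` has derivative zero and
  -- the others become the series with shifted coefficients.
  set g' : ℕ → ℂ → ℂ := fun p t => Nat.casesOn p 0 fun q =>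
    (c (v + t • b) * (Θ.mat q (v + t • b) * a (q + 1))) i j with hg'
  have hder : ∀ p, ∀ t ∈ S, HasDerivAt (g p) (g' p t) t := by
    intro p t ht
    have hw := hD (hball t ht)
    have hman : MatAnalyticAt (fun t : ℂ => Θ.mat p (v + t • b)) t :=
      MatAnalyticAt.comp (Θ.mat_analytic hw p) (line_analytic v b t)
    have h1 : MatAnalyticAt (fun t : ℂ => Θ.mat p (v + t • b) * a p) t := hman.mul (matAnalyticAt_const _ _)
    have h2 := (h1 i j).differentiableAt.hasDerivAt
    have h3 : deriv (fun t : ℂ => (Θ.mat p (v + t • b) * a p) i j) t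
        = matDeriv 1 (fun t : ℂ => Θ.mat p (v + t • b) * a p) t i j := by
      rw [matDeriv_apply, fderiv_apply_one_eq_deriv]
    rw [h3, matDeriv_mul_const 1 _ hman, matDeriv_line (Θ.mat_analytic hw p)] at h2
    rcases p with _ | p
    · simp only [Θ.mpd_mat_zero hw, smul_zero, Finset.sum_const_zero, zero_mul, Matrix.zero_apply] at h2
      exact h2
    · simp only [Θ.mpd_mat_succ hw] at h2
      have e : ∑ α, b α • (M.mulBy α (v + t • b) * Θ.mat p (v + t • b))
          = c (v + t • b) * Θ.mat p (v + t • b) := by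
        simp only [hc, Finset.sum_mul, Matrix.smul_mul]
      rw [e, mul_assoc] at h2
      exact h2
  obtain ⟨C, ρ, hρ, hρl, hC⟩ := id hs
  obtain ⟨E, κ, hκ0, hκ1, hE⟩ := factorialGrowth.exists_geometric (factorialGrowth.shift_one ha) C hρ
    (by linarith)
  set u : ℕ → ℝ := fun p => Nat.casesOn p 0 fun q => |B| * (E * κ ^ q) with hu
  have husum : Summable u := by
    rw [← summable_nat_add_iff 1]
    exact ((summable_geometric_of_lt_one hκ0 hκ1).mul_left E).mul_left |B|
  have hbound : ∀ p, ∀ t ∈ S, ‖g' p t‖ ≤ u p := by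
    intro p t ht
    rcases p with _ | p
    · simp [hg', hu]
    · refine (norm_apply_le_entryNorm _ i j).trans ((entryNorm_mul _ _).trans ?_)
      refine mul_le_mul ((hB _ (hball t ht)).trans (le_abs_self B)) ((entryNorm_mul _ _).trans ?_)
        (entryNorm_nonneg _) (abs_nonneg B)
      exact (mul_le_mul_of_nonneg_right (hC p _ (hball t ht)) (entryNorm_nonneg _)).trans (hE p)
  have hsum : ∀ t ∈ S, HasSum (fun p => g p t) (Θ.eval (v + t • b) a i j) := fun t ht =>
    matHasSum_iff.1 ((hs.boundedAt (hball t ht)).hasSum_eval ha) i j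
  have hmain := hasDerivAt_tsum_of_isPreconnected husum hSo (isPreconnected_line_preimage v b δ)
    hder hbound ht (hsum t ht).summable ht
  have hval : ∑' p, g' p t = (c (v + t • b) * Θ.eval (v + t • b) fun p => a (p + 1)) i j := by
    have h1 := matHasSum_iff.1 (((hs.boundedAt (hball t ht)).hasSum_eval
      (factorialGrowth.shift_one ha)).mul_left (c (v + t • b))) i j
    have h2 := (hasSum_nat_add_iff' (f := fun p => g' p t)
      (g := (c (v + t • b) * Θ.eval (v + t • b) fun p => a (p + 1)) i j) 1)
    rw [Finset.sum_range_one] at h2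
    change HasSum _ (_ - 0) ↔ _ at h2
    rw [sub_zero] at h2
    exact (h2.1 h1).tsum_eq
  rw [hval] at hmain
  refine hmain.congr_of_eventuallyEq ((hSo.eventually_mem ht).mono fun t ht => ?_)
  exact (hsum t ht).tsum_eq.symm

theorem BoundedOn.eval_analytic {ℓ δ : ℝ} (hs : Θ.BoundedOn ℓ (Metric.closedBall v δ))
    (hD : Metric.closedBall v δ ⊆ X.D) {a : ℕ → Matrix (Fin n) (Fin n) ℂ}
    (ha : a ∈ factorialGrowth (Fin n) (Fin n) ℓ) (b : Vec n) {t : ℂ}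
    (ht : v + t • b ∈ Metric.ball v δ) : MatAnalyticAt (fun t : ℂ => Θ.eval (v + t • b) a) t := by
  intro i j
  have hSo : IsOpen {t : ℂ | v + t • b ∈ Metric.ball v δ} := Metric.isOpen_ball.preimage (by fun_prop)
  exact DifferentiableOn.analyticAt (s := {t : ℂ | v + t • b ∈ Metric.ball v δ})
    (fun t ht => (hs.hasDerivAt_eval hD ha b ht i j).differentiableAt.differentiableWithinAt)
    (hSo.mem_nhds ht)

/-- Near `v` the matrix of gradients of the periods is a constant multiple of `∑ Θ_p A_p`. -/
theorem BoundedOn.periodMat_eq {W : Set (Vec n × ℂ)} {p : Fin n → Vec n → ℂ → ℂ}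
    (hp : X.IsPeriodBasis W p) {δ : ℝ} (hlam : lam ≠ 0)
    (hK : ∀ k, K ≤ k → ∀ Y, IsDeg M.μ k Y → Y = 0)
    (hs : Θ.BoundedOn ‖lam‖ (Metric.closedBall v δ)) (hW : ∀ w ∈ Metric.closedBall v δ, (w, lam) ∈ W)
    {w : Vec n} (hw : w ∈ Metric.ball v δ) :
    M.periodMat p (w, lam) = Θ.eval w (Θ.coeff lam K)
      * ((Θ.eval v (Θ.coeff lam K))⁻¹ * M.periodMat p (v, lam)) := by
  have hD : Metric.closedBall v δ ⊆ X.D := fun w hw => hp.mem_D (hW w hw)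
  set a := Θ.coeff lam K
  have ha : a ∈ factorialGrowth (Fin n) (Fin n) ‖lam‖ := Θ.coeff_growth hlam K
  set b := w - v
  have hw1 : v + (1 : ℂ) • b = w := by simp [b]
  have hw0 : v + (0 : ℂ) • b = v := by simp
  have hv : v ∈ Metric.ball v δ := Metric.mem_ball_self (dist_nonneg.trans_lt (Metric.mem_ball.1 hw))
  have hSo : IsOpen {t : ℂ | v + t • b ∈ Metric.ball v δ} := Metric.isOpen_ball.preimage (by fun_prop)
  have hcl : ∀ t ∈ {t : ℂ | v + t • b ∈ Metric.ball v δ}, v + t • b ∈ Metric.closedBall v δ :=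
    fun t ht => Metric.ball_subset_closedBall ht
  have hΦan : ∀ t ∈ {t : ℂ | v + t • b ∈ Metric.ball v δ},
      MatAnalyticAt (fun w => M.periodMat p (w, lam)) (v + t • b) := fun t ht =>
    MatAnalyticAt.comp (f := fun w : Vec n => (w, lam)) (hp.periodMat_analyticAt (hW _ (hcl t ht)))
      (analyticAt_id.prod analyticAt_const)
  -- Along the segment from `v` to `w` the series and the gradient matrix satisfy the same equation
  -- `Y' = -L C_b μ₊ Y`, so their quotient is constant.
  have h := inv_mul_eq_of_matDeriv hSo (isPreconnected_line_preimage v b δ)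
    (T := fun t => Θ.eval (v + t • b) a) (Φ := fun t => M.periodMat p (v + t • b, lam))
    (B := fun t => -(M.res lam (v + t • b) * (∑ α, b α • M.mulBy α (v + t • b)) * M.muPlus))
    (fun t ht => hs.eval_analytic hD ha b ht)
    (fun t ht => MatAnalyticAt.comp (F := fun w => M.periodMat p (w, lam)) (hΦan t ht) (line_analytic v b t))
    (fun t ht => (hs.boundedAt (hcl t ht)).det_eval_ne_zero (hD (hcl t ht)) hlam hK)
    (fun t ht => by
      have hdet := hp.det_ne_zero (hW _ (hcl t ht))
      have hdom := X.mem_domain (hD (hcl t ht))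
      have h1 : matDeriv 1 (fun t : ℂ => Θ.eval (v + t • b) a) t
          = (∑ α, b α • M.mulBy α (v + t • b)) * Θ.eval (v + t • b) fun p => a (p + 1) := by
        ext i j
        rw [matDeriv_apply, fderiv_apply_one_eq_deriv]
        exact (hs.hasDerivAt_eval hD ha b ht i j).deriv
      have h2 := (hs.boundedAt (hcl t ht)).eulerSub_mul_eval_coeff (hD (hcl t ht)) hlam hK
      have h3 : Θ.eval (v + t • b) (fun p => a (p + 1))
          = -(M.res lam (v + t • b) * (M.muPlus * Θ.eval (v + t • b) a)) := by
        calc _ = M.res lam (v + t • b) * (M.eulerSub lam (v + t • b)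
              * Θ.eval (v + t • b) (fun p => a (p + 1))) := by
              rw [← mul_assoc, GenFrobeniusManifold.res_mul hdet, one_mul]
          _ = _ := by rw [h2, mul_neg]
      -- Termwise differentiation puts the multiplication to the left of the resolvent, the
      -- Gauss–Manin system to the right; they commute.
      have h4 : M.res lam (v + t • b) * (∑ α, b α • M.mulBy α (v + t • b))
          = (∑ α, b α • M.mulBy α (v + t • b)) * M.res lam (v + t • b) := by
        rw [Finset.mul_sum, Finset.sum_mul]
        refine Finset.sum_congr rfl fun α _ => ?_
        rw [Matrix.mul_smul, Matrix.smul_mul, GenFrobeniusManifold.res_mulBy_comm hdom hdet]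
      rw [h1, h3, h4]
      noncomm_ring)
    (fun t ht => by
      have hz := hW _ (hcl t ht)
      have hdet := hp.det_ne_zero hz
      rw [matDeriv_line (F := fun w => M.periodMat p (w, lam)) (hΦan t ht)]
      have h1 : ∀ α, mpd α (fun w => M.periodMat p (w, lam)) (v + t • b)
          = -(M.res lam (v + t • b) * M.mulBy α (v + t • b) * M.muPlus
            * M.periodMat p (v + t • b, lam)) := fun α => by
        rw [← GenFrobeniusManifold.matDeriv_periodMat_left hp.period hz (X.mem_domain (hp.mem_D hz)) hdet]
        ext i j
        change fderiv ℂ (fun w => M.periodMat p (w, lam) i j) (v + t • b) (Pi.single α 1)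
          = fderiv ℂ (fun z => M.periodMat p z i j) (v + t • b, lam) (Pi.single α 1, 0)
        exact fderiv_slice_left (f := fun z => M.periodMat p z i j)
          (hp.periodMat_analyticAt hz i j).differentiableAt _
      simp only [h1, Finset.mul_sum, Finset.sum_mul, smul_neg, Finset.sum_neg_distrib, neg_mul,
        Matrix.mul_smul, Matrix.smul_mul])
    (x := 1) (y := 0) (by change v + (1 : ℂ) • b ∈ Metric.ball v δ; rwa [hw1])
    (by change v + (0 : ℂ) • b ∈ Metric.ball v δ; rwa [hw0])
  simp only [hw1, hw0] at h
  have hTw := (hs.boundedAt (Metric.ball_subset_closedBall hw)).det_eval_ne_zero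
    (hD (Metric.ball_subset_closedBall hw)) hlam hK
  rw [← h, ← mul_assoc, Matrix.mul_nonsing_inv _ (Ne.isUnit hTw), one_mul]

end Calibration

theorem factorialGrowth.mul_const {l m n : Type*} [Fintype l] [Fintype m] [Fintype n] {ℓ : ℝ}
    {a : ℕ → Matrix m n ℂ} (ha : a ∈ factorialGrowth m n ℓ) (A : Matrix n l ℂ) :
    (fun p => a p * A) ∈ factorialGrowth m l ℓ := by
  intro r hr hrl
  obtain ⟨C, hC⟩ := ha r hr hrl
  refine ⟨C * entryNorm A, fun p => (entryNorm_mul _ _).trans ?_⟩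
  calc _ ≤ C * (p.factorial : ℝ) / r ^ p * entryNorm A :=
        mul_le_mul_of_nonneg_right (hC p) (entryNorm_nonneg A)
    _ = _ := by ring

/-- Summation over a finite first index, then over the second one. -/
theorem hasSum_prod_of_fintype {ι κ : Type*} [Fintype ι] {f : ι × κ → ℂ} {g : κ → ℝ} (hg : Summable g)
    (hf : ∀ x, ‖f x‖ ≤ g x.2) {s : ℂ} (hs : HasSum (fun p => ∑ i, f (i, p)) s) : HasSum f s := by
  have h1 : Summable fun x : ι × κ => (1 : ℝ) * |g x.2| :=
    Summable.mul_of_nonneg (f := fun _ : ι => (1 : ℝ)) (hasSum_fintype _).summable hg.abs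
      (fun _ => zero_le_one) (fun _ => abs_nonneg _)
  have h2 : Summable f := Summable.of_norm_bounded h1 fun x =>
    (hf x).trans (by rw [one_mul]; exact le_abs_self _)
  have h3 : HasSum (f ∘ Equiv.prodComm κ ι) (∑' x, f x) := (Equiv.hasSum_iff _).2 h2.hasSum
  have h4 := h3.prod_fiberwise (g := fun p => ∑ i, f (i, p)) fun p => hasSum_fintype _
  exact hs.unique h4 ▸ h2.hasSum

theorem exists_between_finite {ι : Type*} [Finite ι] {c : ι → ℝ} {ℓ : ℝ} (h0 : 0 < ℓ) (h : ∀ i, c i < ℓ) :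
    ∃ r, 0 < r ∧ r < ℓ ∧ ∀ i, c i < r := by
  have h1 : ∀ᶠ r in 𝓝[<] ℓ, 0 < r ∧ r < ℓ ∧ ∀ i, c i < r :=
    (Filter.Eventually.and (p := fun r => r ∈ Set.Ioo 0 ℓ) (q := fun r => ∀ i, r ∈ Set.Ioo (c i) ℓ)
      (Ioo_mem_nhdsLT h0) (eventually_all.2 fun i => Ioo_mem_nhdsLT (h i))).mono
      fun r hr => ⟨hr.1.1, hr.1.2, fun i => (hr.2 i).1⟩
  exact h1.exists

/-! ### Expansions of `∂_λ p_α` and their star products near `λ = ∞` -/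

namespace CanonicalChart.IsPeriodBasis

variable {n : ℕ} {M : GenFrobeniusManifold n} {X : CanonicalChart M} {W : Set (Vec n × ℂ)}
  {p : Fin n → Vec n → ℂ → ℂ} {v : Vec n} {lam : ℂ}

/-- Mixed partial derivatives of `p` commute, so the gradient of `∂_λ p` is the `λ`-derivative of
the gradient. -/
theorem pd_deriv (hp : X.IsPeriodBasis W p) (hz : (v, lam) ∈ W) (α β : Fin n) :
    pd β (fun w => deriv (p α w) lam) v
      = (M.η * matDeriv (0, 1) (M.periodMat p) (v, lam)) β α := by
  set f : Vec n × ℂ → ℂ := fun x => p α x.1 x.2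
  have hf : AnalyticAt ℂ f (v, lam) := (hp.period α).analytic _ hz
  have h1 : (fun w => deriv (p α w) lam) =ᶠ[𝓝 v] fun w => fderiv ℂ f (w, lam) (0, 1) := by
    have h : ∀ᶠ w in 𝓝 v, (w, lam) ∈ W :=
      (Continuous.prodMk_left lam).continuousAt.eventually (hp.isOpen.eventually_mem hz)
    exact h.mono fun w hw => deriv_slice_right (f := f) ((hp.period α).analytic _ hw).differentiableAt
  have hd : ∀ a b : Vec n × ℂ, fderiv ℂ (fun x => fderiv ℂ f x a) (v, lam) b
      = fderiv ℂ (fderiv ℂ f) (v, lam) b a := fun a b => by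
    have h0 : HasFDerivAt (fun x => fderiv ℂ f x a) _ (v, lam) :=
      (ContinuousLinearMap.apply ℂ ℂ a).hasFDerivAt.comp (v, lam) hf.fderiv.differentiableAt.hasFDerivAt
    rw [h0.fderiv]
    rfl
  have hda : ∀ a : Vec n × ℂ, DifferentiableAt ℂ (fun x => fderiv ℂ f x a) (v, lam) := fun a =>
    ((ContinuousLinearMap.apply ℂ ℂ a).hasFDerivAt.comp (v, lam)
      hf.fderiv.differentiableAt.hasFDerivAt).differentiableAt
  have hsymm : IsSymmSndFDerivAt ℂ f (v, lam) := (hf.contDiffAt (n := 2)).isSymmSndFDerivAt (by simp)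
  have h2 : pd β (fun w => deriv (p α w) lam) v
      = fderiv ℂ (fun x => fderiv ℂ f x (Pi.single β 1, 0)) (v, lam) (0, 1) := by
    rw [pd, h1.fderiv_eq, fderiv_slice_left (f := fun x => fderiv ℂ f x (0, 1)) (hda _), hd, hd, hsymm.eq]
  have h3 : (fun z => (M.η * M.periodMat p z) β α) =ᶠ[𝓝 (v, lam)]
      fun x => fderiv ℂ f x (Pi.single β 1, 0) := by
    refine (GenFrobeniusManifold.periodMat_eventuallyEq (M := M) (p := p) fun α => (hp.period α).analytic _ hz).mono
      fun y hy => ?_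
    change (M.η * M.periodMat p y) β α = _
    rw [hy, ← mul_assoc, M.η_mul_inv, one_mul]
    rfl
  rw [h2, ← matDeriv_const_mul _ _ (hp.periodMat_analyticAt hz), matDeriv_apply, h3.fderiv_eq]

end CanonicalChart.IsPeriodBasis

namespace Calibration

variable {n : ℕ} {M : GenFrobeniusManifold n} {X : CanonicalChart M} {Θ : Calibration X} {v : Vec n}
  {lam : ℂ} {K : ℕ} {ℓ : ℝ}

variable (Θ) in
-- The inequalities `2 |u_i| < ℓ` persist with room to spare on a small closed ball, where the
-- uniform bounds of the `Θ_p` apply.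
theorem exists_boundedOn (hv : v ∈ X.D) (hℓ : 0 < ℓ) (hu : ∀ i, 2 * ‖X.u i v‖ < ℓ) {O : Set (Vec n)}
    (hO : O ∈ 𝓝 v) :
    ∃ δ, 0 < δ ∧ Metric.closedBall v δ ⊆ O ∧ Θ.BoundedOn ℓ (Metric.closedBall v δ) := by
  obtain ⟨ρ₀, h0, h1, h2⟩ := exists_between_finite (c := fun i => ‖X.u i v‖) (half_pos hℓ)
    fun i => by linarith [hu i]
  have h3 : ∀ᶠ w in 𝓝 v, w ∈ O ∧ w ∈ X.D ∧ ∀ i, ‖X.u i w‖ < ρ₀ :=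
    Filter.Eventually.and (p := fun w => w ∈ O) hO ((X.isOpen_D.eventually_mem hv).and (eventually_all.2 fun i =>
      (X.u_analytic i v hv).continuousAt.norm.eventually_lt continuousAt_const (h2 i)))
  obtain ⟨δ, hδ, h⟩ := Metric.nhds_basis_closedBall.eventually_iff.1 h3
  refine ⟨δ, hδ, fun w hw => (h hw).1, ?_⟩
  obtain ⟨C, hC⟩ := Θ.exists_mat_bound (isCompact_closedBall v δ) (fun w hw => (h hw).2.1) h0.le
    (ρ := (ρ₀ + ℓ / 2) / 2) (by linarith) fun w hw i => ((h hw).2.2 i).le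
  exact ⟨C, _, by linarith, by linarith, hC⟩

theorem BoundedOn.isExpansion {δ : ℝ} (hs : Θ.BoundedOn ℓ (Metric.closedBall v δ)) (hδ : 0 < δ)
    (hℓ : 0 < ℓ) (hu : ∀ i, 2 * ‖X.u i v‖ < ℓ) {a : ℕ → Matrix (Fin n) (Fin n) ℂ}
    (ha : a ∈ factorialGrowth (Fin n) (Fin n) ℓ) {f : Vec n → ℂ} {α : Fin n}
    (hf : ∀ w ∈ Metric.ball v δ, ∀ β, pd β f w = (M.η * Θ.eval w a) β α) :
    Θ.IsExpansion (fun γ p => a p γ α) f v := by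
  refine ⟨?_, ?_⟩
  · obtain ⟨r, h0, h1, h2⟩ := exists_between_finite hℓ hu
    obtain ⟨C, hC⟩ := ha r h0 h1
    exact ⟨C, r, h2, fun γ p => (norm_apply_le_entryNorm _ _ _).trans (hC p)⟩
  · refine (Metric.isOpen_ball.eventually_mem (Metric.mem_ball_self hδ)).mono fun w hw β => ?_
    rw [hf w hw]
    have hb := hs.boundedAt (Metric.ball_subset_closedBall hw)
    obtain ⟨C, κ, hκ0, hκ1, hC⟩ := hb.entryNorm_mul_le ha
    refine hasSum_prod_of_fintype
      (((summable_geometric_of_lt_one hκ0 hκ1).mul_left C).mul_left (entryNorm M.η)) (fun x => ?_) ?_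
    · have e : pd β (Θ.θ x.1 x.2) w = (M.η * Θ.mat x.2 w) β x.1 := by rw [Θ.η_mat]; rfl
      rw [e, norm_mul, mul_comm]
      calc _ ≤ entryNorm (M.η * Θ.mat x.2 w) * entryNorm (a x.2) :=
            mul_le_mul (norm_apply_le_entryNorm _ _ _) (norm_apply_le_entryNorm _ _ _) (norm_nonneg _)
              (entryNorm_nonneg _)
        _ ≤ entryNorm M.η * entryNorm (Θ.mat x.2 w) * entryNorm (a x.2) :=
            mul_le_mul_of_nonneg_right (entryNorm_mul _ _) (entryNorm_nonneg _)
        _ ≤ _ := by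
            rw [mul_assoc]
            exact mul_le_mul_of_nonneg_left (hC x.2) (entryNorm_nonneg _)
    · refine (matHasSum_iff.1 ((hb.hasSum_eval ha).mul_left M.η) β α).congr_fun fun p => ?_
      rw [← mul_assoc, Θ.η_mat, Matrix.mul_apply]
      exact Finset.sum_congr rfl fun γ _ => mul_comm _ _

theorem BoundedAt.hasSum_star_apply (hv : Θ.BoundedAt ℓ v) {a b : ℕ → Matrix (Fin n) (Fin n) ℂ}
    (ha : a ∈ factorialGrowth (Fin n) (Fin n) ℓ) (hb : b ∈ factorialGrowth (Fin n) (Fin n) ℓ) (α β : Fin n) :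
    HasSum (fun x : (Fin n × ℕ) × (Fin n × ℕ) =>
      a x.1.2 x.1.1 α * b x.2.2 x.2.1 β * Θ.Ω x.1.1 x.1.2 x.2.1 x.2.2 v) (Θ.star v a b α β) := by
  obtain ⟨g, hg, h⟩ := hv.star_bound ha hb
  refine (Equiv.hasSum_iff (Equiv.prodProdProdComm (Fin n) (Fin n) ℕ ℕ)).1 ?_
  refine hasSum_prod_of_fintype hg (fun x => ?_) ?_
  · refine le_trans ?_ (h x.2)
    change ‖a x.2.1 x.1.1 α * b x.2.2 x.1.2 β * Θ.twoPt x.2.1 x.2.2 v x.1.1 x.1.2‖ ≤ _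
    rw [norm_mul, norm_mul, mul_right_comm]
    refine mul_le_mul (mul_le_mul ?_ ?_ (norm_nonneg _) (entryNorm_nonneg _)) ?_ (norm_nonneg _)
      (mul_nonneg (entryNorm_nonneg _) (entryNorm_nonneg _)) <;> exact norm_apply_le_entryNorm _ _ _
  · refine (matHasSum_iff.1 (hv.hasSum_star ha hb) α β).congr_fun fun x => ?_
    rw [Matrix.mul_apply, Fintype.sum_prod_type, Finset.sum_comm]
    refine Finset.sum_congr rfl fun δ _ => ?_
    rw [Matrix.mul_apply, Finset.sum_mul]
    refine Finset.sum_congr rfl fun γ _ => ?_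
    change a x.1 γ α * b x.2 δ β * Θ.Ω γ x.1 δ x.2 v = a x.1 γ α * Θ.Ω γ x.1 δ x.2 v * b x.2 δ β
    ring

theorem BoundedAt.eval_mul_const (hv : Θ.BoundedAt ℓ v) {a : ℕ → Matrix (Fin n) (Fin n) ℂ}
    (ha : a ∈ factorialGrowth (Fin n) (Fin n) ℓ) (y : Matrix (Fin n) (Fin n) ℂ) :
    Θ.eval v (fun p => a p * y) = Θ.eval v a * y := by
  refine (hv.hasSum_eval (factorialGrowth.mul_const ha y)).unique ?_
  exact ((hv.hasSum_eval ha).mul_right y).congr_fun fun p => (mul_assoc _ _ _).symm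

theorem BoundedAt.star_mul_const (hv : Θ.BoundedAt ℓ v) {a : ℕ → Matrix (Fin n) (Fin n) ℂ}
    (ha : a ∈ factorialGrowth (Fin n) (Fin n) ℓ) (y : Matrix (Fin n) (Fin n) ℂ) :
    Θ.star v (fun p => a p * y) (fun p => a p * y) = y.transpose * Θ.star v a a * y := by
  have hy := factorialGrowth.mul_const ha y
  refine (hv.hasSum_star hy hy).unique ?_
  refine (((hv.hasSum_star ha ha).mul_left y.transpose).mul_right y).congr_fun fun x => ?_
  rw [Matrix.transpose_mul]
  simp only [mul_assoc]

/-- The `λ`-derivatives of the periods near `λ = ∞`. -/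
theorem BoundedOn.matDeriv_periodMat {W : Set (Vec n × ℂ)} {p : Fin n → Vec n → ℂ → ℂ}
    (hp : X.IsPeriodBasis W p) {δ : ℝ} (hlam : lam ≠ 0)
    (hK : ∀ k, K ≤ k → ∀ Y, IsDeg M.μ k Y → Y = 0)
    (hs : Θ.BoundedOn ‖lam‖ (Metric.closedBall v δ)) (hW : ∀ w ∈ Metric.closedBall v δ, (w, lam) ∈ W)
    {w : Vec n} (hw : w ∈ Metric.ball v δ) :
    matDeriv (0, 1) (M.periodMat p) (w, lam) = Θ.eval w fun q => Θ.coeff lam K (q + 1)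
      * -((Θ.eval v (Θ.coeff lam K))⁻¹ * M.periodMat p (v, lam)) := by
  have hw' := Metric.ball_subset_closedBall hw
  have hzw : (w, lam) ∈ W := hW w hw'
  have hdet := hp.det_ne_zero hzw
  have h1 := (hs.boundedAt hw').eulerSub_mul_eval_coeff (hp.mem_D hzw) hlam hK
  have h2 : Θ.eval w (fun p => Θ.coeff lam K (p + 1))
      = -(M.res lam w * (M.muPlus * Θ.eval w (Θ.coeff lam K))) := by
    rw [← mul_neg, ← h1, ← mul_assoc, GenFrobeniusManifold.res_mul hdet, one_mul]
  have h3 := GenFrobeniusManifold.matDeriv_periodMat_right hp.period hzw hdet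
  rw [hs.periodMat_eq hp hlam hK hW hw] at h3
  rw [h3, (hs.boundedAt hw').eval_mul_const (factorialGrowth.shift_one (Θ.coeff_growth hlam K)), h2,
    neg_mul_neg]
  simp only [mul_assoc]

theorem sum_mul_eq_trace (A B : Matrix (Fin n) (Fin n) ℂ) :
    ∑ α, ∑ β, A α β * B α β = (A.transpose * B).trace := by
  rw [Finset.sum_comm]
  rfl

/-- The star products of the `λ`-derivatives of the periods near `λ = ∞`. -/
theorem exists_isStar (Θ : Calibration X) {W : Set (Vec n × ℂ)} {p : Fin n → Vec n → ℂ → ℂ}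
    (hp : X.IsPeriodBasis W p) (hz : (v, lam) ∈ W) (hu : ∀ i, 2 * ‖X.u i v‖ < ‖lam‖) :
    ∃ s : Fin n → Fin n → ℂ,
      (∀ α β, Θ.IsStar (fun w => deriv (p α w) lam) (fun w => deriv (p β w) lam) v (s α β)) ∧
      M.starSum v lam = ∑ α, ∑ β, gram M p v lam α β * s α β := by
  -- A nonconstant unit field forces `n ≥ 1`. Then there is at least one inequality `2 |u_i| < |λ|`,
  -- and `λ ≠ 0` follows.
  obtain ⟨-, -, α₀, -⟩ := M.e_nonflat
  have hℓ : 0 < ‖lam‖ := lt_of_le_of_lt (by positivity) (hu α₀)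
  have hlam : lam ≠ 0 := norm_pos_iff.1 hℓ
  have hvD : v ∈ X.D := hp.mem_D hz
  obtain ⟨K, hK⟩ := exists_isDeg_eq_zero M.μ
  have hO : {w : Vec n | (w, lam) ∈ W} ∈ 𝓝 v :=
    (hp.isOpen.preimage (Continuous.prodMk_left lam)).mem_nhds hz
  obtain ⟨δ, hδ, hW, hs⟩ := Θ.exists_boundedOn hvD hℓ hu hO
  have hcl : ∀ w ∈ Metric.ball v δ, w ∈ Metric.closedBall v δ := fun w hw =>
    Metric.ball_subset_closedBall hw
  have hbv : Θ.BoundedAt ‖lam‖ v := hs.boundedAt (hcl v (Metric.mem_ball_self hδ))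
  set T := Θ.eval v (Θ.coeff lam K) with hT
  -- The constant right factor between the series and the gradients of the given basis.
  set y := T⁻¹ * M.periodMat p (v, lam) with hy
  have ha : (fun p => Θ.coeff lam K (p + 1)) ∈ factorialGrowth (Fin n) (Fin n) ‖lam‖ :=
    factorialGrowth.shift_one (Θ.coeff_growth hlam K)
  have hay := factorialGrowth.mul_const ha (-y)
  have hexp : ∀ α, Θ.IsExpansion (fun γ p => (Θ.coeff lam K (p + 1) * -y) γ α)
      (fun w => deriv (p α w) lam) v := fun α =>
    hs.isExpansion hδ hℓ hu hay fun w hw β => by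
      rw [hp.pd_deriv (hW (hcl w hw)), hs.matDeriv_periodMat hp hlam hK (fun w hw => hW hw) hw]
  refine ⟨fun α β => Θ.star v (fun p => Θ.coeff lam K (p + 1) * -y)
    (fun p => Θ.coeff lam K (p + 1) * -y) α β, fun α β => ⟨_, _, hexp α, hexp β,
      hbv.hasSum_star_apply hay hay α β⟩, ?_⟩
  have hTdet : T.det ≠ 0 := hbv.det_eval_ne_zero hvD hlam hK
  have hTy : T * y = M.periodMat p (v, lam) := by
    rw [hy, ← mul_assoc, Matrix.mul_nonsing_inv _ (Ne.isUnit hTdet), one_mul]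
  clear_value y
  -- Absorbing `y` into the Gram matrix gives the inverse Gram matrix of the series itself, so the
  -- chosen basis no longer appears.
  have hZ : T * (y * gram M p v lam * y.transpose) * T.transpose = M.res lam v * M.η⁻¹ := by
    rw [← GenFrobeniusManifold.periodMat_gram (p := p) (z := (v, lam)) (X.mem_domain hvD)
      (hp.independent _ _ hz), ← hTy, Matrix.transpose_mul T]
    simp only [mul_assoc]
  have hdet := hp.det_ne_zero hz
  rw [← hbv.trace_star hvD hlam hK hdet hZ, hbv.star_mul_const ha]
  rw [sum_mul_eq_trace, Matrix.transpose_mul, Matrix.transpose_mul, Matrix.transpose_transpose, Matrix.transpose_neg]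
  rw [mul_assoc, Matrix.trace_mul_comm]
  congr 1
  noncomm_ring

/-- The explicit expression is rational in `λ` with poles only at `0` and the `u_i`, so it is the
analytic continuation of its values near infinity. -/
theorem isStarSum_starSum (Θ : Calibration X) : Θ.IsStarSum M.starSum where
  analytic := by
    intro v hv lam hlam
    have hres : MatAnalyticAt (fun l => M.res l v) lam := fun i j =>
      analyticAt_slice_right (f := fun z : Vec n × ℂ => M.res z.2 z.1 i j)
        (GenFrobeniusManifold.res_analytic₂ (X.mem_domain hv)
          ((X.det_eulerSub_ne_zero_iff hv).2 hlam.2) i j)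
    have h1 : AnalyticAt ℂ (fun l => (M.res l v * M.muPlus * M.res l v * M.muMinus).trace) lam := by
      have h := ((hres.mul (matAnalyticAt_const M.muPlus _)).mul hres).mul (matAnalyticAt_const M.muMinus _)
      exact Finset.analyticAt_fun_sum _ fun i _ => h i i
    have h2 : AnalyticAt ℂ (fun l : ℂ => 1 / (2 * l ^ 2)) lam :=
      analyticAt_const.fun_div (analyticAt_const.fun_mul (analyticAt_id.fun_pow 2))
        (mul_ne_zero two_ne_zero (pow_ne_zero 2 hlam.1))
    exact (analyticAt_const.fun_mul h1).fun_add (h2.fun_mul analyticAt_const)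
  near_infinity := fun _ _ hp _ _ hz hu => Θ.exists_isStar hp hz hu

end Calibration

/-! ### Existence and uniqueness of the genus one solution -/

namespace CanonicalChart

variable {n N : ℕ} {M : GenFrobeniusManifold n} (X : CanonicalChart M)

/-- Only finitely many `λ` are excluded, namely `0` and the values `u_i(v)`. -/
theorem exists_mem_isPeriodBasis {v : Vec n} (hv : v ∈ X.D) :
    ∃ lam : ℂ, lam ≠ 0 ∧ ∃ (W : Set (Vec n × ℂ)) (p : Fin n → Vec n → ℂ → ℂ),
      X.IsPeriodBasis W p ∧ (v, lam) ∈ W := by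
  obtain ⟨lam, hlam⟩ := ((Set.finite_range fun i => X.u i v).insert 0).exists_notMem
  rw [Set.mem_insert_iff, not_or] at hlam
  exact ⟨lam, hlam.1, X.exists_isPeriodBasis (z₀ := (v, lam)) hv fun i h => hlam.2 ⟨i, h.symm⟩⟩

theorem solvesGenusOne {τ : Vec n → ℂ} (hτ : X.IsTau τ)
    {J24 : Vec n → ℂ} (hJ24 : AnalyticOnNhd ℂ J24 X.D) (hJ24_pow : ∀ v ∈ X.D, J24 v ^ 24 = X.J v)
    {logτJ : Vec n → ℂ} (hlogτJ : AnalyticOnNhd ℂ logτJ X.D)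
    (hlogτJ_exp : ∀ v ∈ X.D, Complex.exp (logτJ v) = τ v / J24 v)
    {U : Set (Jet 1 n)} (hU : IsOpen U) (hUD : ∀ j ∈ U, j 0 ∈ X.D)
    {logux : Fin n → Jet 1 n → ℂ} (hlogux : ∀ i, AnalyticOnNhd ℂ (logux i) U)
    (hlogux_exp : ∀ i, ∀ j ∈ U, Complex.exp (logux i j) = canonicalX X i j)
    (hN : 1 ≤ N) {U' : Set (Jet N n)} (hU' : ∀ j ∈ U', truncOne hN j ∈ U) :
    SolvesGenusOne X M.starSum U'
      (fun j => logτJ (truncOne hN j 0) + (1 / 24) * ∑ i, logux i (truncOne hN j)) where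
  analytic := by
    intro j hj
    have h0 : AnalyticAt ℂ (fun j : Jet N n => truncOne hN j) j := (truncOneL hN).analyticAt j
    have h1 : AnalyticAt ℂ (fun j : Jet N n => truncOne hN j 0) j :=
      (ContinuousLinearMap.proj (R := ℂ) (φ := fun _ : Fin (N + 1) => Vec n) 0).analyticAt j
    have h2 : AnalyticAt ℂ (fun j : Jet N n => logτJ (truncOne hN j 0)) j :=
      AnalyticAt.fun_comp (f := fun j : Jet N n => truncOne hN j 0) (hlogτJ _ (hUD _ (hU' j hj))) h1
    have h3 : ∀ i, AnalyticAt ℂ (fun j : Jet N n => logux i (truncOne hN j)) j := fun i =>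
      AnalyticAt.fun_comp (f := fun j : Jet N n => truncOne hN j) (hlogux i _ (hU' j hj)) h0
    exact h2.fun_add (analyticAt_const.fun_mul (Finset.analyticAt_fun_sum _ fun i _ => h3 i))
  equation := by
    intro W p hp j hj lam hW _
    rw [← X.genusOne_curveK hτ hJ24 hJ24_pow hlogτJ hlogτJ_exp hU hUD hlogux hlogux_exp hN j
      (hU' j hj) fun i => hp.ne_u hW i]
    exact Finset.sum_congr rfl fun s _ => Finset.sum_congr rfl fun γ _ => by rw [hp.K_eq hW]

end CanonicalChart

end GFM

end

open GFM
theorem mainTheorem4 {n : ℕ} (M : GenFrobeniusManifold n) (X : CanonicalChart M)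
    (Θ : Calibration X)
    -- the isomonodromic tau function, and branches of `J^{1/24}` and of `log (τ / J^{1/24})`
    (τ : Vec n → ℂ) (hτ : X.IsTau τ)
    (J24 : Vec n → ℂ) (hJ24 : AnalyticOnNhd ℂ J24 X.D) (hJ24_pow : ∀ v ∈ X.D, J24 v ^ 24 = X.J v)
    (logτJ : Vec n → ℂ) (hlogτJ : AnalyticOnNhd ℂ logτJ X.D)
    (hlogτJ_exp : ∀ v ∈ X.D, Complex.exp (logτJ v) = τ v / J24 v)
    -- an open set of first order jets over `D` with branches of `log u_{i,x}`
    (U : Set (Jet 1 n)) (hU : IsOpen U) (hUD : ∀ j ∈ U, j 0 ∈ X.D)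
    (logux : Fin n → Jet 1 n → ℂ) (hlogux : ∀ i, AnalyticOnNhd ℂ (logux i) U)
    (hlogux_exp : ∀ i, ∀ j ∈ U, Complex.exp (logux i j) = canonicalX X i j) :
    ∃ S : Vec n → ℂ → ℂ, Θ.IsStarSum S ∧
      SolvesGenusOne X S U (fun j => logτJ (j 0) + (1 / 24) * ∑ i, logux i j) ∧
      -- up to an additive constant it is the only solution, among functions of jets of any order
      ∀ (N : ℕ) (hN : 1 ≤ N) (U' : Set (Jet N n)) (F : Jet N n → ℂ),
        IsOpen U' → IsPreconnected U' → (∀ j ∈ U', truncOne hN j ∈ U) →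
        SolvesGenusOne X S U' F →
        ∃ C : ℂ, ∀ j ∈ U', F j =
          logτJ (truncOne hN j 0) + (1 / 24) * ∑ i, logux i (truncOne hN j) + C := by
  have hsolves : ∀ (N : ℕ) (hN : 1 ≤ N) (U' : Set (Jet N n)), (∀ j ∈ U', truncOne hN j ∈ U) →
      SolvesGenusOne X M.starSum U'
        (fun j => logτJ (truncOne hN j 0) + (1 / 24) * ∑ i, logux i (truncOne hN j)) :=
    fun N hN U' hU' => X.solvesGenusOne hτ hJ24 hJ24_pow hlogτJ hlogτJ_exp hU hUD hlogux hlogux_exp hN hU'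
  refine ⟨M.starSum, Θ.isStarSum_starSum, hsolves 1 le_rfl U fun _ hj => hj, ?_⟩
  intro N hN U' F hUo hUc hUU hF
  refine X.exists_eq_add_const (fun v hv => X.exists_mem_isPeriodBasis hv) hN hUo hUc
    (fun j hj => hUD _ (hUU j hj)) (fun j hj i => ?_) hF (hsolves N hN U' hUU)
  -- The existence of a branch of `log u_{i,x}` on `U` already implies `u_{i,x} ≠ 0`, which the
  -- leading coefficients at the poles require.
  have h := X.canonicalX_eq i (truncOne hN j)
  rw [← hlogux_exp i _ (hUU j hj)] at h
  exact h ▸ Complex.exp_ne_zero _
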